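/- Let $n\ge 1$ and $\lambda\in\mathbb C$. Let $\mathcal A=\bigoplus_d\mathcal A^d$ be the graded Poisson algebra of smooth complex-valued functions on $T^*\mathbb{RP}^n$ that are polynomial along the cotangent fibres (bracket normalized by $\{\xi_i,u_i\}=1$ in Darboux coordinates), and let $\mathcal B^\lambda$ be the filtered algebra of smooth linear differential operators on $\lambda$-densities on $\mathbb{RP}^n$. For $x\in\mathfrak{sl}_{n+1}(\mathbb R)$ let $\eta^x_\lambda\in\mathcal B^\lambda$ be the Lie derivative on $\lambda$-densities along the vector field $\eta^x$ on $\mathbb{RP}^n$ generated by $x$, and let $\mu^x\in\mathcal A^1$ be the principal symbol of $\eta^x$; extend $x\mapsto\mu^x$ complex linearly to $\mathfrak{sl}_{n+1}(\mathbb C)$. There is exactly one complex-linear isomorphism $\mathcal Q_\lambda:\mathcal A\to\mathcal B^\lambda$ such that $\phi$ is the principal symbol of $\mathcal Q_\lambda(\phi)$ for every $d$ and $\phi\in\mathcal A^d$, and which is equivariant for $SL_{n+1}(\mathbb R)$ and infinitesimally, i.e. $\mathcal Q_\lambda(\{\mu^x,\phi\})=[\eta^x_\lambda,\mathcal Q_\lambda(\phi)]$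 for $x\in\mathfrak{sl}_{n+1}(\mathbb R)$ (the Lecomte–Ovsienko quantization map). It defines unique bilinear maps $C^\lambda_p:\mathcal A\times\mathcal A\to\mathcal A$, $p\ge0$, with $C^\lambda_p(\mathcal A^j,\mathcal A^k)\subseteq\mathcal A^{j+k-p}$ ($=0$ if $p>j+k$) and $\mathcal Q_\lambda(\phi)\mathcal Q_\lambda(\psi)=\sum_p\mathcal Q_\lambda(C^\lambda_p(\phi,\psi))$ for homogeneous $\phi,\psi$; put $\phi\star_\lambda\psi=\sum_pC^\lambda_p(\phi,\psi)t^p$. Let $\mathcal R\subseteq\mathcal A$ be the algebra of restrictions to $T^*\mathbb{RP}^n$ of the regular functions on the complex algebraic variety $T^*\mathbb{CP}^n$. Restriction is injective, and $\mathcal R$ is generated by the momentum functions $\mu^x$, $x\in\mathfrak{sl}_{n+1}(\mathbb C)$. Then $\star_\lambda$ restricts to a graded $SL_{n+1}(\mathbb C)$-equivariant star product on $\mathcal R$. That is, $\mathcal R=\bigoplus_d(\mathcal R\cap\mathcal A^d)$, and for $\phi,\psi\in\mathcal R$: $C^\lambda_p(\phi,\psi)\in\mathcal R$ for all $p$, and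 $=0$ for $p$ large; $C^\lambda_0(\phi,\psi)=\phi\psi$; $C^\lambda_1(\phi,\psi)-C^\lambda_1(\psi,\phi)=\{\phi,\psi\}$; $\star_\lambda$ is associative with unit $1$; $C^\lambda_p(\mathcal R\cap\mathcal A^j,\mathcal R\cap\mathcal A^k)\subseteq\mathcal R\cap\mathcal A^{j+k-p}$ ($=0$ if $p>j+k$); and $C^\lambda_p(g\phi,g\psi)=g\,C^\lambda_p(\phi,\psi)$ for $g\in SL_{n+1}(\mathbb C)$, acting on $\mathcal R$ through its action on $T^*\mathbb{CP}^n$. Moreover $\mathcal Q_\lambda$ maps $\mathcal R$ onto the algebra of (restrictions to $\mathbb{RP}^n$ of) global twisted algebraic differential operators on $\mathbb{CP}^n$ for the formal $\lambda$-th power of the canonical bundle. -/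

import Mathlib

open scoped ContDiff
open scoped Matrix

noncomputable section

namespace ProjQuant

/-! ### The cotangent bundle of projective space in homogeneous coordinates -/

section Cotangent

variable (𝕜 : Type) [Field 𝕜] (n : ℕ)

/-- Pairs `(u, p)` with `u ≠ 0` a vector of `𝕜ⁿ⁺¹` and `p` a covector with `p(u) = 0`. -/
def Cone : Type :=
  {x : (Fin (n + 1) → 𝕜) × (Fin (n + 1) → 𝕜) // x.1 ≠ 0 ∧ x.2 ⬝ᵥ x.1 = 0}

/-- `(u, p)` and `(c u, c⁻¹ p)` are the same point of the cotangent bundle. -/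
instance coneSetoid : Setoid (Cone 𝕜 n) where
  r x y := ∃ c : 𝕜ˣ, y.1.1 = c • x.1.1 ∧ y.1.2 = c⁻¹ • x.1.2
  iseqv := by
    refine ⟨fun x => ⟨1, by simp⟩, ?_, ?_⟩
    · rintro x y ⟨c, h1, h2⟩
      exact ⟨c⁻¹, by rw [h1, inv_smul_smul], by rw [h2, inv_inv, smul_inv_smul]⟩
    · rintro x y z ⟨c, h1, h2⟩ ⟨d, h3, h4⟩
      exact ⟨d * c, by rw [h3, h1, smul_smul], by rw [h4, h2, smul_smul, mul_inv]⟩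

/-- The total space of `T*ℙⁿ(𝕜)`.  The tangent space of `ℙⁿ` at the line `𝕜u` is
`Hom(𝕜u, 𝕜ⁿ⁺¹/𝕜u)`, and the class of `(u, p)` is the covector `τ ↦ p(τ(u))`. -/
def CotP : Type := Quotient (coneSetoid 𝕜 n)

variable {𝕜 n}

/-- The point of `T*ℙⁿ` with homogeneous coordinates `(u, p)`. -/
def CotP.mk (u p : Fin (n + 1) → 𝕜) (hu : u ≠ 0) (hp : p ⬝ᵥ u = 0) : CotP 𝕜 n :=
  Quotient.mk (coneSetoid 𝕜 n) ⟨(u, p), hu, hp⟩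

/-- The canonical lift to `T*ℙⁿ` of the action of `SL_{n+1}(𝕜)`: `g·(u, p) = (g u, p g⁻¹)`. -/
def CotP.act (g : Matrix.SpecialLinearGroup (Fin (n + 1)) 𝕜) : CotP 𝕜 n → CotP 𝕜 n :=
  Quotient.map
    (fun x : Cone 𝕜 n =>
      (⟨((↑g : Matrix (Fin (n + 1)) (Fin (n + 1)) 𝕜) *ᵥ x.1.1, x.1.2 ᵥ* (↑(g⁻¹) : Matrix (Fin (n + 1)) (Fin (n + 1)) 𝕜)), by
        have hg : (↑(g⁻¹) : Matrix (Fin (n + 1)) (Fin (n + 1)) 𝕜) * (↑g : Matrix (Fin (n + 1)) (Fin (n + 1)) 𝕜) = 1 := by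
          rw [← Matrix.SpecialLinearGroup.coe_mul, inv_mul_cancel,
            Matrix.SpecialLinearGroup.coe_one]
        refine ⟨fun h => x.2.1 ?_, ?_⟩
        · have h' := congrArg (fun v => (↑(g⁻¹) : Matrix (Fin (n + 1)) (Fin (n + 1)) 𝕜) *ᵥ v) h
          simpa only [Matrix.mulVec_mulVec, hg, Matrix.one_mulVec, Matrix.mulVec_zero] using h'
        · rw [← Matrix.dotProduct_mulVec, Matrix.mulVec_mulVec, hg, Matrix.one_mulVec]
          exact x.2.2⟩ : Cone 𝕜 n))
    (by
      rintro x y ⟨c, h1, h2⟩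
      refine ⟨c, ?_, ?_⟩
      · change (↑g : Matrix (Fin (n + 1)) (Fin (n + 1)) 𝕜) *ᵥ y.1.1 = c • ((↑g : Matrix (Fin (n + 1)) (Fin (n + 1)) 𝕜) *ᵥ x.1.1)
        rw [h1, Matrix.mulVec_smul]
      · change y.1.2 ᵥ* (↑(g⁻¹) : Matrix (Fin (n + 1)) (Fin (n + 1)) 𝕜) = c⁻¹ • (x.1.2 ᵥ* (↑(g⁻¹) : Matrix (Fin (n + 1)) (Fin (n + 1)) 𝕜))
        rw [h2, Matrix.smul_vecMul])

/-- The induced action of `SL_{n+1}(𝕜)` on functions on `T*ℙⁿ`. -/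
def actFun (g : Matrix.SpecialLinearGroup (Fin (n + 1)) 𝕜) (f : CotP 𝕜 n → ℂ) : CotP 𝕜 n → ℂ :=
  fun x => f (CotP.act g⁻¹ x)

/-- The affine coordinates `z_j = u_j / u_k` (`j ≠ k`) on the open set `u_k ≠ 0`. -/
def chartCoord (k : Fin (n + 1)) (u : Fin (n + 1) → 𝕜) : Fin n → 𝕜 :=
  fun j => u (k.succAbove j) / u k

end Cotangent

/-- The inclusion of `T*ℝℙⁿ` in `T*ℂℙⁿ`. -/
def complexify {n : ℕ} : CotP ℝ n → CotP ℂ n :=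
  Quotient.map
    (fun x : Cone ℝ n =>
      (⟨(fun i => (x.1.1 i : ℂ), fun i => (x.1.2 i : ℂ)), by
        refine ⟨fun h => x.2.1 ?_, ?_⟩
        · funext i
          exact Complex.ofReal_eq_zero.1 (congrFun h i)
        · have h := congrArg (fun r : ℝ => (r : ℂ)) x.2.2
          simpa [dotProduct] using h⟩ : Cone ℂ n))
    (by
      rintro x y ⟨c, h1, h2⟩
      refine ⟨Units.map (algebraMap ℝ ℂ).toMonoidHom c, ?_, ?_⟩
      · funext i
        simp [h1, Units.smul_def]
      · funext i
        simp [h2, Units.smul_def])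

/-! ### Symbols -/

/-- Smooth complex valued functions on `ℝⁿ`. -/
def Smooth (n : ℕ) : Subalgebra ℂ ((Fin n → ℝ) → ℂ) where
  carrier := {f | ContDiff ℝ ∞ f}
  mul_mem' := by
    intro f g (hf : ContDiff ℝ ∞ f) (hg : ContDiff ℝ ∞ g)
    exact hf.mul hg
  add_mem' := by
    intro f g (hf : ContDiff ℝ ∞ f) (hg : ContDiff ℝ ∞ g)
    exact hf.add hg
  algebraMap_mem' c := (contDiff_const : ContDiff ℝ ∞ (fun _ : Fin n → ℝ => c))

/-- Evaluation of smooth functions at a point. -/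
def evSmooth {n : ℕ} (z : Fin n → ℝ) : Smooth n →+* ℂ :=
  (Pi.evalRingHom (fun _ : Fin n → ℝ => ℂ) z).comp (Smooth n).val.toRingHom

/-- The partial derivative `∂/∂z_i` of a smooth function. -/
def Smooth.partialDeriv {n : ℕ} (i : Fin n) (f : Smooth n) : Smooth n :=
  ⟨fun z => fderiv ℝ f.1 z (Pi.single i 1), by
    have hf : ContDiff ℝ ∞ f.1 := f.2
    exact (hf.fderiv_right (m := ∞) (by simp)).clm_apply contDiff_const⟩

/-- Smooth functions on `T*ℝⁿ` polynomial along the fibres: polynomials in the momenta `ζ_j`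
with smooth coefficients. -/
abbrev PolSmooth (n : ℕ) : Type := MvPolynomial (Fin n) (Smooth n)

/-- Regular functions on `T*ℂⁿ`: polynomials in the momenta `ζ_j` whose coefficients are
polynomials in the coordinates `z_j`. -/
abbrev PolAlg (n : ℕ) : Type := MvPolynomial (Fin n) (MvPolynomial (Fin n) ℂ)

/-- Complex polynomials as smooth functions on `ℝⁿ`. -/
def polyToSmooth (n : ℕ) : MvPolynomial (Fin n) ℂ →+* Smooth n :=
  (MvPolynomial.aeval (fun j : Fin n =>
    (⟨fun z => ((z j : ℝ) : ℂ),
      (Complex.ofRealCLM.contDiff.comp (contDiff_apply ℝ ℝ j) :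
        ContDiff ℝ ∞ (fun z : Fin n → ℝ => ((z j : ℝ) : ℂ)))⟩ :
      Smooth n))).toRingHom

/-- Restriction of coefficients from `ℂⁿ` to `ℝⁿ`. -/
def toSmooth {n : ℕ} : PolAlg n →+* PolSmooth n := MvPolynomial.map (polyToSmooth n)

/-- The function `φ` on `T*ℝℙⁿ` is given on `u_k ≠ 0`, in the coordinates `z_j = u_j / u_k` and
their conjugate momenta `ζ_j = u_k p_j`, by `a`. -/
def HasSymbol {n : ℕ} (k : Fin (n + 1)) (φ : CotP ℝ n → ℂ) (a : PolSmooth n) : Prop :=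
  ∀ (u p : Fin (n + 1) → ℝ) (hu : u ≠ 0) (hp : p ⬝ᵥ u = 0), u k ≠ 0 →
    φ (CotP.mk u p hu hp) =
      MvPolynomial.eval₂ (evSmooth (chartCoord k u))
        (fun j => ((u k * p (k.succAbove j) : ℝ) : ℂ)) a

/-- The same over `ℂ`, with polynomial coefficients. -/
def HasAlgSymbol {n : ℕ} (k : Fin (n + 1)) (f : CotP ℂ n → ℂ) (a : PolAlg n) : Prop :=
  ∀ (u p : Fin (n + 1) → ℂ) (hu : u ≠ 0) (hp : p ⬝ᵥ u = 0), u k ≠ 0 →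
    f (CotP.mk u p hu hp) =
      MvPolynomial.eval₂ (MvPolynomial.eval (chartCoord k u))
        (fun j => u k * p (k.succAbove j)) a

/-- The algebra `𝒜` of smooth complex valued functions on `T*ℝℙⁿ` which are polynomial along
the cotangent fibres. -/
def Sym (n : ℕ) : Subalgebra ℂ (CotP ℝ n → ℂ) where
  carrier := {φ | ∀ k, ∃ a, HasSymbol k φ a}
  mul_mem' := by
    intro φ ψ hφ hψ k
    obtain ⟨a, ha⟩ := hφ k
    obtain ⟨b, hb⟩ := hψ k
    exact ⟨a * b, fun u p hu hp hk => by
      rw [MvPolynomial.eval₂_mul, ← ha u p hu hp hk, ← hb u p hu hp hk]; rfl⟩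
  add_mem' := by
    intro φ ψ hφ hψ k
    obtain ⟨a, ha⟩ := hφ k
    obtain ⟨b, hb⟩ := hψ k
    exact ⟨a + b, fun u p hu hp hk => by
      rw [MvPolynomial.eval₂_add, ← ha u p hu hp hk, ← hb u p hu hp hk]; rfl⟩
  algebraMap_mem' := by
    intro c k
    exact ⟨MvPolynomial.C (algebraMap ℂ (Smooth n) c), fun u p hu hp hk => by
      rw [MvPolynomial.eval₂_C]; rfl⟩

/-- The graded piece `𝒜^d` of functions homogeneous of degree `d` along the fibres. -/
def SymDeg (n d : ℕ) : Submodule ℂ (Sym n) where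
  carrier := {φ | ∀ k, ∃ a : PolSmooth n, a.IsHomogeneous d ∧ HasSymbol k φ.1 a}
  zero_mem' := fun k => ⟨0, MvPolynomial.isHomogeneous_zero _ _ _, fun u p hu hp hk => by
    rw [MvPolynomial.eval₂_zero]; rfl⟩
  add_mem' := by
    intro φ ψ hφ hψ k
    obtain ⟨a, ha', ha⟩ := hφ k
    obtain ⟨b, hb', hb⟩ := hψ k
    exact ⟨a + b, ha'.add hb', fun u p hu hp hk => by
      rw [MvPolynomial.eval₂_add, ← ha u p hu hp hk, ← hb u p hu hp hk]; rfl⟩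
  smul_mem' := by
    intro c φ hφ k
    obtain ⟨a, ha', ha⟩ := hφ k
    refine ⟨MvPolynomial.C (algebraMap ℂ (Smooth n) c) * a, ?_, fun u p hu hp hk => ?_⟩
    · simpa using (MvPolynomial.isHomogeneous_C (Fin n) (algebraMap ℂ (Smooth n) c)).mul ha'
    · rw [MvPolynomial.eval₂_mul, MvPolynomial.eval₂_C, ← ha u p hu hp hk]; rfl

/-- `∂/∂z_i` acting on the coefficients of a symbol. -/
def coeffDeriv {n : ℕ} (i : Fin n) (a : PolSmooth n) : PolSmooth n :=
  ∑ α ∈ a.support, MvPolynomial.monomial α (Smooth.partialDeriv i (a.coeff α))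

/-- The canonical Poisson bracket of `T*ℝⁿ`, normalized by `{ζ_i, z_i} = 1`. -/
def poisson {n : ℕ} (a b : PolSmooth n) : PolSmooth n :=
  ∑ i, (MvPolynomial.pderiv i a * coeffDeriv i b - coeffDeriv i a * MvPolynomial.pderiv i b)

/-- `χ = {φ, ψ}` on `T*ℝℙⁿ`. -/
def IsPoissonBracket {n : ℕ} (φ ψ χ : CotP ℝ n → ℂ) : Prop :=
  ∀ k, ∃ a b, HasSymbol k φ a ∧ HasSymbol k ψ b ∧ HasSymbol k χ (poisson a b)

/-! ### Regular functions on `T*ℂℙⁿ` and the momentum algebra -/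

/-- The algebra of regular functions on the variety `T*ℂℙⁿ`, which is glued from the affine
spaces `T*ℂⁿ` over the standard charts `u_k ≠ 0`. -/
def Reg (n : ℕ) : Subalgebra ℂ (CotP ℂ n → ℂ) where
  carrier := {f | ∀ k, ∃ a, HasAlgSymbol k f a}
  mul_mem' := by
    intro φ ψ hφ hψ k
    obtain ⟨a, ha⟩ := hφ k
    obtain ⟨b, hb⟩ := hψ k
    exact ⟨a * b, fun u p hu hp hk => by
      rw [MvPolynomial.eval₂_mul, ← ha u p hu hp hk, ← hb u p hu hp hk]; rfl⟩
  add_mem' := by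
    intro φ ψ hφ hψ k
    obtain ⟨a, ha⟩ := hφ k
    obtain ⟨b, hb⟩ := hψ k
    exact ⟨a + b, fun u p hu hp hk => by
      rw [MvPolynomial.eval₂_add, ← ha u p hu hp hk, ← hb u p hu hp hk]; rfl⟩
  algebraMap_mem' := by
    intro c k
    exact ⟨MvPolynomial.C (MvPolynomial.C c), fun u p hu hp hk => by
      rw [MvPolynomial.eval₂_C, MvPolynomial.eval_C]; rfl⟩

theorem evSmooth_polyToSmooth {n : ℕ} (z : Fin n → ℝ) (q : MvPolynomial (Fin n) ℂ) :
    evSmooth z (polyToSmooth n q) = MvPolynomial.eval (fun j => (z j : ℂ)) q := by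
  have h : (evSmooth z).comp (polyToSmooth n) = MvPolynomial.eval (fun j => (z j : ℂ)) := by
    apply MvPolynomial.ringHom_ext
    · intro c
      simp [polyToSmooth, evSmooth]
    · intro i
      simp [polyToSmooth, evSmooth]
  exact congrArg (fun F => F q) h

theorem restrict_mem {n : ℕ} (f : Reg n) : (fun x => f.1 (complexify x)) ∈ Sym n := by
  intro k
  obtain ⟨a, ha⟩ := f.2 k
  refine ⟨toSmooth a, fun u p hu hp hk => ?_⟩
  have hu' : (fun i => (u i : ℂ)) ≠ 0 := fun h => hu (by
    funext i
    exact Complex.ofReal_eq_zero.1 (congrFun h i))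
  have hp' : (fun i => (p i : ℂ)) ⬝ᵥ (fun i => (u i : ℂ)) = 0 := by
    have h := congrArg (fun r : ℝ => (r : ℂ)) hp
    simpa [dotProduct] using h
  have h := ha (fun i => (u i : ℂ)) (fun i => (p i : ℂ)) hu' hp' (by exact_mod_cast hk)
  refine (show f.1 (complexify (CotP.mk u p hu hp)) = _ from h).trans ?_
  rw [toSmooth, MvPolynomial.eval₂_map]
  congr 1
  · ext q
    · simp [evSmooth_polyToSmooth]
    · simp [evSmooth_polyToSmooth, chartCoord]
  · funext j
    push_cast
    rfl

/-- Restriction of regular functions from `T*ℂℙⁿ` to `T*ℝℙⁿ`. -/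
def restrict (n : ℕ) : Reg n →ₐ[ℂ] Sym n where
  toFun f := ⟨fun x => f.1 (complexify x), restrict_mem f⟩
  map_one' := rfl
  map_mul' _ _ := rfl
  map_zero' := rfl
  map_add' _ _ := rfl
  commutes' _ := rfl

/-- The momentum algebra `ℛ ⊆ 𝒜`: the restrictions of the regular functions on `T*ℂℙⁿ`. -/
def MomAlg (n : ℕ) : Subalgebra ℂ (Sym n) := (restrict n).range

/-- The momentum function `μ^x (u, p) = -p(x u)` on `T*ℂℙⁿ`, the principal symbol of the vector
field `u ↦ -x u` generated by `x`. -/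
def momentum {n : ℕ} (x : Matrix (Fin (n + 1)) (Fin (n + 1)) ℂ) : CotP ℂ n → ℂ :=
  Quotient.lift (fun y : Cone ℂ n => -(y.1.2 ⬝ᵥ (x *ᵥ y.1.1))) (by
    rintro y z ⟨c, h1, h2⟩
    rw [h1, h2, Matrix.mulVec_smul, smul_dotProduct, dotProduct_smul, smul_smul,
      inv_mul_cancel, one_smul])

/-- The momentum function `μ^x` on `T*ℝℙⁿ`, for a complex matrix `x`. -/
def momentumReal {n : ℕ} (x : Matrix (Fin (n + 1)) (Fin (n + 1)) ℂ) : CotP ℝ n → ℂ :=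
  fun y => momentum x (complexify y)

/-! ### Densities and differential operators -/

/-- The smooth `lam`-densities on `ℝℙⁿ`.  Such a density is `s |ω|^lam` with
`ω = ∑ (-1)^i u_i du_0 ∧ ⋯ ∧ (omit du_i) ∧ ⋯ ∧ du_n`, where `s` is a smooth function on
`ℝⁿ⁺¹ \ {0}` with `s(c u) = |c|^{-lam (n+1)} s(u)`; the value of `s` at the origin is `0` by
convention.  On the big cell `u_0 = 1` it is `s(1, z) |dz|^lam`. -/
def Dens (n : ℕ) (lam : ℂ) : Submodule ℂ ((Fin (n + 1) → ℝ) → ℂ) where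
  carrier := {s | ContDiffOn ℝ ∞ s {0}ᶜ ∧ s 0 = 0 ∧
    ∀ (c : ℝ) (u : Fin (n + 1) → ℝ), c ≠ 0 →
      s (c • u) = ((|c| : ℝ) : ℂ) ^ (-(lam * (n + 1))) * s u}
  zero_mem' := ⟨contDiffOn_const, rfl, fun c u _ => by simp⟩
  add_mem' := by
    rintro s t ⟨h1, h2, h3⟩ ⟨h4, h5, h6⟩
    refine ⟨h1.add h4, by simp [h2, h5], fun c u hc => ?_⟩
    simp only [Pi.add_apply, h3 c u hc, h6 c u hc, mul_add]
  smul_mem' := by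
    rintro b s ⟨h1, h2, h3⟩
    refine ⟨contDiffOn_const.smul h1, by simp [h2], fun c u hc => ?_⟩
    simp only [Pi.smul_apply, h3 c u hc, smul_eq_mul]
    ring

section PartialDerivatives

variable (𝕜 : Type) [NontriviallyNormedField 𝕜] [NormedSpace 𝕜 ℂ] {n : ℕ}

/-- `∂s/∂u_i`. -/
def partialU (i : Fin (n + 1)) (s : (Fin (n + 1) → 𝕜) → ℂ) : (Fin (n + 1) → 𝕜) → ℂ :=
  fun u => fderiv 𝕜 s u (Pi.single i 1)

/-- The iterated partial derivative of `s` of multidegree `α` in the variables `u_j`, `j ≠ k`. -/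
def multiPartial (k : Fin (n + 1)) (α : Fin n →₀ ℕ) (s : (Fin (n + 1) → 𝕜) → ℂ) :
    (Fin (n + 1) → 𝕜) → ℂ :=
  (List.finRange n).foldr (fun j f => (partialU 𝕜 (k.succAbove j))^[α j] f) s

end PartialDerivatives

/-- The operator `P` on `lam`-densities is `∑_α a_α(z) ∂_z^α` over the chart `u_k ≠ 0`, in the
coordinates `z_j = u_j / u_k` and the trivialization `|dz|^lam`.  On functions `s` of
homogeneity degree `-lam (n+1)` the operator `∂/∂z_j` is `u_k ∂/∂u_j`. -/
def HasFullSymbol {n : ℕ} {lam : ℂ} (k : Fin (n + 1)) (P : Module.End ℂ (Dens n lam))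
    (a : PolSmooth n) : Prop :=
  ∀ (s : Dens n lam) (u : Fin (n + 1) → ℝ), u k ≠ 0 →
    (P s).1 u = ∑ α ∈ a.support,
      evSmooth (chartCoord k u) (a.coeff α) * ((u k : ℝ) : ℂ) ^ α.degree *
        multiPartial ℝ k α s.1 u

/-- The smooth linear differential operators on `lam`-densities on `ℝℙⁿ`. -/
def DiffOp (n : ℕ) (lam : ℂ) : Submodule ℂ (Module.End ℂ (Dens n lam)) where
  carrier := {P | ∀ k, ∃ a, HasFullSymbol k P a}
  zero_mem' := fun k => ⟨0, fun s u hk => by simp⟩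
  add_mem' := by
    intro P R hP hR k
    obtain ⟨a, ha⟩ := hP k
    obtain ⟨b, hb⟩ := hR k
    refine ⟨a + b, fun s u hk => ?_⟩
    have e : ∀ (c : PolSmooth n) (S : Finset (Fin n →₀ ℕ)), c.support ⊆ S →
        ∑ α ∈ c.support, evSmooth (chartCoord k u) (c.coeff α) * ((u k : ℝ) : ℂ) ^ α.degree *
          multiPartial ℝ k α s.1 u =
        ∑ α ∈ S, evSmooth (chartCoord k u) (c.coeff α) * ((u k : ℝ) : ℂ) ^ α.degree *
          multiPartial ℝ k α s.1 u := by
      intro c S hS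
      refine Finset.sum_subset hS fun α _ hα => ?_
      rw [MvPolynomial.notMem_support_iff.1 hα]
      simp
    classical
    rw [e (a + b) (a.support ∪ b.support) MvPolynomial.support_add]
    have h1 := (ha s u hk).trans (e a (a.support ∪ b.support) Finset.subset_union_left)
    have h2 := (hb s u hk).trans (e b (a.support ∪ b.support) Finset.subset_union_right)
    have h3 : ((P + R) s).1 u = (P s).1 u + (R s).1 u := rfl
    rw [h3, h1, h2, ← Finset.sum_add_distrib]
    refine Finset.sum_congr rfl fun α _ => ?_
    rw [MvPolynomial.coeff_add, map_add]
    ring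
  smul_mem' := by
    intro c P hP k
    obtain ⟨a, ha⟩ := hP k
    refine ⟨MvPolynomial.C (algebraMap ℂ (Smooth n) c) * a, fun s u hk => ?_⟩
    have h3 : ((c • P) s).1 u = c * (P s).1 u := rfl
    have hs : (MvPolynomial.C (algebraMap ℂ (Smooth n) c) * a).support ⊆ a.support := by
      intro α hα
      rw [MvPolynomial.mem_support_iff, MvPolynomial.coeff_C_mul] at hα
      exact MvPolynomial.mem_support_iff.2 fun h => hα (by rw [h, mul_zero])
    rw [h3, ha s u hk, Finset.mul_sum]
    symm
    refine (Finset.sum_subset hs fun α _ hα => ?_).trans ?_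
    · rw [MvPolynomial.notMem_support_iff.1 hα]
      simp
    · refine Finset.sum_congr rfl fun α _ => ?_
      rw [MvPolynomial.coeff_C_mul, map_mul]
      have h4 : evSmooth (chartCoord k u) (algebraMap ℂ (Smooth n) c) = c := rfl
      rw [h4]
      ring

/-- `P` has order at most `d` and its principal symbol of degree `d` is `φ`. -/
def IsPrincipalSymbol {n : ℕ} {lam : ℂ} (d : ℕ) (P : Module.End ℂ (Dens n lam))
    (φ : CotP ℝ n → ℂ) : Prop :=
  ∀ k, ∃ a, HasFullSymbol k P a ∧ a.totalDegree ≤ d ∧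
    HasSymbol k φ (MvPolynomial.homogeneousComponent d a)

/-- The action of `SL_{n+1}(ℝ)` on `lam`-densities, `(g s)(u) = s(g⁻¹ u)`. -/
def actDens {n : ℕ} (lam : ℂ) (g : Matrix.SpecialLinearGroup (Fin (n + 1)) ℝ) :
    Module.End ℂ (Dens n lam) where
  toFun s := ⟨fun u => s.1 ((↑(g⁻¹) : Matrix (Fin (n + 1)) (Fin (n + 1)) ℝ) *ᵥ u), by
    obtain ⟨h1, h2, h3⟩ := s.2
    refine ⟨?_, by simpa using h2, fun c u hc => ?_⟩
    · refine h1.comp (t := {0}ᶜ)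
        (f := fun u => (↑(g⁻¹) : Matrix (Fin (n + 1)) (Fin (n + 1)) ℝ) *ᵥ u) ?_ ?_
      · exact ((LinearMap.toContinuousLinearMap (Matrix.mulVecLin (↑(g⁻¹) : Matrix (Fin (n + 1)) (Fin (n + 1)) ℝ))).contDiff).contDiffOn
      · intro u hu h
        apply hu
        have h' := congrArg (fun v => (↑g : Matrix (Fin (n + 1)) (Fin (n + 1)) ℝ) *ᵥ v) (show (↑(g⁻¹) : Matrix (Fin (n + 1)) (Fin (n + 1)) ℝ) *ᵥ u = 0 from h)
        have hg : (↑g : Matrix (Fin (n + 1)) (Fin (n + 1)) ℝ) * (↑(g⁻¹) : Matrix (Fin (n + 1)) (Fin (n + 1)) ℝ) = 1 := by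
          rw [← Matrix.SpecialLinearGroup.coe_mul, mul_inv_cancel,
            Matrix.SpecialLinearGroup.coe_one]
        simpa only [Matrix.mulVec_mulVec, hg, Matrix.one_mulVec, Matrix.mulVec_zero,
          Set.mem_singleton_iff] using h'
    · exact (congrArg s.1 (Matrix.mulVec_smul _ c u)).trans (h3 c _ hc)⟩
  map_add' _ _ := rfl
  map_smul' _ _ := rfl

/-- The Lie derivative `η_lam^x` on `lam`-densities of the vector field generated by
`x ∈ 𝔰𝔩_{n+1}(ℝ)`: the derivative at `t = 0` of `s(exp(-t x) u)`. -/
def lieDeriv {n : ℕ} (lam : ℂ) (x : Matrix (Fin (n + 1)) (Fin (n + 1)) ℝ) :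
    Module.End ℂ (Dens n lam) where
  toFun s := ⟨fun u => -(fderiv ℝ s.1 u (x *ᵥ u)), by
    obtain ⟨h1, h2, h3⟩ := s.2
    have ho : IsOpen ({0}ᶜ : Set (Fin (n + 1) → ℝ)) := isOpen_compl_singleton
    refine ⟨?_, by simp, fun c u hc => ?_⟩
    · refine ContDiffOn.neg ?_
      refine (h1.fderiv_of_isOpen ho (m := ∞) (by simp)).clm_apply ?_
      exact ((LinearMap.toContinuousLinearMap (Matrix.mulVecLin x)).contDiff).contDiffOn
    · by_cases hu : u = 0
      · subst hu
        simp
      have hu' : c • u ≠ 0 := smul_ne_zero hc hu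
      have hd : ∀ v : Fin (n + 1) → ℝ, v ≠ 0 → DifferentiableAt ℝ s.1 v := fun v hv =>
        (h1.differentiableOn (by simp)).differentiableAt (ho.mem_nhds hv)
      have hl : HasFDerivAt (fun v : Fin (n + 1) → ℝ => c • v)
          (c • ContinuousLinearMap.id ℝ (Fin (n + 1) → ℝ)) u := (hasFDerivAt_id u).const_smul c
      have e1 := (hd _ hu').hasFDerivAt.comp u hl
      have e2 := (hd u hu).hasFDerivAt.const_mul (((|c| : ℝ) : ℂ) ^ (-(lam * (n + 1))))
      have e3 : (s.1 ∘ fun v : Fin (n + 1) → ℝ => c • v) =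
          fun v => ((|c| : ℝ) : ℂ) ^ (-(lam * (n + 1))) * s.1 v := by
        funext v
        exact h3 c v hc
      rw [e3] at e1
      have e4 := congrArg (fun L => L (x *ᵥ u)) (e1.unique e2)
      have e5 : fderiv ℝ s.1 (c • u) (c • (x *ᵥ u)) =
          ((|c| : ℝ) : ℂ) ^ (-(lam * (n + 1))) * fderiv ℝ s.1 u (x *ᵥ u) := by
        simpa using e4
      change -(fderiv ℝ s.1 (c • u) (x *ᵥ (c • u))) =
        ((|c| : ℝ) : ℂ) ^ (-(lam * (n + 1))) * -(fderiv ℝ s.1 u (x *ᵥ u))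
      rw [Matrix.mulVec_smul, e5, mul_neg]⟩
  map_add' s t := by
    apply Subtype.ext
    funext u
    have ho : IsOpen ({0}ᶜ : Set (Fin (n + 1) → ℝ)) := isOpen_compl_singleton
    by_cases hu : u = 0
    · subst hu
      simp
    have hd : ∀ r : Dens n lam, DifferentiableAt ℝ r.1 u := fun r =>
      (r.2.1.differentiableOn (by simp)).differentiableAt (ho.mem_nhds hu)
    change -(fderiv ℝ (s.1 + t.1) u (x *ᵥ u)) =
      -(fderiv ℝ s.1 u (x *ᵥ u)) + -(fderiv ℝ t.1 u (x *ᵥ u))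
    rw [fderiv_add (hd s) (hd t), _root_.add_apply, neg_add]
  map_smul' c s := by
    apply Subtype.ext
    funext u
    have ho : IsOpen ({0}ᶜ : Set (Fin (n + 1) → ℝ)) := isOpen_compl_singleton
    by_cases hu : u = 0
    · subst hu
      simp
    have hd : DifferentiableAt ℝ s.1 u :=
      (s.2.1.differentiableOn (by simp)).differentiableAt (ho.mem_nhds hu)
    change -(fderiv ℝ (c • s.1) u (x *ᵥ u)) = c • -(fderiv ℝ s.1 u (x *ᵥ u))
    rw [fderiv_const_smul hd, _root_.smul_apply, smul_neg]

/-! ### Twisted algebraic differential operators on `ℂℙⁿ` -/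

/-- `s` is a holomorphic function on the open set `O ⊆ ℂⁿ⁺¹ \ {0}`, homogeneous (infinitesimally)
of degree `-lam (n+1)`: a local section of the formal power `𝒦^lam` of the canonical bundle
`𝒦 = 𝒪(-n-1)` of `ℂℙⁿ`. -/
def IsLocalSection {n : ℕ} (lam : ℂ) (O : Set (Fin (n + 1) → ℂ)) (s : (Fin (n + 1) → ℂ) → ℂ) :
    Prop :=
  IsOpen O ∧ 0 ∉ O ∧ DifferentiableOn ℂ s O ∧
    ∀ u ∈ O, fderiv ℂ s u u = -(lam * (n + 1)) * s u

/-- The action on local sections, over `u_k ≠ 0`, of the algebraic differential operator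
`∑_α b_α(z) ∂_z^α` in the coordinates `z_j = u_j / u_k` and the trivialization
`(dz_1 ∧ ⋯ ∧ dz_n)^lam`; the operator `∂/∂z_j` is `u_k ∂/∂u_j`. -/
def applyAlg {n : ℕ} (k : Fin (n + 1)) (b : PolAlg n) (s : (Fin (n + 1) → ℂ) → ℂ)
    (u : Fin (n + 1) → ℂ) : ℂ :=
  ∑ α ∈ b.support, MvPolynomial.eval (chartCoord k u) (b.coeff α) * u k ^ α.degree *
    multiPartial ℂ k α s u

/-- A global twisted algebraic differential operator on `ℂℙⁿ` for `𝒦^lam`: differential operators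
with polynomial coefficients on the standard charts, which agree on the overlaps. -/
def IsTDO {n : ℕ} (lam : ℂ) (b : Fin (n + 1) → PolAlg n) : Prop :=
  ∀ (O : Set (Fin (n + 1) → ℂ)) (s : (Fin (n + 1) → ℂ) → ℂ), IsLocalSection lam O s →
    ∀ (k l : Fin (n + 1)) (u : Fin (n + 1) → ℂ), u ∈ O → u k ≠ 0 → u l ≠ 0 →
      applyAlg k (b k) s u = applyAlg l (b l) s u

/-- The operators on `lam`-densities on `ℝℙⁿ` which are the restrictions of the twisted algebraic
differential operators on `ℂℙⁿ`. -/
def AlgDiffOp (n : ℕ) (lam : ℂ) : Set (Module.End ℂ (Dens n lam)) :=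
  {P | ∃ b : Fin (n + 1) → PolAlg n, IsTDO lam b ∧ ∀ k, HasFullSymbol k P (toSmooth (b k))}

/-! ### Equivariant quantization and star products -/

/-- `Q` is an `SL_{n+1}(ℝ)`-equivariant quantization map from `𝒜` to the differential operators on
`lam`-densities: a linear isomorphism, such that `φ` is the principal symbol of `Q φ` for
homogeneous `φ`, equivariant under `𝔰𝔩_{n+1}(ℝ)` and `SL_{n+1}(ℝ)`. -/
structure IsEquivariantQuantization {n : ℕ} (lam : ℂ) (Q : Sym n ≃ₗ[ℂ] DiffOp n lam) : Prop where
  symbol : ∀ (d : ℕ) (φ : Sym n), φ ∈ SymDeg n d → IsPrincipalSymbol d (Q φ).1 φ.1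
  lie_equivariant : ∀ x : Matrix (Fin (n + 1)) (Fin (n + 1)) ℝ, x.trace = 0 → ∀ φ : Sym n,
    ∃ χ : Sym n, IsPoissonBracket (momentumReal (x.map Complex.ofReal)) φ.1 χ.1 ∧
      (Q χ).1 = lieDeriv lam x * (Q φ).1 - (Q φ).1 * lieDeriv lam x
  equivariant : ∀ (g : Matrix.SpecialLinearGroup (Fin (n + 1)) ℝ) (φ : Sym n),
    ∃ χ : Sym n, χ.1 = actFun g φ.1 ∧
      (Q χ).1 = actDens lam g * (Q φ).1 * actDens lam g⁻¹

/-- `C p` are the coefficients of the product `φ ⋆ ψ = ∑_p C_p(φ, ψ) t^p` defined by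
`Q_t(φ ⋆ ψ) = Q_t(φ) Q_t(ψ)`, where `Q_t(φ) = t^d Q(φ)` for `φ ∈ 𝒜^d`. -/
def IsStarOf {n : ℕ} {lam : ℂ} (Q : Sym n ≃ₗ[ℂ] DiffOp n lam)
    (C : ℕ → Sym n →ₗ[ℂ] Sym n →ₗ[ℂ] Sym n) : Prop :=
  ∀ (j k : ℕ) (φ ψ : Sym n), φ ∈ SymDeg n j → ψ ∈ SymDeg n k →
    (∀ p, p ≤ j + k → C p φ ψ ∈ SymDeg n (j + k - p)) ∧
    (∀ p, j + k < p → C p φ ψ = 0) ∧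
    (Q φ).1 * (Q ψ).1 = ∑ p ∈ Finset.range (j + k + 1), (Q (C p φ ψ)).1

/-- The bilinear maps `C p` on `𝒜` restrict to a graded star product
`φ ⋆ ψ = ∑_p C_p(φ, ψ) t^p` on the subalgebra `S` of `𝒜`. -/
structure RestrictsToGradedStarProduct {n : ℕ} (S : Subalgebra ℂ (Sym n))
    (C : ℕ → Sym n →ₗ[ℂ] Sym n →ₗ[ℂ] Sym n) : Prop where
  graded_algebra : Subalgebra.toSubmodule S ≤ ⨆ d, Subalgebra.toSubmodule S ⊓ SymDeg n d
  closed : ∀ p, ∀ φ ∈ S, ∀ ψ ∈ S, C p φ ψ ∈ S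
  finite : ∀ φ ∈ S, ∀ ψ ∈ S, ∃ N, ∀ p, N ≤ p → C p φ ψ = 0
  coeff_zero : ∀ φ ∈ S, ∀ ψ ∈ S, C 0 φ ψ = φ * ψ
  coeff_one : ∀ φ ∈ S, ∀ ψ ∈ S, IsPoissonBracket φ.1 ψ.1 (C 1 φ ψ - C 1 ψ φ).1
  unit : ∀ p, 1 ≤ p → ∀ φ ∈ S, C p 1 φ = 0 ∧ C p φ 1 = 0
  assoc : ∀ r, ∀ φ ∈ S, ∀ ψ ∈ S, ∀ χ ∈ S,
    ∑ ij ∈ Finset.HasAntidiagonal.antidiagonal r, C ij.1 (C ij.2 φ ψ) χ =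
      ∑ ij ∈ Finset.HasAntidiagonal.antidiagonal r, C ij.1 φ (C ij.2 ψ χ)
  graded : ∀ (p j k : ℕ), ∀ φ ∈ S, ∀ ψ ∈ S, φ ∈ SymDeg n j → ψ ∈ SymDeg n k →
    (p ≤ j + k → C p φ ψ ∈ SymDeg n (j + k - p)) ∧ (j + k < p → C p φ ψ = 0)

/-- The maps `C p` on the momentum algebra are equivariant for the representation of
`SL_{n+1}(ℂ)` on `ℛ` coming from its action on `T*ℂℙⁿ`. -/
def IsSLEquivariant {n : ℕ} (C : ℕ → Sym n →ₗ[ℂ] Sym n →ₗ[ℂ] Sym n) : Prop :=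
  ∀ (g : Matrix.SpecialLinearGroup (Fin (n + 1)) ℂ) (p : ℕ) (f₁ f₂ f₃ : Reg n),
    C p (restrict n f₁) (restrict n f₂) = restrict n f₃ →
    ∃ h₁ h₂ h₃ : Reg n, h₁.1 = actFun g f₁.1 ∧ h₂.1 = actFun g f₂.1 ∧ h₃.1 = actFun g f₃.1 ∧
      C p (restrict n h₁) (restrict n h₂) = restrict n h₃

end ProjQuant

end

/-! The proof rests on the Casimir element `∑ E_ij E_ji` of `gl_{n+1}`. It acts on symbols by
iterated Poisson brackets with momentum functions, and on operators by iterated commutators with the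
Lie derivatives `eta`. The identity matrix acts trivially in both cases, so passing from `sl` to
`gl` changes nothing. A computation in affine coordinates (`sum_bracket_momSym`) shows that it
multiplies symbols of degree `d` by `2d(d+n)`, whatever `lam` is. Since the principal symbol of a
commutator is a Poisson bracket, the Casimir operator on differential operators preserves the order
filtration and acts on the graded pieces by the same scalars (`casimir_sub_mem`). These scalars are
distinct, so a homogeneous symbol has exactly one lift to an operator that is an eigenvector for the
scalar of its degree (`exists_isEigenLift`, `IsEigenLift.unique`). The eigenlift is the quantization
map. It is equivariant because the Casimir operator commutes with commutators and with conjugation.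
Conversely, an equivariant quantization transports the Casimir operator from symbols to operators,
so it must be the eigenlift (`isEigenLift_of_isEquivariantQuantization`).

The groundwork is a calculus of full symbols in charts: `comp` encodes composition through the
Leibniz rule. Principal symbols are recovered without reference to a chart by applying an operator
of order `d` to a density that vanishes to order `d` at the given point
(`HasFullSymbol.apply_testDens`). Every homogeneous symbol is a principal symbol, because a
partition of unity writes it through functions on the base and momentum functions (`symbol_eq_sum`).

On the complex side, a regular function becomes a polynomial in `(u, p)` after multiplication by a
power of one coordinate `u_a`. Regularity on another chart forces this polynomial, on `u_a = 0`, to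
be divisible by the quadric `∑_{j ≠ a} u_j p_j`, which equals `-u_a p_a` on the cone; so the pole
order can be lowered step by step (`exists_pole_order_pred`). What remains is a polynomial of weight
zero, hence a polynomial in the products `u_i p_j`, which are momentum functions up to sign
(`momGen_eq_top`).

It follows that a homogeneous element of the momentum algebra is the principal symbol of an operator
in `lieOp`, the algebra generated by the Lie derivatives. This algebra is stable under the Casimir
operator, so the eigenlift can be found inside it (`quantLin_mem_lieOp`). Conversely, an operator
with polynomial full symbols has a regular principal symbol, and induction on the order shows that
the quantized momentum algebra, `lieOp` and `polyOp` coincide. Elements of `lieOp` act on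
holomorphic sections, so these are also the twisted differential operators (`mem_algDiffOp_iff`).

The coefficients of the star product are the homogeneous components of the transported composition
product (`IsStarOf.apply`), so the star product axioms reflect associativity, the order filtration
and the symbol of a commutator. Equivariance under the real group is inherited from the
quantization. For a transvection `1 + t E` both sides are polynomial in `t`, so agreement for real
`t` implies agreement for complex `t`, and transvections generate the complex group
(`regStar_actReg`). -/

noncomputable section

set_option linter.unusedSectionVars false

namespace ProjQuant

/-! ### Polynomials in commuting operators -/

section Op

variable {r : ℕ} {A M : Type*} [CommRing A] [AddCommGroup M] [Module A M]
  (T : Fin r → AddMonoid.End M)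

/-- The monomial `T^α` in the operators `T j`. -/
def opPow (α : Fin r →₀ ℕ) : AddMonoid.End M :=
  ((List.finRange r).map fun j => T j ^ α j).prod

/-- The value at `m` of the operator `∑ a_α T^α`, as a function of `a`. -/
def op (m : M) : MvPolynomial (Fin r) A →ₗ[A] M :=
  (MvPolynomial.basisMonomials (Fin r) A).constr A (fun α => opPow T α m)

theorem opPow_zero : opPow T 0 = 1 := by
  simp [opPow]

theorem commute_listProd {ι : Type*} {R : Type*} [Monoid R] (x : R) (f : ι → R) (l : List ι)
    (h : ∀ i, Commute x (f i)) : Commute x (l.map f).prod := by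
  induction l with
  | nil => simp
  | cons a l ih => simpa using (h a).mul_right ih

/-- Since the operators commute, the additional factor `T i` can be pulled out of the ordered
product to its right end. The induction runs over lists without repetition, in which `i` occurs at
most once. -/
theorem opPow_add_single (hT : ∀ i j, Commute (T i) (T j)) (α : Fin r →₀ ℕ) (i : Fin r) :
    opPow T (α + Finsupp.single i 1) = opPow T α * T i := by
  have key : ∀ l : List (Fin r), l.Nodup →
      (l.map fun j => T j ^ ((α + Finsupp.single i 1 : Fin r →₀ ℕ) j)).prod =
        (l.map fun j => T j ^ α j).prod * (if i ∈ l then T i else 1) := by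
    intro l
    induction l with
    | nil => simp
    | cons a l ih =>
      intro hl
      rw [List.nodup_cons] at hl
      rw [List.map_cons, List.prod_cons, List.map_cons, List.prod_cons, ih hl.2]
      by_cases h : a = i
      · subst h
        have hc : Commute (T a) (l.map fun j => T j ^ α j).prod :=
          commute_listProd _ _ _ fun j => (hT a j).pow_right _
        simp [hl.1, pow_succ, mul_assoc, hc.eq]
      · have h' : i ≠ a := fun e => h e.symm
        simp [h', mul_assoc]
  simpa [opPow] using key (List.finRange r) (List.nodup_finRange r)

variable {T}

@[simp]
theorem op_monomial (m : M) (α : Fin r →₀ ℕ) (c : A) :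
    op T m (MvPolynomial.monomial α c) = c • opPow T α m := by
  have h : (MvPolynomial.monomial α c : MvPolynomial (Fin r) A) =
      c • (MvPolynomial.basisMonomials (Fin r) A α) := by
    simp [MvPolynomial.smul_monomial]
  rw [h, map_smul, op, Module.Basis.constr_basis]

@[simp]
theorem op_C (m : M) (c : A) : op T m (MvPolynomial.C c) = c • m := by
  rw [← MvPolynomial.monomial_zero', op_monomial, opPow_zero]
  rfl

theorem op_C_mul (m : M) (c : A) (F : MvPolynomial (Fin r) A) :
    op T m (MvPolynomial.C c * F) = c • op T m F := by
  rw [← MvPolynomial.smul_eq_C_mul, map_smul]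

/-- Together with `op_C` and additivity this is a recursion that determines `op`. Later inductions
on symbols peel off the factor that acts first on the argument. -/
theorem op_mul_X (hT : ∀ i j, Commute (T i) (T j)) (m : M) (F : MvPolynomial (Fin r) A)
    (i : Fin r) : op T m (F * MvPolynomial.X i) = op T (T i m) F := by
  induction F using MvPolynomial.induction_on' with
  | monomial α c =>
    rw [MvPolynomial.X, MvPolynomial.monomial_mul, mul_one, op_monomial, op_monomial,
      opPow_add_single T hT]
    rfl
  | add p q hp hq => rw [add_mul, map_add, map_add, hp, hq]

theorem op_add_right (m m' : M) (F : MvPolynomial (Fin r) A) :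
    op T (m + m') F = op T m F + op T m' F := by
  induction F using MvPolynomial.induction_on' with
  | monomial α c => simp
  | add p q hp hq => rw [map_add, map_add, map_add, hp, hq]; abel

/-- Naturality of `op` for a map of modules which intertwines the operators. -/
theorem op_map {B N : Type*} [CommRing B] [AddCommGroup N] [Module B N]
    {T' : Fin r → AddMonoid.End N} (hT : ∀ i j, Commute (T i) (T j))
    (hT' : ∀ i j, Commute (T' i) (T' j)) (f : A →+* B) (g : M →+ N)
    (hg : ∀ (a : A) m, g (a • m) = f a • g m) (hgT : ∀ i m, g (T i m) = T' i (g m)) (m : M)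
    (F : MvPolynomial (Fin r) A) : g (op T m F) = op T' (g m) (MvPolynomial.map f F) := by
  induction F using MvPolynomial.induction_on generalizing m with
  | C a => simp [hg]
  | add p q hp hq => simp [hp, hq]
  | mul_X p i hp =>
    rw [op_mul_X hT, hp, map_mul, MvPolynomial.map_X, op_mul_X hT', hgT]

end Op

/-! ### The filtration by the degree -/

section Degree

variable {σ A : Type*} [CommRing A]

/-- The polynomials all of whose monomials have degree less than `m`. -/
def degLT (σ A : Type*) [CommRing A] (m : ℕ) : Submodule A (MvPolynomial σ A) where
  carrier := {a | ∀ α : σ →₀ ℕ, m ≤ α.degree → a.coeff α = 0}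
  zero_mem' := by intro α _; simp
  add_mem' := by intro a b ha hb α h; rw [MvPolynomial.coeff_add, ha α h, hb α h, add_zero]
  smul_mem' := by intro c a ha α h; rw [MvPolynomial.coeff_smul, ha α h, smul_zero]

theorem degLT_mono {m m' : ℕ} (h : m ≤ m') : degLT σ A m ≤ degLT σ A m' :=
  fun _ ha α hα => ha α (h.trans hα)

/-- The strict inequality in `degLT` makes the filtration start at zero, which is the base case of
the later inductions on the order. -/
theorem degLT_zero {a : MvPolynomial σ A} (h : a ∈ degLT σ A 0) : a = 0 := by
  ext α
  simpa using h α (Nat.zero_le _)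

theorem mem_degLT_succ_iff {d : ℕ} {a : MvPolynomial σ A} :
    a ∈ degLT σ A (d + 1) ↔ a.totalDegree ≤ d := by
  have e : ∀ α : σ →₀ ℕ, α.degree = α.sum fun _ e => e := fun _ => rfl
  constructor
  · intro h
    refine Finset.sup_le fun α hα => ?_
    by_contra hlt
    push Not at hlt
    exact (MvPolynomial.mem_support_iff.1 hα) (h α (by rw [e]; exact hlt))
  · intro h α hα
    by_contra hne
    have h1 := MvPolynomial.le_totalDegree (MvPolynomial.mem_support_iff.2 hne)
    have h2 := e α
    omega

theorem monomial_mem_degLT {m : ℕ} {α : σ →₀ ℕ} (h : α.degree < m) (c : A) :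
    MvPolynomial.monomial α c ∈ degLT σ A m := by
  classical
  intro β hβ
  rw [MvPolynomial.coeff_monomial, if_neg]
  rintro rfl
  omega

theorem IsHomogeneous_mem_degLT {d : ℕ} {a : MvPolynomial σ A} (h : a.IsHomogeneous d) :
    a ∈ degLT σ A (d + 1) := by
  intro α hα
  exact h.coeff_eq_zero (by omega)

/-- Degrees at most `d - 1` and `e - 1` add up to less than `d + e - 1`. The truncated subtraction
is harmless, since a factor in `degLT σ A 0` is zero. -/
theorem mul_mem_degLT {d e : ℕ} {a b : MvPolynomial σ A} (ha : a ∈ degLT σ A d)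
    (hb : b ∈ degLT σ A e) : a * b ∈ degLT σ A (d + e - 1) := by
  classical
  intro α hα
  rw [MvPolynomial.coeff_mul]
  refine Finset.sum_eq_zero fun x hx => ?_
  rw [Finset.HasAntidiagonal.mem_antidiagonal] at hx
  have h : x.1.degree + x.2.degree = α.degree := by rw [← hx, map_add]
  rcases le_or_gt d x.1.degree with h1 | h1
  · rw [ha _ h1, zero_mul]
  · rw [hb _ (by omega), mul_zero]

theorem C_mul_mem_degLT {d : ℕ} {a : MvPolynomial σ A} (ha : a ∈ degLT σ A d) (c : A) :
    MvPolynomial.C c * a ∈ degLT σ A d := by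
  rw [← MvPolynomial.smul_eq_C_mul]
  exact Submodule.smul_mem _ _ ha

theorem pderiv_mem_degLT {d : ℕ} {a : MvPolynomial σ A} (ha : a ∈ degLT σ A d) (i : σ) :
    MvPolynomial.pderiv i a ∈ degLT σ A (d - 1) := by
  intro α hα
  rw [MvPolynomial.coeff_pderiv, ha _ (by rw [map_add, Finsupp.degree_single]; omega), zero_mul]

theorem sub_homogeneousComponent_mem {d : ℕ} {a : MvPolynomial σ A}
    (ha : a ∈ degLT σ A (d + 1)) : a - MvPolynomial.homogeneousComponent d a ∈ degLT σ A d := by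
  intro α hα
  rw [MvPolynomial.coeff_sub, MvPolynomial.coeff_homogeneousComponent]
  split_ifs with h
  · simp
  · rw [ha α (by omega), sub_zero]

theorem homogeneousComponent_of_mem_degLT {d : ℕ} {a : MvPolynomial σ A}
    (ha : a ∈ degLT σ A d) : MvPolynomial.homogeneousComponent d a = 0 := by
  ext α
  rw [MvPolynomial.coeff_homogeneousComponent]
  split_ifs with h
  · rw [ha α h.ge, MvPolynomial.coeff_zero]
  · simp

/-- Top degree part of a polynomial with a given homogeneous principal part. -/
theorem homogeneousComponent_eq_of_sub_mem {d : ℕ} {a b : MvPolynomial σ A}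
    (hb : b.IsHomogeneous d) (h : a - b ∈ degLT σ A d) :
    MvPolynomial.homogeneousComponent d a = b := by
  have h1 := homogeneousComponent_of_mem_degLT h
  rw [map_sub, MvPolynomial.homogeneousComponent_eq_self hb, sub_eq_zero] at h1
  exact h1

end Degree

/-! ### Derivations acting on coefficients and composition of symbols -/

section Comp

variable {A : Type*} [CommRing A] [Algebra ℂ A]

/-- A derivation acting on the coefficients of a polynomial. -/
def mapD {σ : Type*} (d : Derivation ℂ A A) : MvPolynomial σ A →+ MvPolynomial σ A where
  toFun a := ∑ α ∈ a.support, MvPolynomial.monomial α (d (a.coeff α))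
  map_zero' := by simp
  map_add' a b := by
    classical
    have e : ∀ (c : MvPolynomial σ A) (β : σ →₀ ℕ),
        (∑ α ∈ c.support, MvPolynomial.monomial α (d (c.coeff α))).coeff β = d (c.coeff β) := by
      intro c β
      rw [MvPolynomial.coeff_sum]
      simp only [MvPolynomial.coeff_monomial]
      rw [Finset.sum_ite_eq']
      split_ifs with h
      · rfl
      · rw [MvPolynomial.notMem_support_iff.1 h, map_zero]
    ext β
    rw [MvPolynomial.coeff_add, e, e, e, MvPolynomial.coeff_add, map_add]

@[simp]
theorem coeff_mapD {σ : Type*} (d : Derivation ℂ A A) (a : MvPolynomial σ A) (β : σ →₀ ℕ) :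
    (mapD d a).coeff β = d (a.coeff β) := by
  classical
  change (∑ α ∈ a.support, MvPolynomial.monomial α (d (a.coeff α))).coeff β = _
  rw [MvPolynomial.coeff_sum]
  simp only [MvPolynomial.coeff_monomial]
  rw [Finset.sum_ite_eq']
  split_ifs with h
  · rfl
  · rw [MvPolynomial.notMem_support_iff.1 h, map_zero]

@[simp]
theorem mapD_C {σ : Type*} (d : Derivation ℂ A A) (c : A) :
    mapD d (MvPolynomial.C c : MvPolynomial σ A) = MvPolynomial.C (d c) := by
  classical
  ext β
  rw [coeff_mapD, MvPolynomial.coeff_C, MvPolynomial.coeff_C]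
  split_ifs <;> simp

@[simp]
theorem mapD_monomial {σ : Type*} (d : Derivation ℂ A A) (α : σ →₀ ℕ) (c : A) :
    mapD d (MvPolynomial.monomial α c : MvPolynomial σ A) = MvPolynomial.monomial α (d c) := by
  classical
  ext β
  rw [coeff_mapD, MvPolynomial.coeff_monomial, MvPolynomial.coeff_monomial]
  split_ifs <;> simp

theorem mapD_mul {σ : Type*} (d : Derivation ℂ A A) (a b : MvPolynomial σ A) :
    mapD d (a * b) = mapD d a * b + a * mapD d b := by
  classical
  ext β
  simp only [coeff_mapD, MvPolynomial.coeff_mul, MvPolynomial.coeff_add, map_sum,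
    Derivation.leibniz, smul_eq_mul, ← Finset.sum_add_distrib]
  refine Finset.sum_congr rfl fun x _ => ?_
  ring

@[simp]
theorem mapD_X {σ : Type*} (d : Derivation ℂ A A) (i : σ) :
    mapD d (MvPolynomial.X i : MvPolynomial σ A) = 0 := by
  rw [MvPolynomial.X, mapD_monomial, Derivation.map_one_eq_zero, map_zero]

theorem mapD_mem_degLT {σ : Type*} (d : Derivation ℂ A A) {m : ℕ} {a : MvPolynomial σ A}
    (ha : a ∈ degLT σ A m) : mapD d a ∈ degLT σ A m := by
  intro α hα
  rw [coeff_mapD, ha α hα, map_zero]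

theorem mapD_isHomogeneous {σ : Type*} (d : Derivation ℂ A A) {m : ℕ} {a : MvPolynomial σ A}
    (ha : a.IsHomogeneous m) : (mapD d a).IsHomogeneous m := by
  intro α hα
  refine ha fun h => hα ?_
  rw [coeff_mapD, h, map_zero]

theorem mapD_comm {σ : Type*} {d d' : Derivation ℂ A A} (h : ∀ c, d (d' c) = d' (d c))
    (a : MvPolynomial σ A) : mapD d (mapD d' a) = mapD d' (mapD d a) := by
  ext α
  simp [h]

theorem mapD_pderiv {σ : Type*} (d : Derivation ℂ A A) (i : σ) (a : MvPolynomial σ A) :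
    mapD d (MvPolynomial.pderiv i a) = MvPolynomial.pderiv i (mapD d a) := by
  ext α
  rw [coeff_mapD, MvPolynomial.coeff_pderiv, MvPolynomial.coeff_pderiv, coeff_mapD,
    Derivation.leibniz]
  have h : d ((α i : A) + 1) = 0 := by
    rw [map_add, Derivation.map_natCast, Derivation.map_one_eq_zero, add_zero]
  rw [h, smul_zero, zero_add, smul_eq_mul, mul_comm]

variable {r : ℕ} (D : Fin r → Derivation ℂ A A)

/-- The symbol of `∂_j ∘ b`. -/
def symbolMulLeft (j : Fin r) : AddMonoid.End (MvPolynomial (Fin r) A) :=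
  AddMonoidHom.mulRight (MvPolynomial.X j) + mapD (D j)

theorem symbolMulLeft_apply (j : Fin r) (b : MvPolynomial (Fin r) A) :
    symbolMulLeft D j b = b * MvPolynomial.X j + mapD (D j) b := rfl

/-- The symbol of the composition of the operators with symbols `a` and `b`. -/
def comp (a b : MvPolynomial (Fin r) A) : MvPolynomial (Fin r) A := op (symbolMulLeft D) b a

variable {D} (hD : ∀ i j c, D i (D j c) = D j (D i c))

include hD in
-- This is the hypothesis of `op_mul_X` for the operators `symbolMulLeft D j`, hence what makes
-- recursion on the left argument of `comp` possible.
theorem symbolMulLeft_commute (i j : Fin r) :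
    Commute (symbolMulLeft D i) (symbolMulLeft D j) := by
  ext1 b
  change symbolMulLeft D i (symbolMulLeft D j b) = symbolMulLeft D j (symbolMulLeft D i b)
  simp only [symbolMulLeft_apply, mapD_mul, mapD_X, map_add, mapD_comm (hD i j)]
  ring

theorem symbolMulLeft_mem_degLT (j : Fin r) {m : ℕ} {b : MvPolynomial (Fin r) A}
    (hb : b ∈ degLT (Fin r) A m) : symbolMulLeft D j b ∈ degLT (Fin r) A (m + 1) := by
  rw [symbolMulLeft_apply]
  refine Submodule.add_mem _ ?_ (degLT_mono (Nat.le_succ m) (mapD_mem_degLT _ hb))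
  have h := mul_mem_degLT hb
    (IsHomogeneous_mem_degLT (MvPolynomial.isHomogeneous_X A j))
  exact h

omit [Algebra ℂ A] in
theorem X_mul_mem_degLT (j : Fin r) {m : ℕ} {b : MvPolynomial (Fin r) A}
    (hb : b ∈ degLT (Fin r) A m) : b * MvPolynomial.X j ∈ degLT (Fin r) A (m + 1) :=
  mul_mem_degLT hb (IsHomogeneous_mem_degLT (MvPolynomial.isHomogeneous_X A j))

theorem comp_add_left (a a' b : MvPolynomial (Fin r) A) :
    comp D (a + a') b = comp D a b + comp D a' b := map_add _ _ _

theorem comp_add_right (a b b' : MvPolynomial (Fin r) A) :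
    comp D a (b + b') = comp D a b + comp D a b' := op_add_right _ _ _

theorem comp_C_left (c : A) (b : MvPolynomial (Fin r) A) :
    comp D (MvPolynomial.C c) b = MvPolynomial.C c * b := by
  rw [comp, op_C, MvPolynomial.smul_eq_C_mul]

include hD in
theorem comp_mul_X (a b : MvPolynomial (Fin r) A) (j : Fin r) :
    comp D (a * MvPolynomial.X j) b = comp D a (symbolMulLeft D j b) :=
  op_mul_X (symbolMulLeft_commute hD) _ _ _

omit [Algebra ℂ A] in
/-- Induction on polynomials with a bound on the degree. -/
theorem degLT_induction {P : ℕ → MvPolynomial (Fin r) A → Prop}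
    (hC : ∀ d c, P d (MvPolynomial.C c))
    (hadd : ∀ d a b, P d a → P d b → P d (a + b))
    (hX : ∀ d a j, a ∈ degLT (Fin r) A (d + 1) → P d a → P (d + 1) (a * MvPolynomial.X j)) (d : ℕ)
    (a : MvPolynomial (Fin r) A) (ha : a ∈ degLT (Fin r) A (d + 1)) : P d a := by
  have hm : ∀ (d : ℕ) (α : Fin r →₀ ℕ) (c : A), α.degree ≤ d → P d (MvPolynomial.monomial α c) := by
    intro d
    induction d with
    | zero =>
      intro α c hα
      have : α = 0 := (Finsupp.degree_eq_zero_iff α).1 (by omega)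
      subst this
      exact hC 0 c
    | succ d ih =>
      intro α c hα
      by_cases h : α = 0
      · subst h
        exact hC _ c
      · obtain ⟨j, hj⟩ : ∃ j, α j ≠ 0 := by
          by_contra hcon
          push Not at hcon
          exact h (Finsupp.ext hcon)
        have e : α = (α - Finsupp.single j 1) + Finsupp.single j 1 := by
          refine (tsub_add_cancel_of_le ?_).symm
          rw [Finsupp.single_le_iff]
          omega
        have e2 : (α - Finsupp.single j 1).degree + 1 = α.degree := by
          conv_rhs => rw [e, map_add, Finsupp.degree_single]
        have e3 : (MvPolynomial.monomial α c : MvPolynomial (Fin r) A) =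
            MvPolynomial.monomial (α - Finsupp.single j 1) c * MvPolynomial.X j := by
          rw [MvPolynomial.X, MvPolynomial.monomial_mul, mul_one, ← e]
        rw [e3]
        exact hX d _ j (monomial_mem_degLT (by omega) c) (ih _ c (by omega))
  rw [a.as_sum]
  have hs : ∀ s ⊆ a.support, P d (∑ α ∈ s, MvPolynomial.monomial α (a.coeff α)) := by
    intro s
    classical
    induction s using Finset.induction_on with
    | empty =>
      intro _
      simpa using hC d 0
    | insert α s hα ih =>
      intro hs
      rw [Finset.sum_insert hα]
      refine hadd _ _ _ (hm _ _ _ ?_) (ih fun β hβ => hs (Finset.mem_insert_of_mem hβ))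
      by_contra hlt
      exact MvPolynomial.mem_support_iff.1 (hs (Finset.mem_insert_self α s)) (ha α (by omega))
  exact hs _ subset_rfl

include hD in
-- Moving `∂_j` past `b` gives `b ξ_j` and the correction `mapD (D j) b`, which has one degree less.
-- The induction on `a` lets `b` and its order vary, because each factor `ξ_j` of `a` is absorbed
-- into `b`.
theorem comp_sub_mul_mem {d e : ℕ} {a b : MvPolynomial (Fin r) A}
    (ha : a ∈ degLT (Fin r) A (d + 1)) (hb : b ∈ degLT (Fin r) A (e + 1)) :
    comp D a b - a * b ∈ degLT (Fin r) A (d + e) := by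
  refine degLT_induction (P := fun d a => ∀ (e : ℕ) (b : MvPolynomial (Fin r) A),
    b ∈ degLT (Fin r) A (e + 1) → comp D a b - a * b ∈ degLT (Fin r) A (d + e))
    ?_ ?_ ?_ d a ha e b hb
  · intro d c e b _
    rw [comp_C_left, sub_self]
    exact Submodule.zero_mem _
  · intro d a a' h h' e b hb
    rw [comp_add_left, add_mul, add_sub_add_comm]
    exact Submodule.add_mem _ (h e b hb) (h' e b hb)
  · intro d a j ha h e b hb
    have h1 := h (e + 1) _ (symbolMulLeft_mem_degLT (D := D) j hb)
    have h2 := mul_mem_degLT ha (mapD_mem_degLT (D j) hb)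
    have e1 : comp D (a * MvPolynomial.X j) b - a * MvPolynomial.X j * b =
        (comp D a (symbolMulLeft D j b) - a * symbolMulLeft D j b) + a * mapD (D j) b := by
      rw [comp_mul_X hD, symbolMulLeft_apply]
      ring
    rw [e1]
    refine Submodule.add_mem _ (degLT_mono (by omega) h1) (degLT_mono (by omega) h2)

include hD in
-- The sum is the first order term of the Leibniz expansion of a composition. The same induction as
-- for `comp_sub_mul_mem` applies; peeling off `ξ_j` contributes the term `a * mapD (D j) b` of the
-- sum up to lower order.
theorem comp_sub_mul_sub_mem {d e : ℕ} {a b : MvPolynomial (Fin r) A}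
    (ha : a ∈ degLT (Fin r) A (d + 1)) (hb : b ∈ degLT (Fin r) A (e + 1)) :
    comp D a b - a * b - ∑ i, MvPolynomial.pderiv i a * mapD (D i) b ∈
      degLT (Fin r) A (d + e - 1) := by
  refine degLT_induction (P := fun d a => ∀ (e : ℕ) (b : MvPolynomial (Fin r) A),
    b ∈ degLT (Fin r) A (e + 1) → comp D a b - a * b - ∑ i, MvPolynomial.pderiv i a * mapD (D i) b ∈
      degLT (Fin r) A (d + e - 1))
    ?_ ?_ ?_ d a ha e b hb
  · intro d c e b _
    simp only [comp_C_left, MvPolynomial.pderiv_C, zero_mul, Finset.sum_const_zero, sub_self]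
    exact Submodule.zero_mem _
  · intro d a a' h h' e b hb
    have e1 : comp D (a + a') b - (a + a') * b -
          ∑ i, MvPolynomial.pderiv i (a + a') * mapD (D i) b =
        (comp D a b - a * b - ∑ i, MvPolynomial.pderiv i a * mapD (D i) b) +
        (comp D a' b - a' * b - ∑ i, MvPolynomial.pderiv i a' * mapD (D i) b) := by
      simp only [comp_add_left, map_add, add_mul, Finset.sum_add_distrib]
      ring
    rw [e1]
    exact Submodule.add_mem _ (h e b hb) (h' e b hb)
  · intro d a j ha h e b hb
    have h1 := h (e + 1) _ (X_mul_mem_degLT j hb)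
    have h2 := comp_sub_mul_mem hD ha (mapD_mem_degLT (D j) hb)
    have e1 : comp D (a * MvPolynomial.X j) b - a * MvPolynomial.X j * b -
          ∑ i, MvPolynomial.pderiv i (a * MvPolynomial.X j) * mapD (D i) b =
        (comp D a (b * MvPolynomial.X j) - a * (b * MvPolynomial.X j) -
          ∑ i, MvPolynomial.pderiv i a * mapD (D i) (b * MvPolynomial.X j)) +
        (comp D a (mapD (D j) b) - a * mapD (D j) b) := by
      have e2 : ∑ i, MvPolynomial.pderiv i (a * MvPolynomial.X j) * mapD (D i) b =
          (∑ i, MvPolynomial.pderiv i a * mapD (D i) (b * MvPolynomial.X j)) +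
            a * mapD (D j) b := by
        classical
        simp only [mapD_mul, mapD_X, mul_zero, add_zero, Derivation.leibniz, smul_eq_mul, add_mul,
          Finset.sum_add_distrib, MvPolynomial.pderiv_X]
        have e3 : ∑ i, a * (Pi.single i 1 : Fin r → MvPolynomial (Fin r) A) j * mapD (D i) b =
            a * mapD (D j) b := by
          rw [Finset.sum_eq_single j]
          · simp
          · intro i _ hij
            rw [Pi.single_eq_of_ne (Ne.symm hij)]
            ring
          · simp
        rw [e3, add_comm]
        congr 1
        exact Finset.sum_congr rfl fun i _ => by ring
      rw [comp_mul_X hD, symbolMulLeft_apply, comp_add_right, e2]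
      ring
    rw [e1]
    exact Submodule.add_mem _ (degLT_mono (by omega) h1) (degLT_mono (by omega) h2)

include hD in
theorem comp_mem_degLT {d e : ℕ} {a b : MvPolynomial (Fin r) A}
    (ha : a ∈ degLT (Fin r) A (d + 1)) (hb : b ∈ degLT (Fin r) A (e + 1)) :
    comp D a b ∈ degLT (Fin r) A (d + e + 1) := by
  have h1 := degLT_mono (Nat.le_succ _) (comp_sub_mul_mem hD ha hb)
  have h2 := mul_mem_degLT ha hb
  have h3 := Submodule.add_mem _ h1 (degLT_mono (by omega : _ ≤ (d + e).succ) h2)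
  simpa using h3

/-- The Poisson bracket of two symbols. -/
def bracket (D : Fin r → Derivation ℂ A A) (a b : MvPolynomial (Fin r) A) :
    MvPolynomial (Fin r) A :=
  ∑ i, (MvPolynomial.pderiv i a * mapD (D i) b - mapD (D i) a * MvPolynomial.pderiv i b)

theorem bracket_mem_degLT {d e : ℕ} {a b : MvPolynomial (Fin r) A}
    (ha : a ∈ degLT (Fin r) A (d + 1)) (hb : b ∈ degLT (Fin r) A (e + 1)) :
    bracket D a b ∈ degLT (Fin r) A (d + e) := by
  refine Submodule.sum_mem _ fun i _ => Submodule.sub_mem _ ?_ ?_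
  · exact degLT_mono (by omega) (mul_mem_degLT (pderiv_mem_degLT ha i) (mapD_mem_degLT _ hb))
  · exact degLT_mono (by omega) (mul_mem_degLT (mapD_mem_degLT _ ha) (pderiv_mem_degLT hb i))

include hD in
/-- The commutator of two operators has the Poisson bracket as its principal symbol. -/
theorem comp_sub_comp_sub_bracket_mem {d e : ℕ} {a b : MvPolynomial (Fin r) A}
    (ha : a ∈ degLT (Fin r) A (d + 1)) (hb : b ∈ degLT (Fin r) A (e + 1)) :
    comp D a b - comp D b a - bracket D a b ∈ degLT (Fin r) A (d + e - 1) := by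
  have h1 := comp_sub_mul_sub_mem hD ha hb
  have h2 := comp_sub_mul_sub_mem hD hb ha
  rw [add_comm e d] at h2
  have h3 := Submodule.sub_mem _ h1 h2
  convert h3 using 1
  rw [bracket, Finset.sum_sub_distrib]
  have : ∑ i, mapD (D i) a * MvPolynomial.pderiv i b =
      ∑ i, MvPolynomial.pderiv i b * mapD (D i) a := Finset.sum_congr rfl fun i _ => mul_comm _ _
  rw [this]
  ring

theorem bracket_add_right (a b b' : MvPolynomial (Fin r) A) :
    bracket D a (b + b') = bracket D a b + bracket D a b' := by
  rw [bracket, bracket, bracket, ← Finset.sum_add_distrib]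
  refine Finset.sum_congr rfl fun i _ => ?_
  simp only [map_add]
  ring

theorem bracket_add_left (a a' b : MvPolynomial (Fin r) A) :
    bracket D (a + a') b = bracket D a b + bracket D a' b := by
  rw [bracket, bracket, bracket, ← Finset.sum_add_distrib]
  refine Finset.sum_congr rfl fun i _ => ?_
  simp only [map_add]
  ring

theorem bracket_isHomogeneous {d e : ℕ} {a b : MvPolynomial (Fin r) A} (ha : a.IsHomogeneous d)
    (hb : b.IsHomogeneous e) : (bracket D a b).IsHomogeneous (d + e - 1) := by
  refine MvPolynomial.IsHomogeneous.sum _ _ _ fun i _ => MvPolynomial.IsHomogeneous.sub ?_ ?_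
  -- For `d = 0` the symbol `a` contains no momenta and the term is zero, whatever the truncated
  -- exponent.
  · rcases d with _ | d
    · rw [degLT_zero (pderiv_mem_degLT (IsHomogeneous_mem_degLT ha) i), zero_mul]
      exact MvPolynomial.isHomogeneous_zero _ _ _
    · have := (ha.pderiv (i := i)).mul (mapD_isHomogeneous (D i) hb)
      convert this using 1
      omega
  · rcases e with _ | e
    · rw [degLT_zero (pderiv_mem_degLT (IsHomogeneous_mem_degLT hb) i), mul_zero]
      exact MvPolynomial.isHomogeneous_zero _ _ _
    · have := (mapD_isHomogeneous (D i) ha).mul (hb.pderiv (i := i))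
      convert this using 1
      omega

theorem bracket_zero_right (a : MvPolynomial (Fin r) A) : bracket D a 0 = 0 := by
  simp [bracket]

include hD in
-- The bracket of the full symbols is the leading part of the commutator up to lower order, and
-- replacing the full symbols by their leading parts changes the bracket only in lower order. The
-- first order is written `d + 1` so that the order `d + e` of the commutator is not a truncated
-- difference.
theorem commutator_symbol {d e : ℕ} {a b : MvPolynomial (Fin r) A}
    (h2 : a ∈ degLT (Fin r) A (d + 1 + 1)) (h5 : b ∈ degLT (Fin r) A (e + 1)) :
    comp D a b - comp D b a ∈ degLT (Fin r) A (d + e + 1) ∧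
      MvPolynomial.homogeneousComponent (d + e) (comp D a b - comp D b a) =
        bracket D (MvPolynomial.homogeneousComponent (d + 1) a)
          (MvPolynomial.homogeneousComponent e b) := by
  have ha := MvPolynomial.homogeneousComponent_isHomogeneous (d + 1) a
  have hb := MvPolynomial.homogeneousComponent_isHomogeneous e b
  have ha1 := sub_homogeneousComponent_mem h2
  have hb1 := sub_homogeneousComponent_mem h5
  generalize MvPolynomial.homogeneousComponent (d + 1) a = a' at *
  generalize MvPolynomial.homogeneousComponent e b = b' at *
  have hbr := bracket_isHomogeneous (D := D) ha hb
  rw [show d + 1 + e - 1 = d + e by omega] at hbr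
  have h7 := comp_sub_comp_sub_bracket_mem hD h2 h5
  rw [show d + 1 + e - 1 = d + e by omega] at h7
  have h8 : bracket D (a - a') b ∈ degLT (Fin r) A (d + e) :=
    bracket_mem_degLT ha1 h5
  have h9 : bracket D a' (b - b') ∈ degLT (Fin r) A (d + e) := by
    rcases e with _ | e
    · rw [degLT_zero hb1, bracket_zero_right]
      exact Submodule.zero_mem _
    · exact degLT_mono (by omega) (bracket_mem_degLT (IsHomogeneous_mem_degLT ha) hb1)
  have e1 := bracket_add_left (D := D) (a - a') a' b
  have e2 := bracket_add_right (D := D) a' (b - b') b'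
  rw [sub_add_cancel] at e1 e2
  rw [e1, e2] at h7
  have h10 : comp D a b - comp D b a - bracket D a' b' ∈
      degLT (Fin r) A (d + e) := by
    have h11 := Submodule.add_mem _ (Submodule.add_mem _ h7 h8) h9
    generalize comp D a b - comp D b a = X at *
    generalize bracket D (a - a') b = Y at *
    generalize bracket D a' (b - b') = Z at *
    have e3 : X - (Y + (Z + bracket D a' b')) + Y + Z = X - bracket D a' b' := by ring
    rwa [e3] at h11
  refine ⟨?_, homogeneousComponent_eq_of_sub_mem hbr h10⟩
  have h12 := Submodule.add_mem _ (degLT_mono (Nat.le_succ _) h10) (IsHomogeneous_mem_degLT hbr)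
  rwa [sub_add_cancel] at h12

/-- Composition of symbols is composition of operators. -/
theorem op_comp {M : Type*} [AddCommGroup M] [Module A M] {T : Fin r → AddMonoid.End M}
    (hD : ∀ i j c, D i (D j c) = D j (D i c))
    (hT : ∀ i j, Commute (T i) (T j))
    (hTD : ∀ i (c : A) (m : M), T i (c • m) = D i c • m + c • T i m)
    (m : M) (a b : MvPolynomial (Fin r) A) :
    op T m (comp D a b) = op T (op T m b) a := by
  -- The Leibniz rule `hTD` turns `symbolMulLeft D j` on symbols into `T j` on values; the rest is
  -- induction on `a`.
  have h1 : ∀ (j : Fin r) (b : MvPolynomial (Fin r) A),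
      op T m (symbolMulLeft D j b) = T j (op T m b) := by
    intro j b
    rw [symbolMulLeft_apply, map_add]
    induction b using MvPolynomial.induction_on' with
    | monomial α c =>
      have hc : Commute (T j) (opPow T α) := commute_listProd _ _ _ fun i => (hT j i).pow_right _
      rw [MvPolynomial.X, MvPolynomial.monomial_mul, mul_one, mapD_monomial, op_monomial,
        op_monomial, op_monomial, opPow_add_single T hT, hTD, ← hc.eq, add_comm]
      rfl
    | add p q hp hq =>
      rw [add_mul, map_add, map_add, map_add, map_add, map_add, ← hp, ← hq]
      abel
  induction a using MvPolynomial.induction_on generalizing b with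
  | C c => rw [comp_C_left, op_C_mul, op_C]
  | add p q hp hq => rw [comp_add_left, map_add, map_add, hp, hq]
  | mul_X p j hp => rw [comp_mul_X hD, hp, h1, op_mul_X hT]

/-- Naturality of the composition of symbols. -/
theorem map_comp {B : Type*} [CommRing B] [Algebra ℂ B] {D' : Fin r → Derivation ℂ B B}
    (hD : ∀ i j c, D i (D j c) = D j (D i c)) (hD' : ∀ i j c, D' i (D' j c) = D' j (D' i c))
    (f : A →+* B) (hf : ∀ i c, f (D i c) = D' i (f c)) (a b : MvPolynomial (Fin r) A) :
    MvPolynomial.map f (comp D a b) = comp D' (MvPolynomial.map f a) (MvPolynomial.map f b) := by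
  refine op_map (symbolMulLeft_commute hD) (symbolMulLeft_commute hD') f
    (MvPolynomial.map f : MvPolynomial (Fin r) A →+* _).toAddMonoidHom ?_ ?_ b a
  · intro c m
    change MvPolynomial.map f (c • m) = f c • MvPolynomial.map f m
    rw [MvPolynomial.smul_eq_C_mul, MvPolynomial.smul_eq_C_mul, map_mul, MvPolynomial.map_C]
  · intro i m
    change MvPolynomial.map f (symbolMulLeft D i m) = symbolMulLeft D' i (MvPolynomial.map f m)
    rw [symbolMulLeft_apply, symbolMulLeft_apply, map_add, map_mul, MvPolynomial.map_X]
    congr 1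
    ext α
    simp [MvPolynomial.coeff_map, hf]

end Comp

/-! ### Differential operators with respect to commuting derivations -/

section DiffOpAlg

variable {S : Type*} [CommRing S] [Algebra ℂ S] {r : ℕ}

/-- A derivation as an additive endomorphism. -/
def toEnd (d : Derivation ℂ S S) : AddMonoid.End S := (d : S →ₗ[ℂ] S).toAddMonoidHom

@[simp]
theorem toEnd_apply (d : Derivation ℂ S S) (s : S) : toEnd d s = d s := rfl

/-- The value at `s` of the differential operator `∑ a_α D^α`. -/
def dop (D : Fin r → Derivation ℂ S S) (s : S) : MvPolynomial (Fin r) S →ₗ[S] S :=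
  op (fun j => toEnd (D j)) s

/-- The derivations `D j` commute with each other. -/
def Commuting (D : Fin r → Derivation ℂ S S) : Prop := ∀ i j c, D i (D j c) = D j (D i c)

variable {D : Fin r → Derivation ℂ S S}

theorem Commuting.commute (hD : Commuting D) (i j : Fin r) :
    Commute (toEnd (D i)) (toEnd (D j)) := by
  ext1 s
  exact hD i j s

@[simp]
theorem dop_C (s c : S) : dop D s (MvPolynomial.C c) = c * s := op_C _ _

theorem dop_C_mul (s c : S) (F : MvPolynomial (Fin r) S) :
    dop D s (MvPolynomial.C c * F) = c * dop D s F := op_C_mul _ _ _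

theorem dop_mul_X (hD : Commuting D) (s : S) (F : MvPolynomial (Fin r) S) (i : Fin r) :
    dop D s (F * MvPolynomial.X i) = dop D (D i s) F := op_mul_X hD.commute _ _ _

theorem dop_const_mul (hD : Commuting D) {y : S} (hy : ∀ j, D j y = 0) (s : S)
    (F : MvPolynomial (Fin r) S) : dop D (y * s) F = y * dop D s F := by
  induction F using MvPolynomial.induction_on generalizing s with
  | C c => rw [dop_C, dop_C, mul_left_comm]
  | add p q hp hq => rw [map_add, map_add, hp, hq, mul_add]
  | mul_X p i hp =>
    have h : D i (y * s) = y * D i s := by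
      rw [Derivation.leibniz, hy, smul_zero, add_zero, smul_eq_mul]
    rw [dop_mul_X hD, dop_mul_X hD, h, hp]

theorem dop_comp (hD : Commuting D) (s : S) (a b : MvPolynomial (Fin r) S) :
    dop D s (comp D a b) = dop D (dop D s b) a := by
  refine op_comp hD hD.commute (fun i c m => ?_) s a b
  simp only [toEnd_apply, smul_eq_mul, Derivation.leibniz]
  ring

/-- The value at a zero of `l` of an operator of order at most `d` applied to `l ^ d * g`. -/
theorem dop_pow_mul (hD : Commuting D) (ev : S →+* ℂ) (l : S) (hl : ev l = 0) (d : ℕ)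
    (F : MvPolynomial (Fin r) S) (hF : F ∈ degLT (Fin r) S (d + 1)) (g : S) :
    ev (dop D (l ^ d * g) F) = d.factorial * ev g *
      MvPolynomial.eval₂ ev (fun j => ev (D j l)) (MvPolynomial.homogeneousComponent d F) := by
  refine degLT_induction (P := fun d F => ∀ g, ev (dop D (l ^ d * g) F) = d.factorial * ev g *
      MvPolynomial.eval₂ ev (fun j => ev (D j l)) (MvPolynomial.homogeneousComponent d F))
    ?_ ?_ ?_ d F hF g
  · intro d c g
    rw [dop_C, map_mul, map_mul, map_pow, hl]
    rcases d with _ | d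
    · simp [MvPolynomial.homogeneousComponent_zero, mul_comm]
    · rw [MvPolynomial.homogeneousComponent_eq_zero (d + 1) (MvPolynomial.C c) (by simp)]
      simp
  · intro d a b ha hb g
    rw [map_add, map_add, map_add, MvPolynomial.eval₂_add, ha, hb]
    ring
  · intro d F j hF ih g
    -- One derivative lowers the power of `l` by one. The part of the cofactor that still contains
    -- `l` disappears at the zero of `l`, and the factor `d + 1` builds up the factorial.
    have h1 : D j (l ^ (d + 1) * g) =
        l ^ d * (((d : S) + 1) * D j l * g + l * D j g) := by
      rw [Derivation.leibniz, Derivation.leibniz_pow]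
      simp only [smul_eq_mul, nsmul_eq_mul, Nat.add_sub_cancel]
      push_cast
      ring
    have h2 : MvPolynomial.homogeneousComponent (d + 1) (F * MvPolynomial.X j) =
        MvPolynomial.homogeneousComponent d F * MvPolynomial.X j := by
      refine homogeneousComponent_eq_of_sub_mem
        ((MvPolynomial.homogeneousComponent_isHomogeneous d F).mul
          (MvPolynomial.isHomogeneous_X S j)) ?_
      rw [← sub_mul]
      exact X_mul_mem_degLT j (sub_homogeneousComponent_mem hF)
    rw [dop_mul_X hD, h1, ih, h2, MvPolynomial.eval₂_mul, MvPolynomial.eval₂_X]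
    simp only [map_add, map_mul, map_natCast, map_one, hl, Nat.factorial_succ]
    push_cast
    ring

/-- Since `y` is a constant for all the derivations, its powers can be collected in front. It is
applied with `y = u_k`, which converts powers of `u_k ∂/∂u_j` into powers of `∂/∂u_j`. -/
theorem opPow_smul (hD : Commuting D) (y : S) (hy : ∀ j, D j y = 0) (α : Fin r →₀ ℕ) (s : S) :
    opPow (fun j => toEnd (y • D j)) α s = y ^ α.degree * opPow (fun j => toEnd (D j)) α s := by
  have hyD : Commuting (fun j => y • D j) := by
    intro i j c
    simp only [Derivation.smul_apply, smul_eq_mul, Derivation.leibniz, hy, mul_zero, add_zero,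
      hD i j c]
  have h : ∀ (m : ℕ) (α : Fin r →₀ ℕ) (s : S), α.degree = m →
      opPow (fun j => toEnd (y • D j)) α s =
        y ^ α.degree * opPow (fun j => toEnd (D j)) α s := by
    intro m
    induction m with
    | zero =>
      intro α s hα
      have : α = 0 := (Finsupp.degree_eq_zero_iff α).1 hα
      subst this
      simp [opPow_zero]
    | succ m ih =>
      intro α s hα
      obtain ⟨j, hj⟩ : ∃ j, α j ≠ 0 := by
        by_contra hcon
        push Not at hcon
        have : α = 0 := Finsupp.ext hcon
        simp [this] at hα
      have e : α = (α - Finsupp.single j 1) + Finsupp.single j 1 := by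
        refine (tsub_add_cancel_of_le ?_).symm
        rw [Finsupp.single_le_iff]
        omega
      generalize α - Finsupp.single j 1 = β at e
      subst e
      rw [map_add, Finsupp.degree_single] at hα
      rw [opPow_add_single _ hyD.commute, opPow_add_single _ hD.commute, map_add,
        Finsupp.degree_single]
      change opPow (fun j => toEnd (y • D j)) β (y * D j s) =
        y ^ (β.degree + 1) * opPow (fun j => toEnd (D j)) β (D j s)
      have h2 : ∀ t : S, opPow (fun j => toEnd (D j)) β (y * t) =
          y * opPow (fun j => toEnd (D j)) β t := by
        intro t
        have h3 := dop_const_mul hD hy t (MvPolynomial.monomial β 1)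
        simpa only [dop, op_monomial, one_smul] using h3
      rw [ih β _ (by omega), h2]
      ring
  exact h _ α s rfl

end DiffOpAlg

section

/-! ### Smooth functions on an open set -/

section SmoothOn

open TopologicalSpace (Opens)

variable {𝕜 : Type} [RCLike 𝕜] [NormedAlgebra 𝕜 ℂ] {E : Type} [NormedAddCommGroup E]
  [NormedSpace 𝕜 E]

/-- Extension by zero of a function defined on an open set. -/
def extendZero {O : Opens E} (f : O → ℂ) : E → ℂ := Function.extend Subtype.val f 0

theorem extendZero_apply {O : Opens E} (f : O → ℂ) (u : O) : extendZero f u = f u :=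
  Subtype.val_injective.extend_apply f 0 u

theorem extendZero_eqOn {O : Opens E} {f : O → ℂ} {s : E → ℂ} (h : ∀ u : O, f u = s u) :
    Set.EqOn (extendZero f) s O := fun u hu => by
  rw [← h ⟨u, hu⟩]
  exact extendZero_apply f ⟨u, hu⟩

variable (𝕜) in
/-- The algebra of complex valued functions on `O` which are smooth over `𝕜`. -/
def SmoothOn (O : Opens E) : Subalgebra ℂ (O → ℂ) where
  carrier := {f | ContDiffOn 𝕜 ∞ (extendZero f) O}
  mul_mem' := by
    intro f g (hf : ContDiffOn 𝕜 ∞ _ _) (hg : ContDiffOn 𝕜 ∞ _ _)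
    refine (hf.mul hg).congr (extendZero_eqOn fun u => ?_)
    simp [extendZero_apply]
  add_mem' := by
    intro f g (hf : ContDiffOn 𝕜 ∞ _ _) (hg : ContDiffOn 𝕜 ∞ _ _)
    refine (hf.add hg).congr (extendZero_eqOn fun u => ?_)
    simp [extendZero_apply]
  algebraMap_mem' c := by
    refine (contDiffOn_const (c := c)).congr (extendZero_eqOn fun u => rfl)

namespace SmoothOn

variable {O O' : Opens E}

/-- The restriction to `O` of a function which is smooth there. -/
def mk (s : E → ℂ) (hs : ContDiffOn 𝕜 ∞ s O) : SmoothOn 𝕜 O :=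
  ⟨fun u => s u, hs.congr (extendZero_eqOn fun _ => rfl)⟩

@[simp]
theorem mk_apply (s : E → ℂ) (hs : ContDiffOn 𝕜 ∞ s O) (u : O) : (mk s hs).1 u = s u := rfl

theorem contDiffOn (f : SmoothOn 𝕜 O) : ContDiffOn 𝕜 ∞ (extendZero f.1) O := f.2

@[ext]
theorem ext {f g : SmoothOn 𝕜 O} (h : ∀ u, f.1 u = g.1 u) : f = g := Subtype.ext (funext h)

/-- Evaluation at a point. -/
def ev (u : O) : SmoothOn 𝕜 O →+* ℂ :=
  (Pi.evalRingHom (fun _ : O => ℂ) u).comp (SmoothOn 𝕜 O).val.toRingHom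

@[simp]
theorem ev_apply (u : O) (f : SmoothOn 𝕜 O) : ev u f = f.1 u := rfl

theorem differentiableAt (f : SmoothOn 𝕜 O) (u : O) : DifferentiableAt 𝕜 (extendZero f.1) u :=
  ((SmoothOn.contDiffOn f).differentiableOn (by simp)).differentiableAt (O.2.mem_nhds u.2)

/-- The derivative at a point of the open set depends only on the germ there, so the extension by
zero may be replaced by any function that agrees with `f` on `O`. -/
theorem fderiv_eq (f : SmoothOn 𝕜 O) {s : E → ℂ} (h : ∀ u : O, f.1 u = s u) (u : O) :
    fderiv 𝕜 (extendZero f.1) u = fderiv 𝕜 s u :=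
  ((extendZero_eqOn h).eventuallyEq_of_mem (O.2.mem_nhds u.2)).fderiv_eq

/-- The derivative in the direction `v`. -/
def dir (v : E) : Derivation ℂ (SmoothOn 𝕜 O) (SmoothOn 𝕜 O) :=
  Derivation.mk'
    { toFun := fun f => mk (fun u => fderiv 𝕜 (extendZero f.1) u v)
        (((SmoothOn.contDiffOn f).fderiv_of_isOpen O.2 (m := ∞) (by simp)).clm_apply contDiffOn_const)
      map_add' := fun f g => by
        ext u
        have h := fderiv_eq (f + g) (s := extendZero f.1 + extendZero g.1)
          (fun u => by simp [extendZero_apply]) u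
        change fderiv 𝕜 (extendZero (f + g).1) u v = _
        rw [h, fderiv_add (SmoothOn.differentiableAt f u) (SmoothOn.differentiableAt g u)]
        rfl
      map_smul' := fun c f => by
        ext u
        have h := fderiv_eq (c • f) (s := c • extendZero f.1)
          (fun u => by simp [extendZero_apply]) u
        change fderiv 𝕜 (extendZero (c • f).1) u v = _
        rw [h, fderiv_const_smul (SmoothOn.differentiableAt f u)]
        rfl }
    (fun f g => by
      ext u
      have h := fderiv_eq (f * g) (s := extendZero f.1 * extendZero g.1)
          (fun u => by simp [extendZero_apply]) u
      change fderiv 𝕜 (extendZero (f * g).1) u v = f.1 u * fderiv 𝕜 (extendZero g.1) u v +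
        g.1 u * fderiv 𝕜 (extendZero f.1) u v
      rw [h, fderiv_mul (SmoothOn.differentiableAt f u) (SmoothOn.differentiableAt g u), extendZero_apply,
        extendZero_apply]
      simp [smul_eq_mul])

theorem dir_apply (v : E) (f : SmoothOn 𝕜 O) (u : O) :
    (dir v f).1 u = fderiv 𝕜 (extendZero f.1) u v := rfl

theorem dir_apply_of_eq (v : E) (f : SmoothOn 𝕜 O) {s : E → ℂ} (h : ∀ u : O, f.1 u = s u)
    (u : O) : (dir v f).1 u = fderiv 𝕜 s u v := by
  rw [dir_apply, fderiv_eq f h]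

theorem dir_comm (v w : E) (f : SmoothOn 𝕜 O) : dir v (dir w f) = dir w (dir v f) := by
  ext u
  have hc : ContDiffAt 𝕜 ∞ (extendZero f.1) u := (SmoothOn.contDiffOn f).contDiffAt (O.2.mem_nhds u.2)
  have h2 : DifferentiableAt 𝕜 (fderiv 𝕜 (extendZero f.1)) u :=
    (hc.fderiv_right (m := ∞) (by simp)).differentiableAt (by simp)
  have key : ∀ v w : E, (dir v (dir w f)).1 u =
      fderiv 𝕜 (fderiv 𝕜 (extendZero f.1)) u v w := by
    intro v w
    rw [dir_apply_of_eq v (dir w f) (s := fun x => fderiv 𝕜 (extendZero f.1) x w)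
      (fun x => dir_apply w f x), fderiv_clm_apply h2 (differentiableAt_const w)]
    simp
  rw [key, key]
  exact (hc.isSymmSndFDerivAt (by simpa using WithTop.coe_le_coe.2 (le_top (a := (2 : ℕ∞))))).eq v w

/-- Restriction to a smaller open set. -/
def res (h : O' ≤ O) : SmoothOn 𝕜 O →ₐ[ℂ] SmoothOn 𝕜 O' where
  toFun f := mk (extendZero f.1) ((SmoothOn.contDiffOn f).mono h)
  map_one' := by ext u; exact extendZero_apply _ ⟨u.1, h u.2⟩
  map_zero' := by ext u; exact extendZero_apply _ ⟨u.1, h u.2⟩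
  map_mul' f g := by
    ext u
    have e := fun f : O → ℂ => extendZero_apply f ⟨u.1, h u.2⟩
    change extendZero (f * g).1 u = extendZero f.1 u * extendZero g.1 u
    rw [e, e, e]
    rfl
  map_add' f g := by
    ext u
    have e := fun f : O → ℂ => extendZero_apply f ⟨u.1, h u.2⟩
    change extendZero (f + g).1 u = extendZero f.1 u + extendZero g.1 u
    rw [e, e, e]
    rfl
  commutes' c := by ext u; exact extendZero_apply _ ⟨u.1, h u.2⟩

theorem res_apply (h : O' ≤ O) (f : SmoothOn 𝕜 O) (u : O') :
    (res h f).1 u = f.1 ⟨u.1, h u.2⟩ := extendZero_apply _ ⟨u.1, h u.2⟩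

theorem dir_res (h : O' ≤ O) (v : E) (f : SmoothOn 𝕜 O) : dir v (res h f) = res h (dir v f) := by
  ext u
  rw [res_apply, dir_apply_of_eq v (res h f) (s := extendZero f.1) (fun u => rfl), dir_apply]

/-- A linear function on `O`. -/
def linear (L : E →L[𝕜] ℂ) : SmoothOn 𝕜 O := mk L L.contDiff.contDiffOn

@[simp]
theorem linear_apply (L : E →L[𝕜] ℂ) (u : O) : (linear L : SmoothOn 𝕜 O).1 u = L u := rfl

theorem dir_linear (L : E →L[𝕜] ℂ) (v : E) :
    dir v (linear L : SmoothOn 𝕜 O) = algebraMap ℂ _ (L v) := by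
  ext u
  rw [dir_apply_of_eq v _ (s := L) (fun _ => rfl), L.fderiv]
  rfl

end SmoothOn

/-! ### Homogeneous coordinates -/

variable {n : ℕ}

/-- The standard basis vectors. -/
abbrev basisVec (𝕜 : Type) [RCLike 𝕜] {n : ℕ} (i : Fin (n + 1)) : Fin (n + 1) → 𝕜 := Pi.single i 1

/-- The linear function `u ↦ p(u)`. -/
def covec (p : Fin (n + 1) → 𝕜) : (Fin (n + 1) → 𝕜) →L[𝕜] ℂ :=
  (Algebra.linearMap 𝕜 ℂ).toContinuousLinearMap.comp
    (LinearMap.toContinuousLinearMap (Fintype.linearCombination 𝕜 p))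

theorem covec_apply (p u : Fin (n + 1) → 𝕜) : covec p u = algebraMap 𝕜 ℂ (p ⬝ᵥ u) := by
  simp [covec, Fintype.linearCombination_apply, dotProduct, mul_comm]

variable {O : Opens (Fin (n + 1) → 𝕜)}

/-- The coordinate function `u_i`. -/
def coord (i : Fin (n + 1)) : SmoothOn 𝕜 O := SmoothOn.linear (covec (Pi.single i 1))

@[simp]
theorem coord_apply (i : Fin (n + 1)) (u : O) :
    (coord i : SmoothOn 𝕜 O).1 u = algebraMap 𝕜 ℂ (u.1 i) := by
  simp [coord, covec_apply]

variable (𝕜 O) in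
/-- The partial derivatives `∂/∂u_i`. -/
def partials (i : Fin (n + 1)) : Derivation ℂ (SmoothOn 𝕜 O) (SmoothOn 𝕜 O) :=
  SmoothOn.dir (basisVec 𝕜 i)

theorem partials_commuting : Commuting (partials 𝕜 O) := fun _ _ f => SmoothOn.dir_comm _ _ f

theorem partials_coord (i j : Fin (n + 1)) :
    partials 𝕜 O i (coord j) = if i = j then 1 else 0 := by
  rw [partials, coord, SmoothOn.dir_linear, covec_apply]
  by_cases h : i = j
  · subst h; simp
  · simp [h]

theorem multiPartial_eq_opPow (k : Fin (n + 1)) (α : Fin n →₀ ℕ) {s : (Fin (n + 1) → 𝕜) → ℂ}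
    (f : SmoothOn 𝕜 O) (h : ∀ u : O, f.1 u = s u) (u : O) :
    multiPartial 𝕜 k α s u =
      (opPow (fun j => toEnd (partials 𝕜 O (k.succAbove j))) α f).1 u := by
  have h1 : ∀ (i : Fin (n + 1)) (m : ℕ) (f : SmoothOn 𝕜 O) (s : (Fin (n + 1) → 𝕜) → ℂ),
      (∀ u : O, f.1 u = s u) →
      ∀ u : O, ((toEnd (partials 𝕜 O i) ^ m) f).1 u = (partialU 𝕜 i)^[m] s u := by
    intro i m
    induction m with
    | zero => intro f s h u; exact h u
    | succ m ih =>
      intro f s h u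
      rw [pow_succ', Function.iterate_succ', Function.comp_apply]
      exact SmoothOn.dir_apply_of_eq _ _ (ih f s h) u
  have h2 : ∀ l : List (Fin n), ∀ u : O,
      ((l.map fun j => toEnd (partials 𝕜 O (k.succAbove j)) ^ α j).prod f).1 u =
        l.foldr (fun j f => (partialU 𝕜 (k.succAbove j))^[α j] f) s u := by
    intro l
    induction l with
    | nil => exact h
    | cons a l ih =>
      intro u
      rw [List.map_cons, List.prod_cons, List.foldr_cons]
      exact h1 _ _ _ _ ih u
  exact (h2 (List.finRange n) u).symm

end SmoothOn

end

section

open TopologicalSpace (Opens)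

/-! ### Operators in the affine charts -/

section Chart

variable {𝕜 : Type} [RCLike 𝕜] [NormedAlgebra 𝕜 ℂ] {n : ℕ} {O : Opens (Fin (n + 1) → 𝕜)}

variable (𝕜 O) in
/-- The derivation `∂/∂z_j = u_k ∂/∂u_j` in the chart `u_k ≠ 0`. -/
def chartD (k : Fin (n + 1)) (j : Fin n) : Derivation ℂ (SmoothOn 𝕜 O) (SmoothOn 𝕜 O) :=
  (coord k : SmoothOn 𝕜 O) • partials 𝕜 O (k.succAbove j)

theorem chartD_apply (k : Fin (n + 1)) (j : Fin n) (f : SmoothOn 𝕜 O) :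
    chartD 𝕜 O k j f = coord k * partials 𝕜 O (k.succAbove j) f := rfl

theorem partials_succAbove_coord (k : Fin (n + 1)) (j : Fin n) :
    partials 𝕜 O (k.succAbove j) (coord k) = 0 := by
  rw [partials_coord, if_neg (Fin.succAbove_ne k j)]

theorem chartD_commuting (k : Fin (n + 1)) : Commuting (chartD 𝕜 O k) := by
  intro i j f
  simp only [chartD_apply, Derivation.leibniz, partials_succAbove_coord, smul_eq_mul, mul_zero,
    add_zero, partials_commuting (𝕜 := 𝕜) (O := O) (k.succAbove i) (k.succAbove j) f]

theorem op_map_eq_sum {R S : Type*} [CommRing R] [CommRing S] {r : ℕ}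
    (T : Fin r → AddMonoid.End S) (f : R →+* S) (s : S) (a : MvPolynomial (Fin r) R) :
    op T s (MvPolynomial.map f a) = ∑ α ∈ a.support, f (a.coeff α) * opPow T α s := by
  conv_lhs => rw [a.as_sum, map_sum, map_sum]
  exact Finset.sum_congr rfl fun α _ => by
    rw [MvPolynomial.map_monomial, op_monomial, smul_eq_mul]

/-- The sum defining operators in a chart, in terms of the derivations `u_k ∂/∂u_j`. -/
theorem dop_chartD_apply {R : Type*} [CommRing R] (k : Fin (n + 1)) (f : R →+* SmoothOn 𝕜 O)
    (a : MvPolynomial (Fin n) R) {s : (Fin (n + 1) → 𝕜) → ℂ} (t : SmoothOn 𝕜 O)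
    (h : ∀ u : O, t.1 u = s u) (u : O) :
    (dop (chartD 𝕜 O k) t (MvPolynomial.map f a)).1 u =
      ∑ α ∈ a.support, (f (a.coeff α)).1 u * algebraMap 𝕜 ℂ (u.1 k) ^ α.degree *
        multiPartial 𝕜 k α s u := by
  rw [dop, op_map_eq_sum]
  change SmoothOn.ev u _ = _
  rw [map_sum]
  refine Finset.sum_congr rfl fun α _ => ?_
  have e : opPow (fun j => toEnd (chartD 𝕜 O k j)) α t =
      coord k ^ α.degree * opPow (fun j => toEnd (partials 𝕜 O (k.succAbove j))) α t :=
    opPow_smul (D := fun j => partials 𝕜 O (k.succAbove j))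
      (fun i j f => partials_commuting _ _ f) (coord k) (partials_succAbove_coord k) α t
  rw [e, multiPartial_eq_opPow k α t h u, map_mul, map_mul, map_pow, SmoothOn.ev_apply,
    SmoothOn.ev_apply, SmoothOn.ev_apply, coord_apply, mul_assoc]

/-- The function `u_k⁻¹`. -/
def coordInv (k : Fin (n + 1)) (hO : ∀ u ∈ O, u k ≠ 0) : SmoothOn 𝕜 O :=
  SmoothOn.mk (fun u => (algebraMap 𝕜 ℂ (u k))⁻¹) (by
    refine ContDiffOn.inv ?_ fun u hu => ?_
    · have h : ContDiff 𝕜 ∞ (covec (Pi.single k 1 : Fin (n + 1) → 𝕜)) :=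
        (covec (Pi.single k 1 : Fin (n + 1) → 𝕜)).contDiff
      refine h.contDiffOn.congr fun u _ => ?_
      simp [covec_apply]
    · simpa using hO u hu)

theorem coord_mul_coordInv (k : Fin (n + 1)) (hO : ∀ u ∈ O, u k ≠ 0) :
    coord k * coordInv k hO = (1 : SmoothOn 𝕜 O) := by
  ext u
  change (coord k : SmoothOn 𝕜 O).1 u * (algebraMap 𝕜 ℂ (u.1 k))⁻¹ = 1
  rw [coord_apply, mul_inv_cancel₀]
  simpa using hO u.1 u.2

/-- The affine coordinate `z_j`. -/
def affCoord (k : Fin (n + 1)) (hO : ∀ u ∈ O, u k ≠ 0) (j : Fin n) : SmoothOn 𝕜 O :=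
  coord (k.succAbove j) * coordInv k hO

theorem affCoord_apply (k : Fin (n + 1)) (hO : ∀ u ∈ O, u k ≠ 0) (j : Fin n) (u : O) :
    (affCoord k hO j).1 u = algebraMap 𝕜 ℂ (chartCoord k u.1 j) := by
  change (coord (k.succAbove j) : SmoothOn 𝕜 O).1 u * (algebraMap 𝕜 ℂ (u.1 k))⁻¹ = _
  rw [coord_apply, chartCoord, div_eq_mul_inv, map_mul, map_inv₀]

/-- The product rule applied to `coord k * coordInv k hO = 1` gives the derivative without computing
an `fderiv`. -/
theorem partials_coordInv (k : Fin (n + 1)) (hO : ∀ u ∈ O, u k ≠ 0) (i : Fin (n + 1)) :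
    partials 𝕜 O i (coordInv k hO) = if i = k then -(coordInv k hO) ^ 2 else 0 := by
  have h1 := coord_mul_coordInv (𝕜 := 𝕜) k hO
  have h2 := congrArg (partials 𝕜 O i) h1
  rw [Derivation.leibniz, Derivation.map_one_eq_zero, partials_coord, smul_eq_mul,
    smul_eq_mul] at h2
  have h3 : partials 𝕜 O i (coordInv k hO) = coordInv k hO *
      (coord k * partials 𝕜 O i (coordInv k hO)) := by
    rw [← mul_assoc, mul_comm (coordInv k hO), h1, one_mul]
  split_ifs at h2 ⊢ with h
  · rw [h3, eq_neg_of_add_eq_zero_left h2]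
    ring
  · rw [h3]
    simp only [mul_zero, add_zero] at h2
    rw [h2, mul_zero]

theorem chartD_affCoord (k : Fin (n + 1)) (hO : ∀ u ∈ O, u k ≠ 0) (i j : Fin n) :
    chartD 𝕜 O k i (affCoord k hO j) = if i = j then 1 else 0 := by
  rw [chartD_apply, affCoord, Derivation.leibniz, partials_coordInv,
    if_neg (Fin.succAbove_ne k i), partials_coord]
  simp only [Fin.succAbove_right_inj, smul_eq_mul, mul_zero, zero_add]
  split_ifs with h
  · rw [mul_one, coord_mul_coordInv]
  · simp

end Chart

/-! ### Points in a chart -/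

section ChartPoint

variable {𝕜 : Type} [Field 𝕜] {n : ℕ}

/-- The vector with `u_k = 1` and given affine coordinates. -/
def chartVec (k : Fin (n + 1)) (z : Fin n → 𝕜) : Fin (n + 1) → 𝕜 := k.insertNth (1 : 𝕜) z

/-- The covector with given momenta which vanishes on `chartVec k z`. -/
def chartCovec (k : Fin (n + 1)) (z ζ : Fin n → 𝕜) : Fin (n + 1) → 𝕜 :=
  k.insertNth (-(ζ ⬝ᵥ z)) ζ

@[simp]
theorem chartVec_self (k : Fin (n + 1)) (z : Fin n → 𝕜) : chartVec k z k = 1 := by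
  simp [chartVec]

@[simp]
theorem chartVec_succAbove (k : Fin (n + 1)) (z : Fin n → 𝕜) (j : Fin n) :
    chartVec k z (k.succAbove j) = z j := by
  simp [chartVec]

theorem chartVec_ne_zero (k : Fin (n + 1)) (z : Fin n → 𝕜) : chartVec k z ≠ 0 := fun h => by
  have := congrFun h k
  simp at this

@[simp]
theorem chartCovec_succAbove (k : Fin (n + 1)) (z ζ : Fin n → 𝕜) (j : Fin n) :
    chartCovec k z ζ (k.succAbove j) = ζ j := by
  simp [chartCovec]

theorem chartCovec_dotProduct (k : Fin (n + 1)) (z ζ : Fin n → 𝕜) :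
    chartCovec k z ζ ⬝ᵥ chartVec k z = 0 := by
  rw [dotProduct, Fin.sum_univ_succAbove _ k]
  simp [chartCovec, chartVec, dotProduct]

@[simp]
theorem chartCoord_chartVec (k : Fin (n + 1)) (z : Fin n → 𝕜) : chartCoord k (chartVec k z) = z := by
  funext j
  simp [chartCoord]

theorem eq_smul_chartVec (k : Fin (n + 1)) {u : Fin (n + 1) → 𝕜} (hu : u k ≠ 0) :
    u = u k • chartVec k (chartCoord k u) := by
  funext i
  rcases Fin.eq_self_or_eq_succAbove k i with rfl | ⟨j, rfl⟩
  · simp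
  · simp [chartCoord, mul_div_cancel₀ _ hu]

end ChartPoint

/-! ### Real charts -/

section Real

variable {n : ℕ}

/-- The real points are Zariski dense, because `ℝ` is an infinite subset of `ℂ`. -/
theorem polynomial_eq_zero_of_real {σ : Type*} {a : MvPolynomial σ ℂ}
    (h : ∀ x : σ → ℝ, MvPolynomial.eval (fun i => (x i : ℂ)) a = 0) : a = 0 := by
  refine MvPolynomial.funext_set (fun _ => Set.range (Complex.ofReal)) (fun _ => ?_) fun x hx => ?_
  · exact Set.infinite_range_of_injective Complex.ofReal_injective
  · choose y hy using fun i => hx i (Set.mem_univ i)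
    have e : x = fun i => (y i : ℂ) := funext fun i => (hy i).symm
    rw [e, h, map_zero]

/-- A symbol which vanishes at all points vanishes. -/
theorem polSmooth_eq_zero {a : PolSmooth n}
    (h : ∀ z ζ : Fin n → ℝ, MvPolynomial.eval₂ (evSmooth z) (fun j => (ζ j : ℂ)) a = 0) : a = 0 := by
  ext α z
  have h1 : MvPolynomial.map (evSmooth z) a = 0 := polynomial_eq_zero_of_real fun ζ => by
    rw [MvPolynomial.eval_map]
    exact h z ζ
  have h2 := congrArg (MvPolynomial.coeff α) h1
  rw [MvPolynomial.coeff_map] at h2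
  exact h2

/-- Every choice of affine coordinates and momenta occurs at the point given by `chartVec` and
`chartCovec`, so the function determines all values of the symbol, and these determine its
coefficients. -/
theorem HasSymbol.unique {k : Fin (n + 1)} {φ : CotP ℝ n → ℂ} {a b : PolSmooth n}
    (ha : HasSymbol k φ a) (hb : HasSymbol k φ b) : a = b := by
  rw [← sub_eq_zero]
  refine polSmooth_eq_zero fun z ζ => ?_
  have h1 := ha (chartVec k z) (chartCovec k z ζ) (chartVec_ne_zero k z)
    (chartCovec_dotProduct k z ζ) (by simp)
  have h2 := hb (chartVec k z) (chartCovec k z ζ) (chartVec_ne_zero k z)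
    (chartCovec_dotProduct k z ζ) (by simp)
  rw [MvPolynomial.eval₂_sub]
  simp only [chartCoord_chartVec, chartVec_self, one_mul, chartCovec_succAbove] at h1 h2
  rw [← h1, ← h2, sub_self]

/-- The partial derivatives of smooth functions on `ℝⁿ` as derivations. -/
def smoothD (i : Fin n) : Derivation ℂ (Smooth n) (Smooth n) :=
  Derivation.mk'
    { toFun := Smooth.partialDeriv i
      map_add' := fun f g => by
        have hf : ContDiff ℝ ∞ f.1 := f.2
        have hg : ContDiff ℝ ∞ g.1 := g.2
        ext z
        change fderiv ℝ (f.1 + g.1) z _ = _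
        rw [fderiv_add (hf.differentiable (by simp) z) (hg.differentiable (by simp) z)]
        rfl
      map_smul' := fun c f => by
        have hf : ContDiff ℝ ∞ f.1 := f.2
        ext z
        change fderiv ℝ (c • f.1) z _ = _
        rw [fderiv_const_smul (hf.differentiable (by simp) z)]
        rfl }
    (fun f g => by
      have hf : ContDiff ℝ ∞ f.1 := f.2
      have hg : ContDiff ℝ ∞ g.1 := g.2
      ext z
      change fderiv ℝ (f.1 * g.1) z _ = f.1 z * fderiv ℝ g.1 z _ + g.1 z * fderiv ℝ f.1 z _
      rw [fderiv_mul (hf.differentiable (by simp) z) (hg.differentiable (by simp) z)]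
      simp [smul_eq_mul])

theorem smoothD_commuting : Commuting (smoothD (n := n)) := by
  intro i j f
  have hf : ContDiff ℝ ∞ f.1 := f.2
  ext z
  have key : ∀ i j : Fin n, (smoothD i (smoothD j f)).1 z =
      fderiv ℝ (fderiv ℝ f.1) z (Pi.single i 1) (Pi.single j 1) := by
    intro i j
    change fderiv ℝ (fun z => fderiv ℝ f.1 z (Pi.single j 1)) z (Pi.single i 1) = _
    rw [fderiv_clm_apply ((hf.fderiv_right (m := ∞) (by simp)).differentiable (by simp) z)
      (differentiableAt_const _)]
    simp
  rw [key, key]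
  exact (hf.contDiffAt.isSymmSndFDerivAt
    (by simpa using WithTop.coe_le_coe.2 (le_top (a := (2 : ℕ∞))))).eq _ _

theorem poisson_eq (a b : PolSmooth n) : poisson a b = bracket smoothD a b := rfl

variable {O : Opens (Fin (n + 1) → ℝ)}

theorem contDiffOn_chartCoord (k : Fin (n + 1)) (hO : ∀ u ∈ O, u k ≠ 0) :
    ContDiffOn ℝ ∞ (chartCoord k : (Fin (n + 1) → ℝ) → _) O := by
  refine contDiffOn_pi.2 fun j => ContDiffOn.div ?_ ?_ hO
  · exact (contDiff_apply ℝ ℝ _).contDiffOn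
  · exact (contDiff_apply ℝ ℝ _).contDiffOn

/-- Functions of the affine coordinates as functions of the homogeneous coordinates. -/
def pullback (k : Fin (n + 1)) (hO : ∀ u ∈ O, u k ≠ 0) : Smooth n →+* SmoothOn ℝ O where
  toFun f := SmoothOn.mk (f.1 ∘ chartCoord k)
    ((show ContDiff ℝ ∞ f.1 from f.2).comp_contDiffOn (contDiffOn_chartCoord k hO))
  map_one' := rfl
  map_mul' _ _ := rfl
  map_zero' := rfl
  map_add' _ _ := rfl

@[simp]
theorem pullback_apply (k : Fin (n + 1)) (hO : ∀ u ∈ O, u k ≠ 0) (f : Smooth n) (u : O) :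
    (pullback k hO f).1 u = evSmooth (chartCoord k u.1) f := rfl

/-- The chain rule reduces the claim to the derivative of `chartCoord k` along the coordinate
direction, which is `u_k⁻¹` times a basis vector; its components are read off from
`chartD_affCoord`. The factor `u_k` in `chartD` cancels `u_k⁻¹`. -/
theorem chartD_pullback (k : Fin (n + 1)) (hO : ∀ u ∈ O, u k ≠ 0) (j : Fin n) (f : Smooth n) :
    chartD ℝ O k j (pullback k hO f) = pullback k hO (smoothD j f) := by
  ext u
  have hf : ContDiff ℝ ∞ f.1 := f.2
  have h1 : DifferentiableAt ℝ (chartCoord k : (Fin (n + 1) → ℝ) → _) u.1 :=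
    ((contDiffOn_chartCoord k hO).differentiableOn (by simp)).differentiableAt (O.2.mem_nhds u.2)
  have h2 : fderiv ℝ (chartCoord k : (Fin (n + 1) → ℝ) → _) u.1 (Pi.single (k.succAbove j) 1) =
      (u.1 k)⁻¹ • Pi.single j 1 := by
    funext i
    have h3 : DifferentiableAt ℝ (fun v : Fin (n + 1) → ℝ => chartCoord k v i) u.1 :=
      (differentiableAt_pi.1 h1) i
    have h4 := chartD_affCoord (𝕜 := ℝ) k hO j i
    have h5 := congrArg (fun f => SmoothOn.ev u f) h4
    simp only [chartD_apply, map_mul, SmoothOn.ev_apply, coord_apply] at h5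
    rw [partials, SmoothOn.dir_apply_of_eq _ _ (s := fun v => ((chartCoord k v i : ℝ) : ℂ))
      (fun v => affCoord_apply k hO i v)] at h5
    have h6 : HasFDerivAt (fun v : Fin (n + 1) → ℝ => ((chartCoord k v i : ℝ) : ℂ))
        (Complex.ofRealCLM.comp (fderiv ℝ (fun v => chartCoord k v i) u.1)) u.1 :=
      Complex.ofRealCLM.hasFDerivAt.comp u.1 h3.hasFDerivAt
    rw [h6.fderiv] at h5
    have h7 : fderiv ℝ (chartCoord k : (Fin (n + 1) → ℝ) → _) u.1
        (Pi.single (k.succAbove j) 1) i =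
        fderiv ℝ (fun v => chartCoord k v i) u.1 (Pi.single (k.succAbove j) 1) := by
      rw [fderiv_apply h1]
      rfl
    have h8 : u.1 k * fderiv ℝ (fun v => chartCoord k v i) u.1 (Pi.single (k.succAbove j) 1) =
        if j = i then 1 else 0 := by
      have : ((u.1 k * fderiv ℝ (fun v => chartCoord k v i) u.1
          (Pi.single (k.succAbove j) 1) : ℝ) : ℂ) = if j = i then 1 else 0 := by
        rw [Complex.ofReal_mul]
        refine h5.trans ?_
        split_ifs <;> simp
      split_ifs at this ⊢ <;> exact_mod_cast this
    rw [h7, Pi.smul_apply, Pi.single_apply, smul_eq_mul, eq_inv_mul_iff_mul_eq₀ (hO u.1 u.2), h8]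
    simp [eq_comm]
  rw [chartD_apply]
  change (coord k : SmoothOn ℝ O).1 u * (partials ℝ O (k.succAbove j) (pullback k hO f)).1 u =
    fderiv ℝ f.1 (chartCoord k u.1) (Pi.single j 1)
  rw [partials, SmoothOn.dir_apply_of_eq _ _ (s := f.1 ∘ chartCoord k) (fun v => rfl),
    fderiv_comp _ (hf.differentiable (by simp) _) h1, ContinuousLinearMap.comp_apply, h2, map_smul,
    coord_apply]
  simp only [Complex.coe_algebraMap, Complex.real_smul]
  rw [← mul_assoc, ← Complex.ofReal_mul, mul_inv_cancel₀ (hO u.1 u.2), Complex.ofReal_one, one_mul]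

/-- The set `u_k ≠ 0`. -/
def chartSet (k : Fin (n + 1)) : Opens (Fin (n + 1) → ℝ) :=
  ⟨{u | u k ≠ 0}, isOpen_ne_fun (continuous_apply k) continuous_const⟩

theorem chartSet_ne (k : Fin (n + 1)) : ∀ u ∈ chartSet k, u k ≠ 0 := fun _ hu => hu

/-- The set of nonzero vectors. -/
def punctured (n : ℕ) : Opens (Fin (n + 1) → ℝ) := ⟨{0}ᶜ, isOpen_compl_singleton⟩

theorem chartSet_le (k : Fin (n + 1)) : chartSet k ≤ punctured n := by
  rintro u hu rfl
  exact hu rfl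

/-- A density as a smooth function away from the origin. -/
def densOn (O : Opens (Fin (n + 1) → ℝ)) (hO : O ≤ punctured n) {lam : ℂ} :
    Dens n lam →ₗ[ℂ] SmoothOn ℝ O where
  toFun s := SmoothOn.mk s.1 (s.2.1.mono hO)
  map_add' _ _ := rfl
  map_smul' _ _ := rfl

@[simp]
theorem densOn_apply (hO : O ≤ punctured n) {lam : ℂ} (s : Dens n lam) (u : O) :
    (densOn O hO s).1 u = s.1 u := rfl

theorem densOn_injective {lam : ℂ} :
    Function.Injective (densOn (punctured n) le_rfl (lam := lam)) := by
  intro s t h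
  apply Subtype.ext
  funext u
  by_cases hu : u = 0
  · rw [hu, s.2.2.1, t.2.2.1]
  · exact congrFun (congrArg Subtype.val h) ⟨u, hu⟩

/-- The pointwise formula becomes an identity in the algebra of smooth functions on `chartSet k`,
where the calculus of `dop` and `comp` applies. -/
theorem hasFullSymbol_iff {lam : ℂ} {k : Fin (n + 1)} {P : Module.End ℂ (Dens n lam)}
    {a : PolSmooth n} : HasFullSymbol k P a ↔ ∀ s, densOn (chartSet k) (chartSet_le k) (P s) =
      dop (chartD ℝ _ k) (densOn (chartSet k) (chartSet_le k) s)
        (MvPolynomial.map (pullback k (chartSet_ne k)) a) := by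
  constructor
  · intro h s
    ext u
    rw [densOn_apply, h s u.1 u.2, dop_chartD_apply k _ a (s := s.1) _ (fun _ => rfl)]
    rfl
  · intro h s u hu
    have h1 := congrArg (fun f => f.1 ⟨u, hu⟩) (h s)
    rw [densOn_apply, dop_chartD_apply k _ a (s := s.1) _ (fun _ => rfl)] at h1
    exact h1

end Real

end

section

open TopologicalSpace (Opens)

section

variable {n : ℕ} {lam : ℂ}

/-! ### Calculus of full symbols -/

theorem HasFullSymbol.add {k : Fin (n + 1)} {P R : Module.End ℂ (Dens n lam)} {a b : PolSmooth n}
    (ha : HasFullSymbol k P a) (hb : HasFullSymbol k R b) : HasFullSymbol k (P + R) (a + b) := by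
  rw [hasFullSymbol_iff] at *
  intro s
  rw [LinearMap.add_apply, map_add, ha, hb, map_add, map_add]

theorem HasFullSymbol.zero (k : Fin (n + 1)) :
    HasFullSymbol k (0 : Module.End ℂ (Dens n lam)) 0 := by
  rw [hasFullSymbol_iff]
  intro s
  rw [map_zero, map_zero, LinearMap.zero_apply, map_zero]

theorem HasFullSymbol.smul {k : Fin (n + 1)} {P : Module.End ℂ (Dens n lam)} {a : PolSmooth n}
    (ha : HasFullSymbol k P a) (c : ℂ) :
    HasFullSymbol k (c • P) (MvPolynomial.C (algebraMap ℂ (Smooth n) c) * a) := by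
  rw [hasFullSymbol_iff] at *
  intro s
  rw [LinearMap.smul_apply, map_smul, ha, map_mul, MvPolynomial.map_C, dop_C_mul]
  rfl

theorem HasFullSymbol.neg {k : Fin (n + 1)} {P : Module.End ℂ (Dens n lam)} {a : PolSmooth n}
    (ha : HasFullSymbol k P a) : HasFullSymbol k (-P) (-a) := by
  rw [hasFullSymbol_iff] at *
  intro s
  rw [LinearMap.neg_apply, map_neg, ha, map_neg, map_neg]

theorem HasFullSymbol.sub {k : Fin (n + 1)} {P R : Module.End ℂ (Dens n lam)} {a b : PolSmooth n}
    (ha : HasFullSymbol k P a) (hb : HasFullSymbol k R b) : HasFullSymbol k (P - R) (a - b) := by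
  have e : P - R = P + -R := sub_eq_add_neg P R
  rw [e, sub_eq_add_neg]
  exact ha.add hb.neg

theorem HasFullSymbol.one (k : Fin (n + 1)) :
    HasFullSymbol k (1 : Module.End ℂ (Dens n lam)) 1 := by
  rw [hasFullSymbol_iff]
  intro s
  rw [map_one, ← MvPolynomial.C_1, dop_C, one_mul]
  rfl

/-- Pulling back coefficients intertwines `∂/∂z_j` with `u_k ∂/∂u_j`, so it is compatible with
`comp`, and `comp` computes composition of operators. -/
theorem HasFullSymbol.mul {k : Fin (n + 1)} {P R : Module.End ℂ (Dens n lam)} {a b : PolSmooth n}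
    (ha : HasFullSymbol k P a) (hb : HasFullSymbol k R b) :
    HasFullSymbol k (P * R) (comp smoothD a b) := by
  rw [hasFullSymbol_iff] at *
  intro s
  have e : MvPolynomial.map (pullback k (chartSet_ne k)) (comp smoothD a b) =
      comp (chartD ℝ (chartSet k) k) (MvPolynomial.map (pullback k (chartSet_ne k)) a)
        (MvPolynomial.map (pullback k (chartSet_ne k)) b) :=
    map_comp (D := smoothD) (D' := chartD ℝ (chartSet k) k) (fun i j c => smoothD_commuting i j c)
      (fun i j c => chartD_commuting (𝕜 := ℝ) (O := chartSet k) k i j c)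
      (pullback k (chartSet_ne k)) (fun i c => (chartD_pullback k (chartSet_ne k) i c).symm) a b
  rw [Module.End.mul_apply, ha, hb, e, dop_comp (chartD_commuting k)]

/-! ### Test densities -/

theorem dotProduct_self_ne_zero {u : Fin (n + 1) → ℝ} (hu : u ≠ 0) : u ⬝ᵥ u ≠ 0 :=
  fun h => hu (dotProduct_self_eq_zero.1 h)

/-- A smooth function away from the origin, homogeneous of degree `-lam (n + 1) - d`. -/
def testWeight (lam : ℂ) (d : ℕ) (v u : Fin (n + 1) → ℝ) : ℂ :=
  ((v ⬝ᵥ u : ℝ) : ℂ) ^ d * (((u ⬝ᵥ u : ℝ) : ℂ) ^ d)⁻¹ *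
    Complex.exp (-(lam * (n + 1)) / 2 * (Real.log (u ⬝ᵥ u) : ℂ))

theorem testWeight_self_ne_zero (lam : ℂ) (d : ℕ) {u : Fin (n + 1) → ℝ} (hu : u ≠ 0) :
    testWeight lam d u u ≠ 0 := by
  have h : ((u ⬝ᵥ u : ℝ) : ℂ) ≠ 0 := by exact_mod_cast dotProduct_self_ne_zero hu
  exact mul_ne_zero (mul_ne_zero (pow_ne_zero _ h) (inv_ne_zero (pow_ne_zero _ h)))
    (Complex.exp_ne_zero _)

theorem contDiff_dotProduct (v : Fin (n + 1) → ℝ) : ContDiff ℝ ∞ fun u => v ⬝ᵥ u := by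
  unfold dotProduct
  fun_prop

theorem contDiff_dotProduct_self : ContDiff ℝ ∞ fun u : Fin (n + 1) → ℝ => u ⬝ᵥ u := by
  unfold dotProduct
  fun_prop

theorem contDiffOn_testWeight (lam : ℂ) (d : ℕ) (v : Fin (n + 1) → ℝ) :
    ContDiffOn ℝ ∞ (testWeight lam d v) {0}ᶜ := by
  have h0 : ∀ u ∈ ({0}ᶜ : Set (Fin (n + 1) → ℝ)), u ⬝ᵥ u ≠ 0 :=
    fun u hu => dotProduct_self_ne_zero hu
  have h1 : ∀ {f : (Fin (n + 1) → ℝ) → ℝ} {t : Set (Fin (n + 1) → ℝ)}, ContDiffOn ℝ ∞ f t →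
      ContDiffOn ℝ ∞ (fun u => (f u : ℂ)) t :=
    fun h => Complex.ofRealCLM.contDiff.comp_contDiffOn h
  refine ContDiffOn.mul (ContDiffOn.mul ?_ ?_) ?_
  · exact (h1 (contDiff_dotProduct v).contDiffOn).pow d
  · refine ContDiffOn.inv ((h1 contDiff_dotProduct_self.contDiffOn).pow d) fun u hu => ?_
    exact pow_ne_zero _ (by exact_mod_cast h0 u hu)
  · refine ContDiff.comp_contDiffOn (Complex.contDiff_exp (𝕜 := ℝ)) (contDiffOn_const.mul (h1 ?_))
    exact contDiff_dotProduct_self.contDiffOn.log h0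

/-- The factor `(v·u)^d / (u·u)^d` has degree `-d` including the sign of `c`, and the exponential is
`|u|^(-lam (n+1))`. Multiplication by `p(u)^d` therefore yields exactly the homogeneity required of
a density. -/
theorem testWeight_smul (lam : ℂ) (d : ℕ) (v u : Fin (n + 1) → ℝ) {c : ℝ} (hc : c ≠ 0)
    (hu : u ≠ 0) : (c : ℂ) ^ d * testWeight lam d v (c • u) =
      ((|c| : ℝ) : ℂ) ^ (-(lam * (n + 1))) * testWeight lam d v u := by
  have hu' := dotProduct_self_ne_zero hu
  have hc' : ((|c| : ℝ) : ℂ) ≠ 0 := by exact_mod_cast abs_ne_zero.2 hc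
  have e1 : (c • u) ⬝ᵥ (c • u) = c ^ 2 * (u ⬝ᵥ u) := by
    rw [smul_dotProduct, dotProduct_smul, smul_eq_mul, smul_eq_mul]
    ring
  have e2 : Real.log (c ^ 2 * (u ⬝ᵥ u)) = 2 * Real.log |c| + Real.log (u ⬝ᵥ u) := by
    rw [Real.log_mul (pow_ne_zero 2 hc) hu', Real.log_pow, Real.log_abs]
    norm_num
  have hcC : (c : ℂ) ≠ 0 := by exact_mod_cast hc
  rw [testWeight, testWeight, e1, e2, dotProduct_smul, Complex.cpow_def_of_ne_zero hc',
    ← Complex.ofReal_log (abs_nonneg c)]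
  have e3 : Complex.exp (-(lam * (n + 1)) / 2 * ((2 * Real.log |c| + Real.log (u ⬝ᵥ u) : ℝ) : ℂ)) =
      Complex.exp ((Real.log |c| : ℂ) * -(lam * (n + 1))) *
        Complex.exp (-(lam * (n + 1)) / 2 * (Real.log (u ⬝ᵥ u) : ℂ)) := by
    rw [← Complex.exp_add]
    congr 1
    push_cast
    ring
  rw [e3, smul_eq_mul]
  have e4 : (((c ^ 2 * (u ⬝ᵥ u) : ℝ) : ℂ) ^ d)⁻¹ =
      ((c : ℂ) ^ d)⁻¹ * ((c : ℂ) ^ d)⁻¹ * (((u ⬝ᵥ u : ℝ) : ℂ) ^ d)⁻¹ := by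
    push_cast
    rw [mul_pow, mul_inv, ← mul_inv ((c : ℂ) ^ d), ← pow_add, ← pow_mul, two_mul]
  rw [e4]
  push_cast
  rw [mul_pow]
  field_simp

/-- The density `p(u)^d` times a factor which does not vanish at `v`. -/
def testDens (lam : ℂ) (d : ℕ) (v p : Fin (n + 1) → ℝ) : Dens n lam :=
  ⟨fun u => if u = 0 then 0 else ((p ⬝ᵥ u : ℝ) : ℂ) ^ d * testWeight lam d v u, by
    refine ⟨?_, by simp, fun c u hc => ?_⟩
    · have h : ContDiffOn ℝ ∞ (fun u : Fin (n + 1) → ℝ =>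
          ((p ⬝ᵥ u : ℝ) : ℂ) ^ d * testWeight lam d v u) {0}ᶜ :=
        ContDiffOn.mul ((Complex.ofRealCLM.contDiff.comp (contDiff_dotProduct p)).contDiffOn.pow d)
          (contDiffOn_testWeight lam d v)
      exact h.congr fun u hu => if_neg hu
    · by_cases hu : u = 0
      · simp [hu]
      · dsimp only
        rw [if_neg hu, if_neg (smul_ne_zero hc hu), dotProduct_smul, smul_eq_mul]
        have h := testWeight_smul lam d v u hc hu
        push_cast
        rw [mul_pow, mul_comm ((c : ℂ) ^ d), mul_assoc, h]
        ring⟩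

theorem testDens_apply (d : ℕ) (v p : Fin (n + 1) → ℝ) {u : Fin (n + 1) → ℝ} (hu : u ≠ 0) :
    (testDens lam d v p).1 u = ((p ⬝ᵥ u : ℝ) : ℂ) ^ d * testWeight lam d v u := if_neg hu

/-- Operators of order at most `d` on test densities. -/
theorem HasFullSymbol.apply_testDens {k : Fin (n + 1)} {P : Module.End ℂ (Dens n lam)}
    {a : PolSmooth n} (ha : HasFullSymbol k P a) {d : ℕ} (had : a ∈ degLT (Fin n) (Smooth n) (d + 1))
    {u p : Fin (n + 1) → ℝ} (hk : u k ≠ 0) (hp : p ⬝ᵥ u = 0) :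
    (P (testDens lam d u p)).1 u = d.factorial * testWeight lam d u u *
      MvPolynomial.eval₂ (evSmooth (chartCoord k u))
        (fun j => ((u k * p (k.succAbove j) : ℝ) : ℂ))
        (MvPolynomial.homogeneousComponent d a) := by
  rw [hasFullSymbol_iff] at ha
  have h1 := congrArg (SmoothOn.ev ⟨u, hk⟩) (ha (testDens lam d u p))
  let g : SmoothOn ℝ (chartSet k) := SmoothOn.mk (testWeight lam d u)
    ((contDiffOn_testWeight lam d u).mono (chartSet_le k))
  let l : SmoothOn ℝ (chartSet k) := SmoothOn.linear (covec p)
  -- The test density is `l ^ d * g` with `l` the linear function `p`, which vanishes at `u`; so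
  -- `dop_pow_mul` isolates the component of degree `d` of the symbol.
  have h2 : densOn (chartSet k) (chartSet_le k) (testDens lam d u p) = l ^ d * g := by
    ext v
    rw [densOn_apply, testDens_apply _ _ _ (chartSet_le k v.2)]
    change _ = (l.1 v) ^ d * g.1 v
    rw [SmoothOn.linear_apply, covec_apply]
    rfl
  have h3 : MvPolynomial.map (pullback k (chartSet_ne k)) a ∈
      degLT (Fin n) (SmoothOn ℝ (chartSet k)) (d + 1) := by
    intro α hα
    rw [MvPolynomial.coeff_map, had α hα, map_zero]
  have h4 : MvPolynomial.homogeneousComponent d (MvPolynomial.map (pullback k (chartSet_ne k)) a) =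
      MvPolynomial.map (pullback k (chartSet_ne k)) (MvPolynomial.homogeneousComponent d a) := by
    ext1 α
    simp only [MvPolynomial.coeff_homogeneousComponent, MvPolynomial.coeff_map]
    split_ifs <;> simp
  rw [SmoothOn.ev_apply, densOn_apply, h2, dop_pow_mul (chartD_commuting k) _ _
    (by rw [SmoothOn.ev_apply, SmoothOn.linear_apply, covec_apply, hp, map_zero]) d _ h3, h4,
    MvPolynomial.eval₂_map] at h1
  rw [h1]
  congr 1
  have e : (fun j => SmoothOn.ev (⟨u, hk⟩ : chartSet k) (chartD ℝ (chartSet k) k j l)) =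
      fun j => ((u k * p (k.succAbove j) : ℝ) : ℂ) := by
    funext j
    rw [chartD_apply, partials, SmoothOn.dir_linear, covec_apply, map_mul, SmoothOn.ev_apply,
      coord_apply]
    simp
  rw [e]
  rfl

/-- If the zero operator had a nonzero symbol, applying it to test densities would show that the
component of top degree vanishes at every point. The degree bound of the symbol is lowered in this
way until it reaches zero. -/
theorem HasFullSymbol.unique {k : Fin (n + 1)} {P : Module.End ℂ (Dens n lam)} {a b : PolSmooth n}
    (ha : HasFullSymbol k P a) (hb : HasFullSymbol k P b) : a = b := by
  have h0 : HasFullSymbol k (0 : Module.End ℂ (Dens n lam)) (a - b) := by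
    have e : P - P = 0 := sub_self P
    exact e ▸ ha.sub hb
  rw [← sub_eq_zero]
  generalize a - b = c at h0
  have h : ∀ d, c ∈ degLT (Fin n) (Smooth n) d → c = 0 := by
    intro d
    induction d with
    | zero => exact degLT_zero
    | succ d ih =>
      intro hc
      have h1 : MvPolynomial.homogeneousComponent d c = 0 := polSmooth_eq_zero fun z ζ => by
        have h2 := h0.apply_testDens hc (u := chartVec k z) (by simp) (chartCovec_dotProduct k z ζ)
        have h3 : (((0 : Module.End ℂ (Dens n lam)) (testDens lam d (chartVec k z)
          (chartCovec k z ζ))).1 (chartVec k z)) = 0 := rfl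
        rw [h3, eq_comm, mul_eq_zero, or_iff_right] at h2
        · simpa using h2
        · exact mul_ne_zero (by exact_mod_cast d.factorial_ne_zero)
            (testWeight_self_ne_zero lam d (chartVec_ne_zero k z))
      have h4 := sub_homogeneousComponent_mem hc
      rw [h1, sub_zero] at h4
      exact ih h4
  exact h (c.totalDegree + 1) (mem_degLT_succ_iff.2 le_rfl)

/-! ### The order filtration -/

variable (n lam) in
/-- The differential operators of order less than `d`. -/
def OrdLT (d : ℕ) : Submodule ℂ (Module.End ℂ (Dens n lam)) where
  carrier := {P | ∀ k, ∃ a ∈ degLT (Fin n) (Smooth n) d, HasFullSymbol k P a}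
  zero_mem' := fun k => ⟨0, Submodule.zero_mem _, HasFullSymbol.zero k⟩
  add_mem' := by
    intro P R hP hR k
    obtain ⟨a, ha, ha'⟩ := hP k
    obtain ⟨b, hb, hb'⟩ := hR k
    exact ⟨a + b, Submodule.add_mem _ ha hb, ha'.add hb'⟩
  smul_mem' := by
    intro c P hP k
    obtain ⟨a, ha, ha'⟩ := hP k
    exact ⟨_, C_mul_mem_degLT ha _, ha'.smul c⟩

theorem ordLT_mono {d e : ℕ} (h : d ≤ e) : OrdLT n lam d ≤ OrdLT n lam e := fun P hP k => by
  obtain ⟨a, ha, ha'⟩ := hP k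
  exact ⟨a, degLT_mono h ha, ha'⟩

theorem ordLT_le_diffOp (d : ℕ) : OrdLT n lam d ≤ DiffOp n lam := fun P hP k => by
  obtain ⟨a, _, ha'⟩ := hP k
  exact ⟨a, ha'⟩

theorem exists_mem_ordLT {P : Module.End ℂ (Dens n lam)} (hP : P ∈ DiffOp n lam) :
    ∃ d, P ∈ OrdLT n lam d := by
  choose a ha using hP
  refine ⟨Finset.univ.sup (fun k => (a k).totalDegree) + 1, fun k => ⟨a k, ?_, ha k⟩⟩
  exact mem_degLT_succ_iff.2 (Finset.le_sup (f := fun k => (a k).totalDegree) (Finset.mem_univ k))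

theorem exists_ne_zero {𝕜 : Type} [Field 𝕜] {u : Fin (n + 1) → 𝕜} (hu : u ≠ 0) :
    ∃ k, u k ≠ 0 := by
  by_contra h
  push Not at h
  exact hu (funext h)

theorem ordLT_zero {P : Module.End ℂ (Dens n lam)} (hP : P ∈ OrdLT n lam 0) : P = 0 := by
  ext s u
  by_cases hu : u = 0
  · rw [hu, (P s).2.2.1]
    rfl
  · obtain ⟨k, hk⟩ := exists_ne_zero hu
    obtain ⟨a, ha, ha'⟩ := hP k
    rw [ha' s u hk, degLT_zero ha]
    simp

theorem mul_mem_ordLT {d e : ℕ} {P R : Module.End ℂ (Dens n lam)} (hP : P ∈ OrdLT n lam (d + 1))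
    (hR : R ∈ OrdLT n lam (e + 1)) : P * R ∈ OrdLT n lam (d + e + 1) := fun k => by
  obtain ⟨a, ha, ha'⟩ := hP k
  obtain ⟨b, hb, hb'⟩ := hR k
  exact ⟨_, comp_mem_degLT smoothD_commuting ha hb, ha'.mul hb'⟩

theorem mul_mem_diffOp {P R : Module.End ℂ (Dens n lam)} (hP : P ∈ DiffOp n lam)
    (hR : R ∈ DiffOp n lam) : P * R ∈ DiffOp n lam := fun k => by
  obtain ⟨a, ha'⟩ := hP k
  obtain ⟨b, hb'⟩ := hR k
  exact ⟨_, ha'.mul hb'⟩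

/-! ### The grading of the algebra of symbols -/

theorem symbol_ext {φ ψ : CotP ℝ n → ℂ} (h : ∀ k, ∃ a, HasSymbol k φ a ∧ HasSymbol k ψ a) :
    φ = ψ := by
  funext x
  induction x using Quotient.inductionOn with
  | _ x =>
    obtain ⟨⟨u, p⟩, hu, hp⟩ := x
    obtain ⟨k, hk⟩ := exists_ne_zero hu
    obtain ⟨a, h1, h2⟩ := h k
    exact (h1 u p hu hp hk).trans (h2 u p hu hp hk).symm

theorem HasSymbol.add {k : Fin (n + 1)} {φ ψ : CotP ℝ n → ℂ} {a b : PolSmooth n}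
    (ha : HasSymbol k φ a) (hb : HasSymbol k ψ b) : HasSymbol k (φ + ψ) (a + b) :=
  fun u p hu hp hk => by
    rw [MvPolynomial.eval₂_add, ← ha u p hu hp hk, ← hb u p hu hp hk]; rfl

theorem HasSymbol.mul {k : Fin (n + 1)} {φ ψ : CotP ℝ n → ℂ} {a b : PolSmooth n}
    (ha : HasSymbol k φ a) (hb : HasSymbol k ψ b) : HasSymbol k (φ * ψ) (a * b) :=
  fun u p hu hp hk => by
    rw [MvPolynomial.eval₂_mul, ← ha u p hu hp hk, ← hb u p hu hp hk]; rfl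

theorem HasSymbol.smul {k : Fin (n + 1)} {φ : CotP ℝ n → ℂ} {a : PolSmooth n}
    (ha : HasSymbol k φ a) (c : ℂ) :
    HasSymbol k (c • φ) (MvPolynomial.C (algebraMap ℂ (Smooth n) c) * a) :=
  fun u p hu hp hk => by
    rw [MvPolynomial.eval₂_mul, MvPolynomial.eval₂_C, ← ha u p hu hp hk]; rfl

theorem HasSymbol.zero (k : Fin (n + 1)) : HasSymbol k (0 : CotP ℝ n → ℂ) 0 :=
  fun u p hu hp hk => by rw [MvPolynomial.eval₂_zero]; rfl

theorem HasSymbol.one (k : Fin (n + 1)) : HasSymbol k (1 : CotP ℝ n → ℂ) 1 :=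
  fun u p hu hp hk => by rw [MvPolynomial.eval₂_one]; rfl

theorem HasSymbol.neg {k : Fin (n + 1)} {φ : CotP ℝ n → ℂ} {a : PolSmooth n}
    (ha : HasSymbol k φ a) : HasSymbol k (-φ) (-a) :=
  fun u p hu hp hk => by
    rw [MvPolynomial.eval₂_neg, ← ha u p hu hp hk]; rfl

theorem HasSymbol.sub {k : Fin (n + 1)} {φ ψ : CotP ℝ n → ℂ} {a b : PolSmooth n}
    (ha : HasSymbol k φ a) (hb : HasSymbol k ψ b) : HasSymbol k (φ - ψ) (a - b) := by
  rw [sub_eq_add_neg, sub_eq_add_neg]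
  exact ha.add hb.neg

theorem hasSymbol_sum {ι : Type*} (s : Finset ι) {k : Fin (n + 1)} {φ : ι → CotP ℝ n → ℂ}
    {a : ι → PolSmooth n} (h : ∀ i ∈ s, HasSymbol k (φ i) (a i)) :
    HasSymbol k (∑ i ∈ s, φ i) (∑ i ∈ s, a i) := by
  classical
  induction s using Finset.induction_on with
  | empty => simpa using HasSymbol.zero k
  | insert i s hi ih =>
    rw [Finset.sum_insert hi, Finset.sum_insert hi]
    exact (h i (Finset.mem_insert_self i s)).add
      (ih fun j hj => h j (Finset.mem_insert_of_mem hj))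

/-- Multiplication of covectors by a number. -/
def CotP.scale {𝕜 : Type} [Field 𝕜] (t : 𝕜) : CotP 𝕜 n → CotP 𝕜 n :=
  Quotient.map
    (fun x : Cone 𝕜 n => (⟨(x.1.1, t • x.1.2), x.2.1, by
      rw [smul_dotProduct, x.2.2, smul_zero]⟩ : Cone 𝕜 n))
    (by
      rintro x y ⟨c, h1, h2⟩
      refine ⟨c, h1, ?_⟩
      change t • y.1.2 = c⁻¹ • t • x.1.2
      rw [h2, smul_comm])

theorem eval₂_smul_of_isHomogeneous {R : Type*} [CommRing R] {σ : Type*} (f : R →+* ℂ) (x : σ → ℂ)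
    (t : ℂ) {d : ℕ} {a : MvPolynomial σ R} (ha : a.IsHomogeneous d) :
    MvPolynomial.eval₂ f (fun j => t * x j) a = t ^ d * MvPolynomial.eval₂ f x a := by
  rw [MvPolynomial.eval₂_eq, MvPolynomial.eval₂_eq, Finset.mul_sum]
  refine Finset.sum_congr rfl fun α hα => ?_
  have h2 : α.degree = d := by
    by_contra hne
    exact MvPolynomial.mem_support_iff.1 hα (ha.coeff_eq_zero hne)
  simp only [mul_pow, Finset.prod_mul_distrib]
  rw [Finset.prod_pow_eq_pow_sum, ← h2]
  have : α.degree = ∑ i ∈ α.support, α i := rfl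
  rw [this]
  ring

/-- The restriction of a symbol to a line in a fibre is a polynomial. -/
theorem exists_fiberPoly {φ : CotP ℝ n → ℂ} (hφ : φ ∈ Sym n) (x : CotP ℝ n) :
    ∃ P : Polynomial ℂ, ∀ t : ℝ, φ (CotP.scale t x) = P.eval (t : ℂ) := by
  induction x using Quotient.inductionOn with
  | _ x =>
    obtain ⟨⟨u, p⟩, hu, hp⟩ := x
    obtain ⟨k, hk⟩ := exists_ne_zero hu
    obtain ⟨a, ha⟩ := hφ k
    refine ⟨∑ d ∈ Finset.range (a.totalDegree + 1), Polynomial.C (MvPolynomial.eval₂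
      (evSmooth (chartCoord k u)) (fun j => ((u k * p (k.succAbove j) : ℝ) : ℂ))
      (MvPolynomial.homogeneousComponent d a)) * Polynomial.X ^ d, fun t => ?_⟩
    have h := ha u (t • p) hu (by rw [smul_dotProduct, hp, smul_zero]) hk
    refine (show φ (CotP.scale t (CotP.mk u p hu hp)) = _ from h).trans ?_
    conv_lhs => rw [← MvPolynomial.sum_homogeneousComponent a]
    rw [MvPolynomial.eval₂_sum, Polynomial.eval_finsetSum]
    refine Finset.sum_congr rfl fun d _ => ?_
    rw [Polynomial.eval_mul, Polynomial.eval_C, Polynomial.eval_pow, Polynomial.eval_X, mul_comm,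
      ← eval₂_smul_of_isHomogeneous _ _ _ (MvPolynomial.homogeneousComponent_isHomogeneous d a)]
    congr 1
    funext j
    simp only [Pi.smul_apply, smul_eq_mul]
    push_cast
    ring

theorem polynomial_eq_of_real {P R : Polynomial ℂ} (h : ∀ t : ℝ, P.eval (t : ℂ) = R.eval (t : ℂ)) :
    P = R := by
  refine Polynomial.eq_of_infinite_eval_eq P R
    ((Set.infinite_range_of_injective Complex.ofReal_injective).mono ?_)
  rintro _ ⟨t, rfl⟩
  exact h t

/-- The component of degree `d` of a symbol, as a function. -/
def symCompFun (d : ℕ) (φ : Sym n) (x : CotP ℝ n) : ℂ :=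
  (exists_fiberPoly φ.2 x).choose.coeff d

/-- The polynomial chosen along a line in the fibre is determined by its values at real `t`. Hence
the homogeneous component does not depend on a chart, although it can be computed in any chart. -/
theorem symCompFun_eq (d : ℕ) (φ : Sym n) (x : CotP ℝ n) {P : Polynomial ℂ}
    (hP : ∀ t : ℝ, φ.1 (CotP.scale t x) = P.eval (t : ℂ)) : symCompFun d φ x = P.coeff d := by
  have h : (exists_fiberPoly φ.2 x).choose = P := polynomial_eq_of_real fun t => by
    rw [← hP t]
    exact ((exists_fiberPoly φ.2 x).choose_spec t).symm
  rw [symCompFun, h]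

theorem hasSymbol_symCompFun {k : Fin (n + 1)} {φ : Sym n} {a : PolSmooth n}
    (ha : HasSymbol k φ.1 a) (d : ℕ) :
    HasSymbol k (symCompFun d φ) (MvPolynomial.homogeneousComponent d a) := by
  intro u p hu hp hk
  rw [symCompFun_eq d φ (CotP.mk u p hu hp)
    (P := ∑ d ∈ Finset.range (a.totalDegree + 1), Polynomial.C (MvPolynomial.eval₂
      (evSmooth (chartCoord k u)) (fun j => ((u k * p (k.succAbove j) : ℝ) : ℂ))
      (MvPolynomial.homogeneousComponent d a)) * Polynomial.X ^ d)]
  · rw [Polynomial.finsetSum_coeff]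
    simp only [Polynomial.coeff_C_mul, Polynomial.coeff_X_pow]
    simp only [mul_ite, mul_one, mul_zero, Finset.sum_ite_eq, Finset.mem_range]
    split_ifs with h
    · rfl
    · rw [MvPolynomial.homogeneousComponent_eq_zero d a (by omega), MvPolynomial.eval₂_zero]
  · intro t
    have h := ha u (t • p) hu (by rw [smul_dotProduct, hp, smul_zero]) hk
    refine (show φ.1 (CotP.scale t (CotP.mk u p hu hp)) = _ from h).trans ?_
    conv_lhs => rw [← MvPolynomial.sum_homogeneousComponent a]
    rw [MvPolynomial.eval₂_sum, Polynomial.eval_finsetSum]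
    refine Finset.sum_congr rfl fun d _ => ?_
    rw [Polynomial.eval_mul, Polynomial.eval_C, Polynomial.eval_pow, Polynomial.eval_X, mul_comm,
      ← eval₂_smul_of_isHomogeneous _ _ _ (MvPolynomial.homogeneousComponent_isHomogeneous d a)]
    congr 1
    funext j
    simp only [Pi.smul_apply, smul_eq_mul]
    push_cast
    ring

end

end

section

open TopologicalSpace (Opens)

section

variable {n : ℕ} {lam : ℂ}

theorem sym_ext {φ ψ : Sym n} (h : ∀ k a, HasSymbol k φ.1 a → HasSymbol k ψ.1 a) : φ = ψ :=
  Subtype.ext (symbol_ext fun k => by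
    obtain ⟨a, ha⟩ := φ.2 k
    exact ⟨a, ha, h k a ha⟩)

/-- The component of degree `d` of a symbol. -/
def symComp (d : ℕ) : Sym n →ₗ[ℂ] Sym n where
  toFun φ := ⟨symCompFun d φ, fun k => by
    obtain ⟨a, ha⟩ := φ.2 k
    exact ⟨_, hasSymbol_symCompFun ha d⟩⟩
  map_add' φ ψ := by
    refine sym_ext fun k c hc => ?_
    obtain ⟨a, ha⟩ := φ.2 k
    obtain ⟨b, hb⟩ := ψ.2 k
    have h1 := hasSymbol_symCompFun (φ := φ + ψ) (ha.add hb) d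
    have h2 := (hasSymbol_symCompFun ha d).add (hasSymbol_symCompFun hb d)
    rw [← map_add] at h2
    rw [hc.unique h1]
    exact h2
  map_smul' r φ := by
    refine sym_ext fun k c hc => ?_
    obtain ⟨a, ha⟩ := φ.2 k
    have h1 := hasSymbol_symCompFun (φ := r • φ) (ha.smul r) d
    have h2 := (hasSymbol_symCompFun ha d).smul r
    rw [hc.unique h1, MvPolynomial.homogeneousComponent_C_mul]
    exact h2

theorem hasSymbol_symComp {k : Fin (n + 1)} {φ : Sym n} {a : PolSmooth n}
    (ha : HasSymbol k φ.1 a) (d : ℕ) :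
    HasSymbol k (symComp d φ).1 (MvPolynomial.homogeneousComponent d a) :=
  hasSymbol_symCompFun ha d

theorem symComp_mem (d : ℕ) (φ : Sym n) : symComp d φ ∈ SymDeg n d := fun k => by
  obtain ⟨a, ha⟩ := φ.2 k
  exact ⟨_, MvPolynomial.homogeneousComponent_isHomogeneous d a, hasSymbol_symComp ha d⟩

theorem symComp_of_mem {d : ℕ} {φ : Sym n} (hφ : φ ∈ SymDeg n d) : symComp d φ = φ :=
  Subtype.ext (symbol_ext fun k => by
    obtain ⟨a, ha, ha'⟩ := hφ k
    refine ⟨a, ?_, ha'⟩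
    have h := hasSymbol_symComp ha' d
    rwa [MvPolynomial.homogeneousComponent_eq_self ha] at h)

theorem symComp_of_ne {d e : ℕ} (hde : d ≠ e) {φ : Sym n} (hφ : φ ∈ SymDeg n e) :
    symComp d φ = 0 :=
  Subtype.ext (symbol_ext fun k => by
    obtain ⟨a, ha, ha'⟩ := hφ k
    refine ⟨0, ?_, HasSymbol.zero k⟩
    have h := hasSymbol_symComp ha' d
    rwa [MvPolynomial.homogeneousComponent_of_mem ha, if_neg hde] at h)

/-- A symbol is the sum of its components. -/
theorem exists_sum_symComp (φ : Sym n) :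
    ∃ N, (∀ d, N ≤ d → symComp d φ = 0) ∧ φ = ∑ d ∈ Finset.range N, symComp d φ := by
  choose a ha using φ.2
  set N := Finset.univ.sup (fun k => (a k).totalDegree) + 1 with hN
  have h0 : ∀ d, N ≤ d → ∀ k, MvPolynomial.homogeneousComponent d (a k) = 0 := fun d hd k =>
    MvPolynomial.homogeneousComponent_eq_zero d _ (by
      have := Finset.le_sup (f := fun k => (a k).totalDegree) (Finset.mem_univ k)
      omega)
  refine ⟨N, fun d hd => Subtype.ext (symbol_ext fun k => ⟨0, ?_, HasSymbol.zero k⟩),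
    Subtype.ext (symbol_ext fun k => ⟨a k, ha k, ?_⟩)⟩
  · have h := hasSymbol_symComp (ha k) d
    rwa [h0 d hd k] at h
  · have h : HasSymbol k (∑ d ∈ Finset.range N, (symComp d φ).1)
        (∑ d ∈ Finset.range N, MvPolynomial.homogeneousComponent d (a k)) :=
      hasSymbol_sum _ fun d _ => hasSymbol_symComp (ha k) d
    have e : ∑ d ∈ Finset.range N, MvPolynomial.homogeneousComponent d (a k) = a k := by
      conv_rhs => rw [← MvPolynomial.sum_homogeneousComponent (a k)]
      symm
      refine Finset.sum_subset (Finset.range_mono ?_) fun d _ hd => ?_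
      · have := Finset.le_sup (f := fun k => (a k).totalDegree) (Finset.mem_univ k)
        omega
      · exact MvPolynomial.homogeneousComponent_eq_zero d _ (by
          rw [Finset.mem_range] at hd
          omega)
    rw [e] at h
    convert h
    exact AddSubmonoidClass.coe_finsetSum _ _

theorem sym_ext_symComp {φ ψ : Sym n} (h : ∀ d, symComp d φ = symComp d ψ) : φ = ψ := by
  rw [← sub_eq_zero]
  have h' : ∀ d, symComp d (φ - ψ) = 0 := fun d => by rw [map_sub, h, sub_self]
  obtain ⟨N, _, hN⟩ := exists_sum_symComp (φ - ψ)
  rw [hN]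
  exact Finset.sum_eq_zero fun d _ => h' d

/-- Induction on symbols: homogeneous elements and sums. -/
theorem sym_induction {p : Sym n → Prop} (hom : ∀ d, ∀ φ ∈ SymDeg n d, p φ)
    (add : ∀ φ ψ, p φ → p ψ → p (φ + ψ)) (φ : Sym n) : p φ := by
  obtain ⟨N, _, hN⟩ := exists_sum_symComp φ
  rw [hN]
  refine Finset.sum_induction _ p (fun _ _ => add _ _) (hom 0 0 (Submodule.zero_mem _)) ?_
  exact fun d _ => hom d _ (symComp_mem d φ)

theorem mul_mem_symDeg {d e : ℕ} {φ ψ : Sym n} (hφ : φ ∈ SymDeg n d) (hψ : ψ ∈ SymDeg n e) :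
    φ * ψ ∈ SymDeg n (d + e) := fun k => by
  obtain ⟨a, ha, ha'⟩ := hφ k
  obtain ⟨b, hb, hb'⟩ := hψ k
  exact ⟨a * b, ha.mul hb, ha'.mul hb'⟩

theorem one_mem_symDeg : (1 : Sym n) ∈ SymDeg n 0 := fun k =>
  ⟨1, MvPolynomial.isHomogeneous_one _ _, HasSymbol.one k⟩

theorem symComp_sum_range {N : ℕ} {f : ℕ → Sym n} (hf : ∀ d, f d ∈ SymDeg n d) (e : ℕ) :
    symComp e (∑ d ∈ Finset.range N, f d) = if e < N then f e else 0 := by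
  rw [map_sum]
  split_ifs with h
  · rw [Finset.sum_eq_single_of_mem e (Finset.mem_range.2 h), symComp_of_mem (hf e)]
    exact fun d _ hd => symComp_of_ne hd.symm (hf d)
  · refine Finset.sum_eq_zero fun d hd => symComp_of_ne ?_ (hf d)
    rw [Finset.mem_range] at hd
    omega

/-! ### Principal symbols -/

theorem isPrincipalSymbol_iff {d : ℕ} {P : Module.End ℂ (Dens n lam)} {φ : CotP ℝ n → ℂ} :
    IsPrincipalSymbol d P φ ↔ ∀ k, ∃ a, HasFullSymbol k P a ∧
      a ∈ degLT (Fin n) (Smooth n) (d + 1) ∧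
      HasSymbol k φ (MvPolynomial.homogeneousComponent d a) := by
  simp only [mem_degLT_succ_iff]
  rfl

theorem IsPrincipalSymbol.mem_ordLT {d : ℕ} {P : Module.End ℂ (Dens n lam)} {φ : CotP ℝ n → ℂ}
    (h : IsPrincipalSymbol d P φ) : P ∈ OrdLT n lam (d + 1) := fun k => by
  obtain ⟨a, h1, h2, _⟩ := isPrincipalSymbol_iff.1 h k
  exact ⟨a, h2, h1⟩

theorem IsPrincipalSymbol.unique {d : ℕ} {P : Module.End ℂ (Dens n lam)} {φ ψ : CotP ℝ n → ℂ}
    (hφ : IsPrincipalSymbol d P φ) (hψ : IsPrincipalSymbol d P ψ) : φ = ψ :=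
  symbol_ext fun k => by
    obtain ⟨a, h1, _, h3⟩ := hφ k
    obtain ⟨b, h4, _, h6⟩ := hψ k
    rw [h4.unique h1] at h6
    exact ⟨_, h3, h6⟩

theorem IsPrincipalSymbol.add {d : ℕ} {P R : Module.End ℂ (Dens n lam)} {φ ψ : CotP ℝ n → ℂ}
    (hφ : IsPrincipalSymbol d P φ) (hψ : IsPrincipalSymbol d R ψ) :
    IsPrincipalSymbol d (P + R) (φ + ψ) := by
  rw [isPrincipalSymbol_iff] at *
  intro k
  obtain ⟨a, h1, h2, h3⟩ := hφ k
  obtain ⟨b, h4, h5, h6⟩ := hψ k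
  refine ⟨a + b, h1.add h4, Submodule.add_mem _ h2 h5, ?_⟩
  rw [map_add]
  exact h3.add h6

theorem IsPrincipalSymbol.smul {d : ℕ} {P : Module.End ℂ (Dens n lam)} {φ : CotP ℝ n → ℂ}
    (hφ : IsPrincipalSymbol d P φ) (c : ℂ) : IsPrincipalSymbol d (c • P) (c • φ) := by
  rw [isPrincipalSymbol_iff] at *
  intro k
  obtain ⟨a, h1, h2, h3⟩ := hφ k
  refine ⟨_, h1.smul c, C_mul_mem_degLT h2 _, ?_⟩
  rw [MvPolynomial.homogeneousComponent_C_mul]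
  exact h3.smul c

theorem IsPrincipalSymbol.sub {d : ℕ} {P R : Module.End ℂ (Dens n lam)} {φ ψ : CotP ℝ n → ℂ}
    (hφ : IsPrincipalSymbol d P φ) (hψ : IsPrincipalSymbol d R ψ) :
    IsPrincipalSymbol d (P - R) (φ - ψ) := by
  rw [isPrincipalSymbol_iff] at *
  intro k
  obtain ⟨a, h1, h2, h3⟩ := hφ k
  obtain ⟨b, h4, h5, h6⟩ := hψ k
  refine ⟨a - b, h1.sub h4, Submodule.sub_mem _ h2 h5, ?_⟩
  rw [map_sub]
  exact h3.sub h6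

theorem isPrincipalSymbol_zero_of_mem {d : ℕ} {P : Module.End ℂ (Dens n lam)}
    (hP : P ∈ OrdLT n lam d) : IsPrincipalSymbol d P 0 := by
  rw [isPrincipalSymbol_iff]
  intro k
  obtain ⟨a, ha, ha'⟩ := hP k
  refine ⟨a, ha', degLT_mono (Nat.le_succ d) ha, ?_⟩
  rw [homogeneousComponent_of_mem_degLT ha]
  exact HasSymbol.zero k

theorem IsPrincipalSymbol.mem_of_zero {d : ℕ} {P : Module.End ℂ (Dens n lam)}
    (h : IsPrincipalSymbol d P 0) : P ∈ OrdLT n lam d := fun k => by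
  obtain ⟨a, h1, h2, h3⟩ := isPrincipalSymbol_iff.1 h k
  refine ⟨a, ?_, h1⟩
  have h4 := sub_homogeneousComponent_mem h2
  rwa [h3.unique (HasSymbol.zero k), sub_zero] at h4

theorem IsPrincipalSymbol.sub_mem {d : ℕ} {P R : Module.End ℂ (Dens n lam)} {φ : CotP ℝ n → ℂ}
    (hP : IsPrincipalSymbol d P φ) (hR : IsPrincipalSymbol d R φ) : P - R ∈ OrdLT n lam d := by
  have h := hP.sub hR
  rw [sub_self] at h
  exact h.mem_of_zero

theorem IsPrincipalSymbol.mul {d e : ℕ} {P R : Module.End ℂ (Dens n lam)} {φ ψ : CotP ℝ n → ℂ}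
    (hφ : IsPrincipalSymbol d P φ) (hψ : IsPrincipalSymbol e R ψ) :
    IsPrincipalSymbol (d + e) (P * R) (φ * ψ) := by
  rw [isPrincipalSymbol_iff] at *
  intro k
  obtain ⟨a, h1, h2, h3⟩ := hφ k
  obtain ⟨b, h4, h5, h6⟩ := hψ k
  refine ⟨_, h1.mul h4, comp_mem_degLT smoothD_commuting h2 h5, ?_⟩
  have e1 : MvPolynomial.homogeneousComponent (d + e) (comp smoothD a b) =
      MvPolynomial.homogeneousComponent d a * MvPolynomial.homogeneousComponent e b := by
    refine homogeneousComponent_eq_of_sub_mem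
      ((MvPolynomial.homogeneousComponent_isHomogeneous d a).mul
        (MvPolynomial.homogeneousComponent_isHomogeneous e b)) ?_
    have h7 := comp_sub_mul_mem smoothD_commuting h2 h5
    have h8 := mul_mem_degLT (sub_homogeneousComponent_mem h2) h5
    have h9 := mul_mem_degLT (IsHomogeneous_mem_degLT
      (MvPolynomial.homogeneousComponent_isHomogeneous d a)) (sub_homogeneousComponent_mem h5)
    have h10 := Submodule.add_mem _ (Submodule.add_mem _ h7
      (degLT_mono (by omega : _ ≤ d + e) h8)) (degLT_mono (by omega : _ ≤ d + e) h9)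
    convert h10 using 1
    ring
  rw [e1]
  exact h3.mul h6

/-- Operators of order at most `d` have a principal symbol of degree `d`. -/
theorem exists_isPrincipalSymbol {d : ℕ} {P : Module.End ℂ (Dens n lam)}
    (hP : P ∈ OrdLT n lam (d + 1)) : ∃ φ ∈ SymDeg n d, IsPrincipalSymbol d P φ.1 := by
  -- No chart enters this quotient, while `HasFullSymbol.apply_testDens` identifies it with the
  -- leading part of the full symbol in each chart. This is why the leading parts glue to one
  -- function on the cotangent bundle.
  let f : Cone ℝ n → ℂ := fun x => (P (testDens lam d x.1.1 x.1.2)).1 x.1.1 /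
    (d.factorial * testWeight lam d x.1.1 x.1.1)
  choose a ha ha' using hP
  have h1 : ∀ (k : Fin (n + 1)) (x : Cone ℝ n), x.1.1 k ≠ 0 → f x =
      MvPolynomial.eval₂ (evSmooth (chartCoord k x.1.1))
        (fun j => ((x.1.1 k * x.1.2 (k.succAbove j) : ℝ) : ℂ))
        (MvPolynomial.homogeneousComponent d (a k)) := by
    intro k x hk
    have hne : (d.factorial : ℂ) * testWeight lam d x.1.1 x.1.1 ≠ 0 :=
      mul_ne_zero (by exact_mod_cast d.factorial_ne_zero) (testWeight_self_ne_zero lam d x.2.1)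
    change _ / _ = _
    rw [(ha' k).apply_testDens (ha k) hk x.2.2, mul_div_cancel_left₀ _ hne]
  let φ : CotP ℝ n → ℂ := Quotient.lift f (by
    rintro x y ⟨c, h2, h3⟩
    obtain ⟨k, hk⟩ := exists_ne_zero x.2.1
    have hk' : y.1.1 k ≠ 0 := by
      rw [h2]
      exact mul_ne_zero c.ne_zero hk
    rw [h1 k x hk, h1 k y hk']
    have e1 : chartCoord k x.1.1 = chartCoord k y.1.1 := by
      funext j
      rw [h2]
      simp only [chartCoord, Pi.smul_apply, Units.smul_def, smul_eq_mul]
      rw [mul_div_mul_left _ _ c.ne_zero]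
    have e2 : ∀ j, x.1.1 k * x.1.2 (k.succAbove j) = y.1.1 k * y.1.2 (k.succAbove j) := by
      intro j
      rw [h2, h3]
      simp only [Pi.smul_apply, Units.smul_def, smul_eq_mul, Units.val_inv_eq_inv_val]
      field_simp [c.ne_zero]
    rw [e1]
    simp only [e2])
  have h2 : ∀ k, HasSymbol k φ (MvPolynomial.homogeneousComponent d (a k)) :=
    fun k u p hu hp hk => h1 k ⟨(u, p), hu, hp⟩ hk
  refine ⟨⟨φ, fun k => ⟨_, h2 k⟩⟩, fun k =>
    ⟨_, MvPolynomial.homogeneousComponent_isHomogeneous d (a k), h2 k⟩, ?_⟩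
  exact isPrincipalSymbol_iff.2 fun k => ⟨a k, ha' k, ha k, h2 k⟩

/-! ### Poisson brackets -/

theorem IsPoissonBracket.add_right {φ ψ ψ' χ χ' : CotP ℝ n → ℂ} (h : IsPoissonBracket φ ψ χ)
    (h' : IsPoissonBracket φ ψ' χ') : IsPoissonBracket φ (ψ + ψ') (χ + χ') := fun k => by
  obtain ⟨a, b, h1, h2, h3⟩ := h k
  obtain ⟨a', b', h4, h5, h6⟩ := h' k
  rw [h4.unique h1] at h6
  refine ⟨a, b + b', h1, h2.add h5, ?_⟩
  rw [poisson_eq, bracket_add_right]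
  exact h3.add h6

theorem IsPoissonBracket.add_left {φ φ' ψ χ χ' : CotP ℝ n → ℂ} (h : IsPoissonBracket φ ψ χ)
    (h' : IsPoissonBracket φ' ψ χ') : IsPoissonBracket (φ + φ') ψ (χ + χ') := fun k => by
  obtain ⟨a, b, h1, h2, h3⟩ := h k
  obtain ⟨a', b', h4, h5, h6⟩ := h' k
  rw [h5.unique h2] at h6
  refine ⟨a + a', b, h1.add h4, h2, ?_⟩
  rw [poisson_eq, bracket_add_left]
  exact h3.add h6

theorem bracket_swap (a b : PolSmooth n) : bracket smoothD b a = -bracket smoothD a b := by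
  rw [bracket, bracket, ← Finset.sum_neg_distrib]
  exact Finset.sum_congr rfl fun i _ => by ring

theorem IsPoissonBracket.swap {φ ψ χ : CotP ℝ n → ℂ} (h : IsPoissonBracket φ ψ χ) :
    IsPoissonBracket ψ φ (-χ) := fun k => by
  obtain ⟨a, b, h1, h2, h3⟩ := h k
  refine ⟨b, a, h2, h1, ?_⟩
  rw [poisson_eq, bracket_swap]
  exact h3.neg

theorem bracket_of_isHomogeneous_zero {a b : PolSmooth n} (ha : a.IsHomogeneous 0)
    (hb : b.IsHomogeneous 0) : bracket smoothD a b = 0 :=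
  degLT_zero (bracket_mem_degLT (IsHomogeneous_mem_degLT ha) (IsHomogeneous_mem_degLT hb))

/-- The commutator of operators of orders at most `d + 1` and `e`. -/
theorem IsPrincipalSymbol.commutator {d e : ℕ} {P R : Module.End ℂ (Dens n lam)}
    {φ ψ : CotP ℝ n → ℂ} (hφ : IsPrincipalSymbol (d + 1) P φ) (hψ : IsPrincipalSymbol e R ψ) :
    ∃ χ ∈ SymDeg n (d + e), IsPrincipalSymbol (d + e) (P * R - R * P) χ.1 ∧
      IsPoissonBracket φ ψ χ.1 := by
  have key : ∀ k, ∃ c a b, HasFullSymbol k (P * R - R * P) c ∧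
      c ∈ degLT (Fin n) (Smooth n) (d + e + 1) ∧ HasSymbol k φ a ∧ HasSymbol k ψ b ∧
      MvPolynomial.homogeneousComponent (d + e) c = bracket smoothD a b := by
    intro k
    obtain ⟨a, h1, h2, h3⟩ := isPrincipalSymbol_iff.1 hφ k
    obtain ⟨b, h4, h5, h6⟩ := isPrincipalSymbol_iff.1 hψ k
    obtain ⟨h7, h8⟩ := commutator_symbol smoothD_commuting h2 h5
    exact ⟨_, _, _, (h1.mul h4).sub (h4.mul h1), h7, h3, h6, h8⟩
  have hmem : P * R - R * P ∈ OrdLT n lam (d + e + 1) := fun k => by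
    obtain ⟨c, _, _, h1, h2, _⟩ := key k
    exact ⟨c, h2, h1⟩
  obtain ⟨χ, hχ, hχ'⟩ := exists_isPrincipalSymbol hmem
  refine ⟨χ, hχ, hχ', fun k => ?_⟩
  obtain ⟨c, a, b, h1, h2, h3, h4, h5⟩ := key k
  obtain ⟨c', h6, h7, h8⟩ := hχ' k
  refine ⟨a, b, h3, h4, ?_⟩
  rw [poisson_eq, ← h5, h1.unique h6]
  exact h8

end

end

/-! ### The Casimir operator on symbols -/

section Weyl

variable {S : Type*} [CommRing S] [Algebra ℂ S] {r : ℕ} {D : Fin r → Derivation ℂ S S}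
  {y : Fin r → S}

theorem mapD_C_mul (d : Derivation ℂ S S) (c : S) (F : MvPolynomial (Fin r) S) :
    mapD d (MvPolynomial.C c * F) = MvPolynomial.C (d c) * F + MvPolynomial.C c * mapD d F := by
  rw [mapD_mul, mapD_C]

variable (y) in
/-- The symbol `∑ y_i ξ_i` of the Euler vector field. -/
def eulerSymbol : MvPolynomial (Fin r) S := ∑ i, MvPolynomial.C (y i) * MvPolynomial.X i

variable (D) in
/-- The divergence `∑ ∂²/∂y_i∂ξ_i`. -/
def divergence (F : MvPolynomial (Fin r) S) : MvPolynomial (Fin r) S :=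
  ∑ i, mapD (D i) (MvPolynomial.pderiv i F)

variable (D y) in
/-- The Poisson bracket with `-y_j ξ_i`. -/
def glAct (i j : Fin r) (F : MvPolynomial (Fin r) S) : MvPolynomial (Fin r) S :=
  MvPolynomial.pderiv j F * MvPolynomial.X i - MvPolynomial.C (y j) * mapD (D i) F

/-- With `E = ∑ x_i E_i` the double sum is `E² - E`, so it acts by `d² - d` on an eigenvector of `E`
with eigenvalue `d`. -/
theorem sum_euler_euler {R : Type*} [CommRing R] (E : Fin r → R → R) (x : Fin r → R)
    (hadd : ∀ i a b, E i (a + b) = E i a + E i b)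
    (hE : ∀ i j G, E i (x j * G) = (if i = j then G else 0) + x j * E i G) {d : ℕ} {F : R}
    (hF : ∑ i, x i * E i F = d • F) :
    ∑ i, ∑ j, x i * (x j * E i (E j F)) = (d * d - d : ℤ) • F := by
  have hsum : ∀ i (f : Fin r → R), E i (∑ j, f j) = ∑ j, E i (f j) := fun i f =>
    map_sum (AddMonoidHom.mk' (E i) (hadd i)) f _
  have hsmul : ∀ i (a : R), E i (d • a) = d • E i a := fun i a =>
    map_nsmul (AddMonoidHom.mk' (E i) (hadd i)) d a
  have h1 : ∀ i, x i * E i (∑ j, x j * E j F) =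
      x i * E i F + ∑ j, x i * (x j * E i (E j F)) := by
    intro i
    rw [hsum]
    simp only [hE, Finset.sum_add_distrib, Finset.sum_ite_eq, Finset.mem_univ, if_true, mul_add,
      Finset.mul_sum]
  have h2 : ∑ i, x i * E i (∑ j, x j * E j F) = d • d • F := by
    rw [hF]
    simp only [hsmul, mul_smul_comm]
    rw [← Finset.smul_sum, hF]
  rw [Finset.sum_congr rfl fun i _ => h1 i, Finset.sum_add_distrib, hF] at h2
  rw [sub_smul, mul_smul, natCast_zsmul, natCast_zsmul, ← h2, add_sub_cancel_left]

/-- The factors `y` and `ξ` are moved to the outside of all derivatives. Summation over the indices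
then produces only Euler operators and the divergence. -/
theorem glAct_glAct (hy : ∀ i j, D i (y j) = if i = j then 1 else 0)
    (F : MvPolynomial (Fin r) S) (i j : Fin r) : glAct D y i j (glAct D y j i F) =
      (MvPolynomial.C (y j) * mapD (D j) F +
        MvPolynomial.C (y j) * (MvPolynomial.C (y i) * mapD (D i) (mapD (D j) F))) -
      MvPolynomial.pderiv i (mapD (D i) F) * (MvPolynomial.C (y j) * MvPolynomial.X j) -
      MvPolynomial.pderiv j (mapD (D j) F) * (MvPolynomial.C (y i) * MvPolynomial.X i) +
      (MvPolynomial.X i * MvPolynomial.pderiv i F + MvPolynomial.X j * (MvPolynomial.X i *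
        MvPolynomial.pderiv j (MvPolynomial.pderiv i F))) := by
  have hyy : ∀ i, D i (y i) = 1 := fun i => by rw [hy, if_pos rfl]
  simp only [glAct, map_sub, mapD_mul, mapD_X, mapD_C, hyy, Derivation.leibniz,
    MvPolynomial.pderiv_C, MvPolynomial.pderiv_X_self, smul_eq_mul, map_one, mapD_pderiv,
    mul_zero, add_zero, mul_one]
  ring


theorem bracket_mul_left (a b F : MvPolynomial (Fin r) S) :
    bracket D (a * b) F = a * bracket D b F + b * bracket D a F := by
  simp only [bracket, Finset.mul_sum, ← Finset.sum_add_distrib]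
  refine Finset.sum_congr rfl fun i _ => ?_
  rw [Derivation.leibniz, mapD_mul, smul_eq_mul, smul_eq_mul]
  ring

theorem bracket_X_left (i : Fin r) (F : MvPolynomial (Fin r) S) :
    bracket D (MvPolynomial.X i) F = mapD (D i) F := by
  rw [bracket, Finset.sum_eq_single_of_mem i (Finset.mem_univ i)]
  · rw [MvPolynomial.pderiv_X_self, mapD_X, one_mul, zero_mul, sub_zero]
  · intro j _ hj
    rw [MvPolynomial.pderiv_X_of_ne hj.symm, mapD_X, zero_mul, zero_mul, sub_zero]

theorem bracket_coord_left (hy : ∀ i j, D i (y j) = if i = j then 1 else 0) (j : Fin r)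
    (F : MvPolynomial (Fin r) S) :
    bracket D (MvPolynomial.C (y j)) F = -MvPolynomial.pderiv j F := by
  rw [bracket, Finset.sum_eq_single_of_mem j (Finset.mem_univ j)]
  · rw [MvPolynomial.pderiv_C, mapD_C, hy, if_pos rfl, map_one, zero_mul, one_mul, zero_sub]
  · intro i _ hi
    rw [MvPolynomial.pderiv_C, mapD_C, hy, if_neg hi, map_zero, zero_mul, zero_mul, sub_zero]

theorem bracket_neg_left (a F : MvPolynomial (Fin r) S) : bracket D (-a) F = -bracket D a F := by
  simp only [bracket, ← Finset.sum_neg_distrib]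
  refine Finset.sum_congr rfl fun i _ => ?_
  rw [map_neg, map_neg]
  ring

theorem bracket_sum_left {ι : Type*} (t : Finset ι) (a : ι → MvPolynomial (Fin r) S)
    (F : MvPolynomial (Fin r) S) : bracket D (∑ i ∈ t, a i) F = ∑ i ∈ t, bracket D (a i) F :=
  map_sum (AddMonoidHom.mk' (fun a => bracket D a F) fun a b => bracket_add_left a b F) a t

theorem bracket_eq_glAct (hy : ∀ i j, D i (y j) = if i = j then 1 else 0) (i j : Fin r)
    (F : MvPolynomial (Fin r) S) :
    bracket D (-(MvPolynomial.C (y j) * MvPolynomial.X i)) F = glAct D y i j F := by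
  rw [bracket_neg_left, bracket_mul_left, bracket_X_left, bracket_coord_left hy, glAct]
  ring

variable (D y) in
/-- The Euler operator `∑ y_i ∂/∂y_i` on coefficients. -/
def eulerD (F : MvPolynomial (Fin r) S) : MvPolynomial (Fin r) S :=
  ∑ i, MvPolynomial.C (y i) * mapD (D i) F

/-- The Euler vector field of the chart measures the degree in the coordinates minus the degree in
the momenta. -/
theorem bracket_eulerSymbol (hy : ∀ i j, D i (y j) = if i = j then 1 else 0) {d : ℕ}
    {F : MvPolynomial (Fin r) S} (hF : F.IsHomogeneous d) :
    bracket D (eulerSymbol y) F = eulerD D y F - d • F := by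
  rw [eulerSymbol, bracket_sum_left, ← hF.sum_X_mul_pderiv, eulerD, ← Finset.sum_sub_distrib]
  refine Finset.sum_congr rfl fun i _ => ?_
  rw [bracket_mul_left, bracket_X_left, bracket_coord_left hy]
  ring

theorem eulerD_isHomogeneous {d : ℕ} {F : MvPolynomial (Fin r) S} (hF : F.IsHomogeneous d) :
    (eulerD D y F).IsHomogeneous d := by
  refine MvPolynomial.IsHomogeneous.sum _ _ _ fun i _ => ?_
  have h := (MvPolynomial.isHomogeneous_C (Fin r) (y i)).mul (mapD_isHomogeneous (D i) hF)
  rwa [zero_add] at h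

theorem eulerD_sub (F G : MvPolynomial (Fin r) S) :
    eulerD D y (F - G) = eulerD D y F - eulerD D y G := by
  simp only [eulerD, map_sub, mul_sub, Finset.sum_sub_distrib]

theorem eulerD_nsmul (m : ℕ) (F : MvPolynomial (Fin r) S) :
    eulerD D y (m • F) = m • eulerD D y F := by
  simp only [eulerD, map_nsmul, mul_smul_comm, Finset.smul_sum]

theorem mapD_eulerD (hD : Commuting D) (hy : ∀ i j, D i (y j) = if i = j then 1 else 0)
    (i : Fin r) (F : MvPolynomial (Fin r) S) :
    mapD (D i) (eulerD D y F) = mapD (D i) F + eulerD D y (mapD (D i) F) := by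
  have h : ∀ j, mapD (D i) (MvPolynomial.C (y j) * mapD (D j) F) =
      (if i = j then mapD (D j) F else 0) +
        MvPolynomial.C (y j) * mapD (D j) (mapD (D i) F) := by
    intro j
    rw [mapD_C_mul, hy, mapD_comm (hD i j)]
    split_ifs <;> simp
  rw [eulerD, map_sum, Finset.sum_congr rfl fun j _ => h j, Finset.sum_add_distrib,
    Finset.sum_ite_eq, if_pos (Finset.mem_univ i), eulerD]

/-- This is the contribution to the Casimir operator of the block of matrices whose two indices
differ from `k`. The terms with `eulerD` and `divergence` are not scalars; they cancel only against
the remaining blocks. -/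
theorem sum_glAct_glAct (hD : Commuting D) (hy : ∀ i j, D i (y j) = if i = j then 1 else 0)
    {d : ℕ} {F : MvPolynomial (Fin r) S} (hF : F.IsHomogeneous d) :
    ∑ i, ∑ j, glAct D y i j (glAct D y j i F) =
      (r : MvPolynomial (Fin r) S) * eulerD D y F + (eulerD D y (eulerD D y F) - eulerD D y F) +
        (r * d + d * d - d) * F - 2 * (divergence D F * eulerSymbol y) := by
  have e2 : ∑ i, ∑ j, MvPolynomial.C (y j) * (MvPolynomial.C (y i) *
      mapD (D i) (mapD (D j) F)) = eulerD D y (eulerD D y F) - eulerD D y F := by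
    have h : ∀ i, MvPolynomial.C (y i) * mapD (D i) (eulerD D y F) =
        MvPolynomial.C (y i) * mapD (D i) F + ∑ j, MvPolynomial.C (y j) *
          (MvPolynomial.C (y i) * mapD (D i) (mapD (D j) F)) := fun i => by
      rw [mapD_eulerD hD hy, mul_add, eulerD, Finset.mul_sum]
      congr 1
      refine Finset.sum_congr rfl fun j _ => ?_
      rw [mapD_comm (hD i j), mul_left_comm]
    rw [eulerD, Finset.sum_congr rfl fun i _ => h i, Finset.sum_add_distrib, ← eulerD,
      add_sub_cancel_left]
  have hX : ∑ i, MvPolynomial.X i * MvPolynomial.pderiv i F = d • F := hF.sum_X_mul_pderiv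
  have e3 := sum_euler_euler (fun i (G : MvPolynomial (Fin r) S) => MvPolynomial.pderiv i G)
    (fun i => MvPolynomial.X i) (fun i a b => map_add _ a b) (fun i j G => by
      rw [Derivation.leibniz, MvPolynomial.pderiv_X, smul_eq_mul, smul_eq_mul]
      by_cases h : i = j
      · subst h
        simp [add_comm]
      · simp [h, Ne.symm h]) hX
  have e4 : ∑ i, ∑ j, MvPolynomial.pderiv i (mapD (D i) F) *
      (MvPolynomial.C (y j) * MvPolynomial.X j) = divergence D F * eulerSymbol y := by
    rw [divergence, eulerSymbol, Finset.sum_mul_sum]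
    simp only [mapD_pderiv]
  have e5 : ∑ i, ∑ j, MvPolynomial.pderiv j (mapD (D j) F) *
      (MvPolynomial.C (y i) * MvPolynomial.X i) = divergence D F * eulerSymbol y := by
    rw [Finset.sum_comm, e4]
  have e3' : ∑ i, ∑ j, MvPolynomial.X j * (MvPolynomial.X i *
        MvPolynomial.pderiv j (MvPolynomial.pderiv i F)) = (d * d - d : ℤ) • F := by
    rw [← e3, Finset.sum_comm]
  have e6 : ∑ i : Fin r, r • (MvPolynomial.X i * MvPolynomial.pderiv i F) = r • d • F := by
    rw [← Finset.smul_sum, hX]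
  rw [Finset.sum_congr rfl fun i _ => Finset.sum_congr rfl fun j _ => glAct_glAct hy F i j]
  simp only [Finset.sum_add_distrib, Finset.sum_sub_distrib]
  rw [e2, e3', e4, e5, ← eulerD]
  simp only [Finset.sum_const, Finset.card_univ, Fintype.card_fin]
  rw [e6]
  generalize divergence D F * eulerSymbol y = Z
  generalize eulerD D y (eulerD D y F) = Z2
  generalize eulerD D y F = Z1
  simp only [nsmul_eq_mul, zsmul_eq_mul]
  push_cast
  ring

variable (y) in
/-- The homogeneous coordinate `u_j / u_k` in the chart `u_k ≠ 0`. -/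
def homCoord (k j : Fin (r + 1)) : S := k.insertNth (α := fun _ => S) 1 y j

@[simp]
theorem homCoord_self (k : Fin (r + 1)) : homCoord y k k = 1 := by simp [homCoord]

@[simp]
theorem homCoord_succAbove (k : Fin (r + 1)) (j : Fin r) :
    homCoord y k (k.succAbove j) = y j := by simp [homCoord]

variable (y) in
/-- The momentum function of the elementary matrix `E_ij` in the chart `u_k ≠ 0`. -/
def momSym (k i j : Fin (r + 1)) : MvPolynomial (Fin r) S :=
  -(MvPolynomial.C (homCoord y k j) *
    k.insertNth (α := fun _ => MvPolynomial (Fin r) S) (-eulerSymbol y) MvPolynomial.X i)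

/-- This is the contribution to the Casimir operator of the pairs with exactly one index equal to
`k`. These pair the translations `∂_i` with the quadratic vector fields `y_i ∑ y_l ∂_l`, and supply
the opposite of the divergence term of `sum_glAct_glAct`. -/
theorem sum_mixed (hD : Commuting D) (hy : ∀ i j, D i (y j) = if i = j then 1 else 0) {d : ℕ}
    {F : MvPolynomial (Fin r) S} (hF : F.IsHomogeneous d) :
    ∑ i, (-mapD (D i) (MvPolynomial.C (y i) * (eulerD D y F - d • F) -
        eulerSymbol y * MvPolynomial.pderiv i F) -
      (MvPolynomial.C (y i) * (eulerD D y (mapD (D i) F) - d • mapD (D i) F) -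
        eulerSymbol y * MvPolynomial.pderiv i (mapD (D i) F))) =
      2 * (divergence D F * eulerSymbol y) - 2 * eulerD D y (eulerD D y F) +
        (2 * d + 1 - r) * eulerD D y F + (r * d + d) * F := by
  have hyy : ∀ i, D i (y i) = 1 := fun i => by rw [hy, if_pos rfl]
  have hE : ∀ i, mapD (D i) (eulerSymbol y) = MvPolynomial.X i := fun i => by
    rw [eulerSymbol, map_sum, Finset.sum_eq_single_of_mem i (Finset.mem_univ i)]
    · rw [mapD_C_mul, mapD_X, hyy, map_one, one_mul, mul_zero, add_zero]
    · intro j _ hj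
      rw [mapD_C_mul, mapD_X, hy, if_neg (Ne.symm hj), map_zero, zero_mul, mul_zero, add_zero]
  have h1 : ∀ i, (-mapD (D i) (MvPolynomial.C (y i) * (eulerD D y F - d • F) -
        eulerSymbol y * MvPolynomial.pderiv i F) -
      (MvPolynomial.C (y i) * (eulerD D y (mapD (D i) F) - d • mapD (D i) F) -
        eulerSymbol y * MvPolynomial.pderiv i (mapD (D i) F))) =
      d • F - eulerD D y F + MvPolynomial.X i * MvPolynomial.pderiv i F +
        2 * (mapD (D i) (MvPolynomial.pderiv i F) * eulerSymbol y) -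
        2 * (MvPolynomial.C (y i) * mapD (D i) (eulerD D y F)) +
        (2 * (d : MvPolynomial (Fin r) S) + 1) * (MvPolynomial.C (y i) * mapD (D i) F) := fun i => by
    rw [map_sub, mapD_C_mul, mapD_mul, hE, hyy, map_one, map_sub, map_nsmul, ← mapD_pderiv,
      mapD_eulerD hD hy, nsmul_eq_mul, nsmul_eq_mul]
    ring
  rw [Finset.sum_congr rfl fun i _ => h1 i]
  simp only [Finset.sum_add_distrib, Finset.sum_sub_distrib, ← Finset.mul_sum]
  rw [hF.sum_X_mul_pderiv, ← Finset.sum_mul, ← divergence]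
  rw [show ∑ i, MvPolynomial.C (y i) * mapD (D i) (eulerD D y F) = eulerD D y (eulerD D y F)
    from rfl, show ∑ i, MvPolynomial.C (y i) * mapD (D i) F = eulerD D y F from rfl]
  simp only [Finset.sum_const, Finset.card_univ, Fintype.card_fin, nsmul_eq_mul]
  generalize divergence D F * eulerSymbol y = Z
  generalize eulerD D y (eulerD D y F) = Z2
  generalize eulerD D y F = Z1
  ring

/-- The Casimir operator acts on symbols of degree `d` by a scalar. -/
theorem sum_bracket_momSym (hD : Commuting D) (hy : ∀ i j, D i (y j) = if i = j then 1 else 0)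
    (k : Fin (r + 1)) {d : ℕ} {F : MvPolynomial (Fin r) S} (hF : F.IsHomogeneous d) :
    ∑ i, ∑ j, bracket D (momSym y k i j) (bracket D (momSym y k j i) F) =
      (2 * d * (d + r) : ℕ) • F := by
  have hkk : momSym y k k k = eulerSymbol y := by simp [momSym]
  have hik : ∀ i, momSym y k (k.succAbove i) k = -MvPolynomial.X i := fun i => by simp [momSym]
  have hki : ∀ i, momSym y k k (k.succAbove i) = MvPolynomial.C (y i) * eulerSymbol y :=
    fun i => by simp [momSym]
  have hij : ∀ i j, momSym y k (k.succAbove i) (k.succAbove j) =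
      -(MvPolynomial.C (y j) * MvPolynomial.X i) := fun i j => by simp [momSym]
  have h1 : ∀ {G : MvPolynomial (Fin r) S}, G.IsHomogeneous d → ∀ i,
      bracket D (momSym y k k (k.succAbove i)) G =
        MvPolynomial.C (y i) * (eulerD D y G - d • G) - eulerSymbol y * MvPolynomial.pderiv i G :=
    fun hG i => by
      rw [hki, bracket_mul_left, bracket_eulerSymbol hy hG, bracket_coord_left hy]
      ring
  have h2 : ∀ G i, bracket D (momSym y k (k.succAbove i) k) G = -mapD (D i) G := fun G i => by
    rw [hik, bracket_neg_left, bracket_X_left]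
  have h3 : bracket D (momSym y k k k) (bracket D (momSym y k k k) F) =
      eulerD D y (eulerD D y F) - 2 * d * eulerD D y F + d * d * F := by
    have hF' : (d • F).IsHomogeneous d := by
      rw [nsmul_eq_mul, ← map_natCast (MvPolynomial.C)]
      simpa using (MvPolynomial.isHomogeneous_C (Fin r) (d : S)).mul hF
    rw [hkk, bracket_eulerSymbol hy hF, bracket_eulerSymbol hy
      ((eulerD_isHomogeneous hF).sub hF'), eulerD_sub, eulerD_nsmul]
    simp only [nsmul_eq_mul]
    ring
  have h4 := sum_mixed hD hy hF
  have h5 : ∀ i, bracket D (momSym y k k (k.succAbove i))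
      (bracket D (momSym y k (k.succAbove i) k) F) + bracket D (momSym y k (k.succAbove i) k)
        (bracket D (momSym y k k (k.succAbove i)) F) =
      (-mapD (D i) (MvPolynomial.C (y i) * (eulerD D y F - d • F) -
        eulerSymbol y * MvPolynomial.pderiv i F) -
      (MvPolynomial.C (y i) * (eulerD D y (mapD (D i) F) - d • mapD (D i) F) -
        eulerSymbol y * MvPolynomial.pderiv i (mapD (D i) F))) := fun i => by
    rw [h2, h2, h1 hF, ← zero_sub (mapD (D i) F),
      h1 ((MvPolynomial.isHomogeneous_zero _ _ _).sub (mapD_isHomogeneous _ hF)), eulerD_sub,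
      smul_sub, map_sub, show eulerD D y (0 : MvPolynomial (Fin r) S) = 0 by simp [eulerD],
      smul_zero, map_zero]
    ring
  -- Splitting off the index `k` in both sums leaves the corner, the mixed pairs and the `gl_r`
  -- block. The square of `eulerD` occurs with coefficients `1`, `-2`, `1`, the divergence with `0`,
  -- `2`, `-2`, and the terms linear in `eulerD` cancel as well; the constants add up to `2d(d +
  -- r)`.
  rw [Fin.sum_univ_succAbove _ k, Fin.sum_univ_succAbove _ k, h3]
  have h6 : ∀ i : Fin r, ∑ j, bracket D (momSym y k (k.succAbove i) j)
      (bracket D (momSym y k j (k.succAbove i)) F) =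
      bracket D (momSym y k (k.succAbove i) k) (bracket D (momSym y k k (k.succAbove i)) F) +
        ∑ j, glAct D y i j (glAct D y j i F) := fun i => by
    rw [Fin.sum_univ_succAbove _ k]
    congr 1
    refine Finset.sum_congr rfl fun j _ => ?_
    rw [hij, hij, bracket_eq_glAct hy, bracket_eq_glAct hy]
  rw [Finset.sum_congr rfl fun i _ => h6 i, Finset.sum_add_distrib, sum_glAct_glAct hD hy hF,
    add_assoc, ← add_assoc (∑ i, _) (∑ i, _), ← Finset.sum_add_distrib,
    Finset.sum_congr rfl fun i _ => h5 i, h4]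
  generalize divergence D F * eulerSymbol y = Z
  generalize eulerD D y (eulerD D y F) = Z2
  generalize eulerD D y F = Z1
  simp only [nsmul_eq_mul]
  push_cast
  ring

end Weyl

section

open TopologicalSpace (Opens)

/-! ### Symbols of the Lie derivatives -/

section LieSym

variable {S : Type*} [CommRing S] [Algebra ℂ S] {n : ℕ} {y : Fin n → S}

theorem momSym_self (k j : Fin (n + 1)) :
    momSym y k k j = MvPolynomial.C (homCoord y k j) * eulerSymbol y := by
  simp [momSym]

theorem momSym_succAbove (k : Fin (n + 1)) (i : Fin n) (j : Fin (n + 1)) :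
    momSym y k (k.succAbove i) j = -(MvPolynomial.C (homCoord y k j) * MvPolynomial.X i) := by
  simp [momSym]

theorem eulerSymbol_isHomogeneous : (eulerSymbol y).IsHomogeneous 1 := by
  refine MvPolynomial.IsHomogeneous.sum _ _ _ fun i _ => ?_
  have h := (MvPolynomial.isHomogeneous_C (Fin n) (y i)).mul (MvPolynomial.isHomogeneous_X S i)
  rwa [zero_add] at h

theorem momSym_isHomogeneous (k i j : Fin (n + 1)) : (momSym y k i j).IsHomogeneous 1 := by
  rcases Fin.eq_self_or_eq_succAbove k i with rfl | ⟨i, rfl⟩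
  · rw [momSym_self]
    have h := (MvPolynomial.isHomogeneous_C (Fin n) (homCoord y i j)).mul
      (eulerSymbol_isHomogeneous (y := y))
    rwa [zero_add] at h
  · rw [momSym_succAbove]
    have h := (MvPolynomial.isHomogeneous_C (Fin n) (homCoord y k j)).mul
      (MvPolynomial.isHomogeneous_X S i)
    rw [zero_add] at h
    exact h.neg

/-- The momentum functions in homogeneous coordinates. -/
theorem eval₂_momSym (ev : S →+* ℂ) {U P : Fin (n + 1) → ℂ} {k : Fin (n + 1)} (hU : U k ≠ 0)
    (hP : P ⬝ᵥ U = 0) (hy : ∀ l, ev (y l) = U (k.succAbove l) / U k) (i j : Fin (n + 1)) :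
    MvPolynomial.eval₂ ev (fun l => U k * P (k.succAbove l)) (momSym y k i j) = -(P i * U j) := by
  have hZ : ev (homCoord y k j) = U j / U k := by
    rcases Fin.eq_self_or_eq_succAbove k j with rfl | ⟨j, rfl⟩
    · rw [homCoord_self, map_one, div_self hU]
    · rw [homCoord_succAbove, hy]
  -- The condition `p(u) = 0` is used here: it expresses `∑_{l ≠ k} u_l p_l` through `u_k p_k`.
  have hE : MvPolynomial.eval₂ ev (fun l => U k * P (k.succAbove l)) (eulerSymbol y) =
      -(U k * P k) := by
    rw [dotProduct, Fin.sum_univ_succAbove _ k] at hP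
    rw [eulerSymbol, MvPolynomial.eval₂_sum]
    simp only [MvPolynomial.eval₂_mul, MvPolynomial.eval₂_C, MvPolynomial.eval₂_X, hy]
    rw [mul_comm (U k) (P k), ← eq_neg_of_add_eq_zero_right hP]
    refine Finset.sum_congr rfl fun l _ => ?_
    field_simp
  rcases Fin.eq_self_or_eq_succAbove k i with rfl | ⟨i, rfl⟩
  · rw [momSym_self, MvPolynomial.eval₂_mul, MvPolynomial.eval₂_C, hE, hZ]
    field_simp
  · rw [momSym_succAbove, MvPolynomial.eval₂_neg, MvPolynomial.eval₂_mul, MvPolynomial.eval₂_C,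
      MvPolynomial.eval₂_X, hZ]
    field_simp

variable (y) in
/-- The full symbol, in the chart `u_k ≠ 0`, of `-u_j ∂/∂u_i` acting on homogeneous functions of
degree `μ`. -/
def lieSym (μ : ℂ) (k i j : Fin (n + 1)) : MvPolynomial (Fin n) S :=
  momSym y k i j - if i = k then MvPolynomial.C (μ • homCoord y k j) else 0

theorem map_momSym {S' : Type*} [CommRing S'] [Algebra ℂ S'] (f : S →ₐ[ℂ] S')
    (k i j : Fin (n + 1)) : MvPolynomial.map (f : S →+* S') (momSym y k i j) =
      momSym (fun l => f (y l)) k i j := by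
  have hZ : f (homCoord y k j) = homCoord (fun l => f (y l)) k j := by
    rcases Fin.eq_self_or_eq_succAbove k j with rfl | ⟨j, rfl⟩
    · simp
    · simp
  rcases Fin.eq_self_or_eq_succAbove k i with rfl | ⟨i, rfl⟩
  · rw [momSym_self, momSym_self, map_mul, MvPolynomial.map_C, RingHom.coe_coe, hZ, eulerSymbol,
      map_sum, eulerSymbol]
    simp
  · rw [momSym_succAbove, momSym_succAbove, map_neg, map_mul, MvPolynomial.map_C,
      RingHom.coe_coe, hZ, MvPolynomial.map_X]

theorem map_lieSym {S' : Type*} [CommRing S'] [Algebra ℂ S'] (f : S →ₐ[ℂ] S') (μ : ℂ)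
    (k i j : Fin (n + 1)) : MvPolynomial.map (f : S →+* S') (lieSym y μ k i j) =
      lieSym (fun l => f (y l)) μ k i j := by
  have hZ : f (homCoord y k j) = homCoord (fun l => f (y l)) k j := by
    rcases Fin.eq_self_or_eq_succAbove k j with rfl | ⟨j, rfl⟩
    · simp
    · simp
  rw [lieSym, lieSym, map_sub, map_momSym]
  congr 1
  split_ifs
  · rw [MvPolynomial.map_C, RingHom.coe_coe, map_smul, hZ]
  · rw [map_zero]

theorem lieSym_mem_degLT (μ : ℂ) (k i j : Fin (n + 1)) :
    lieSym y μ k i j ∈ degLT (Fin n) S 2 := by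
  refine Submodule.sub_mem _ (IsHomogeneous_mem_degLT (momSym_isHomogeneous k i j)) ?_
  split_ifs
  · exact monomial_mem_degLT (by simp) _
  · exact Submodule.zero_mem _

theorem homogeneousComponent_lieSym (μ : ℂ) (k i j : Fin (n + 1)) :
    MvPolynomial.homogeneousComponent 1 (lieSym y μ k i j) = momSym y k i j := by
  refine homogeneousComponent_eq_of_sub_mem (momSym_isHomogeneous k i j) ?_
  rw [lieSym, sub_sub_cancel_left]
  refine Submodule.neg_mem _ ?_
  split_ifs
  · exact monomial_mem_degLT (by simp) _
  · exact Submodule.zero_mem _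

/-- For `i ≠ k` the vector field `u_j ∂/∂u_i` is expressed directly through the chart derivations.
The derivative `∂/∂u_k` is not one of them, and Euler's identity replaces `u_k ∂/∂u_k` by `μ - ∑_{l
≠ k} u_l ∂/∂u_l`; this is where the constant term of `lieSym` comes from. -/
theorem dop_lieSym_of_eq {D : Fin n → Derivation ℂ S S} (hD : Commuting D) {k : Fin (n + 1)}
    {c : Fin (n + 1) → S} (hc : ∀ j, c j = c k * homCoord y k j) {t : S} (t' : Fin (n + 1) → S)
    (ht' : ∀ l, D l t = c k * t' (k.succAbove l)) {μ : ℂ} (ht : ∑ i, c i * t' i = μ • t)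
    (i j : Fin (n + 1)) : dop D t (lieSym y μ k i j) = -(c j * t' i) := by
  have hX : ∀ l, dop D t (MvPolynomial.X l) = c k * t' (k.succAbove l) := fun l => by
    have h := dop_mul_X hD t (MvPolynomial.C 1) l
    rwa [dop_C, one_mul, map_one, one_mul, ht'] at h
  rw [lieSym, map_sub, hc j]
  rcases Fin.eq_self_or_eq_succAbove k i with rfl | ⟨i, rfl⟩
  · have hE : dop D t (eulerSymbol y) = μ • t - c i * t' i := by
      rw [eulerSymbol, map_sum, ← ht, Fin.sum_univ_succAbove _ i, add_sub_cancel_left]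
      refine Finset.sum_congr rfl fun l _ => ?_
      rw [dop_C_mul, hX, hc (i.succAbove l), homCoord_succAbove]
      ring
    rw [momSym_self, dop_C_mul, hE, if_pos rfl, dop_C, smul_mul_assoc, mul_sub, mul_smul_comm]
    ring
  · rw [momSym_succAbove, map_neg, dop_C_mul, hX, if_neg (Fin.succAbove_ne k i), map_zero]
    ring

/-- The linear vector field `u_k ∂/∂u_m` has degree zero, so it commutes with the Euler field and
preserves homogeneous functions of each degree. -/
theorem sum_euler_commute {r : ℕ} {D : Fin r → Derivation ℂ S S} (hD : Commuting D) {c : Fin r → S}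
    (hc : ∀ i j, D i (c j) = if i = j then 1 else 0) (k m : Fin r) (t : S) :
    ∑ i, c i * D i (c k * D m t) = c k * D m (∑ i, c i * D i t) := by
  have h1 : ∀ i, c i * D i (c k * D m t) =
      (if i = k then c k * D m t else 0) + c k * (c i * D i (D m t)) := fun i => by
    rw [Derivation.leibniz, hc, smul_eq_mul, smul_eq_mul]
    split_ifs with h
    · rw [h]
      ring
    · ring
  have h2 : ∀ i, D m (c i * D i t) = (if i = m then D m t else 0) + c i * D i (D m t) :=
    fun i => by
      rw [Derivation.leibniz, hc, smul_eq_mul, smul_eq_mul, hD m i t]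
      by_cases h : i = m
      · rw [if_pos h, if_pos h.symm, h]
        ring
      · rw [if_neg h, if_neg (Ne.symm h)]
        ring
  rw [map_sum, Finset.sum_congr rfl fun i _ => h1 i, Finset.sum_congr rfl fun i _ => h2 i,
    Finset.sum_add_distrib, Finset.sum_add_distrib, Finset.sum_ite_eq', Finset.sum_ite_eq',
    if_pos (Finset.mem_univ _), if_pos (Finset.mem_univ _), ← Finset.mul_sum, mul_add]

end LieSym

section EulerOp

variable {𝕜 : Type} [RCLike 𝕜] [NormedAlgebra 𝕜 ℂ] {n : ℕ} {O : Opens (Fin (n + 1) → 𝕜)}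

variable (𝕜 O) in
/-- The Euler vector field `∑ u_i ∂/∂u_i`. -/
def eulerField : Derivation ℂ (SmoothOn 𝕜 O) (SmoothOn 𝕜 O) :=
  ∑ i, (coord i : SmoothOn 𝕜 O) • partials 𝕜 O i

theorem eulerField_apply (t : SmoothOn 𝕜 O) :
    eulerField 𝕜 O t = ∑ i, coord i * partials 𝕜 O i t := by
  have h := congrFun (map_sum (Derivation.coeFnAddMonoidHom (R := ℂ) (A := SmoothOn 𝕜 O)
    (M := SmoothOn 𝕜 O)) (fun i => (coord i : SmoothOn 𝕜 O) • partials 𝕜 O i) Finset.univ) t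
  rw [Finset.sum_apply] at h
  exact h

theorem coord_eq_mul_homCoord (k : Fin (n + 1)) (hO : ∀ u ∈ O, u k ≠ 0) (j : Fin (n + 1)) :
    (coord j : SmoothOn 𝕜 O) = coord k * homCoord (affCoord k hO) k j := by
  rcases Fin.eq_self_or_eq_succAbove k j with rfl | ⟨j, rfl⟩
  · rw [homCoord_self, mul_one]
  · rw [homCoord_succAbove, affCoord, mul_left_comm, coord_mul_coordInv, mul_one]

/-- The operators `-u_j ∂/∂u_i` in a chart. -/
theorem dop_lieSym (k : Fin (n + 1)) (hO : ∀ u ∈ O, u k ≠ 0) {t : SmoothOn 𝕜 O} {μ : ℂ}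
    (ht : eulerField 𝕜 O t = μ • t) (i j : Fin (n + 1)) :
    dop (chartD 𝕜 O k) t (lieSym (affCoord k hO) μ k i j) = -(coord j * partials 𝕜 O i t) := by
  refine dop_lieSym_of_eq (chartD_commuting k) (coord_eq_mul_homCoord k hO)
    (fun i => partials 𝕜 O i t) (fun l => rfl) ?_ i j
  rw [← eulerField_apply, ht]

end EulerOp

end

section

open TopologicalSpace (Opens)

/-! ### The Lie derivatives on densities -/

section LieDensity

variable {n : ℕ} {lam : ℂ}

/-- The inclusion of polynomials in smooth functions, as an algebra morphism. -/
def polyToSmoothAlg (n : ℕ) : MvPolynomial (Fin n) ℂ →ₐ[ℂ] Smooth n :=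
  { polyToSmooth n with
    commutes' := fun c => by
      change polyToSmooth n (algebraMap ℂ _ c) = _
      simp [polyToSmooth] }

/-- The coordinate functions on `ℝⁿ`. -/
def smoothCoord (j : Fin n) : Smooth n := polyToSmoothAlg n (MvPolynomial.X j)

theorem evSmooth_smoothCoord (z : Fin n → ℝ) (j : Fin n) :
    evSmooth z (smoothCoord j) = (z j : ℂ) := by
  have h := evSmooth_polyToSmooth z (MvPolynomial.X j)
  rwa [MvPolynomial.eval_X] at h

/-- `pullback` as an algebra morphism. -/
def pullbackAlg {O : Opens (Fin (n + 1) → ℝ)} (k : Fin (n + 1)) (hO : ∀ u ∈ O, u k ≠ 0) :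
    Smooth n →ₐ[ℂ] SmoothOn ℝ O :=
  { pullback k hO with commutes' := fun _ => rfl }

theorem pullback_smoothCoord {O : Opens (Fin (n + 1) → ℝ)} (k : Fin (n + 1))
    (hO : ∀ u ∈ O, u k ≠ 0) (j : Fin n) : pullback k hO (smoothCoord j) = affCoord k hO j := by
  ext u
  rw [pullback_apply, evSmooth_smoothCoord, affCoord_apply]
  rfl

theorem smoothD_smoothCoord (i j : Fin n) :
    smoothD i (smoothCoord j) = if i = j then 1 else 0 := by
  have e : (smoothCoord j).1 = fun z => ((z j : ℝ) : ℂ) := by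
    funext z
    exact evSmooth_smoothCoord z j
  ext z
  change fderiv ℝ (smoothCoord j).1 z (Pi.single i 1) = _
  rw [e]
  have h : HasFDerivAt (fun z : Fin n → ℝ => ((z j : ℝ) : ℂ))
      (Complex.ofRealCLM.comp (ContinuousLinearMap.proj j)) z :=
    (Complex.ofRealCLM.comp (ContinuousLinearMap.proj (R := ℝ) (φ := fun _ : Fin n => ℝ) j)).hasFDerivAt
  rw [h.fderiv]
  by_cases hij : i = j
  · subst hij
    simp
  · rw [if_neg hij]
    simp [Ne.symm hij]

/-- Euler's identity results from differentiating `c ↦ s (c • u)` at `c = 1`, where `|c| = c` and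
the complex power is differentiable. -/
theorem fderiv_dens_self (s : Dens n lam) {u : Fin (n + 1) → ℝ} (hu : u ≠ 0) :
    fderiv ℝ s.1 u u = -(lam * (n + 1)) * s.1 u := by
  have hd : DifferentiableAt ℝ s.1 u :=
    (s.2.1.differentiableOn (by simp)).differentiableAt (isOpen_compl_singleton.mem_nhds hu)
  have h1 : HasDerivAt (fun c : ℝ => s.1 (c • u)) (fderiv ℝ s.1 u u) 1 := by
    have h2 : HasDerivAt (fun c : ℝ => c • u) u 1 := by
      simpa using (hasDerivAt_id (1 : ℝ)).smul_const u
    have h3 : HasFDerivAt s.1 (fderiv ℝ s.1 u) ((1 : ℝ) • u) := by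
      rw [one_smul]
      exact hd.hasFDerivAt
    exact h3.comp_hasDerivAt 1 h2
  have h4 : HasDerivAt (fun c : ℝ => (c : ℂ) ^ (-(lam * (n + 1))) * s.1 u)
      (-(lam * (n + 1)) * s.1 u) 1 := by
    have h5 : HasDerivAt (fun c : ℝ => (c : ℂ) ^ (-(lam * (n + 1)))) (-(lam * (n + 1))) 1 := by
      have h6 := (hasDerivAt_id ((1 : ℝ) : ℂ)).cpow_const (c := -(lam * (n + 1))) (by simp)
      have h7 := h6.comp_ofReal
      simpa using h7
    exact h5.mul_const _
  refine h1.unique (h4.congr_of_eventuallyEq ?_)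
  filter_upwards [lt_mem_nhds (zero_lt_one (α := ℝ))] with c hc
  rw [s.2.2.2 c u hc.ne', abs_of_pos hc]

theorem eulerField_densOn {O : Opens (Fin (n + 1) → ℝ)} (hO : O ≤ punctured n) (s : Dens n lam) :
    eulerField ℝ O (densOn O hO s) = (-(lam * (n + 1))) • densOn O hO s := by
  ext u
  have h := fderiv_dens_self s (hO u.2)
  rw [eulerField_apply]
  change SmoothOn.ev u _ = -(lam * (n + 1)) * s.1 u.1
  rw [← h, map_sum]
  have e : ∀ L : (Fin (n + 1) → ℝ) →L[ℝ] ℂ, L u.1 = ∑ i, (u.1 i : ℂ) * L (Pi.single i 1) := by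
    intro L
    conv_lhs => rw [pi_eq_sum_univ' u.1, map_sum]
    simp
  rw [e]
  refine Finset.sum_congr rfl fun i _ => ?_
  rw [map_mul, SmoothOn.ev_apply, SmoothOn.ev_apply, coord_apply, partials,
    SmoothOn.dir_apply_of_eq _ _ (s := s.1) (fun _ => rfl)]
  rfl

theorem densOn_lieDeriv {O : Opens (Fin (n + 1) → ℝ)} (hO : O ≤ punctured n) (s : Dens n lam)
    (i j : Fin (n + 1)) : densOn O hO (lieDeriv lam (Matrix.single i j 1) s) =
      -(coord j * partials ℝ O i (densOn O hO s)) := by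
  ext u
  change -(fderiv ℝ s.1 u.1 (Matrix.single i j 1 *ᵥ u.1)) =
    -((coord j : SmoothOn ℝ O).1 u * (partials ℝ O i (densOn O hO s)).1 u)
  have h : Matrix.single i j (1 : ℝ) *ᵥ u.1 = u.1 j • Pi.single i 1 := by
    rw [Matrix.single_mulVec]
    funext l
    by_cases h : l = i
    · subst h
      simp
    · simp [h]
  rw [h, map_smul, coord_apply, partials, SmoothOn.dir_apply_of_eq _ _ (s := s.1) (fun _ => rfl)]
  rfl

theorem hasFullSymbol_lieDeriv (k i j : Fin (n + 1)) :
    HasFullSymbol k (lieDeriv lam (Matrix.single i j 1))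
      (lieSym smoothCoord (-(lam * (n + 1))) k i j) := by
  rw [hasFullSymbol_iff]
  intro s
  have e : MvPolynomial.map (pullback k (chartSet_ne k))
      (lieSym smoothCoord (-(lam * (n + 1))) k i j) =
      lieSym (affCoord k (chartSet_ne k)) (-(lam * (n + 1))) k i j := by
    have h := map_lieSym (y := smoothCoord) (pullbackAlg k (chartSet_ne (n := n) k))
      (-(lam * (n + 1))) k i j
    have h2 : (fun l => pullbackAlg k (chartSet_ne (n := n) k) (smoothCoord l)) =
        affCoord k (chartSet_ne k) := funext fun l => pullback_smoothCoord k (chartSet_ne k) l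
    rw [h2] at h
    exact h
  rw [e, dop_lieSym k (chartSet_ne k) (eulerField_densOn (chartSet_le k) s), densOn_lieDeriv]

theorem hasSymbol_momentumReal (k i j : Fin (n + 1)) :
    HasSymbol k (momentumReal (Matrix.single i j 1)) (momSym smoothCoord k i j) := by
  intro u p hu hp hk
  have hk' : ((u k : ℝ) : ℂ) ≠ 0 := by exact_mod_cast hk
  have hp' : (fun i => (p i : ℂ)) ⬝ᵥ (fun i => (u i : ℂ)) = 0 := by
    have h := congrArg (fun r : ℝ => (r : ℂ)) hp
    simpa [dotProduct] using h
  have h := eval₂_momSym (y := smoothCoord) (evSmooth (chartCoord k u)) hk' hp' (fun l => by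
    rw [evSmooth_smoothCoord]
    simp [chartCoord]) i j
  have e : (fun l => ((u k * p (k.succAbove l) : ℝ) : ℂ)) =
      fun l => (u k : ℂ) * (p (k.succAbove l) : ℂ) := by
    funext l
    push_cast
    rfl
  rw [e, h]
  change -((fun i => (p i : ℂ)) ⬝ᵥ (Matrix.single i j (1 : ℂ) *ᵥ fun i => (u i : ℂ))) = _
  simp [Matrix.single_mulVec, dotProduct, Function.update_apply]

theorem IsPrincipalSymbol.sum {ι : Type*} (t : Finset ι) {d : ℕ}
    {P : ι → Module.End ℂ (Dens n lam)} {φ : ι → CotP ℝ n → ℂ}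
    (h : ∀ i ∈ t, IsPrincipalSymbol d (P i) (φ i)) :
    IsPrincipalSymbol d (∑ i ∈ t, P i) (∑ i ∈ t, φ i) := by
  classical
  induction t using Finset.induction_on with
  | empty =>
    rw [Finset.sum_empty, Finset.sum_empty]
    exact isPrincipalSymbol_zero_of_mem (Submodule.zero_mem _)
  | insert i t hi ih =>
    rw [Finset.sum_insert hi, Finset.sum_insert hi]
    exact (h i (Finset.mem_insert_self i t)).add
      (ih fun j hj => h j (Finset.mem_insert_of_mem hj))

theorem isPrincipalSymbol_lieDeriv_single (i j : Fin (n + 1)) :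
    IsPrincipalSymbol 1 (lieDeriv lam (Matrix.single i j 1))
      (momentumReal (Matrix.single i j 1)) := by
  rw [isPrincipalSymbol_iff]
  intro k
  refine ⟨_, hasFullSymbol_lieDeriv k i j, lieSym_mem_degLT _ _ _ _, ?_⟩
  rw [homogeneousComponent_lieSym]
  exact hasSymbol_momentumReal k i j

theorem lieDeriv_eq_sum (x : Matrix (Fin (n + 1)) (Fin (n + 1)) ℝ) :
    lieDeriv lam x = ∑ i, ∑ j, (x i j : ℂ) • lieDeriv lam (Matrix.single i j 1) := by
  ext s u
  simp only [LinearMap.sum_apply, LinearMap.smul_apply, AddSubmonoidClass.coe_finsetSum,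
    Finset.sum_apply]
  change -(fderiv ℝ s.1 u (x *ᵥ u)) =
    ∑ i, ∑ j, (x i j : ℂ) * -(fderiv ℝ s.1 u (Matrix.single i j 1 *ᵥ u))
  conv_lhs => rw [Matrix.matrix_eq_sum_single x]
  have h : ∀ i j, Matrix.single i j (x i j) = x i j • Matrix.single i j (1 : ℝ) := by
    intro i j
    rw [Matrix.smul_single, smul_eq_mul, mul_one]
  simp only [Matrix.sum_mulVec, map_sum, h, Matrix.smul_mulVec, map_smul, mul_neg,
    Finset.sum_neg_distrib]
  rfl

theorem momentum_mk (x : Matrix (Fin (n + 1)) (Fin (n + 1)) ℂ) (u p : Fin (n + 1) → ℂ) (hu : u ≠ 0)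
    (hp : p ⬝ᵥ u = 0) : momentum x (CotP.mk u p hu hp) = -(p ⬝ᵥ (x *ᵥ u)) := rfl

theorem momentum_eq_sum (x : Matrix (Fin (n + 1)) (Fin (n + 1)) ℂ) :
    momentum x = ∑ i, ∑ j, x i j • momentum (Matrix.single i j 1) := by
  funext y
  simp only [Finset.sum_apply, Pi.smul_apply, smul_eq_mul]
  induction y using Quotient.inductionOn with
  | _ y =>
    change -(y.1.2 ⬝ᵥ (x *ᵥ y.1.1)) =
      ∑ i, ∑ j, x i j * -(y.1.2 ⬝ᵥ (Matrix.single i j 1 *ᵥ y.1.1))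
    conv_lhs => rw [Matrix.matrix_eq_sum_single x]
    have h : ∀ i j, Matrix.single i j (x i j) = x i j • Matrix.single i j (1 : ℂ) := by
      intro i j
      rw [Matrix.smul_single, smul_eq_mul, mul_one]
    simp only [Matrix.sum_mulVec, dotProduct_sum, h, Matrix.smul_mulVec, dotProduct_smul, mul_neg,
      Finset.sum_neg_distrib, smul_eq_mul]

theorem momentumReal_eq_sum (x : Matrix (Fin (n + 1)) (Fin (n + 1)) ℂ) :
    momentumReal x = ∑ i, ∑ j, x i j • momentumReal (Matrix.single i j 1) := by
  funext y
  have h := congrFun (momentum_eq_sum x) (complexify y)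
  simp only [Finset.sum_apply, Pi.smul_apply] at h ⊢
  exact h

theorem isPrincipalSymbol_lieDeriv (x : Matrix (Fin (n + 1)) (Fin (n + 1)) ℝ) :
    IsPrincipalSymbol 1 (lieDeriv lam x) (momentumReal (x.map Complex.ofReal)) := by
  rw [lieDeriv_eq_sum, momentumReal_eq_sum]
  exact IsPrincipalSymbol.sum _ fun i _ => IsPrincipalSymbol.sum _ fun j _ =>
    (isPrincipalSymbol_lieDeriv_single i j).smul _

end LieDensity

end

section

open TopologicalSpace (Opens)

/-! ### Multiplication operators -/

section MulOp

variable {n : ℕ} {lam : ℂ}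

/-- Multiplication by a smooth function on `ℝℙⁿ`. -/
def mulOp (lam : ℂ) (f : Dens n 0) : Module.End ℂ (Dens n lam) where
  toFun s := ⟨fun u => f.1 u * s.1 u, ContDiffOn.mul f.2.1 s.2.1, by
    change f.1 0 * s.1 0 = 0
    rw [s.2.2.1, mul_zero], fun c u hc => by
    change f.1 (c • u) * s.1 (c • u) = _ * (f.1 u * s.1 u)
    rw [s.2.2.2 c u hc, f.2.2.2 c u hc]
    simp only [zero_mul, neg_zero, Complex.cpow_zero, one_mul]
    ring⟩
  map_add' s t := by
    apply Subtype.ext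
    funext u
    exact mul_add _ _ _
  map_smul' c s := by
    apply Subtype.ext
    funext u
    exact mul_left_comm _ _ _

theorem dens_zero_smul (f : Dens n 0) {c : ℝ} (hc : c ≠ 0) (u : Fin (n + 1) → ℝ) :
    f.1 (c • u) = f.1 u := by
  rw [f.2.2.2 c u hc]
  simp

/-- A function on `ℝℙⁿ` as a function on `T*ℝℙⁿ`. -/
def baseFun (f : Dens n 0) : CotP ℝ n → ℂ :=
  Quotient.lift (fun x : Cone ℝ n => f.1 x.1.1) (by
    rintro x y ⟨c, h1, _⟩
    rw [h1, Units.smul_def, dens_zero_smul f c.ne_zero])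

/-- A function on `ℝℙⁿ` in the affine coordinates. -/
def chartFun (k : Fin (n + 1)) (f : Dens n 0) : Smooth n :=
  ⟨fun z => f.1 (chartVec k z), by
    refine contDiffOn_univ.1 (f.2.1.comp (t := {0}ᶜ) (ContDiff.contDiffOn ?_)
      fun z _ => chartVec_ne_zero k z)
    refine contDiff_pi.2 fun i => ?_
    rcases Fin.eq_self_or_eq_succAbove k i with rfl | ⟨i, rfl⟩
    · simp only [chartVec_self]
      exact contDiff_const
    · simp only [chartVec_succAbove]
      exact contDiff_apply ℝ ℝ i⟩

theorem evSmooth_chartFun {k : Fin (n + 1)} (f : Dens n 0) {u : Fin (n + 1) → ℝ} (hk : u k ≠ 0) :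
    evSmooth (chartCoord k u) (chartFun k f) = f.1 u := by
  change f.1 (chartVec k (chartCoord k u)) = f.1 u
  conv_rhs => rw [eq_smul_chartVec k hk]
  rw [dens_zero_smul f hk]

theorem isPrincipalSymbol_mulOp (f : Dens n 0) : IsPrincipalSymbol 0 (mulOp lam f) (baseFun f) := by
  rw [isPrincipalSymbol_iff]
  intro k
  refine ⟨MvPolynomial.C (chartFun k f), ?_, monomial_mem_degLT (by simp) _, ?_⟩
  · rw [hasFullSymbol_iff]
    intro s
    rw [MvPolynomial.map_C, dop_C]
    ext u
    change f.1 u.1 * s.1 u.1 = evSmooth (chartCoord k u.1) (chartFun k f) * s.1 u.1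
    rw [evSmooth_chartFun f u.2]
  · rw [MvPolynomial.homogeneousComponent_zero, MvPolynomial.coeff_zero_C]
    intro u p hu hp hk
    rw [MvPolynomial.eval₂_C, evSmooth_chartFun f hk]
    rfl

end MulOp

/-! ### A partition of unity -/

section Partition

variable {n : ℕ}

/-- A function supported in the chart `u_k ≠ 0`. -/
def bump (k : Fin (n + 1)) (u : Fin (n + 1) → ℝ) : ℝ :=
  Real.smoothTransition (2 * (n + 1) * u k ^ 2 / (u ⬝ᵥ u) - 1)

theorem bump_nonneg (k : Fin (n + 1)) (u : Fin (n + 1) → ℝ) : 0 ≤ bump k u :=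
  Real.smoothTransition.nonneg _

/-- Some `u_k²` is at least the average `(u·u)/(n+1)`. For this `k` the argument of the smooth
transition is at least `1`. -/
theorem sum_bump_pos {u : Fin (n + 1) → ℝ} (hu : u ≠ 0) : 0 < ∑ k, bump k u := by
  have h0 : 0 < u ⬝ᵥ u := by
    have : 0 ≤ u ⬝ᵥ u := Finset.sum_nonneg fun i _ => mul_self_nonneg (u i)
    exact lt_of_le_of_ne this (dotProduct_self_ne_zero hu).symm
  obtain ⟨k, _, hk⟩ := Finset.exists_le_of_sum_le (s := Finset.univ)
    (f := fun _ : Fin (n + 1) => (u ⬝ᵥ u) / (n + 1)) (g := fun k => u k ^ 2)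
    Finset.univ_nonempty (by
      simp only [Finset.sum_const, Finset.card_univ, Fintype.card_fin, nsmul_eq_mul]
      push_cast
      rw [mul_div_cancel₀ _ (by positivity), dotProduct]
      exact le_of_eq (Finset.sum_congr rfl fun i _ => by ring))
  refine Finset.sum_pos' (fun k _ => bump_nonneg k u) ⟨k, Finset.mem_univ k, ?_⟩
  refine Real.smoothTransition.pos_of_pos ?_
  rw [div_le_iff₀ (by positivity)] at hk
  rw [sub_pos, lt_div_iff₀ h0]
  linarith

theorem contDiffOn_bump (k : Fin (n + 1)) : ContDiffOn ℝ ∞ (bump k) {0}ᶜ := by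
  refine Real.smoothTransition.contDiff.comp_contDiffOn (ContDiffOn.sub (ContDiffOn.div ?_
    contDiff_dotProduct_self.contDiffOn fun u hu => dotProduct_self_ne_zero hu) contDiffOn_const)
  have h : ContDiff ℝ ∞ fun u : Fin (n + 1) → ℝ => 2 * ((n : ℝ) + 1) * u k ^ 2 := by fun_prop
  exact h.contDiffOn

theorem bump_smul (k : Fin (n + 1)) {c : ℝ} (hc : c ≠ 0) (u : Fin (n + 1) → ℝ) :
    bump k (c • u) = bump k u := by
  rw [bump, bump]
  congr 2
  rw [smul_dotProduct, dotProduct_smul, smul_eq_mul, smul_eq_mul, Pi.smul_apply, smul_eq_mul,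
    ← mul_assoc c c, mul_pow, ← sq, mul_left_comm, mul_div_mul_left _ _ (pow_ne_zero 2 hc)]

/-- The member with index `k` of a partition of unity, multiplied by a function of the affine
coordinates `u_j / u_k`. -/
def cutoff (k : Fin (n + 1)) (a : Smooth n) : Dens n 0 :=
  ⟨fun u => if u k = 0 then 0 else ((bump k u / ∑ l, bump l u : ℝ) : ℂ) * a.1 (chartCoord k u), by
    refine ⟨?_, by simp, fun c u hc => ?_⟩
    · intro u hu
      apply ContDiffAt.contDiffWithinAt
      have hU : ({0}ᶜ : Set (Fin (n + 1) → ℝ)) ∈ nhds u := isOpen_compl_singleton.mem_nhds hu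
      by_cases hk : u k = 0
      · refine (contDiffAt_const (c := (0 : ℂ))).congr_of_eventuallyEq ?_
        have hcont : ContinuousAt (fun v : Fin (n + 1) → ℝ => 2 * ((n : ℝ) + 1) * v k ^ 2 / (v ⬝ᵥ v) - 1) u := by
          refine ContinuousAt.sub (ContinuousAt.div ?_ ?_ (dotProduct_self_ne_zero hu))
            continuousAt_const
          · exact (continuous_const.mul ((continuous_apply k).pow 2)).continuousAt
          · exact contDiff_dotProduct_self.continuous.continuousAt
        -- At `u_k = 0` the argument of the smooth transition is `-1`, so the bump vanishes in a
        -- whole neighbourhood and the value `0` extends the function smoothly across the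
        -- hyperplane.
        have hlt : (2 * ((n : ℝ) + 1) * u k ^ 2 / (u ⬝ᵥ u) - 1) < 0 := by
          rw [hk]
          simp
        filter_upwards [hcont.eventually_lt_const hlt] with v hv
        have : bump k v = 0 := Real.smoothTransition.zero_of_nonpos hv.le
        rw [this]
        simp
      · have hK : {v : Fin (n + 1) → ℝ | v k ≠ 0} ∈ nhds u := (chartSet k).2.mem_nhds hk
        have h1 : ContDiffAt ℝ ∞ (fun v => bump k v / ∑ l, bump l v) u := by
          refine ContDiffAt.div ((contDiffOn_bump k).contDiffAt hU) ?_ (sum_bump_pos hu).ne'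
          exact ContDiffAt.sum fun l _ => (contDiffOn_bump l).contDiffAt hU
        have h2 : ContDiffAt ℝ ∞ (fun v => a.1 (chartCoord k v)) u :=
          ((show ContDiff ℝ ∞ a.1 from a.2).comp_contDiffOn
            (contDiffOn_chartCoord k (chartSet_ne k))).contDiffAt hK
        refine ((Complex.ofRealCLM.contDiff.contDiffAt.comp u h1).mul h2).congr_of_eventuallyEq ?_
        filter_upwards [hK] with v hv
        exact if_neg hv
    · have h : chartCoord k (c • u) = chartCoord k u := by
        funext j
        simp only [chartCoord, Pi.smul_apply, smul_eq_mul]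
        rw [mul_div_mul_left _ _ hc]
      have h' : (c • u) k = 0 ↔ u k = 0 := by simp [hc]
      simp only [h', h, bump_smul _ hc]
      simp⟩

theorem cutoff_apply_of_eq_zero {k : Fin (n + 1)} (a : Smooth n) {u : Fin (n + 1) → ℝ}
    (hk : u k = 0) : (cutoff k a).1 u = 0 := if_pos hk

theorem cutoff_apply {k : Fin (n + 1)} (a : Smooth n) {u : Fin (n + 1) → ℝ} (hk : u k ≠ 0) :
    (cutoff k a).1 u = ((bump k u / ∑ l, bump l u : ℝ) : ℂ) * evSmooth (chartCoord k u) a :=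
  if_neg hk

theorem bump_of_eq_zero {k : Fin (n + 1)} {u : Fin (n + 1) → ℝ} (hk : u k = 0) : bump k u = 0 :=
  Real.smoothTransition.zero_of_nonpos (by rw [hk]; simp)

end Partition

/-! ### Conjugation by the group -/

section Conj

variable {n : ℕ} {lam : ℂ}

theorem actDens_mul (g h : Matrix.SpecialLinearGroup (Fin (n + 1)) ℝ) :
    actDens lam (g * h) = actDens lam g * actDens lam h := by
  ext s u
  change s.1 ((↑((g * h)⁻¹) : Matrix (Fin (n + 1)) (Fin (n + 1)) ℝ) *ᵥ u) =
    s.1 ((↑(h⁻¹) : Matrix (Fin (n + 1)) (Fin (n + 1)) ℝ) *ᵥ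
      ((↑(g⁻¹) : Matrix (Fin (n + 1)) (Fin (n + 1)) ℝ) *ᵥ u))
  rw [mul_inv_rev, Matrix.SpecialLinearGroup.coe_mul, Matrix.mulVec_mulVec]

theorem actDens_one : actDens lam (1 : Matrix.SpecialLinearGroup (Fin (n + 1)) ℝ) = 1 := by
  ext s u
  change s.1 ((↑((1 : Matrix.SpecialLinearGroup (Fin (n + 1)) ℝ)⁻¹) :
    Matrix (Fin (n + 1)) (Fin (n + 1)) ℝ) *ᵥ u) = s.1 u
  rw [inv_one, Matrix.SpecialLinearGroup.coe_one, Matrix.one_mulVec]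

/-- Conjugation of operators by the action of the group on densities. -/
def conj (lam : ℂ) (g : Matrix.SpecialLinearGroup (Fin (n + 1)) ℝ) :
    Module.End ℂ (Dens n lam) →ₐ[ℂ] Module.End ℂ (Dens n lam) :=
  AlgHom.ofLinearMap
    ((LinearMap.mulRight ℂ (actDens lam g⁻¹)).comp (LinearMap.mulLeft ℂ (actDens lam g)))
    (by
      change actDens lam g * 1 * actDens lam g⁻¹ = 1
      rw [mul_one, ← actDens_mul, mul_inv_cancel, actDens_one])
    (by
      intro P R
      change actDens lam g * (P * R) * actDens lam g⁻¹ =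
        (actDens lam g * P * actDens lam g⁻¹) * (actDens lam g * R * actDens lam g⁻¹)
      have h : actDens lam g⁻¹ * actDens lam g = 1 := by
        rw [← actDens_mul, inv_mul_cancel, actDens_one]
      calc actDens lam g * (P * R) * actDens lam g⁻¹ =
          actDens lam g * P * 1 * R * actDens lam g⁻¹ := by noncomm_ring
        _ = _ := by rw [← h]; noncomm_ring)

theorem conj_mulOp (g : Matrix.SpecialLinearGroup (Fin (n + 1)) ℝ) (f : Dens n 0) :
    conj lam g (mulOp lam f) = mulOp lam (actDens 0 g f) := by
  ext s u
  change f.1 ((↑(g⁻¹) : Matrix (Fin (n + 1)) (Fin (n + 1)) ℝ) *ᵥ u) *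
    s.1 ((↑(g⁻¹⁻¹) : Matrix (Fin (n + 1)) (Fin (n + 1)) ℝ) *ᵥ
      ((↑(g⁻¹) : Matrix (Fin (n + 1)) (Fin (n + 1)) ℝ) *ᵥ u)) = f.1 _ * s.1 u
  rw [Matrix.mulVec_mulVec, ← Matrix.SpecialLinearGroup.coe_mul, inv_inv, mul_inv_cancel,
    Matrix.SpecialLinearGroup.coe_one, Matrix.one_mulVec]

theorem actFun_baseFun (g : Matrix.SpecialLinearGroup (Fin (n + 1)) ℝ) (f : Dens n 0) :
    actFun g (baseFun f) = baseFun (actDens 0 g f) := by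
  funext x
  induction x using Quotient.inductionOn with
  | _ x => rfl

theorem conj_lieDeriv (g : Matrix.SpecialLinearGroup (Fin (n + 1)) ℝ)
    (x : Matrix (Fin (n + 1)) (Fin (n + 1)) ℝ) :
    conj lam g (lieDeriv lam x) = lieDeriv lam (g.1 * x * (g⁻¹).1) := by
  ext s u
  set A : Matrix (Fin (n + 1)) (Fin (n + 1)) ℝ := g.1
  set B : Matrix (Fin (n + 1)) (Fin (n + 1)) ℝ := (g⁻¹).1
  have hAB : A * B = 1 := by
    rw [← Matrix.SpecialLinearGroup.coe_mul, mul_inv_cancel, Matrix.SpecialLinearGroup.coe_one]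
  change -(fderiv ℝ (fun v => s.1 ((↑(g⁻¹⁻¹) : Matrix (Fin (n + 1)) (Fin (n + 1)) ℝ) *ᵥ v))
    (B *ᵥ u) (x *ᵥ (B *ᵥ u))) = -(fderiv ℝ s.1 u ((A * x * B) *ᵥ u))
  rw [inv_inv]
  change -(fderiv ℝ (fun v => s.1 (A *ᵥ v)) (B *ᵥ u) (x *ᵥ (B *ᵥ u))) = _
  by_cases hu : u = 0
  · subst hu
    simp
  have hd : DifferentiableAt ℝ s.1 u :=
    (s.2.1.differentiableOn (by simp)).differentiableAt (isOpen_compl_singleton.mem_nhds hu)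
  have e : A *ᵥ (B *ᵥ u) = u := by rw [Matrix.mulVec_mulVec, hAB, Matrix.one_mulVec]
  have h1 : HasFDerivAt (fun v => A *ᵥ v)
      (LinearMap.toContinuousLinearMap (Matrix.mulVecLin A)) (B *ᵥ u) :=
    (LinearMap.toContinuousLinearMap (Matrix.mulVecLin A)).hasFDerivAt
  have h2 : HasFDerivAt s.1 (fderiv ℝ s.1 u) (A *ᵥ (B *ᵥ u)) := by
    rw [e]
    exact hd.hasFDerivAt
  have h3 := (h2.comp (B *ᵥ u) h1).fderiv
  change fderiv ℝ (fun v => s.1 (A *ᵥ v)) (B *ᵥ u) = _ at h3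
  rw [h3]
  change -(fderiv ℝ s.1 u (A *ᵥ (x *ᵥ (B *ᵥ u)))) = _
  rw [Matrix.mulVec_mulVec, Matrix.mulVec_mulVec]

theorem actFun_momentum (g : Matrix.SpecialLinearGroup (Fin (n + 1)) ℂ)
    (x : Matrix (Fin (n + 1)) (Fin (n + 1)) ℂ) :
    actFun g (momentum x) = momentum (g.1 * x * (g⁻¹).1) := by
  funext y
  induction y using Quotient.inductionOn with
  | _ y =>
    change -((y.1.2 ᵥ* (↑(g⁻¹⁻¹) : Matrix (Fin (n + 1)) (Fin (n + 1)) ℂ)) ⬝ᵥ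
      (x *ᵥ ((↑(g⁻¹) : Matrix (Fin (n + 1)) (Fin (n + 1)) ℂ) *ᵥ y.1.1))) =
      -(y.1.2 ⬝ᵥ ((g.1 * x * (g⁻¹).1) *ᵥ y.1.1))
    rw [inv_inv, ← Matrix.dotProduct_mulVec, Matrix.mulVec_mulVec, Matrix.mulVec_mulVec]

theorem actFun_momentumReal (g : Matrix.SpecialLinearGroup (Fin (n + 1)) ℝ)
    (x : Matrix (Fin (n + 1)) (Fin (n + 1)) ℝ) :
    actFun g (momentumReal (x.map Complex.ofReal)) =
      momentumReal ((g.1 * x * (g⁻¹).1 : Matrix (Fin (n + 1)) (Fin (n + 1)) ℝ).map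
        Complex.ofReal) := by
  have key : ∀ (y : Matrix (Fin (n + 1)) (Fin (n + 1)) ℝ) (u p : Fin (n + 1) → ℝ),
      (fun i => (p i : ℂ)) ⬝ᵥ (y.map Complex.ofReal *ᵥ fun i => (u i : ℂ)) =
        ((p ⬝ᵥ (y *ᵥ u) : ℝ) : ℂ) := by
    intro y u p
    simp [dotProduct, Matrix.mulVec]
  funext y
  induction y using Quotient.inductionOn with
  | _ y =>
    change -((fun i => ((y.1.2 ᵥ* (↑(g⁻¹⁻¹) : Matrix (Fin (n + 1)) (Fin (n + 1)) ℝ)) i : ℂ)) ⬝ᵥ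
      (x.map Complex.ofReal *ᵥ fun i =>
        (((↑(g⁻¹) : Matrix (Fin (n + 1)) (Fin (n + 1)) ℝ) *ᵥ y.1.1) i : ℂ))) =
      -((fun i => (y.1.2 i : ℂ)) ⬝ᵥ ((g.1 * x * (g⁻¹).1 :
        Matrix (Fin (n + 1)) (Fin (n + 1)) ℝ).map Complex.ofReal *ᵥ fun i => (y.1.1 i : ℂ)))
    rw [key, key, inv_inv, ← Matrix.dotProduct_mulVec, Matrix.mulVec_mulVec, Matrix.mulVec_mulVec]

end Conj

end

/-! ### Symbols of conjugate operators -/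

section ConjSymbol

variable {n : ℕ} {lam : ℂ}

/-- There is an operator with principal symbol `φ`, compatibly with conjugation. -/
def HasEquivariantLift (lam : ℂ) (d : ℕ) (φ : CotP ℝ n → ℂ) : Prop :=
  ∃ P : Module.End ℂ (Dens n lam), IsPrincipalSymbol d P φ ∧
    ∀ g, IsPrincipalSymbol d (conj lam g P) (actFun g φ)

theorem HasEquivariantLift.add {d : ℕ} {φ ψ : CotP ℝ n → ℂ} (hφ : HasEquivariantLift lam d φ)
    (hψ : HasEquivariantLift lam d ψ) : HasEquivariantLift lam d (φ + ψ) := by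
  obtain ⟨P, h1, h2⟩ := hφ
  obtain ⟨R, h3, h4⟩ := hψ
  refine ⟨P + R, h1.add h3, fun g => ?_⟩
  rw [map_add]
  exact (h2 g).add (h4 g)

theorem HasEquivariantLift.mul {d e : ℕ} {φ ψ : CotP ℝ n → ℂ} (hφ : HasEquivariantLift lam d φ)
    (hψ : HasEquivariantLift lam e ψ) : HasEquivariantLift lam (d + e) (φ * ψ) := by
  obtain ⟨P, h1, h2⟩ := hφ
  obtain ⟨R, h3, h4⟩ := hψ
  refine ⟨P * R, h1.mul h3, fun g => ?_⟩
  rw [map_mul]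
  exact (h2 g).mul (h4 g)

theorem HasEquivariantLift.smul {d : ℕ} {φ : CotP ℝ n → ℂ} (hφ : HasEquivariantLift lam d φ)
    (c : ℂ) : HasEquivariantLift lam d (c • φ) := by
  obtain ⟨P, h1, h2⟩ := hφ
  refine ⟨c • P, h1.smul c, fun g => ?_⟩
  rw [map_smul]
  exact (h2 g).smul c

theorem HasEquivariantLift.sum {ι : Type*} (t : Finset ι) {d : ℕ} {φ : ι → CotP ℝ n → ℂ}
    (h : ∀ i ∈ t, HasEquivariantLift lam d (φ i)) : HasEquivariantLift lam d (∑ i ∈ t, φ i) := by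
  refine Finset.sum_induction _ (HasEquivariantLift lam d) (fun _ _ => HasEquivariantLift.add) ?_ h
  have h0 : IsPrincipalSymbol d (0 : Module.End ℂ (Dens n lam)) 0 :=
    isPrincipalSymbol_zero_of_mem (Submodule.zero_mem _)
  refine ⟨0, h0, fun g => ?_⟩
  rw [map_zero]
  exact h0

theorem hasEquivariantLift_baseFun (f : Dens n 0) : HasEquivariantLift lam 0 (baseFun f) :=
  ⟨mulOp lam f, isPrincipalSymbol_mulOp f, fun g => by
    rw [conj_mulOp, actFun_baseFun]
    exact isPrincipalSymbol_mulOp _⟩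

theorem hasEquivariantLift_momentumReal (i j : Fin (n + 1)) :
    HasEquivariantLift lam 1 (momentumReal (Matrix.single i j 1)) := by
  have e : (Matrix.single i j (1 : ℝ)).map Complex.ofReal = Matrix.single i j (1 : ℂ) := by
    have h := Matrix.map_single i j (1 : ℝ) Complex.ofRealHom
    rwa [map_one] at h
  rw [← e]
  refine ⟨_, isPrincipalSymbol_lieDeriv _, fun g => ?_⟩
  rw [conj_lieDeriv, actFun_momentumReal]
  exact isPrincipalSymbol_lieDeriv _

theorem isPrincipalSymbol_one : IsPrincipalSymbol 0 (1 : Module.End ℂ (Dens n lam)) 1 := by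
  rw [isPrincipalSymbol_iff]
  intro k
  refine ⟨1, HasFullSymbol.one k, monomial_mem_degLT (by simp) 1, ?_⟩
  rw [MvPolynomial.homogeneousComponent_eq_self (MvPolynomial.isHomogeneous_one _ _)]
  exact HasSymbol.one k

theorem hasEquivariantLift_one : HasEquivariantLift lam 0 (1 : CotP ℝ n → ℂ) :=
  ⟨1, isPrincipalSymbol_one, fun g => by rw [map_one]; exact isPrincipalSymbol_one⟩

theorem HasEquivariantLift.pow {φ : CotP ℝ n → ℂ} (hφ : HasEquivariantLift lam 1 φ) (m : ℕ) :
    HasEquivariantLift lam m (φ ^ m) := by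
  induction m with
  | zero =>
    rw [pow_zero]
    exact hasEquivariantLift_one
  | succ m ih =>
    rw [pow_succ]
    exact ih.mul hφ

theorem HasEquivariantLift.prod {ι : Type*} (t : Finset ι) {d : ι → ℕ} {φ : ι → CotP ℝ n → ℂ}
    (h : ∀ i ∈ t, HasEquivariantLift lam (d i) (φ i)) :
    HasEquivariantLift lam (∑ i ∈ t, d i) (∏ i ∈ t, φ i) := by
  classical
  induction t using Finset.induction_on with
  | empty =>
    rw [Finset.sum_empty, Finset.prod_empty]
    exact hasEquivariantLift_one
  | insert i t hi ih =>
    rw [Finset.sum_insert hi, Finset.prod_insert hi]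
    exact (h i (Finset.mem_insert_self i t)).mul (ih fun j hj => h j (Finset.mem_insert_of_mem hj))

theorem baseFun_mk (f : Dens n 0) (u p : Fin (n + 1) → ℝ) (hu : u ≠ 0) (hp : p ⬝ᵥ u = 0) :
    baseFun f (CotP.mk u p hu hp) = f.1 u := rfl

theorem momentumReal_single_mk (i j : Fin (n + 1)) (u p : Fin (n + 1) → ℝ) (hu : u ≠ 0)
    (hp : p ⬝ᵥ u = 0) :
    momentumReal (Matrix.single i j 1) (CotP.mk u p hu hp) = -((p i * u j : ℝ) : ℂ) := by
  change -((fun i => (p i : ℂ)) ⬝ᵥ (Matrix.single i j (1 : ℂ) *ᵥ fun i => (u i : ℂ))) = _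
  simp [Matrix.single_mulVec, dotProduct, Function.update_apply]

/-- A symbol is a polynomial in the momentum functions, with coefficients functions on `ℝℙⁿ`. -/
theorem symbol_eq_sum {φ : CotP ℝ n → ℂ} {a : Fin (n + 1) → PolSmooth n}
    (ha : ∀ k, HasSymbol k φ (a k)) :
    φ = ∑ k, ∑ α ∈ (a k).support, baseFun (cutoff k ((a k).coeff α)) *
      ∏ j, ((-1 : ℂ) • momentumReal (Matrix.single (k.succAbove j) k 1)) ^ α j := by
  funext x
  simp only [Finset.sum_apply, Pi.mul_apply, Finset.prod_apply, Pi.pow_apply, Pi.smul_apply]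
  induction x using Quotient.inductionOn with
  | _ x =>
    obtain ⟨⟨u, p⟩, hu, hp⟩ := x
    change φ (CotP.mk u p hu hp) = ∑ k, ∑ α ∈ (a k).support,
      baseFun (cutoff k ((a k).coeff α)) (CotP.mk u p hu hp) *
        ∏ j, ((-1 : ℂ) • momentumReal (Matrix.single (k.succAbove j) k 1)
          (CotP.mk u p hu hp)) ^ α j
    -- In the chart `k` the conjugate momentum `u_k p_j` is minus the momentum function of `E_jk`,
    -- so the inner sum is `φ` times a member of the partition of unity.
    have h : ∀ k, ∑ α ∈ (a k).support,
        baseFun (cutoff k ((a k).coeff α)) (CotP.mk u p hu hp) *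
          ∏ j, ((-1 : ℂ) • momentumReal (Matrix.single (k.succAbove j) k 1)
            (CotP.mk u p hu hp)) ^ α j =
        ((bump k u / ∑ l, bump l u : ℝ) : ℂ) * φ (CotP.mk u p hu hp) := by
      intro k
      by_cases hk : u k = 0
      · rw [bump_of_eq_zero hk, zero_div, Complex.ofReal_zero, zero_mul]
        refine Finset.sum_eq_zero fun α _ => ?_
        rw [baseFun_mk, cutoff_apply_of_eq_zero _ hk, zero_mul]
      · rw [ha k u p hu hp hk, MvPolynomial.eval₂_eq', Finset.mul_sum]
        refine Finset.sum_congr rfl fun α _ => ?_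
        rw [baseFun_mk, cutoff_apply _ hk, mul_assoc]
        congr 2
        refine Finset.prod_congr rfl fun j _ => ?_
        rw [momentumReal_single_mk, smul_neg, neg_smul, one_smul, neg_neg, mul_comm (u k)]
    rw [Finset.sum_congr rfl fun k _ => h k, ← Finset.sum_mul, ← Complex.ofReal_sum,
      ← Finset.sum_div, div_self (sum_bump_pos hu).ne', Complex.ofReal_one, one_mul]

/-- Conjugation carries multiplication operators to multiplication operators and Lie derivatives to
Lie derivatives, with the expected symbols. Lifts can be added and multiplied, and `symbol_eq_sum`
builds every homogeneous symbol from these two kinds; no transformation rule for full symbols is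
needed. -/
theorem hasEquivariantLift_of_mem {d : ℕ} {φ : Sym n} (hφ : φ ∈ SymDeg n d) :
    HasEquivariantLift lam d φ.1 := by
  choose a ha ha' using hφ
  rw [symbol_eq_sum ha']
  refine HasEquivariantLift.sum _ fun k _ => HasEquivariantLift.sum _ fun α hα => ?_
  have h : α.degree = d := by
    by_contra hne
    exact MvPolynomial.mem_support_iff.1 hα ((ha k).coeff_eq_zero hne)
  have h' : ∑ j, α j = d := by rw [← h, Finsupp.degree_eq_sum]
  rw [← h', ← zero_add (∑ j, α j)]
  exact (hasEquivariantLift_baseFun _).mul (HasEquivariantLift.prod _ fun j _ =>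
    ((hasEquivariantLift_momentumReal _ _).smul _).pow _)

theorem exists_isPrincipalSymbol_eq {d : ℕ} {φ : Sym n} (hφ : φ ∈ SymDeg n d) :
    ∃ P : Module.End ℂ (Dens n lam), IsPrincipalSymbol d P φ.1 := by
  obtain ⟨P, hP, _⟩ := hasEquivariantLift_of_mem (lam := lam) hφ
  exact ⟨P, hP⟩

theorem conj_sub (g : Matrix.SpecialLinearGroup (Fin (n + 1)) ℝ)
    (P R : Module.End ℂ (Dens n lam)) : conj lam g (P - R) = conj lam g P - conj lam g R :=
  map_sub (conj lam g) P R

/-- Subtracting an equivariant lift of the principal symbol lowers the order, and the lift itself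
keeps its order under conjugation; so induction on the order applies. -/
theorem conj_mem_ordLT (g : Matrix.SpecialLinearGroup (Fin (n + 1)) ℝ) {d : ℕ}
    {P : Module.End ℂ (Dens n lam)} (hP : P ∈ OrdLT n lam d) : conj lam g P ∈ OrdLT n lam d := by
  induction d generalizing P with
  | zero =>
    rw [ordLT_zero hP, map_zero]
    exact Submodule.zero_mem _
  | succ d ih =>
    obtain ⟨φ, hφ, h⟩ := exists_isPrincipalSymbol hP
    obtain ⟨R, hR, hR'⟩ := hasEquivariantLift_of_mem (lam := lam) hφ
    have h1 := ih (h.sub_mem hR)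
    rw [conj_sub] at h1
    have h2 := Submodule.add_mem _ (ordLT_mono (Nat.le_succ d) h1) (hR' g).mem_ordLT
    have e : conj lam g P - conj lam g R + conj lam g R = conj lam g P := by abel
    rwa [e] at h2

/-- The operator differs from an equivariant lift of its symbol by lower order terms, which stay of
lower order by `conj_mem_ordLT`. -/
theorem IsPrincipalSymbol.conj {d : ℕ} {P : Module.End ℂ (Dens n lam)} {φ : CotP ℝ n → ℂ}
    (h : IsPrincipalSymbol d P φ) (g : Matrix.SpecialLinearGroup (Fin (n + 1)) ℝ) :
    IsPrincipalSymbol d (conj lam g P) (actFun g φ) := by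
  obtain ⟨ψ, hψ, h'⟩ := exists_isPrincipalSymbol h.mem_ordLT
  rw [h.unique h']
  obtain ⟨R, hR, hR'⟩ := hasEquivariantLift_of_mem (lam := lam) hψ
  have h1 := conj_mem_ordLT g (h'.sub_mem hR)
  rw [conj_sub] at h1
  have h2 := (hR' g).add (isPrincipalSymbol_zero_of_mem h1)
  have e : ProjQuant.conj lam g R + (ProjQuant.conj lam g P - ProjQuant.conj lam g R) =
    ProjQuant.conj lam g P := by abel
  rwa [e, add_zero] at h2

end ConjSymbol

/-! ### The Casimir operator -/

section CasimirAlgebra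

variable {R : Type*} [Ring R] {r : ℕ} {A : Fin r → Fin r → R}

/-- The commutator with `A k l` acts as a derivation on each product `A i j * A j i`. After the
Kronecker deltas are summed out, the four remaining sums cancel in pairs. -/
theorem casimir_commute (hA : ∀ i j k l, A i j * A k l - A k l * A i j =
      (if j = k then A i l else 0) - (if i = l then A k j else 0)) (k l : Fin r) :
    A k l * ∑ i, ∑ j, A i j * A j i = (∑ i, ∑ j, A i j * A j i) * A k l := by
  rw [← sub_eq_zero, Finset.mul_sum, Finset.sum_mul, ← Finset.sum_sub_distrib]
  have h : ∀ i j, A k l * (A i j * A j i) - A i j * A j i * A k l =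
      ((if l = i then A k j * A j i else 0) - (if k = j then A i l * A j i else 0)) +
      ((if l = j then A i j * A k i else 0) - (if k = i then A i j * A j l else 0)) := by
    intro i j
    have e : A k l * (A i j * A j i) - A i j * A j i * A k l =
        (A k l * A i j - A i j * A k l) * A j i + A i j * (A k l * A j i - A j i * A k l) := by
      noncomm_ring
    rw [e, hA, hA, sub_mul, mul_sub, ite_mul, ite_mul, mul_ite, mul_ite]
    simp only [zero_mul, mul_zero]
  have h' : ∀ i, A k l * ∑ j, A i j * A j i - (∑ j, A i j * A j i) * A k l =
      ∑ j, (((if l = i then A k j * A j i else 0) - (if k = j then A i l * A j i else 0)) +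
        ((if l = j then A i j * A k i else 0) - (if k = i then A i j * A j l else 0))) := by
    intro i
    rw [Finset.mul_sum, Finset.sum_mul, ← Finset.sum_sub_distrib]
    exact Finset.sum_congr rfl fun j _ => h i j
  rw [Finset.sum_congr rfl fun i _ => h' i]
  simp only [Finset.sum_add_distrib, Finset.sum_sub_distrib, Finset.sum_ite_eq, Finset.mem_univ,
    if_true]
  rw [Finset.sum_comm (f := fun i j => if l = i then A k j * A j i else 0),
    Finset.sum_comm (f := fun i j => if k = i then A i j * A j l else 0)]
  simp only [Finset.sum_ite_eq, Finset.mem_univ, if_true]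
  abel

/-- Summation over `i` and `j` contracts the coefficients through `g h = 1`, so the Casimir element
does not depend on the basis used to form it. -/
theorem casimir_conj [Algebra ℂ R] {g h : Matrix (Fin r) (Fin r) ℂ} (hgh : g * h = 1) :
    ∑ i, ∑ j, (∑ a, ∑ b, (g a i * h j b) • A a b) * (∑ a, ∑ b, (g a j * h i b) • A a b) =
      ∑ i, ∑ j, A i j * A j i := by
  have e : ∀ a b c d : Fin r, ∑ i, ∑ j, (g a i * h j b) * (g c j * h i d) =
      (if a = d then 1 else 0) * (if c = b then 1 else 0) := by
    intro a b c d
    have h1 : ∑ i, g a i * h i d = if a = d then 1 else 0 := by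
      rw [← Matrix.mul_apply, hgh, Matrix.one_apply]
    have h2 : ∑ i, g c i * h i b = if c = b then 1 else 0 := by
      rw [← Matrix.mul_apply, hgh, Matrix.one_apply]
    rw [← h1, ← h2, Finset.sum_mul_sum]
    refine Finset.sum_congr rfl fun i _ => Finset.sum_congr rfl fun j _ => by ring
  calc _ = ∑ i, ∑ j, ∑ a, ∑ b, ∑ c, ∑ d, ((g a i * h j b) * (g c j * h i d)) • (A a b * A c d) := by
        refine Finset.sum_congr rfl fun i _ => Finset.sum_congr rfl fun j _ => ?_
        rw [Finset.sum_mul]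
        refine Finset.sum_congr rfl fun a _ => ?_
        rw [Finset.sum_mul]
        refine Finset.sum_congr rfl fun b _ => ?_
        simp only [Finset.mul_sum, smul_mul_smul_comm]
    _ = ∑ a, ∑ b, ∑ c, ∑ d, (∑ i, ∑ j, (g a i * h j b) * (g c j * h i d)) • (A a b * A c d) := by
        simp only [Finset.sum_smul]
        rw [Finset.sum_congr rfl fun i _ => Finset.sum_comm, Finset.sum_comm]
        refine Finset.sum_congr rfl fun a _ => ?_
        rw [Finset.sum_congr rfl fun i _ => Finset.sum_comm, Finset.sum_comm]
        refine Finset.sum_congr rfl fun b _ => ?_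
        rw [Finset.sum_congr rfl fun i _ => Finset.sum_comm, Finset.sum_comm]
        refine Finset.sum_congr rfl fun c _ => ?_
        rw [Finset.sum_congr rfl fun i _ => Finset.sum_comm, Finset.sum_comm]
    _ = _ := by
        refine Finset.sum_congr rfl fun a _ => Finset.sum_congr rfl fun b _ => ?_
        simp only [e]
        rw [Finset.sum_eq_single_of_mem b (Finset.mem_univ b),
          Finset.sum_eq_single_of_mem a (Finset.mem_univ a)]
        · simp
        · intro d _ hd
          simp [Ne.symm hd]
        · intro c _ hc
          simp [hc]

variable [Algebra ℂ R]

/-- The commutator with an element. -/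
def ad : R →ₗ[ℂ] Module.End ℂ R := LinearMap.mul ℂ R - (LinearMap.mul ℂ R).flip

theorem ad_apply (x y : R) : ad x y = x * y - y * x := rfl

theorem ad_commutator (x y : R) : ad (x * y - y * x) = ad x * ad y - ad y * ad x := by
  ext1 z
  simp only [ad_apply, LinearMap.sub_apply, Module.End.mul_apply]
  noncomm_ring

variable (A) in
/-- The Casimir operator of the adjoint action of a family of elements. -/
def casimir : Module.End ℂ R := ∑ i, ∑ j, ad (A i j) * ad (A j i)

theorem casimir_apply (x : R) : casimir A x = ∑ i, ∑ j, ad (A i j) (ad (A j i) x) := by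
  simp only [casimir, LinearMap.sum_apply, Module.End.mul_apply]

/-- By `ad_commutator` the operators `ad (A i j)` satisfy the same relations as the `A i j`, so
`casimir_commute` applies to them. -/
theorem casimir_ad (hA : ∀ i j k l, A i j * A k l - A k l * A i j =
      (if j = k then A i l else 0) - (if i = l then A k j else 0)) (k l : Fin r) (x : R) :
    casimir A (ad (A k l) x) = ad (A k l) (casimir A x) := by
  have h := casimir_commute (A := fun i j => ad (A i j)) (fun i j k l => by
    rw [← ad_commutator, hA, map_sub]
    congr 1 <;> split_ifs <;> simp) k l
  exact (congrArg (fun T => T x) h).symm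

theorem casimir_algHom {g h : Matrix (Fin r) (Fin r) ℂ} (hgh : g * h = 1) (σ : R →ₐ[ℂ] R)
    (hσ : ∀ i j, σ (A i j) = ∑ a, ∑ b, (g a i * h j b) • A a b) (x : R) :
    casimir A (σ x) = σ (casimir A x) := by
  have h1 : ∀ y z, σ (ad y z) = ad (σ y) (σ z) := fun y z => by
    rw [ad_apply, ad_apply, map_sub, map_mul, map_mul]
  have h2 : ∀ i j, ad (σ (A i j)) = ∑ a, ∑ b, (g a i * h j b) • ad (A a b) := by
    intro i j
    rw [hσ]
    simp only [map_sum, map_smul]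
  have h3 := casimir_conj (A := fun i j => ad (A i j)) hgh
  rw [← casimir] at h3
  have h4 := congrArg (fun T => T (σ x)) h3
  rw [casimir_apply x, map_sum]
  simp only [map_sum, h1, h2]
  simp only [LinearMap.sum_apply, Module.End.mul_apply] at h4 ⊢
  exact h4.symm

end CasimirAlgebra

/-! ### Eigenvectors of operators on filtered spaces -/

section Filtered

variable {V : Type*} [AddCommGroup V] [Module ℂ V] {T : V → V} {W : ℕ → Submodule ℂ V}
  {c : ℕ → ℂ}

/-- On the graded pieces below `m` the operator `T - c'` acts by the nonzero scalars `c i - c'`.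
Dividing the leading term by such a scalar solves the equation up to an element of the preceding
step. -/
theorem exists_sub_smul_eq (hT : ∀ x y, T (x - y) = T x - T y) (h0 : ∀ x ∈ W 0, x = 0) (hmono : ∀ d, W d ≤ W (d + 1))
    (h : ∀ d, ∀ x ∈ W (d + 1), T x - c d • x ∈ W d) {m : ℕ} {c' : ℂ} (hc : ∀ i < m, c i ≠ c')
    {w : V} (hw : w ∈ W m) : ∃ v ∈ W m, T v - c' • v = w := by
  induction m generalizing w with
  | zero => exact ⟨0, Submodule.zero_mem _, by
      have e := hT 0 0
      rw [sub_self, sub_self] at e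
      rw [h0 w hw, e, smul_zero, sub_self]⟩
  | succ m ih =>
    have hne : c m - c' ≠ 0 := sub_ne_zero.2 (hc m (Nat.lt_succ_self m))
    have hv := Submodule.smul_mem _ (c m - c')⁻¹ hw
    obtain ⟨v, hv1, hv2⟩ := ih (fun i hi => hc i (Nat.lt_succ_of_lt hi))
      (h m _ hv)
    refine ⟨(c m - c')⁻¹ • w - v, Submodule.sub_mem _ hv (hmono m hv1), ?_⟩
    have e : w = (c m - c') • (c m - c')⁻¹ • w := by rw [smul_smul, mul_inv_cancel₀ hne, one_smul]
    rw [hT]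
    conv_rhs => rw [e]
    generalize (c m - c')⁻¹ • w = w' at *
    rw [smul_sub, sub_smul]
    have e2 : T w' - T v - (c' • w' - c' • v) = (T w' - c m • w') - (T v - c' • v) +
        (c m • w' - c' • w') := by abel
    rw [e2, hv2, sub_self, zero_add]

/-- The error `T x - c d • x` lies in `W d`, where all scalars differ from `c d`, so it can be
compensated by a `y` in `W d`. -/
theorem exists_eigenvector (hT : ∀ x y, T (x - y) = T x - T y) (h0 : ∀ x ∈ W 0, x = 0) (hmono : ∀ d, W d ≤ W (d + 1))
    (h : ∀ d, ∀ x ∈ W (d + 1), T x - c d • x ∈ W d) (hc : Function.Injective c) {d : ℕ} {x : V}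
    (hx : x ∈ W (d + 1)) : ∃ y ∈ W d, T (x - y) = c d • (x - y) := by
  obtain ⟨y, hy, hy'⟩ := exists_sub_smul_eq hT h0 hmono h (m := d) (c' := c d)
    (fun i hi heq => hi.ne (hc heq)) (h d x hx)
  refine ⟨y, hy, ?_⟩
  rw [← sub_eq_zero, hT, smul_sub]
  have e : T x - T y - (c d • x - c d • y) = (T x - c d • x) - (T y - c d • y) := by abel
  rw [e, hy', sub_self]

/-- An eigenvector in `W (m + 1)` is multiplied by `c' - c m ≠ 0` modulo `W m`, hence it lies in `W
m`; this descends to `W 0`. -/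
theorem eigenvector_eq_zero (h0 : ∀ x ∈ W 0, x = 0)
    (h : ∀ d, ∀ x ∈ W (d + 1), T x - c d • x ∈ W d) {m : ℕ} {c' : ℂ} (hc : ∀ i < m, c i ≠ c')
    {x : V} (hx : x ∈ W m) (hTx : T x = c' • x) : x = 0 := by
  induction m with
  | zero => exact h0 x hx
  | succ m ih =>
    refine ih (fun i hi => hc i (Nat.lt_succ_of_lt hi)) ?_
    have h1 := h m x hx
    rw [hTx, ← sub_smul] at h1
    have hne : c' - c m ≠ 0 := sub_ne_zero.2 (hc m (Nat.lt_succ_self m)).symm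
    have h2 := Submodule.smul_mem _ (c' - c m)⁻¹ h1
    rwa [smul_smul, inv_mul_cancel₀ hne, one_smul] at h2

end Filtered

/-! ### The Casimir operator on differential operators on densities -/

section Casimir

variable {n : ℕ} {lam : ℂ}

theorem ad_eq (P R : Module.End ℂ (Dens n lam)) : ad P R = P * R - R * P := rfl

/-- The Lie derivative along the vector field of an elementary matrix. -/
def eta (lam : ℂ) (i j : Fin (n + 1)) : Module.End ℂ (Dens n lam) :=
  lieDeriv lam (Matrix.single i j 1)

/-- These are the relations of the elementary matrices in `gl_{n+1}`. They hold for the fields `-y_j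
D_i` in every ring with commuting derivations dual to the coordinates `y`. -/
theorem eta_commutator (i j k l : Fin (n + 1)) : eta lam i j * eta lam k l -
    eta lam k l * eta lam i j = (if j = k then eta lam i l else 0) -
      (if i = l then eta lam k j else 0) := by
  have gen : ∀ {S : Type} [CommRing S] [Algebra ℂ S] {D : Fin (n + 1) → Derivation ℂ S S}
      (_ : Commuting D) {y : Fin (n + 1) → S} (_ : ∀ i j, D i (y j) = if i = j then 1 else 0) (s : S),
      -(y j * D i (-(y l * D k s))) - -(y l * D k (-(y j * D i s))) =
        (if j = k then -(y l * D i s) else 0) - (if i = l then -(y j * D k s) else 0) := by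
    intro S _ _ D hD y hy s
    simp only [map_neg, Derivation.leibniz, hy, smul_eq_mul, hD k i s, eq_comm (a := k)]
    split_ifs <;> ring
  ext1 s
  refine densOn_injective ?_
  have h := gen (partials_commuting (𝕜 := ℝ) (O := punctured n)) (y := coord) partials_coord
    (densOn (punctured n) le_rfl s)
  simp only [← densOn_lieDeriv] at h
  rw [LinearMap.sub_apply, LinearMap.sub_apply, map_sub, map_sub]
  refine h.trans ?_
  congr 1
  · split_ifs
    · rfl
    · rw [LinearMap.zero_apply, map_zero]
  · split_ifs
    · rfl
    · rw [LinearMap.zero_apply, map_zero]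

theorem casimir_ad_lieDeriv (x : Matrix (Fin (n + 1)) (Fin (n + 1)) ℝ)
    (P : Module.End ℂ (Dens n lam)) :
    casimir (eta lam) (ad (lieDeriv lam x) P) = ad (lieDeriv lam x) (casimir (eta lam) P) := by
  have h : ∀ R, ad (lieDeriv lam x) R = ∑ i, ∑ j, (x i j : ℂ) • ad (eta lam i j) R := by
    intro R
    rw [lieDeriv_eq_sum]
    simp only [map_sum, map_smul, LinearMap.sum_apply, LinearMap.smul_apply]
    rfl
  rw [h, h, map_sum]
  refine Finset.sum_congr rfl fun i _ => ?_
  rw [map_sum]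
  refine Finset.sum_congr rfl fun j _ => ?_
  rw [map_smul, casimir_ad (A := eta (n := n) lam) eta_commutator]

theorem casimir_conj_apply (g : Matrix.SpecialLinearGroup (Fin (n + 1)) ℝ)
    (P : Module.End ℂ (Dens n lam)) :
    casimir (eta lam) (conj lam g P) = conj lam g (casimir (eta lam) P) := by
  have h3 : (g.1.map Complex.ofReal) * ((g⁻¹).1.map Complex.ofReal) = 1 := by
    have h4 : g.1 * (g⁻¹).1 = 1 := by
      rw [← Matrix.SpecialLinearGroup.coe_mul, mul_inv_cancel, Matrix.SpecialLinearGroup.coe_one]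
    have h5 := congrArg (fun M => M.map Complex.ofRealHom) h4
    simp only [Matrix.map_mul] at h5
    refine h5.trans ?_
    exact Matrix.map_one _ (map_zero _) (map_one _)
  refine casimir_algHom (A := eta (n := n) lam) h3 (conj lam g) (fun i j => ?_) P
  rw [eta, conj_lieDeriv, lieDeriv_eq_sum]
  refine Finset.sum_congr rfl fun a _ => Finset.sum_congr rfl fun b _ => ?_
  have e : (g.1 * Matrix.single i j 1 * (g⁻¹).1 : Matrix (Fin (n + 1)) (Fin (n + 1)) ℝ) a b =
      g.1 a i * (g⁻¹).1 j b := by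
    rw [Matrix.mul_apply, Finset.sum_eq_single_of_mem j (Finset.mem_univ j)]
    · simp
    · intro l _ hl
      rw [Matrix.mul_single_apply_of_ne _ _ _ _ _ hl, zero_mul]
  rw [e]
  simp [eta]

theorem casimir_eta_apply (P : Module.End ℂ (Dens n lam)) :
    casimir (eta (n := n) lam) P = ∑ i, ∑ j, ad (eta (n := n) lam i j) (ad (eta (n := n) lam j i) P) :=
  casimir_apply (A := eta (n := n) lam) P

theorem casimir_eta_sub (P R : Module.End ℂ (Dens n lam)) :
    casimir (eta lam) (P - R) = casimir (eta lam) P - casimir (eta lam) R :=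
  map_sub (casimir (eta (n := n) lam)) P R

end Casimir

/-! ### The equivariant quantization map -/

section Quantization

variable {n : ℕ} {lam : ℂ}

/-- The eigenvalue of the Casimir operator on symbols of degree `d`. -/
def casVal (n d : ℕ) : ℂ := ((2 * d * (d + n) : ℕ) : ℂ)

/-- The eigenvalues are distinct and do not involve `lam`, which is why the quantization exists and
is unique for every weight. -/
theorem casVal_injective (n : ℕ) : Function.Injective (casVal n) := by
  have h : StrictMono fun d : ℕ => 2 * d * (d + n) := by
    intro d e hde
    dsimp only
    nlinarith
  intro d e hde
  exact h.injective (Nat.cast_injective hde)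

/-- An operator of order one does not raise the order in a commutator, so the filtration is stable
under `ad X` and the induced map on symbols is a Poisson bracket. -/
theorem IsPrincipalSymbol.ad {e : ℕ} {X R : Module.End ℂ (Dens n lam)} {ξ ψ : CotP ℝ n → ℂ}
    (hX : IsPrincipalSymbol 1 X ξ) (hR : IsPrincipalSymbol e R ψ) :
    ∃ χ ∈ SymDeg n e, IsPrincipalSymbol e (ad X R) χ.1 ∧ IsPoissonBracket ξ ψ χ.1 := by
  have h := IsPrincipalSymbol.commutator (d := 0) hX hR
  rw [zero_add] at h
  exact h

/-- This is `sum_bracket_momSym` freed from charts. The existence proof uses it for commutators of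
operators, and the uniqueness proof for an arbitrary equivariant quantization. -/
theorem sum_isPoissonBracket_momentumReal {d : ℕ} {φ : Sym n} (hφ : φ ∈ SymDeg n d)
    {χ χ' : Fin (n + 1) → Fin (n + 1) → Sym n}
    (hχ : ∀ i j, IsPoissonBracket (momentumReal (Matrix.single j i 1)) φ.1 (χ i j).1)
    (hχ' : ∀ i j, IsPoissonBracket (momentumReal (Matrix.single i j 1)) (χ i j).1 (χ' i j).1) :
    ∑ i, ∑ j, (χ' i j).1 = casVal n d • φ.1 := symbol_ext fun k => by
  obtain ⟨a, ha, ha'⟩ := hφ k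
  have h3 : ∀ i j, HasSymbol k (χ' i j).1 (bracket smoothD (momSym smoothCoord k i j)
      (bracket smoothD (momSym smoothCoord k j i) a)) := by
    intro i j
    obtain ⟨b, c, hb, hc, hbc⟩ := hχ i j k
    rw [hb.unique (hasSymbol_momentumReal k j i), hc.unique ha'] at hbc
    obtain ⟨b', c', hb', hc', hbc'⟩ := hχ' i j k
    rw [hb'.unique (hasSymbol_momentumReal k i j), hc'.unique hbc] at hbc'
    exact hbc'
  have h4 : HasSymbol k (∑ i, ∑ j, (χ' i j).1) _ :=
    hasSymbol_sum _ fun i _ => hasSymbol_sum _ fun j _ => h3 i j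
  rw [sum_bracket_momSym smoothD_commuting smoothD_smoothCoord k ha] at h4
  refine ⟨_, h4, ?_⟩
  have h5 := ha'.smul (casVal n d)
  convert h5 using 1
  rw [casVal, map_natCast, map_natCast, nsmul_eq_mul]

theorem casimir_principal {d : ℕ} {P : Module.End ℂ (Dens n lam)} {φ : Sym n}
    (hφ : φ ∈ SymDeg n d) (hP : IsPrincipalSymbol d P φ.1) :
    IsPrincipalSymbol d (casimir (eta lam) P) (casVal n d • φ.1) := by
  choose χ hχ hχ1 hχ2 using fun i j =>
    (isPrincipalSymbol_lieDeriv_single (lam := lam) j i).ad hP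
  choose χ' hχ' hχ1' hχ2' using fun i j =>
    (isPrincipalSymbol_lieDeriv_single (lam := lam) i j).ad (hχ1 i j)
  rw [casimir_eta_apply, ← sum_isPoissonBracket_momentumReal hφ hχ2 hχ2']
  exact IsPrincipalSymbol.sum _ fun i _ => IsPrincipalSymbol.sum _ fun j _ => hχ1' i j

/-- Both terms have the same principal symbol of degree `d`. This is the hypothesis of the
eigenvector lemmas for the order filtration. -/
theorem casimir_sub_mem {d : ℕ} {P : Module.End ℂ (Dens n lam)} (hP : P ∈ OrdLT n lam (d + 1)) :
    casimir (eta lam) P - casVal n d • P ∈ OrdLT n lam d := by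
  obtain ⟨φ, hφ, h⟩ := exists_isPrincipalSymbol hP
  exact (casimir_principal hφ h).sub_mem (h.smul _)

/-- `P` is the operator with principal symbol `φ` of degree `d` on which the Casimir operator acts
by its eigenvalue. -/
def IsEigenLift (d : ℕ) (P : Module.End ℂ (Dens n lam)) (φ : CotP ℝ n → ℂ) : Prop :=
  IsPrincipalSymbol d P φ ∧ casimir (eta lam) P = casVal n d • P

theorem operator_sub_mem {U : Submodule ℂ (Module.End ℂ (Dens n lam))}
    {P R : Module.End ℂ (Dens n lam)} (hP : P ∈ U) (hR : R ∈ U) : P - R ∈ U :=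
  @Submodule.sub_mem ℂ (Module.End ℂ (Dens n lam)) _ _ _ U P R hP hR

set_option maxHeartbeats 1000000 in
/-- Eigenlifts can be found in every subspace invariant under the Casimir operator. -/
theorem exists_isEigenLift_mem (U : Submodule ℂ (Module.End ℂ (Dens n lam)))
    (hU : ∀ P ∈ U, casimir (eta lam) P ∈ U) {d : ℕ} {P : Module.End ℂ (Dens n lam)} (hPU : P ∈ U)
    {φ : CotP ℝ n → ℂ} (hP : IsPrincipalSymbol d P φ) :
    ∃ R ∈ U, IsEigenLift d R φ := by
  have h1 : ∀ (d : ℕ) (x : Module.End ℂ (Dens n lam)), x ∈ OrdLT n lam (d + 1) ⊓ U →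
      casimir (eta lam) x - casVal n d • x ∈ OrdLT n lam d ⊓ U := by
    intro d x hx
    exact Submodule.mem_inf.2 ⟨casimir_sub_mem hx.1, operator_sub_mem (hU x hx.2) (U.smul_mem _ hx.2)⟩
  have h2 : ∀ x : Module.End ℂ (Dens n lam), x ∈ OrdLT n lam 0 ⊓ U → x = 0 :=
    fun x hx => ordLT_zero hx.1
  -- The filtration is the one induced on `U` by the order. The correction `y` lies in `U` and has
  -- order below `d`, so the principal symbol is not affected.
  obtain ⟨y, hy, hy'⟩ := exists_eigenvector (T := fun P => casimir (eta (n := n) lam) P)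
    (W := fun d => OrdLT n lam d ⊓ U) (c := casVal n) casimir_eta_sub h2
    (fun d => inf_le_inf_right U (ordLT_mono (Nat.le_succ d))) h1
    (casVal_injective n) (d := d) (x := P) ⟨hP.mem_ordLT, hPU⟩
  refine ⟨P - y, operator_sub_mem hPU hy.2, ?_, hy'⟩
  have h := hP.sub (isPrincipalSymbol_zero_of_mem hy.1)
  rwa [sub_zero] at h

theorem exists_isEigenLift {d : ℕ} {φ : Sym n} (hφ : φ ∈ SymDeg n d) :
    ∃ P : Module.End ℂ (Dens n lam), IsEigenLift d P φ.1 := by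
  obtain ⟨P, hP⟩ := exists_isPrincipalSymbol_eq (lam := lam) hφ
  obtain ⟨R, _, hR⟩ := exists_isEigenLift_mem
    (⊤ : Submodule ℂ (Module.End ℂ (Dens n lam))) (fun _ _ => Submodule.mem_top)
    Submodule.mem_top hP
  exact ⟨R, hR⟩

theorem IsEigenLift.add {d : ℕ} {P R : Module.End ℂ (Dens n lam)} {φ ψ : CotP ℝ n → ℂ}
    (hP : IsEigenLift d P φ) (hR : IsEigenLift d R ψ) : IsEigenLift d (P + R) (φ + ψ) :=
  ⟨hP.1.add hR.1, by rw [map_add, hP.2, hR.2, smul_add]⟩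

theorem IsEigenLift.smul {d : ℕ} {P : Module.End ℂ (Dens n lam)} {φ : CotP ℝ n → ℂ}
    (hP : IsEigenLift d P φ) (c : ℂ) : IsEigenLift d (c • P) (c • φ) :=
  ⟨hP.1.smul c, by rw [map_smul, hP.2, smul_comm]⟩

/-- The difference of two eigenlifts has order below `d` but eigenvalue `casVal n d`, which does not
occur there. -/
theorem IsEigenLift.unique {d : ℕ} {P R : Module.End ℂ (Dens n lam)} {φ : CotP ℝ n → ℂ}
    (hP : IsEigenLift d P φ) (hR : IsEigenLift d R φ) : P = R := by
  have h1 : casimir (eta lam) (P - R) = casVal n d • (P - R) := by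
    rw [casimir_eta_sub, hP.2, hR.2]
    exact (smul_sub (casVal n d) P R).symm
  have h2 : ∀ (d : ℕ) (x : Module.End ℂ (Dens n lam)), x ∈ OrdLT n lam (d + 1) →
    casimir (eta lam) x - casVal n d • x ∈ OrdLT n lam d := fun d x hx => casimir_sub_mem hx
  have h3 : ∀ x : Module.End ℂ (Dens n lam), x ∈ OrdLT n lam 0 → x = 0 := fun x hx => ordLT_zero hx
  have h4 : P - R ∈ OrdLT n lam d := hP.1.sub_mem hR.1
  have h := eigenvector_eq_zero (T := fun P => casimir (eta (n := n) lam) P) (W := OrdLT n lam)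
    (c := casVal n) h3 h2 (m := d)
    (c' := casVal n d) (fun i hi heq => hi.ne (casVal_injective n heq)) h4 h1
  have e : P - R + R = P := by abel
  rw [← e, h]
  exact zero_add R

/-- The Casimir operator commutes with `ad (lieDeriv lam x)`, so the commutator is again an
eigenlift. Uniqueness of eigenlifts turns this into the infinitesimal equivariance of the
quantization. -/
theorem IsEigenLift.ad {d : ℕ} {P : Module.End ℂ (Dens n lam)} {φ : CotP ℝ n → ℂ}
    (hP : IsEigenLift d P φ) (x : Matrix (Fin (n + 1)) (Fin (n + 1)) ℝ) :
    ∃ χ ∈ SymDeg n d, IsEigenLift d (ad (lieDeriv lam x) P) χ.1 ∧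
      IsPoissonBracket (momentumReal (x.map Complex.ofReal)) φ χ.1 := by
  obtain ⟨χ, h1, h2, h3⟩ := (isPrincipalSymbol_lieDeriv x).ad hP.1
  refine ⟨χ, h1, ⟨h2, ?_⟩, h3⟩
  rw [casimir_ad_lieDeriv, hP.2, map_smul]

theorem IsEigenLift.conj {d : ℕ} {P : Module.End ℂ (Dens n lam)} {φ : CotP ℝ n → ℂ}
    (hP : IsEigenLift d P φ) (g : Matrix.SpecialLinearGroup (Fin (n + 1)) ℝ) :
    IsEigenLift d (conj lam g P) (actFun g φ) :=
  ⟨hP.1.conj g, by rw [casimir_conj_apply, hP.2, map_smul]⟩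

/-- The eigenlift of a homogeneous symbol. -/
def eigenLift (lam : ℂ) (d : ℕ) : SymDeg n d →ₗ[ℂ] Module.End ℂ (Dens n lam) where
  toFun φ := (exists_isEigenLift (lam := lam) φ.2).choose
  map_add' φ ψ := (exists_isEigenLift (lam := lam) (φ + ψ).2).choose_spec.unique
    ((exists_isEigenLift (lam := lam) φ.2).choose_spec.add
      (exists_isEigenLift (lam := lam) ψ.2).choose_spec)
  map_smul' c φ := (exists_isEigenLift (lam := lam) (c • φ).2).choose_spec.unique
    ((exists_isEigenLift (lam := lam) φ.2).choose_spec.smul c)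

theorem isEigenLift_eigenLift {d : ℕ} (φ : SymDeg n d) :
    IsEigenLift d (eigenLift lam d φ) φ.1.1 :=
  (exists_isEigenLift (lam := lam) φ.2).choose_spec

/-- The component of degree `d` of a symbol, as an element of the graded piece. -/
def symCompDeg (d : ℕ) : Sym n →ₗ[ℂ] SymDeg n d := (symComp d).codRestrict (SymDeg n d) (symComp_mem d)

theorem finite_support_quant (φ : Sym n) :
    (Function.support fun d => eigenLift lam d (symCompDeg d φ)).Finite := by
  obtain ⟨N, hN, _⟩ := exists_sum_symComp φ
  refine (Finset.range N).finite_toSet.subset fun d hd => ?_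
  by_contra h
  refine hd ?_
  have e : symCompDeg d φ = 0 := Subtype.ext (hN d (by simpa using h))
  dsimp only
  rw [e, map_zero]

/-- The quantization map, as a linear map to operators. -/
def quantLin (n : ℕ) (lam : ℂ) : Sym n →ₗ[ℂ] Module.End ℂ (Dens n lam) where
  toFun φ := ∑ᶠ d, eigenLift lam d (symCompDeg d φ)
  map_add' φ ψ := by
    simp only [map_add]
    exact finsum_add_distrib (finite_support_quant φ) (finite_support_quant ψ)
  map_smul' c φ := by
    simp only [map_smul, RingHom.id_apply]
    exact (smul_finsum' c (finite_support_quant φ)).symm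

theorem quantLin_of_mem {d : ℕ} {φ : Sym n} (hφ : φ ∈ SymDeg n d) :
    IsEigenLift d (quantLin n lam φ) φ.1 := by
  have h : quantLin n lam φ = eigenLift lam d (symCompDeg d φ) := by
    refine finsum_eq_single _ d fun e he => ?_
    have e : symCompDeg e φ = 0 := Subtype.ext (symComp_of_ne he hφ)
    rw [e, map_zero]
  rw [h]
  have h2 := isEigenLift_eigenLift (lam := lam) (symCompDeg d φ)
  have e : (symCompDeg d φ).1 = φ := symComp_of_mem hφ
  rwa [e] at h2

theorem quantLin_mem_diffOp (φ : Sym n) : quantLin n lam φ ∈ DiffOp n lam := by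
  induction φ using sym_induction with
  | hom d φ hφ => exact ordLT_le_diffOp _ (quantLin_of_mem hφ).1.mem_ordLT
  | add φ ψ hφ hψ =>
    rw [map_add]
    exact Submodule.add_mem _ hφ hψ

/-- The quantization of a symbol of degree at most `d` has the component of degree `d` as its
principal symbol. -/
theorem quantLin_principal {d : ℕ} {φ : Sym n} (hφ : ∀ e, d < e → symComp e φ = 0) :
    IsPrincipalSymbol d (quantLin n lam φ) (symComp d φ).1 := by
  have e : φ = ∑ i ∈ Finset.range d, symComp i φ + symComp d φ := by
    refine sym_ext_symComp fun j => ?_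
    rw [← Finset.sum_range_succ, symComp_sum_range (fun i => symComp_mem i φ)]
    split_ifs with h
    · rfl
    · exact hφ j (by omega)
  have h1 : quantLin n lam (∑ i ∈ Finset.range d, symComp i φ) ∈ OrdLT n lam d := by
    rw [map_sum]
    refine Submodule.sum_mem _ fun i hi => ?_
    exact ordLT_mono (Finset.mem_range.1 hi) (quantLin_of_mem (symComp_mem i φ)).1.mem_ordLT
  have h2 := (isPrincipalSymbol_zero_of_mem h1).add
    (quantLin_of_mem (lam := lam) (symComp_mem d φ)).1
  rw [zero_add, ← map_add, ← e] at h2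
  exact h2

/-- The component of highest degree is the principal symbol of the quantization, so in the kernel
the components vanish from the top downwards. -/
theorem quantLin_injective : Function.Injective (quantLin n lam) := by
  refine (injective_iff_map_eq_zero (quantLin n lam)).2 fun φ hφ => ?_
  have h : ∀ N, (∀ e, N ≤ e → symComp e φ = 0) → φ = 0 := by
    intro N
    induction N with
    | zero =>
      intro h
      refine sym_ext_symComp fun d => ?_
      rw [h d (Nat.zero_le d), map_zero]
    | succ N ih =>
      intro h
      refine ih fun e he => ?_
      rcases he.eq_or_lt with rfl | he
      · have h1 := quantLin_principal (lam := lam) (d := N) (φ := φ) (fun e he => h e he)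
        rw [hφ] at h1
        exact Subtype.ext (h1.unique (isPrincipalSymbol_zero_of_mem (Submodule.zero_mem _)))
      · exact h e he
  obtain ⟨N, hN, _⟩ := exists_sum_symComp φ
  exact h N hN

/-- Subtracting the quantization of its principal symbol lowers the order of an operator. -/
theorem exists_quantLin_eq {d : ℕ} {P : Module.End ℂ (Dens n lam)} (hP : P ∈ OrdLT n lam d) :
    ∃ φ, quantLin n lam φ = P := by
  induction d generalizing P with
  | zero => exact ⟨0, by rw [ordLT_zero hP, map_zero]⟩
  | succ d ih =>
    obtain ⟨φ, hφ, h⟩ := exists_isPrincipalSymbol hP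
    obtain ⟨ψ, hψ⟩ := ih (h.sub_mem (quantLin_of_mem (lam := lam) hφ).1)
    refine ⟨ψ + φ, ?_⟩
    rw [map_add, hψ]
    abel

/-- The equivariant quantization map. -/
def quant (n : ℕ) (lam : ℂ) : Sym n ≃ₗ[ℂ] DiffOp n lam :=
  LinearEquiv.ofBijective ((quantLin n lam).codRestrict _ quantLin_mem_diffOp)
    ⟨fun _ _ h => quantLin_injective (congrArg Subtype.val h), fun P => by
      obtain ⟨d, hd⟩ := exists_mem_ordLT P.2
      obtain ⟨φ, hφ⟩ := exists_quantLin_eq hd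
      exact ⟨φ, Subtype.ext hφ⟩⟩

theorem quant_coe (φ : Sym n) : (quant n lam φ).1 = quantLin n lam φ := rfl

/-- For a homogeneous symbol both sides of each equivariance are eigenlifts of one symbol, so they
agree. -/
theorem quant_isEquivariantQuantization : IsEquivariantQuantization lam (quant n lam) where
  symbol d φ hφ := (quantLin_of_mem hφ).1
  lie_equivariant x _ φ := by
    induction φ using sym_induction with
    | hom d φ hφ =>
      obtain ⟨χ, h1, h2, h3⟩ := (quantLin_of_mem (lam := lam) hφ).ad x
      exact ⟨χ, h3, (quantLin_of_mem h1).unique h2⟩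
    | add φ ψ hφ hψ =>
      obtain ⟨χ, h1, h2⟩ := hφ
      obtain ⟨χ', h3, h4⟩ := hψ
      refine ⟨χ + χ', h1.add_right h3, ?_⟩
      rw [quant_coe] at *
      rw [map_add, h2, h4, quant_coe, quant_coe, quant_coe, map_add]
      noncomm_ring
  equivariant g φ := by
    induction φ using sym_induction with
    | hom d φ hφ =>
      have h := (quantLin_of_mem (lam := lam) hφ).conj g
      obtain ⟨χ, h1, h2⟩ := exists_isPrincipalSymbol h.1.mem_ordLT
      have e := h2.unique h.1
      rw [← e] at h
      exact ⟨χ, e, (quantLin_of_mem h1).unique h⟩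
    | add φ ψ hφ hψ =>
      obtain ⟨χ, h1, h2⟩ := hφ
      obtain ⟨χ', h3, h4⟩ := hψ
      refine ⟨χ + χ', ?_, ?_⟩
      · change χ.1 + χ'.1 = _
        rw [h1, h3]
        rfl
      · rw [quant_coe] at *
        rw [map_add, h2, h4, quant_coe, quant_coe, quant_coe, map_add]
        noncomm_ring

end Quantization

/-! ### Uniqueness of the quantization map -/

section Uniqueness

variable {n : ℕ} {lam : ℂ}

theorem lieDeriv_one : lieDeriv lam (1 : Matrix (Fin (n + 1)) (Fin (n + 1)) ℝ) =
    algebraMap ℂ (Module.End ℂ (Dens n lam)) (lam * (n + 1)) := by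
  ext1 s
  apply Subtype.ext
  funext u
  change -(fderiv ℝ s.1 u ((1 : Matrix (Fin (n + 1)) (Fin (n + 1)) ℝ) *ᵥ u)) =
    lam * (n + 1) * s.1 u
  rw [Matrix.one_mulVec]
  by_cases hu : u = 0
  · rw [hu, s.2.2.1]
    simp
  · rw [fderiv_dens_self s hu]
    ring

theorem momentumReal_one : momentumReal (1 : Matrix (Fin (n + 1)) (Fin (n + 1)) ℂ) = 0 := by
  funext y
  induction y using Quotient.inductionOn with
  | _ y =>
    obtain ⟨⟨u, p⟩, hu, hp⟩ := y
    change -((fun i => (p i : ℂ)) ⬝ᵥ ((1 : Matrix (Fin (n + 1)) (Fin (n + 1)) ℂ) *ᵥ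
      fun i => (u i : ℂ))) = 0
    rw [Matrix.one_mulVec, neg_eq_zero]
    have h := congrArg (fun r : ℝ => (r : ℂ)) hp
    simpa [dotProduct] using h

/-- The trace free part of an elementary matrix. -/
def singleTraceless (i j : Fin (n + 1)) : Matrix (Fin (n + 1)) (Fin (n + 1)) ℝ :=
  Matrix.single i j 1 - (if i = j then ((n : ℝ) + 1)⁻¹ else 0) • 1

theorem trace_singleTraceless (i j : Fin (n + 1)) : (singleTraceless i j).trace = 0 := by
  have h : (n : ℝ) + 1 ≠ 0 := by positivity
  rw [singleTraceless, Matrix.trace_sub, Matrix.trace_smul, Matrix.trace_one]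
  split_ifs with hij
  · subst hij
    simp [h]
  · simp [Matrix.trace_single_eq_of_ne i j (1 : ℝ) hij]

theorem momentumReal_sub_smul_one (x : Matrix (Fin (n + 1)) (Fin (n + 1)) ℂ) (c : ℂ) :
    momentumReal (x - c • 1) = momentumReal x := by
  have h : momentumReal (x - c • 1) = momentumReal x - c • momentumReal (n := n) 1 := by
    funext y
    simp only [Pi.sub_apply, Pi.smul_apply]
    induction y using Quotient.inductionOn with
    | _ y =>
      obtain ⟨⟨u, p⟩, hu, hp⟩ := y
      change -((fun i => (p i : ℂ)) ⬝ᵥ ((x - c • 1) *ᵥ fun i => (u i : ℂ))) =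
        -((fun i => (p i : ℂ)) ⬝ᵥ (x *ᵥ fun i => (u i : ℂ))) -
          c • -((fun i => (p i : ℂ)) ⬝ᵥ ((1 : Matrix (Fin (n + 1)) (Fin (n + 1)) ℂ) *ᵥ
            fun i => (u i : ℂ)))
      rw [Matrix.sub_mulVec, Matrix.smul_mulVec, dotProduct_sub, dotProduct_smul]
      simp only [smul_eq_mul]
      ring
  rw [h, momentumReal_one, smul_zero, sub_zero]

theorem momentumReal_singleTraceless (i j : Fin (n + 1)) :
    momentumReal ((singleTraceless i j).map Complex.ofReal) =
      momentumReal (Matrix.single i j 1) := by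
  have e : (singleTraceless i j).map Complex.ofReal = Matrix.single i j (1 : ℂ) -
      (((if i = j then ((n : ℝ) + 1)⁻¹ else 0 : ℝ)) : ℂ) • 1 := by
    ext a b
    simp only [singleTraceless, Matrix.map_apply, Matrix.sub_apply, Matrix.smul_apply,
      smul_eq_mul, Complex.ofReal_sub, Complex.ofReal_mul, Matrix.single_apply, Matrix.one_apply]
    congr 1
    · split_ifs <;> simp
    · congr 1
      split_ifs <;> simp
  rw [e, momentumReal_sub_smul_one]

theorem lieDeriv_singleTraceless (i j : Fin (n + 1)) :
    ∃ c : ℂ, lieDeriv lam (singleTraceless i j) =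
      eta lam i j - algebraMap ℂ (Module.End ℂ (Dens n lam)) c := by
  refine ⟨((if i = j then ((n : ℝ) + 1)⁻¹ else 0 : ℝ) : ℂ) * (lam * (n + 1)), ?_⟩
  have h : lieDeriv lam (singleTraceless i j) = eta lam i j -
      ((if i = j then ((n : ℝ) + 1)⁻¹ else 0 : ℝ) : ℂ) •
        lieDeriv lam (1 : Matrix (Fin (n + 1)) (Fin (n + 1)) ℝ) := by
    ext1 s
    apply Subtype.ext
    funext u
    change -(fderiv ℝ s.1 u (singleTraceless i j *ᵥ u)) =
      -(fderiv ℝ s.1 u ((Matrix.single i j 1 : Matrix (Fin (n + 1)) (Fin (n + 1)) ℝ) *ᵥ u)) -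
      ((if i = j then ((n : ℝ) + 1)⁻¹ else 0 : ℝ) : ℂ) *
        -(fderiv ℝ s.1 u ((1 : Matrix (Fin (n + 1)) (Fin (n + 1)) ℝ) *ᵥ u))
    rw [singleTraceless, Matrix.sub_mulVec, Matrix.smul_mulVec, map_sub, map_smul,
      Complex.real_smul]
    ring
  rw [h, lieDeriv_one]
  congr 1
  ext1 t
  exact smul_smul _ (lam * (n + 1)) t

theorem ad_sub_algebraMap {R : Type*} [Ring R] [Algebra ℂ R] (x y : R) (c : ℂ) :
    (x - algebraMap ℂ R c) * y - y * (x - algebraMap ℂ R c) = x * y - y * x := by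
  rw [sub_mul, mul_sub, Algebra.commutes c y]
  abel

/-- Equivariance is available for trace free matrices only, while the Casimir operator uses all
elementary matrices. The two differ by multiples of the identity, whose momentum function is zero
and whose Lie derivative is a scalar, hence central. -/
theorem exists_bracket_single {Q : Sym n ≃ₗ[ℂ] DiffOp n lam}
    (hQ : IsEquivariantQuantization lam Q) (i j : Fin (n + 1)) (φ : Sym n) :
    ∃ χ : Sym n, IsPoissonBracket (momentumReal (Matrix.single i j 1)) φ.1 χ.1 ∧
      (Q χ).1 = ad (eta lam i j) (Q φ).1 := by
  obtain ⟨χ, h1, h2⟩ := hQ.lie_equivariant _ (trace_singleTraceless i j) φ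
  rw [momentumReal_singleTraceless] at h1
  obtain ⟨c, hc⟩ := lieDeriv_singleTraceless (lam := lam) i j
  rw [hc] at h2
  exact ⟨χ, h1, h2.trans
    (ad_sub_algebraMap (R := Module.End ℂ (Dens n lam)) (eta lam i j) (Q φ).1 c)⟩

/-- Equivariance carries iterated Poisson brackets with momentum functions to iterated commutators
with `eta`. Hence the scalar of the Casimir operator on symbols of degree `d` passes to `Q φ`. -/
theorem isEigenLift_of_isEquivariantQuantization {Q : Sym n ≃ₗ[ℂ] DiffOp n lam}
    (hQ : IsEquivariantQuantization lam Q) {d : ℕ} {φ : Sym n} (hφ : φ ∈ SymDeg n d) :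
    IsEigenLift d (Q φ).1 φ.1 := by
  refine ⟨hQ.symbol d φ hφ, ?_⟩
  choose χ hχ hχ1 using fun i j => exists_bracket_single hQ j i φ
  choose χ' hχ' hχ1' using fun i j => exists_bracket_single hQ i j (χ i j)
  have h := sum_isPoissonBracket_momentumReal hφ hχ hχ'
  have h1 : ∑ i, ∑ j, χ' i j = casVal n d • φ := by
    apply Subtype.ext
    rw [AddSubmonoidClass.coe_finsetSum]
    simp only [AddSubmonoidClass.coe_finsetSum]
    exact h
  have h2 : ((Q (∑ i, ∑ j, χ' i j)).1 : Module.End ℂ (Dens n lam)) = ∑ i, ∑ j, (Q (χ' i j)).1 := by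
    simp only [map_sum, AddSubmonoidClass.coe_finsetSum]
  rw [casimir_eta_apply]
  rw [h1, map_smul] at h2
  refine Eq.trans ?_ h2.symm
  refine Finset.sum_congr rfl fun i _ => Finset.sum_congr rfl fun j _ => ?_
  rw [hχ1', hχ1]

theorem eq_quant {Q : Sym n ≃ₗ[ℂ] DiffOp n lam} (hQ : IsEquivariantQuantization lam Q) :
    Q = quant n lam := by
  ext1 φ
  apply Subtype.ext
  induction φ using sym_induction with
  | hom d φ hφ =>
    exact (isEigenLift_of_isEquivariantQuantization hQ hφ).unique (quantLin_of_mem hφ)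
  | add φ ψ hφ hψ =>
    rw [map_add, map_add, Submodule.coe_add, Submodule.coe_add, hφ, hψ]

end Uniqueness

/-! ### Regular functions on the cotangent bundle of complex projective space -/

section Regular

variable {n : ℕ}

/-- Polynomials in the homogeneous coordinates `(u, p)` of the cotangent bundle. -/
abbrev ConePoly (n : ℕ) : Type := MvPolynomial (Fin (n + 1) ⊕ Fin (n + 1)) ℂ

/-- The value of a polynomial at `(u, p)`. -/
abbrev evalCone (u p : Fin (n + 1) → ℂ) : ConePoly n →+* ℂ := MvPolynomial.eval (Sum.elim u p)

/-- The value at `(u, p)` of a regular function over the chart `u_k ≠ 0`. -/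
def chartEval (k : Fin (n + 1)) (u p : Fin (n + 1) → ℂ) : PolAlg n →+* ℂ :=
  MvPolynomial.eval₂Hom (MvPolynomial.eval (chartCoord k u)) (fun j => u k * p (k.succAbove j))

theorem hasAlgSymbol_iff {k : Fin (n + 1)} {f : CotP ℂ n → ℂ} {a : PolAlg n} :
    HasAlgSymbol k f a ↔ ∀ (u p : Fin (n + 1) → ℂ) (hu : u ≠ 0) (hp : p ⬝ᵥ u = 0), u k ≠ 0 →
      f (CotP.mk u p hu hp) = chartEval k u p a := Iff.rfl

theorem chartEval_C_C (k : Fin (n + 1)) (u p : Fin (n + 1) → ℂ) (c : ℂ) :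
    chartEval k u p (MvPolynomial.C (MvPolynomial.C c)) = c := by
  simp [chartEval]

theorem chartEval_coord (k : Fin (n + 1)) (u p : Fin (n + 1) → ℂ) (j : Fin n) :
    chartEval k u p (MvPolynomial.C (MvPolynomial.X j)) = u (k.succAbove j) / u k := by
  simp [chartEval, chartCoord]

theorem chartEval_X (k : Fin (n + 1)) (u p : Fin (n + 1) → ℂ) (j : Fin n) :
    chartEval k u p (MvPolynomial.X j) = u k * p (k.succAbove j) := by
  simp [chartEval]

theorem chartEval_smul (k : Fin (n + 1)) (u p : Fin (n + 1) → ℂ) (c : ℂˣ) :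
    chartEval k (c • u) (c⁻¹ • p) = chartEval k u p := by
  have h1 : chartCoord k (c • u) = chartCoord k u := by
    funext j
    simp only [chartCoord, Pi.smul_apply, Units.smul_def, smul_eq_mul]
    exact mul_div_mul_left _ _ c.ne_zero
  rw [chartEval, chartEval, h1]
  congr 1
  funext j
  simp only [Pi.smul_apply, Units.smul_def, smul_eq_mul]
  have := c.ne_zero
  rw [Units.val_inv_eq_inv_val]
  field_simp

/-- Clearing denominators. -/
theorem exists_clear (k : Fin (n + 1)) (a : PolAlg n) : ∃ (M : ℕ) (G : ConePoly n),
    ∀ u p : Fin (n + 1) → ℂ, u k ≠ 0 → u k ^ M * chartEval k u p a = evalCone u p G := by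
  have hadd : ∀ a b : PolAlg n, (∃ (M : ℕ) (G : ConePoly n),
      ∀ u p : Fin (n + 1) → ℂ, u k ≠ 0 → u k ^ M * chartEval k u p a = evalCone u p G) →
      (∃ (M : ℕ) (G : ConePoly n),
      ∀ u p : Fin (n + 1) → ℂ, u k ≠ 0 → u k ^ M * chartEval k u p b = evalCone u p G) →
      ∃ (M : ℕ) (G : ConePoly n),
      ∀ u p : Fin (n + 1) → ℂ, u k ≠ 0 → u k ^ M * chartEval k u p (a + b) = evalCone u p G := by
    rintro a b ⟨M, G, h⟩ ⟨M', G', h'⟩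
    refine ⟨M + M', MvPolynomial.X (Sum.inl k) ^ M' * G + MvPolynomial.X (Sum.inl k) ^ M * G',
      fun u p hk => ?_⟩
    rw [map_add, map_add, map_mul, map_mul, ← h u p hk, ← h' u p hk, map_pow, map_pow,
      MvPolynomial.eval_X, Sum.elim_inl]
    ring
  induction a using MvPolynomial.induction_on with
  | C q =>
    induction q using MvPolynomial.induction_on with
    | C c => exact ⟨0, MvPolynomial.C c, fun u p hk => by
        rw [chartEval_C_C, pow_zero, one_mul, MvPolynomial.eval_C]⟩
    | add q r hq hr =>
      rw [map_add]
      exact hadd _ _ hq hr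
    | mul_X q j hq =>
      obtain ⟨M, G, h⟩ := hq
      refine ⟨M + 1, G * MvPolynomial.X (Sum.inl (k.succAbove j)), fun u p hk => ?_⟩
      rw [map_mul, map_mul, map_mul, chartEval_coord, ← h u p hk, MvPolynomial.eval_X,
        Sum.elim_inl, pow_succ]
      field_simp
  | add a b ha hb => exact hadd _ _ ha hb
  | mul_X a j ha =>
    obtain ⟨M, G, h⟩ := ha
    refine ⟨M, G * (MvPolynomial.X (Sum.inl k) * MvPolynomial.X (Sum.inr (k.succAbove j))),
      fun u p hk => ?_⟩
    rw [map_mul, map_mul, map_mul, chartEval_X, ← h u p hk, MvPolynomial.eval_X,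
      MvPolynomial.eval_X, Sum.elim_inl, Sum.elim_inr]
    ring

theorem eval_aeval {σ τ : Type*} (g : σ → MvPolynomial τ ℂ) (x : τ → ℂ) (H : MvPolynomial σ ℂ) :
    MvPolynomial.eval x (MvPolynomial.aeval g H) =
      MvPolynomial.eval (fun i => MvPolynomial.eval x (g i)) H := by
  induction H using MvPolynomial.induction_on with
  | C c => simp
  | add p q hp hq => simp only [map_add, hp, hq]
  | mul_X p i hp => simp only [map_mul, hp, MvPolynomial.aeval_X, MvPolynomial.eval_X]

/-- The projection of `(u, q)` to the cone `p(u) = 0` along the `k`-th coordinate. -/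
def conePoint (k : Fin (n + 1)) {R : Type*} [CommRing R] (u q : Fin (n + 1) → R) :
    Fin (n + 1) → R :=
  fun j => u k * q j - if j = k then ∑ i, q i * u i else 0

theorem conePoint_dotProduct (k : Fin (n + 1)) {R : Type*} [CommRing R] (u q : Fin (n + 1) → R) :
    conePoint k u q ⬝ᵥ u = 0 := by
  simp only [dotProduct, conePoint, sub_mul, Finset.sum_sub_distrib, ite_mul, zero_mul,
    Finset.sum_ite_eq', Finset.mem_univ, if_true]
  rw [Finset.sum_mul, ← Finset.sum_sub_distrib]
  refine Finset.sum_eq_zero fun i _ => by ring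

/-- The projection reaches every covector of the cone over `u_k ≠ 0`. So the cone is parametrized by
free variables there, and polynomial identities on it can be tested on an affine space. -/
theorem conePoint_of_dotProduct {k : Fin (n + 1)} {u p : Fin (n + 1) → ℂ} (hp : p ⬝ᵥ u = 0)
    (hk : u k ≠ 0) : conePoint k u (fun j => p j / u k) = p := by
  funext j
  have h : ∑ i, p i / u k * u i = 0 := by
    have e : ∑ i, p i / u k * u i = (u k)⁻¹ * (p ⬝ᵥ u) := by
      rw [dotProduct, Finset.mul_sum]
      exact Finset.sum_congr rfl fun i _ => by ring
    rw [e, hp, mul_zero]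
  simp only [conePoint, h, ite_self, sub_zero]
  field_simp

theorem evalCone_conePoint (k : Fin (n + 1)) (u q : Fin (n + 1) → ℂ) (H : ConePoly n) :
    evalCone u q (MvPolynomial.aeval (Sum.elim (fun i => MvPolynomial.X (Sum.inl i))
      (conePoint k (fun i => (MvPolynomial.X (Sum.inl i) : ConePoly n))
        (fun i => MvPolynomial.X (Sum.inr i)))) H) = evalCone u (conePoint k u q) H := by
  rw [evalCone, eval_aeval]
  congr 2
  funext i
  rcases i with i | i
  · simp
  · simp only [Sum.elim_inr, conePoint, map_sub, map_mul, MvPolynomial.eval_X, Sum.elim_inl]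
    congr 1
    split_ifs
    · simp
    · simp

/-- Regular functions which agree at the real points where a coordinate does not vanish are
equal. -/
theorem chartEval_eq_of_real {k l m : Fin (n + 1)} {a b : PolAlg n}
    (h : ∀ u p : Fin (n + 1) → ℝ, p ⬝ᵥ u = 0 → u k ≠ 0 → u l ≠ 0 → u m ≠ 0 →
      chartEval k (fun i => (u i : ℂ)) (fun i => (p i : ℂ)) a =
        chartEval l (fun i => (u i : ℂ)) (fun i => (p i : ℂ)) b)
    {u p : Fin (n + 1) → ℂ} (hp : p ⬝ᵥ u = 0) (hk : u k ≠ 0) (hl : u l ≠ 0) :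
    chartEval k u p a = chartEval l u p b := by
  obtain ⟨M, G, hG⟩ := exists_clear k a
  obtain ⟨M', G', hG'⟩ := exists_clear l b
  let H : ConePoly n := MvPolynomial.X (Sum.inl l) ^ M' * G - MvPolynomial.X (Sum.inl k) ^ M * G'
  have hH : ∀ u p : Fin (n + 1) → ℂ, u k ≠ 0 → u l ≠ 0 → evalCone u p H =
      u l ^ M' * u k ^ M * (chartEval k u p a - chartEval l u p b) := by
    intro u p hk hl
    rw [map_sub, map_mul, map_mul, map_pow, map_pow, MvPolynomial.eval_X, MvPolynomial.eval_X,
      Sum.elim_inl, Sum.elim_inl, ← hG u p hk, ← hG' u p hl]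
    ring
  -- The cone is not an affine space, so `H` is composed with the parametrization `conePoint`. The
  -- coordinate factors make the identity hold also at the real points excluded by the hypothesis.
  have h0 : (MvPolynomial.X (Sum.inl k) * MvPolynomial.X (Sum.inl l) *
      MvPolynomial.X (Sum.inl m) : ConePoly n) *
      MvPolynomial.aeval (Sum.elim (fun i => MvPolynomial.X (Sum.inl i))
      (conePoint k (fun i => (MvPolynomial.X (Sum.inl i) : ConePoly n))
        (fun i => MvPolynomial.X (Sum.inr i)))) H = 0 := by
    refine polynomial_eq_zero_of_real fun x => ?_
    have e : (fun i => (x i : ℂ)) = Sum.elim (fun i => (x (Sum.inl i) : ℂ))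
        (fun i => (x (Sum.inr i) : ℂ)) := by
      funext i
      rcases i with i | i <;> rfl
    rw [e, map_mul, map_mul, map_mul, MvPolynomial.eval_X, MvPolynomial.eval_X,
      MvPolynomial.eval_X, Sum.elim_inl, Sum.elim_inl, Sum.elim_inl, evalCone_conePoint]
    by_cases h1 : x (Sum.inl k) = 0
    · simp [h1]
    by_cases h2 : x (Sum.inl l) = 0
    · simp [h2]
    by_cases h3 : x (Sum.inl m) = 0
    · simp [h3]
    have h4 := h (fun i => x (Sum.inl i)) (conePoint k (fun i => x (Sum.inl i))
      (fun i => x (Sum.inr i))) (conePoint_dotProduct _ _ _) h1 h2 h3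
    have e2 : conePoint k (fun i => (x (Sum.inl i) : ℂ)) (fun i => (x (Sum.inr i) : ℂ)) =
        fun i => ((conePoint k (fun i => x (Sum.inl i)) (fun i => x (Sum.inr i)) i : ℝ) : ℂ) := by
      funext j
      simp only [conePoint]
      split_ifs <;> simp
    rw [hH _ _ (by exact_mod_cast h1) (by exact_mod_cast h2), e2, h4, sub_self, mul_zero, mul_zero]
  have hX : ∀ i : Fin (n + 1), (MvPolynomial.X (Sum.inl i) : ConePoly n) ≠ 0 :=
    fun i => MvPolynomial.X_ne_zero _
  have h1 := (mul_eq_zero.1 h0).resolve_left (mul_ne_zero (mul_ne_zero (hX k) (hX l)) (hX m))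
  have h2 := evalCone_conePoint k u (fun j => p j / u k) H
  rw [h1, map_zero, conePoint_of_dotProduct hp hk, hH u p hk hl] at h2
  have h3 := (mul_eq_zero.1 h2.symm).resolve_left
    (mul_ne_zero (pow_ne_zero _ hl) (pow_ne_zero _ hk))
  exact sub_eq_zero.1 h3

theorem eval₂_toSmooth (k : Fin (n + 1)) (u p : Fin (n + 1) → ℝ) (a : PolAlg n) :
    MvPolynomial.eval₂ (evSmooth (chartCoord k u)) (fun j => ((u k * p (k.succAbove j) : ℝ) : ℂ))
      (toSmooth a) = chartEval k (fun i => (u i : ℂ)) (fun i => (p i : ℂ)) a := by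
  rw [toSmooth, MvPolynomial.eval₂_map, chartEval, MvPolynomial.coe_eval₂Hom]
  congr 1
  · ext q
    · simp [evSmooth_polyToSmooth]
    · simp [evSmooth_polyToSmooth, chartCoord]
  · funext j
    push_cast
    rfl

theorem ofReal_comp_ne_zero {u : Fin (n + 1) → ℝ} (hu : u ≠ 0) : (fun i => (u i : ℂ)) ≠ 0 :=
  fun h => hu (by
    funext i
    exact Complex.ofReal_eq_zero.1 (congrFun h i))

theorem ofReal_dotProduct {u p : Fin (n + 1) → ℝ} (hp : p ⬝ᵥ u = 0) :
    (fun i => (p i : ℂ)) ⬝ᵥ (fun i => (u i : ℂ)) = 0 := by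
  have h := congrArg (fun r : ℝ => (r : ℂ)) hp
  simpa [dotProduct] using h

theorem complexify_mk (u p : Fin (n + 1) → ℝ) (hu : u ≠ 0) (hp : p ⬝ᵥ u = 0) :
    complexify (CotP.mk u p hu hp) = CotP.mk (fun i => (u i : ℂ)) (fun i => (p i : ℂ))
      (ofReal_comp_ne_zero hu) (ofReal_dotProduct hp) := rfl

theorem ne_zero_of_apply_ne_zero {R : Type*} [Zero R] {u : Fin (n + 1) → R} {k : Fin (n + 1)}
    (hk : u k ≠ 0) : u ≠ 0 := fun h => hk (congrFun h k)

theorem cotP_induction {𝕜 : Type} [Field 𝕜] {P : CotP 𝕜 n → Prop}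
    (h : ∀ u p hu hp, P (CotP.mk u p hu hp)) (x : CotP 𝕜 n) : P x := by
  induction x using Quotient.inductionOn with
  | _ y => exact h y.1.1 y.1.2 y.2.1 y.2.2

/-- Regular functions which agree at the real points where a coordinate does not vanish are
equal. -/
theorem reg_ext_of_real {f g : Reg n} {m : Fin (n + 1)}
    (h : ∀ (u p : Fin (n + 1) → ℝ) (hu : u ≠ 0) (hp : p ⬝ᵥ u = 0), u m ≠ 0 →
      f.1 (complexify (CotP.mk u p hu hp)) = g.1 (complexify (CotP.mk u p hu hp))) : f = g := by
  apply Subtype.ext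
  funext x
  induction x using cotP_induction with
  | h u p hu hp =>
    obtain ⟨k, hk⟩ := Function.ne_iff.1 hu
    obtain ⟨a, ha⟩ := f.2 k
    obtain ⟨b, hb⟩ := g.2 k
    rw [hasAlgSymbol_iff] at ha hb
    rw [ha u p hu hp hk, hb u p hu hp hk]
    refine chartEval_eq_of_real (m := m) (fun u p hp h1 _ h3 => ?_) hp hk hk
    have hu := ne_zero_of_apply_ne_zero h1
    have h4 : ((u k : ℝ) : ℂ) ≠ 0 := by exact_mod_cast h1
    have h5 := h u p hu hp h3
    rwa [complexify_mk, ha _ _ _ _ h4, hb _ _ _ _ h4] at h5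

theorem restrict_injective (n : ℕ) : Function.Injective (restrict n) := by
  intro f g h
  refine reg_ext_of_real (m := 0) fun u p hu hp _ => ?_
  exact congrFun (congrArg Subtype.val h) (CotP.mk u p hu hp)

/-- A symbol whose coefficients are polynomials in all charts is the restriction of a regular
function. -/
theorem mem_momAlg_of_hasSymbol {φ : Sym n} {a : Fin (n + 1) → PolAlg n}
    (h : ∀ k, HasSymbol k φ.1 (toSmooth (a k))) : φ ∈ MomAlg n := by
  -- At real points both expressions are the value of `φ`; density of the real points extends the
  -- agreement to the complex cone, so the chart expressions glue.
  have h1 : ∀ {k l : Fin (n + 1)} {u p : Fin (n + 1) → ℂ}, p ⬝ᵥ u = 0 → u k ≠ 0 → u l ≠ 0 →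
      chartEval k u p (a k) = chartEval l u p (a l) := by
    intro k l u p hp hk hl
    refine chartEval_eq_of_real (m := k) (fun u p hp h1 h2 _ => ?_) hp hk hl
    have hu := ne_zero_of_apply_ne_zero h1
    rw [← eval₂_toSmooth, ← eval₂_toSmooth, ← h k u p hu hp h1, ← h l u p hu hp h2]
  choose k hk using fun y : Cone ℂ n => Function.ne_iff.1 y.2.1
  let f : CotP ℂ n → ℂ := Quotient.lift (fun y : Cone ℂ n => chartEval (k y) y.1.1 y.1.2 (a (k y)))
    (by
      rintro y z ⟨c, hc1, hc2⟩
      have h2 : y.1.1 (k z) ≠ 0 := fun h0 => hk z (by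
        rw [hc1, Pi.smul_apply, h0, smul_zero]
        rfl)
      change chartEval (k y) y.1.1 y.1.2 (a (k y)) = chartEval (k z) z.1.1 z.1.2 (a (k z))
      rw [h1 y.2.2 (hk y) h2, hc1, hc2, chartEval_smul])
  have hf : ∀ l, HasAlgSymbol l f (a l) := fun l u p hu hp hl =>
    h1 hp (hk ⟨(u, p), hu, hp⟩) hl
  refine ⟨⟨f, fun l => ⟨a l, hf l⟩⟩, Subtype.ext ?_⟩
  funext x
  induction x using cotP_induction with
  | h u p hu hp =>
    obtain ⟨l, hl⟩ := Function.ne_iff.1 hu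
    have h4 : ((u l : ℝ) : ℂ) ≠ 0 := by exact_mod_cast hl
    change f (complexify (CotP.mk u p hu hp)) = _
    rw [complexify_mk, hasAlgSymbol_iff.1 (hf l) _ _ _ _ h4, h l u p hu hp hl, eval₂_toSmooth]

end Regular

/-! ### Divisibility by the quadric on a coordinate hyperplane -/

section Quadric

variable {n : ℕ}

/-- The polynomial `∑_{j ≠ a} u_j p_j`. -/
def quadric (a : Fin (n + 1)) : ConePoly n :=
  ∑ j ∈ Finset.univ.erase a, MvPolynomial.X (Sum.inl j) * MvPolynomial.X (Sum.inr j)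

theorem evalCone_quadric (a : Fin (n + 1)) (u p : Fin (n + 1) → ℂ) :
    evalCone u p (quadric a) = ∑ j ∈ Finset.univ.erase a, u j * p j := by
  simp [quadric]

theorem dotProduct_eq_quadric (a : Fin (n + 1)) (u p : Fin (n + 1) → ℂ) :
    p ⬝ᵥ u = u a * p a + evalCone u p (quadric a) := by
  rw [evalCone_quadric, dotProduct, ← Finset.add_sum_erase _ _ (Finset.mem_univ a)]
  congr 1
  · ring
  · exact Finset.sum_congr rfl fun i _ => by ring

/-- Elimination of the momentum `p_b` modulo the quadric. -/
def elim (a b : Fin (n + 1)) : ConePoly n →ₐ[ℂ] ConePoly n :=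
  MvPolynomial.aeval (Sum.elim (fun i => MvPolynomial.X (Sum.inl i)) fun j =>
    MvPolynomial.X (Sum.inl b) * MvPolynomial.X (Sum.inr j) - if j = b then quadric a else 0)

theorem evalCone_elim (a b : Fin (n + 1)) (u p : Fin (n + 1) → ℂ) (H : ConePoly n) :
    evalCone u p (elim a b H) = evalCone u (fun j => u b * p j -
      if j = b then evalCone u p (quadric a) else 0) H := by
  rw [elim, evalCone, eval_aeval]
  congr 2
  funext i
  rcases i with i | j
  · simp
  · simp only [Sum.elim_inr, map_sub, map_mul, MvPolynomial.eval_X, Sum.elim_inl]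
    congr 1
    split_ifs <;> simp

/-- The substitution `elim a b` replaces `p_j` by `u_b p_j`, with the quadric subtracted for `j =
b`. Modulo the quadric it therefore only multiplies monomials by powers of `u_b`, and different
monomials are brought to a common power. -/
theorem exists_elim (a b : Fin (n + 1)) (H : ConePoly n) : ∃ (c : ℕ) (H' : ConePoly n),
    quadric a ∣ MvPolynomial.X (Sum.inl b) ^ c * H - elim a b H' := by
  induction H using MvPolynomial.induction_on with
  | C x => exact ⟨0, MvPolynomial.C x, by simp [elim]⟩
  | add H K hH hK =>
    obtain ⟨c, H', h⟩ := hH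
    obtain ⟨d, K', h'⟩ := hK
    refine ⟨c + d, MvPolynomial.X (Sum.inl b) ^ d * H' + MvPolynomial.X (Sum.inl b) ^ c * K', ?_⟩
    have e : elim a b (MvPolynomial.X (Sum.inl b)) = MvPolynomial.X (Sum.inl b) := by simp [elim]
    rw [map_add, map_mul, map_mul, map_pow, map_pow, e]
    have h1 := dvd_add (h.mul_left (MvPolynomial.X (Sum.inl b) ^ d))
      (h'.mul_left (MvPolynomial.X (Sum.inl b) ^ c))
    convert h1 using 1
    ring
  | mul_X H s hH =>
    obtain ⟨c, H', h⟩ := hH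
    rcases s with i | j
    · refine ⟨c, H' * MvPolynomial.X (Sum.inl i), ?_⟩
      have e : elim a b (MvPolynomial.X (Sum.inl i)) = MvPolynomial.X (Sum.inl i) := by simp [elim]
      rw [map_mul, e, ← mul_assoc, ← sub_mul]
      exact h.mul_right _
    · refine ⟨c + 1, H' * MvPolynomial.X (Sum.inr j), ?_⟩
      have e : elim a b (MvPolynomial.X (Sum.inr j)) = MvPolynomial.X (Sum.inl b) *
          MvPolynomial.X (Sum.inr j) - if j = b then quadric a else 0 := by simp [elim]
      have h0 : quadric a ∣ if j = b then quadric a else 0 := by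
        split_ifs
        · exact dvd_rfl
        · exact dvd_zero _
      have h1 := dvd_add (h.mul_left (MvPolynomial.X (Sum.inl b) * MvPolynomial.X (Sum.inr j)))
        (h0.mul_left (elim a b H'))
      rw [map_mul, e]
      convert h1 using 1
      ring

/-- The image of `elim a b` does not involve `p_b`. An element of the image that vanishes on the
quadric over `u_b ≠ 0` is thus zero, because every other choice of coordinates extends to a point of
the quadric. -/
theorem quadric_dvd_pow_mul {a b : Fin (n + 1)} (hab : a ≠ b) {H : ConePoly n}
    (h : ∀ u p : Fin (n + 1) → ℂ, u b ≠ 0 → evalCone u p (quadric a) = 0 → evalCone u p H = 0) :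
    ∃ c : ℕ, quadric a ∣ MvPolynomial.X (Sum.inl b) ^ c * H := by
  obtain ⟨c, H', K, hK⟩ := exists_elim a b H
  have hb : b ∈ Finset.univ.erase a := Finset.mem_erase.2 ⟨hab.symm, Finset.mem_univ b⟩
  have h0 : MvPolynomial.X (Sum.inl b) * elim a b H' = 0 := by
    refine MvPolynomial.funext fun x => ?_
    have e : x = Sum.elim (fun i => x (Sum.inl i)) (fun i => x (Sum.inr i)) := by
      funext i
      rcases i with i | i <;> rfl
    rw [e]
    generalize (fun i => x (Sum.inl i)) = u
    generalize (fun i => x (Sum.inr i)) = p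
    rw [map_mul, MvPolynomial.eval_X, Sum.elim_inl, map_zero]
    by_cases hu : u b = 0
    · rw [hu, zero_mul]
    -- The new value of `p_b` solves the equation of the quadric; this is possible since `u_b ≠ 0`.
    let p' := Function.update p b (-(∑ j ∈ (Finset.univ.erase a).erase b, u j * p j) / u b)
    have hp' : ∀ j, j ≠ b → p' j = p j := fun j hj => Function.update_of_ne hj _ _
    have h1 : evalCone u p' (quadric a) = 0 := by
      rw [evalCone_quadric, ← Finset.add_sum_erase _ _ hb,
        Finset.sum_congr rfl fun j hj => by rw [hp' j (Finset.ne_of_mem_erase hj)]]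
      simp only [p', Function.update_self]
      field_simp
      ring
    have h2 : evalCone u p (elim a b H') = evalCone u p' (elim a b H') := by
      rw [evalCone_elim, evalCone_elim]
      congr 2
      funext j
      by_cases hj : j = b
      · subst hj
        rw [if_pos rfl, if_pos rfl, h1, evalCone_quadric, ← Finset.add_sum_erase _ _ hb]
        simp only [p', Function.update_self]
        field_simp
        ring
      · rw [if_neg hj, if_neg hj, hp' j hj]
    have h3 := congrArg (evalCone u p') hK
    rw [map_sub, map_mul, map_mul, h1, h u p' hu h1, mul_zero, zero_mul, zero_sub,
      neg_eq_zero] at h3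
    change u b * evalCone u p (elim a b H') = 0
    rw [h2, h3, mul_zero]
  have h1 := (mul_eq_zero.1 h0).resolve_left (MvPolynomial.X_ne_zero _)
  exact ⟨c, K, by rw [← hK, h1, sub_zero]⟩

/-- The prime `x` divides the product of `e` with the quotient but not `e`, so it divides the
quotient, and one power of `x` cancels. -/
theorem dvd_of_dvd_pow_mul {R : Type*} [CommRing R] [IsDomain R] {x e : R} (hx : Prime x)
    (he : ¬ x ∣ e) {c : ℕ} {H : R} (h : e ∣ x ^ c * H) : e ∣ H := by
  induction c with
  | zero => rwa [pow_zero, one_mul] at h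
  | succ c ih =>
    obtain ⟨K, hK⟩ := h
    have h1 : x ∣ e * K := by
      rw [← hK, pow_succ', mul_assoc]
      exact dvd_mul_right _ _
    obtain ⟨K', rfl⟩ := (hx.dvd_or_dvd h1).resolve_left he
    refine ih ⟨K', mul_left_cancel₀ hx.ne_zero ?_⟩
    rw [← mul_assoc, ← pow_succ', hK]
    ring

/-- A polynomial vanishing on the quadric is divisible by it; in the case of a projective line, the
quadric is reducible and divisibility by one factor is an assumption. -/
theorem quadric_dvd {a b : Fin (n + 1)} (hab : a ≠ b) {H : ConePoly n}
    (h : ∀ u p : Fin (n + 1) → ℂ, u b ≠ 0 → evalCone u p (quadric a) = 0 → evalCone u p H = 0)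
    (h' : (∀ i, i = a ∨ i = b) → MvPolynomial.X (Sum.inl b) ∣ H) : quadric a ∣ H := by
  obtain ⟨c, hc⟩ := quadric_dvd_pow_mul hab h
  have hX : ∀ s, Prime (MvPolynomial.X s : ConePoly n) := fun s => MvPolynomial.X_prime
  by_cases hi : ∀ i, i = a ∨ i = b
  · have e : quadric a = MvPolynomial.X (Sum.inr b) * MvPolynomial.X (Sum.inl b) := by
      rw [quadric, Finset.sum_eq_single_of_mem b
        (Finset.mem_erase.2 ⟨hab.symm, Finset.mem_univ b⟩), mul_comm]
      intro j hj hjb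
      exact absurd (hi j) (by simp [Finset.ne_of_mem_erase hj, hjb])
    rw [e] at hc ⊢
    have h1 : ¬ (MvPolynomial.X (Sum.inr b) : ConePoly n) ∣ MvPolynomial.X (Sum.inl b) := by
      rw [MvPolynomial.X_dvd_X]
      simp
    have h2 : MvPolynomial.X (Sum.inr b) ∣ H := by
      have h3 := (dvd_mul_right _ _).trans hc
      refine ((hX _).dvd_or_dvd h3).resolve_left fun h4 => h1 ((hX _).dvd_of_dvd_pow h4)
    obtain ⟨K, rfl⟩ := h2
    refine mul_dvd_mul_left _ (((hX _).dvd_or_dvd (h' hi)).resolve_left ?_)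
    rw [MvPolynomial.X_dvd_X]
    simp
  · push Not at hi
    obtain ⟨i, hia, hib⟩ := hi
    refine dvd_of_dvd_pow_mul (hX (Sum.inl b)) ?_ hc
    rintro ⟨K, hK⟩
    -- A third index `i` shows that `u_b` does not divide the quadric: at `u = p = e_i` the quadric
    -- is `1` while `u_b = 0`.
    have h1 := congrArg (evalCone (Pi.single i 1) (Pi.single i 1)) hK
    rw [evalCone_quadric, map_mul, MvPolynomial.eval_X, Sum.elim_inl,
      Pi.single_eq_of_ne (Ne.symm hib), zero_mul,
      Finset.sum_eq_single_of_mem i (Finset.mem_erase.2 ⟨hia, Finset.mem_univ i⟩)] at h1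
    · simp at h1
    · intro j _ hj
      simp [hj]

end Quadric

/-! ### Weight components -/

section Weight

variable {n : ℕ}

/-- The degree in the coordinates `u_i`. -/
def degU (s : Fin (n + 1) ⊕ Fin (n + 1) →₀ ℕ) : ℕ := ∑ i, s (Sum.inl i)

/-- The degree in the momenta `p_i`. -/
def degP (s : Fin (n + 1) ⊕ Fin (n + 1) →₀ ℕ) : ℕ := ∑ i, s (Sum.inr i)

/-- The monomial `u^α p^β`, as a function. -/
def evalMon (u p : Fin (n + 1) → ℂ) (s : Fin (n + 1) ⊕ Fin (n + 1) →₀ ℕ) : ℂ :=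
  (∏ i, u i ^ s (Sum.inl i)) * ∏ i, p i ^ s (Sum.inr i)

theorem evalCone_eq_sum (u p : Fin (n + 1) → ℂ) (G : ConePoly n) :
    evalCone u p G = ∑ s ∈ G.support, G.coeff s * evalMon u p s := by
  rw [evalCone, MvPolynomial.eval_eq']
  refine Finset.sum_congr rfl fun s _ => ?_
  rw [Fintype.prod_sum_type]
  rfl

theorem evalMon_smul (c : ℂˣ) (u p : Fin (n + 1) → ℂ) (s : Fin (n + 1) ⊕ Fin (n + 1) →₀ ℕ) :
    (c : ℂ) ^ degP s * evalMon (c • u) (c⁻¹ • p) s = (c : ℂ) ^ degU s * evalMon u p s := by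
  have h1 : ∏ i, (c • u) i ^ s (Sum.inl i) = (c : ℂ) ^ degU s * ∏ i, u i ^ s (Sum.inl i) := by
    rw [degU, ← Finset.prod_pow_eq_pow_sum, ← Finset.prod_mul_distrib]
    exact Finset.prod_congr rfl fun i _ => by rw [Pi.smul_apply, Units.smul_def, smul_eq_mul, mul_pow]
  have h2 : (c : ℂ) ^ degP s * ∏ i, (c⁻¹ • p) i ^ s (Sum.inr i) = ∏ i, p i ^ s (Sum.inr i) := by
    rw [degP, ← Finset.prod_pow_eq_pow_sum, ← Finset.prod_mul_distrib]
    refine Finset.prod_congr rfl fun i _ => ?_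
    rw [Pi.smul_apply, Units.smul_def, smul_eq_mul, mul_pow, ← mul_assoc, ← mul_pow,
      Units.mul_inv, one_pow, one_mul]
  rw [evalMon, evalMon, h1, ← h2]
  ring

/-- The part of weight `M` of a polynomial, where `u_i` has weight `1` and `p_i` has
weight `-1`. -/
def weightPart (M : ℕ) (G : ConePoly n) : ConePoly n :=
  ∑ s ∈ G.support with degU s = degP s + M, MvPolynomial.monomial s (G.coeff s)

theorem evalCone_weightPart (M : ℕ) (G : ConePoly n) (u p : Fin (n + 1) → ℂ) :
    evalCone u p (weightPart M G) =
      ∑ s ∈ G.support with degU s = degP s + M, G.coeff s * evalMon u p s := by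
  rw [weightPart, map_sum]
  refine Finset.sum_congr rfl fun s _ => ?_
  rw [evalCone, MvPolynomial.eval_monomial, Finsupp.prod_fintype _ _ (fun i => pow_zero _),
    Fintype.prod_sum_type]
  rfl

/-- Under `(u, p) ↦ (c u, c⁻¹ p)` a monomial is multiplied by `c` to the power of its weight, so the
claim compares the coefficients of `c ^ M` in two Laurent polynomials in `c`. -/
theorem evalCone_weightPart_eq {M : ℕ} {G : ConePoly n} {u p : Fin (n + 1) → ℂ} {y : ℂ}
    (h : ∀ c : ℂˣ, evalCone (c • u) (c⁻¹ • p) G = (c : ℂ) ^ M * y) :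
    evalCone u p (weightPart M G) = y := by
  -- Multiplication by `c ^ K` removes the negative powers of `c`.
  let K := G.support.sup degP
  have hK : ∀ s ∈ G.support, degP s ≤ K := fun s hs => Finset.le_sup hs
  let R : Polynomial ℂ := ∑ s ∈ G.support,
    Polynomial.monomial (degU s + K - degP s) (G.coeff s * evalMon u p s) -
      Polynomial.monomial (M + K) y
  have hR : R = 0 := by
    -- Only invertible `c` are allowed in the hypothesis; the factor `X` takes care of the point
    -- `0`.
    have h1 : Polynomial.X * R = 0 := by
      refine Polynomial.funext fun x => ?_
      rw [Polynomial.eval_mul, Polynomial.eval_X, Polynomial.eval_zero]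
      by_cases hx : x = 0
      · rw [hx, zero_mul]
      refine mul_eq_zero_of_right _ ?_
      have h2 := congrArg (fun z => x ^ K * z) (h (Units.mk0 x hx))
      rw [evalCone_eq_sum, Finset.mul_sum, Units.val_mk0] at h2
      simp only [R, Polynomial.eval_sub, Polynomial.eval_finsetSum, Polynomial.eval_monomial]
      rw [sub_eq_zero]
      refine Eq.trans (Finset.sum_congr rfl fun s hs => ?_) (h2.trans (by ring))
      have h3 := evalMon_smul (Units.mk0 x hx) u p s
      rw [Units.val_mk0] at h3
      obtain ⟨k, hk⟩ := Nat.exists_eq_add_of_le (hK s hs)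
      have e : degU s + K - degP s = degU s + k := by omega
      rw [e, hk, pow_add, pow_add]
      linear_combination (-(G.coeff s * x ^ k)) * h3
    exact (mul_eq_zero.1 h1).resolve_left Polynomial.X_ne_zero
  have h4 := congrArg (fun q => Polynomial.coeff q (M + K)) hR
  simp only [R, Polynomial.coeff_sub, Polynomial.finsetSum_coeff, Polynomial.coeff_monomial,
    Polynomial.coeff_zero, if_true] at h4
  rw [evalCone_weightPart, Finset.sum_filter, ← sub_eq_zero]
  refine Eq.trans ?_ h4
  congr 1
  refine Finset.sum_congr rfl fun s hs => ?_
  have h5 := hK s hs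
  have h6 : degU s + K - degP s = M + K ↔ degU s = degP s + M := by omega
  simp only [h6]

theorem degU_of_mem_support_weightPart {M : ℕ} {G : ConePoly n}
    {s : Fin (n + 1) ⊕ Fin (n + 1) →₀ ℕ} (hs : s ∈ (weightPart M G).support) :
    degU s = degP s + M := by
  by_contra hne
  refine MvPolynomial.mem_support_iff.1 hs ?_
  rw [weightPart, MvPolynomial.coeff_sum]
  refine Finset.sum_eq_zero fun t ht => ?_
  rw [MvPolynomial.coeff_monomial, if_neg]
  rintro rfl
  exact hne (Finset.mem_filter.1 ht).2

end Weight

/-! ### Generation of the algebra of regular functions by momentum functions -/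

section Generation

variable {n : ℕ}

/-- Restriction of a polynomial to the hyperplane `u_a = 0`. -/
def hyperplane (a : Fin (n + 1)) : ConePoly n →ₐ[ℂ] ConePoly n :=
  MvPolynomial.aeval (Sum.elim (fun i => if i = a then 0 else MvPolynomial.X (Sum.inl i)) fun j =>
    MvPolynomial.X (Sum.inr j))

theorem evalCone_hyperplane (a : Fin (n + 1)) (u p : Fin (n + 1) → ℂ) (G : ConePoly n) :
    evalCone u p (hyperplane a G) = evalCone (Function.update u a 0) p G := by
  rw [hyperplane, evalCone, eval_aeval]
  congr 2
  funext i
  rcases i with i | j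
  · by_cases h : i = a
    · subst h
      simp
    · simp [h]
  · simp

theorem X_dvd_sub_hyperplane (a : Fin (n + 1)) (G : ConePoly n) :
    MvPolynomial.X (Sum.inl a) ∣ G - hyperplane a G := by
  induction G using MvPolynomial.induction_on with
  | C x => simp [hyperplane]
  | add G H hG hH =>
    rw [map_add]
    convert dvd_add hG hH using 1
    ring
  | mul_X G s hG =>
    have h0 : MvPolynomial.X (Sum.inl a) ∣
        MvPolynomial.X s - hyperplane a (MvPolynomial.X s : ConePoly n) := by
      rcases s with i | j
      · by_cases h : i = a
        · subst h
          simp [hyperplane]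
        · simp [hyperplane, h]
      · simp [hyperplane]
    rw [map_mul]
    convert dvd_add (hG.mul_right (MvPolynomial.X s)) (h0.mul_left (hyperplane a G)) using 1
    ring

/-- If `a` and `b` are the only indices, a monomial of positive degree in `u` that survives `u_a =
0` contains `u_b`. This is the additional input for the projective line, where the quadric is the
reducible polynomial `u_b p_b`. -/
theorem X_dvd_hyperplane {a b : Fin (n + 1)} (hab : ∀ i, i = a ∨ i = b) {G : ConePoly n}
    (hG : ∀ s ∈ G.support, degU s ≠ 0) : MvPolynomial.X (Sum.inl b) ∣ hyperplane a G := by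
  rw [G.as_sum, map_sum]
  refine Finset.dvd_sum fun s hs => ?_
  obtain ⟨i, _, hi⟩ := Finset.exists_ne_zero_of_sum_ne_zero (hG s hs)
  rw [hyperplane, MvPolynomial.aeval_monomial]
  refine Dvd.dvd.mul_left ?_ _
  rw [Finsupp.prod_fintype _ _ (fun i => pow_zero _)]
  refine Dvd.dvd.trans ?_ (Finset.dvd_prod_of_mem _ (Finset.mem_univ (Sum.inl i)))
  refine dvd_pow ?_ hi
  rw [Sum.elim_inl]
  split_ifs with h
  · exact dvd_zero _
  · rw [(hab i).resolve_left h]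

theorem CotP.mk_smul (u p : Fin (n + 1) → ℂ) (hu : u ≠ 0) (hp : p ⬝ᵥ u = 0) (c : ℂˣ)
    (hu' : c • u ≠ 0) (hp' : (c⁻¹ • p) ⬝ᵥ (c • u) = 0) :
    CotP.mk (c • u) (c⁻¹ • p) hu' hp' = CotP.mk u p hu hp :=
  (Quotient.sound ⟨c, rfl, rfl⟩ : CotP.mk u p hu hp = _).symm

theorem smul_dotProduct_smul_inv {u p : Fin (n + 1) → ℂ} (hp : p ⬝ᵥ u = 0) (c : ℂˣ) :
    (c⁻¹ • p) ⬝ᵥ (c • u) = 0 := by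
  rw [smul_dotProduct, dotProduct_smul, hp, smul_zero, smul_zero]

/-- The left side is homogeneous of weight `M`, because `f` is a function of the class of `(u, p)`;
so only the part of weight `M` of the polynomial matters. -/
theorem eq_weightPart {f : CotP ℂ n → ℂ} {a : Fin (n + 1)} {M : ℕ} {G : ConePoly n}
    (h : ∀ u p hu hp, u a ≠ 0 → u a ^ M * f (CotP.mk u p hu hp) = evalCone u p G)
    (u p : Fin (n + 1) → ℂ) (hu : u ≠ 0) (hp : p ⬝ᵥ u = 0) (ha : u a ≠ 0) :
    u a ^ M * f (CotP.mk u p hu hp) = evalCone u p (weightPart M G) := by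
  symm
  refine evalCone_weightPart_eq fun c => ?_
  have hu' : c • u ≠ 0 := by rwa [Ne, smul_eq_zero_iff_eq]
  rw [← h (c • u) (c⁻¹ • p) hu' (smul_dotProduct_smul_inv hp c)
    (by rw [Pi.smul_apply, Ne, smul_eq_zero_iff_eq]; exact ha), CotP.mk_smul u p hu hp,
    Pi.smul_apply, Units.smul_def, smul_eq_mul, mul_pow, mul_assoc]

/-- A function regular on the chart `u_b ≠ 0` has no pole along `u_a = 0`. -/
theorem evalCone_eq_zero_of_hyperplane {f : Reg n} {a b : Fin (n + 1)} (hab : a ≠ b) {M : ℕ}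
    {G : ConePoly n}
    (h : ∀ u p hu hp, u a ≠ 0 → u a ^ (M + 1) * f.1 (CotP.mk u p hu hp) = evalCone u p G)
    {u p : Fin (n + 1) → ℂ} (hp : p ⬝ᵥ u = 0) (ha : u a = 0) (hb : u b ≠ 0) :
    evalCone u p G = 0 := by
  obtain ⟨c, hc⟩ := f.2 b
  rw [hasAlgSymbol_iff] at hc
  obtain ⟨M', G', hG'⟩ := exists_clear b c
  -- The curve `(v t, q t)` leaves the hyperplane `u_a = 0` with speed one. The change of the
  -- covector in the direction `b` keeps it on the cone, and `u_b` stays constant.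
  let v : ℂ → Fin (n + 1) → ℂ := fun t => u + t • Pi.single a 1
  let q : ℂ → Fin (n + 1) → ℂ := fun t => p - (t * p a / u b) • Pi.single b 1
  have hva : ∀ t, v t a = t := fun t => by simp [v, ha]
  have hvb : ∀ t, v t b = u b := fun t => by simp [v, hab.symm]
  have hvq : ∀ t, q t ⬝ᵥ v t = 0 := fun t => by
    simp only [q, v, sub_dotProduct, dotProduct_add, hp, dotProduct_smul, smul_dotProduct,
      single_dotProduct, dotProduct_single, Pi.sub_apply, Pi.smul_apply,
      Pi.single_eq_of_ne hab, smul_eq_mul]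
    field_simp
    ring
  have hcont : ∀ H : ConePoly n, Continuous fun t => evalCone (v t) (q t) H := fun H => by
    refine (MvPolynomial.continuous_eval H).comp (continuous_pi fun i => ?_)
    rcases i with i | i
    · simp only [Sum.elim_inl, v]
      fun_prop
    · simp only [Sum.elim_inr, q]
      fun_prop
  -- For `t ≠ 0` both charts apply and the two expressions for `f` agree; continuity gives the
  -- identity at `t = 0`, where the right side has the factor `0 ^ (M + 1)`.
  have h1 : (fun t => u b ^ M' * evalCone (v t) (q t) G) =
      fun t => t ^ (M + 1) * evalCone (v t) (q t) G' := by
    refine Continuous.ext_on (dense_compl_singleton (0 : ℂ)) (by have := hcont G; fun_prop)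
      (by have := hcont G'; fun_prop) fun t ht => ?_
    have hb' : v t b ≠ 0 := by rwa [hvb]
    have ha' : v t a ≠ 0 := by rw [hva]; exact ht
    have h2 := h (v t) (q t) (ne_zero_of_apply_ne_zero hb') (hvq t) ha'
    rw [hc _ _ _ _ hb'] at h2
    have h3 := hG' (v t) (q t) hb'
    rw [hvb] at h3
    rw [hva] at h2
    rw [← h2, ← h3]
    ring
  have h2 := congrFun h1 0
  have hv0 : v 0 = u := by simp [v]
  have hq0 : q 0 = p := by simp [q]
  rw [hv0, hq0, zero_pow (Nat.succ_ne_zero M), zero_mul] at h2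
  exact (mul_eq_zero.1 h2).resolve_left (pow_ne_zero _ hb)

/-- Regularity on the chart `u_b ≠ 0` makes `G` vanish on the part `u_a = 0` of the cone, that is,
on the quadric. Hence `G` restricted to `u_a = 0` is divisible by the quadric, which equals `-u_a
p_a` on the cone, and a factor `u_a` can be cancelled. The weight part is used because the case of
the projective line needs monomials of positive degree in `u`. -/
theorem exists_pole_order_pred {f : Reg n} {a b : Fin (n + 1)} (hab : a ≠ b) {M : ℕ}
    {G : ConePoly n}
    (h : ∀ u p hu hp, u a ≠ 0 → u a ^ (M + 1) * f.1 (CotP.mk u p hu hp) = evalCone u p G) :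
    ∃ G' : ConePoly n,
      ∀ u p hu hp, u a ≠ 0 → u a ^ M * f.1 (CotP.mk u p hu hp) = evalCone u p G' := by
  have h' := eq_weightPart h
  have hdvd : quadric a ∣ hyperplane a (weightPart (M + 1) G) := by
    refine quadric_dvd hab (fun u p hb hq => ?_) fun hi => X_dvd_hyperplane hi fun s hs => ?_
    · rw [evalCone_hyperplane]
      refine evalCone_eq_zero_of_hyperplane hab h' ?_ (Function.update_self _ _ _)
        (by rwa [Function.update_of_ne hab.symm])
      rw [dotProduct_eq_quadric a, Function.update_self, zero_mul, zero_add, ← hq,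
        evalCone_quadric, evalCone_quadric]
      exact Finset.sum_congr rfl fun j hj => by
        rw [Function.update_of_ne (Finset.ne_of_mem_erase hj)]
    · rw [degU_of_mem_support_weightPart hs]
      omega
  obtain ⟨B, hB⟩ := hdvd
  obtain ⟨A, hA⟩ := X_dvd_sub_hyperplane a (weightPart (M + 1) G)
  -- On the cone `u_a A + quadric * B` equals `u_a (A - p_a B)`.
  refine ⟨A - MvPolynomial.X (Sum.inr a) * B, fun u p hu hp ha => ?_⟩
  have h1 := congrArg (evalCone u p) (sub_eq_iff_eq_add.1 hA)
  rw [← h' u p hu hp ha, hB, map_add, map_mul, map_mul, MvPolynomial.eval_X, Sum.elim_inl] at h1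
  have h2 := dotProduct_eq_quadric a u p
  rw [hp] at h2
  rw [map_sub, map_mul, MvPolynomial.eval_X, Sum.elim_inr]
  refine mul_left_cancel₀ ha ?_
  linear_combination h1 - evalCone u p B * h2

theorem exists_eq_evalCone (f : Reg n) {a b : Fin (n + 1)} (hab : a ≠ b) : ∃ G : ConePoly n,
    ∀ u p hu hp, u a ≠ 0 → f.1 (CotP.mk u p hu hp) = evalCone u p (weightPart 0 G) := by
  obtain ⟨c, hc⟩ := f.2 a
  rw [hasAlgSymbol_iff] at hc
  obtain ⟨M, G, hG⟩ := exists_clear a c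
  have h : ∀ u p hu hp, u a ≠ 0 → u a ^ M * f.1 (CotP.mk u p hu hp) = evalCone u p G :=
    fun u p hu hp ha => by rw [hc u p hu hp ha, hG u p ha]
  clear hG
  induction M generalizing G with
  | zero =>
    refine ⟨G, fun u p hu hp ha => ?_⟩
    have h1 := eq_weightPart h u p hu hp ha
    rwa [pow_zero, one_mul] at h1
  | succ M ih =>
    obtain ⟨G', hG'⟩ := exists_pole_order_pred hab h
    exact ih G' hG'

theorem momentum_mem_reg (x : Matrix (Fin (n + 1)) (Fin (n + 1)) ℂ) : momentum x ∈ Reg n := by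
  rw [momentum_eq_sum]
  refine Subalgebra.sum_mem _ fun i _ => Subalgebra.sum_mem _ fun j _ =>
    Subalgebra.smul_mem _ (fun k => ?_) _
  refine ⟨momSym MvPolynomial.X k i j, fun u p hu hp hk => ?_⟩
  rw [eval₂_momSym _ hk hp (fun l => by simp [chartCoord]), momentum_mk]
  simp [Matrix.single_mulVec, dotProduct, Function.update_apply]

/-- The momentum function, as a regular function. -/
def momReg (x : Matrix (Fin (n + 1)) (Fin (n + 1)) ℂ) : Reg n := ⟨momentum x, momentum_mem_reg x⟩

theorem momentum_sub_smul_one (x : Matrix (Fin (n + 1)) (Fin (n + 1)) ℂ) (c : ℂ) :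
    momentum (x - c • 1) = momentum x := by
  funext y
  induction y using cotP_induction with
  | h u p hu hp =>
    rw [momentum_mk, momentum_mk, Matrix.sub_mulVec, Matrix.smul_mulVec, Matrix.one_mulVec,
      dotProduct_sub, dotProduct_smul, hp, smul_zero, sub_zero]

variable (n) in
/-- The algebra generated by the momentum functions. -/
def momGen : Subalgebra ℂ (Reg n) :=
  Algebra.adjoin ℂ {f : Reg n | ∃ x : Matrix (Fin (n + 1)) (Fin (n + 1)) ℂ,
    x.trace = 0 ∧ f.1 = momentum x}

/-- Subtracting a multiple of the identity makes the matrix trace free and leaves the momentum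
function unchanged, as `p(u) = 0`. -/
theorem momReg_mem_momGen (x : Matrix (Fin (n + 1)) (Fin (n + 1)) ℂ) : momReg x ∈ momGen n := by
  refine Algebra.subset_adjoin ⟨x - (x.trace / (n + 1)) • 1, ?_, (momentum_sub_smul_one _ _).symm⟩
  have h : (n : ℂ) + 1 ≠ 0 := by exact_mod_cast Nat.succ_ne_zero n
  rw [Matrix.trace_sub, Matrix.trace_smul, Matrix.trace_one, Fintype.card_fin, smul_eq_mul]
  push_cast
  field_simp
  ring

theorem exists_single_add {s : Fin (n + 1) ⊕ Fin (n + 1) →₀ ℕ} {d : ℕ} (hU : degU s = d + 1)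
    (hP : degP s = d + 1) : ∃ (i j : Fin (n + 1)) (t : Fin (n + 1) ⊕ Fin (n + 1) →₀ ℕ),
      degU t = d ∧ degP t = d ∧
        s = t + Finsupp.single (Sum.inl i) 1 + Finsupp.single (Sum.inr j) 1 := by
  obtain ⟨i, _, hi⟩ := Finset.exists_ne_zero_of_sum_ne_zero
    (show ∑ i, s (Sum.inl i) ≠ 0 by rw [← degU, hU]; omega)
  obtain ⟨j, _, hj⟩ := Finset.exists_ne_zero_of_sum_ne_zero
    (show ∑ i, s (Sum.inr i) ≠ 0 by rw [← degP, hP]; omega)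
  have e : s = (s - Finsupp.single (Sum.inl i) 1 - Finsupp.single (Sum.inr j) 1) +
      Finsupp.single (Sum.inl i) 1 + Finsupp.single (Sum.inr j) 1 := by
    ext r
    rcases r with r | r
    · by_cases h : i = r
      · subst h
        simp
        omega
      · simp [h]
    · by_cases h : j = r
      · subst h
        simp
        omega
      · simp [h]
  refine ⟨i, j, _, ?_, ?_, e⟩
  · rw [e] at hU
    simp only [degU, Finsupp.add_apply, Finset.sum_add_distrib] at hU ⊢
    simp [Finsupp.single_apply] at hU ⊢
    omega
  · rw [e] at hP
    simp only [degP, Finsupp.add_apply, Finset.sum_add_distrib] at hP ⊢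
    simp [Finsupp.single_apply] at hP ⊢
    omega

theorem evalMon_add_single (u p : Fin (n + 1) → ℂ) (i j : Fin (n + 1))
    (t : Fin (n + 1) ⊕ Fin (n + 1) →₀ ℕ) :
    evalMon u p (t + Finsupp.single (Sum.inl i) 1 + Finsupp.single (Sum.inr j) 1) =
      evalMon u p t * (u i * p j) := by
  simp only [evalMon, Finsupp.add_apply, pow_add, Finset.prod_mul_distrib]
  simp [Finsupp.single_apply, pow_ite]
  ring

/-- A monomial with equal degrees in `u` and `p` is a product of factors `u_i p_j`, and each of
these is minus the momentum function of `E_ji`. -/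
theorem exists_eq_evalMon {d : ℕ} {s : Fin (n + 1) ⊕ Fin (n + 1) →₀ ℕ} (hU : degU s = d)
    (hP : degP s = d) :
    ∃ f ∈ momGen n, ∀ u p hu hp, f.1 (CotP.mk u p hu hp) = evalMon u p s := by
  induction d generalizing s with
  | zero =>
    refine ⟨1, Subalgebra.one_mem _, fun u p hu hp => ?_⟩
    rw [degU, Finset.sum_eq_zero_iff] at hU
    rw [degP, Finset.sum_eq_zero_iff] at hP
    rw [evalMon, Finset.prod_eq_one fun i hi => by rw [hU i hi, pow_zero],
      Finset.prod_eq_one fun i hi => by rw [hP i hi, pow_zero], one_mul]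
    rfl
  | succ d ih =>
    obtain ⟨i, j, t, h1, h2, rfl⟩ := exists_single_add hU hP
    obtain ⟨f, hf, hf'⟩ := ih h1 h2
    refine ⟨f * ((-1 : ℂ) • momReg (Matrix.single j i 1)), Subalgebra.mul_mem _ hf
      (Subalgebra.smul_mem _ (momReg_mem_momGen _) _), fun u p hu hp => ?_⟩
    rw [evalMon_add_single, ← hf' u p hu hp]
    change f.1 (CotP.mk u p hu hp) * ((-1 : ℂ) * momentum (Matrix.single j i 1)
      (CotP.mk u p hu hp)) = _
    rw [momentum_mk]
    simp [Matrix.single_mulVec, dotProduct, Function.update_apply, mul_comm]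

/-- The assumption on `n` provides two different coordinates, so that poles along one can be removed
by regularity on the other chart. What remains is a polynomial of weight zero, whose monomials are
products of momentum functions. -/
theorem momGen_eq_top (hn : 1 ≤ n) : momGen n = ⊤ := by
  refine eq_top_iff.2 fun f _ => ?_
  have hab : (0 : Fin (n + 1)) ≠ Fin.last n := by
    rw [Ne, Fin.ext_iff, Fin.val_zero, Fin.val_last]
    omega
  obtain ⟨G, hG⟩ := exists_eq_evalCone f hab
  have h : ∀ s : Fin (n + 1) ⊕ Fin (n + 1) →₀ ℕ, ∃ g ∈ momGen n, degU s = degP s + 0 →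
      ∀ u p hu hp, g.1 (CotP.mk u p hu hp) = evalMon u p s := by
    intro s
    by_cases hs : degU s = degP s + 0
    · obtain ⟨g, hg, hg'⟩ := exists_eq_evalMon hs rfl
      exact ⟨g, hg, fun _ => hg'⟩
    · exact ⟨0, Subalgebra.zero_mem _, fun h => absurd h hs⟩
  choose g hg hg' using h
  have e : f = ∑ s ∈ G.support with degU s = degP s + 0, G.coeff s • g s := by
    refine reg_ext_of_real (m := 0) fun u p hu hp h0 => ?_
    rw [complexify_mk, hG _ _ _ _ (by exact_mod_cast h0), evalCone_weightPart,
      AddSubmonoidClass.coe_finsetSum, Finset.sum_apply]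
    refine Finset.sum_congr rfl fun s hs => ?_
    rw [← hg' s (Finset.mem_filter.1 hs).2 _ _ (ofReal_comp_ne_zero hu) (ofReal_dotProduct hp)]
    rfl
  rw [e]
  exact Subalgebra.sum_mem _ fun s _ => Subalgebra.smul_mem _ (hg s) _

theorem momAlg_eq_adjoin (hn : 1 ≤ n) : MomAlg n = Algebra.adjoin ℂ
    {φ : Sym n | ∃ x : Matrix (Fin (n + 1)) (Fin (n + 1)) ℂ,
      x.trace = 0 ∧ φ.1 = momentumReal x} := by
  rw [MomAlg, ← Algebra.map_top, ← momGen_eq_top hn, momGen, AlgHom.map_adjoin]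
  congr 1
  ext φ
  constructor
  · rintro ⟨f, ⟨x, hx, hf⟩, rfl⟩
    refine ⟨x, hx, ?_⟩
    change (fun y => f.1 (complexify y)) = _
    rw [hf]
    rfl
  · rintro ⟨x, hx, hφ⟩
    exact ⟨momReg x, ⟨x, hx, rfl⟩, Subtype.ext hφ.symm⟩

theorem momentumReal_mem_symDeg (x : Matrix (Fin (n + 1)) (Fin (n + 1)) ℂ) :
    restrict n (momReg x) ∈ SymDeg n 1 := by
  have h : restrict n (momReg x) = ∑ i, ∑ j, x i j • restrict n (momReg (Matrix.single i j 1)) := by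
    apply Subtype.ext
    rw [AddSubmonoidClass.coe_finsetSum]
    simp only [AddSubmonoidClass.coe_finsetSum]
    exact momentumReal_eq_sum x
  rw [h]
  exact Submodule.sum_mem _ fun i _ => Submodule.sum_mem _ fun j _ => Submodule.smul_mem _ _
    fun k => ⟨_, momSym_isHomogeneous k i j, hasSymbol_momentumReal k i j⟩

/-- The momentum algebra is contained in every graded subalgebra containing the momentum
functions. -/
theorem momAlg_le_iSup_of_mul_mem (hn : 1 ≤ n) {T : ℕ → Submodule ℂ (Sym n)} (h1 : 1 ∈ T 0)
    (hx : ∀ x, restrict n (momReg x) ∈ T 1)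
    (hmul : ∀ j k, ∀ φ ∈ T j, ∀ ψ ∈ T k, φ * ψ ∈ T (j + k)) {φ : Sym n} (hφ : φ ∈ MomAlg n) :
    φ ∈ ⨆ d, T d := by
  rw [momAlg_eq_adjoin hn] at hφ
  induction hφ using Algebra.adjoin_induction with
  | mem φ h =>
    obtain ⟨x, _, h⟩ := h
    have e : restrict n (momReg x) = φ := Subtype.ext h.symm
    rw [← e]
    exact Submodule.mem_iSup_of_mem 1 (hx x)
  | algebraMap c =>
    rw [Algebra.algebraMap_eq_smul_one]
    exact Submodule.smul_mem _ _ (Submodule.mem_iSup_of_mem 0 h1)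
  | add φ ψ _ _ h2 h3 => exact Submodule.add_mem _ h2 h3
  | mul φ ψ _ _ h2 h3 =>
    refine Submodule.iSup_induction _ (motive := fun φ => φ * ψ ∈ _) h2 (fun j φ hφ => ?_) ?_ ?_
    · refine Submodule.iSup_induction _ (motive := fun ψ => φ * ψ ∈ _) h3 (fun k ψ hψ => ?_) ?_ ?_
      · exact Submodule.mem_iSup_of_mem (j + k) (hmul j k φ hφ ψ hψ)
      · rw [mul_zero]
        exact Submodule.zero_mem _
      · intro a b ha hb
        rw [mul_add]
        exact Submodule.add_mem _ ha hb
    · rw [zero_mul]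
      exact Submodule.zero_mem _
    · intro a b ha hb
      rw [add_mul]
      exact Submodule.add_mem _ ha hb

theorem momAlg_le_iSup (hn : 1 ≤ n) :
    Subalgebra.toSubmodule (MomAlg n) ≤ ⨆ d, Subalgebra.toSubmodule (MomAlg n) ⊓ SymDeg n d :=
  fun _ hφ => momAlg_le_iSup_of_mul_mem hn
    (T := fun d => Subalgebra.toSubmodule (MomAlg n) ⊓ SymDeg n d)
    ⟨Subalgebra.one_mem _, one_mem_symDeg⟩
    (fun x => ⟨⟨momReg x, rfl⟩, momentumReal_mem_symDeg x⟩)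
    (fun _ _ _ hφ _ hψ => ⟨Subalgebra.mul_mem _ hφ.1 hψ.1, mul_mem_symDeg hφ.2 hψ.2⟩) hφ

/-- The components of an element of a graded subspace lie in the graded pieces. -/
theorem symComp_mem_of_mem_iSup {T : ℕ → Submodule ℂ (Sym n)} (hT : ∀ d, T d ≤ SymDeg n d)
    {φ : Sym n} (hφ : φ ∈ ⨆ d, T d) (d : ℕ) : symComp d φ ∈ T d := by
  refine Submodule.iSup_induction _ (motive := fun φ => symComp d φ ∈ T d) hφ (fun e φ h => ?_) ?_ ?_
  · by_cases hde : d = e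
    · subst hde
      rwa [symComp_of_mem (hT d h)]
    · rw [symComp_of_ne hde (hT e h)]
      exact Submodule.zero_mem _
  · rw [map_zero]
    exact Submodule.zero_mem _
  · intro a b ha hb
    rw [map_add]
    exact Submodule.add_mem _ ha hb

theorem symComp_mem_momAlg (hn : 1 ≤ n) {φ : Sym n} (hφ : φ ∈ MomAlg n) (d : ℕ) :
    symComp d φ ∈ MomAlg n :=
  (symComp_mem_of_mem_iSup (fun _ => inf_le_right) (momAlg_le_iSup hn hφ) d).1

end Generation

/-! ### Operators with polynomial full symbols -/

section PolynomialOperators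

variable {n : ℕ} {lam : ℂ}

theorem smoothD_polyToSmooth (i : Fin n) (q : MvPolynomial (Fin n) ℂ) :
    smoothD i (polyToSmooth n q) = polyToSmooth n (MvPolynomial.pderiv i q) := by
  change smoothD i (polyToSmoothAlg n q) = polyToSmoothAlg n (MvPolynomial.pderiv i q)
  induction q using MvPolynomial.induction_on with
  | C c =>
    rw [MvPolynomial.pderiv_C, map_zero, ← MvPolynomial.algebraMap_eq, AlgHom.commutes]
    exact Derivation.map_algebraMap _ _
  | add p q hp hq => rw [map_add, map_add, map_add, map_add, hp, hq]
  | mul_X p j hp =>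
    have h : smoothD i (polyToSmoothAlg n (MvPolynomial.X j)) =
        polyToSmoothAlg n (MvPolynomial.pderiv i (MvPolynomial.X j)) := by
      refine (smoothD_smoothCoord i j).trans ?_
      rw [MvPolynomial.pderiv_X, Pi.single_apply]
      by_cases h : i = j
      · subst h
        rw [if_pos rfl, if_pos rfl, map_one]
      · rw [if_neg h, if_neg (Ne.symm h), map_zero]
    rw [map_mul, Derivation.leibniz, Derivation.leibniz, hp, h]
    simp only [smul_eq_mul, map_add, map_mul]

theorem pderiv_commuting : Commuting fun i : Fin n => MvPolynomial.pderiv (R := ℂ) i :=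
  fun i j q => by
    have h : ⁅MvPolynomial.pderiv (R := ℂ) i, MvPolynomial.pderiv (R := ℂ) j⁆ = 0 := by
      refine MvPolynomial.derivation_ext fun k => ?_
      rw [Derivation.commutator_apply, MvPolynomial.pderiv_X, MvPolynomial.pderiv_X,
        Pi.single_apply, Pi.single_apply]
      split_ifs <;> simp
    have h1 := congrArg (fun D => D q) h
    rwa [Derivation.commutator_apply, Derivation.zero_apply, sub_eq_zero] at h1

theorem toSmooth_comp (a b : PolAlg n) :
    toSmooth (comp (fun i => MvPolynomial.pderiv (R := ℂ) i) a b) =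
      comp smoothD (toSmooth a) (toSmooth b) :=
  map_comp (D := fun i => MvPolynomial.pderiv (R := ℂ) i) (D' := smoothD) pderiv_commuting
    smoothD_commuting (polyToSmooth n) (fun i q => (smoothD_polyToSmooth i q).symm) a b

theorem hasFullSymbol_algebraMap (c : ℂ) (k : Fin (n + 1)) :
    HasFullSymbol k (algebraMap ℂ (Module.End ℂ (Dens n lam)) c)
      (toSmooth (MvPolynomial.C (MvPolynomial.C c))) := by
  have h := (HasFullSymbol.one (lam := lam) k).smul c
  rw [mul_one] at h
  have e : algebraMap ℂ (Module.End ℂ (Dens n lam)) c = c • 1 := Algebra.algebraMap_eq_smul_one c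
  rw [e, toSmooth, MvPolynomial.map_C]
  have e' : polyToSmooth n (MvPolynomial.C c) = algebraMap ℂ (Smooth n) c :=
    (polyToSmoothAlg n).commutes c
  rwa [e']

variable (n lam) in
/-- The algebra of the operators whose full symbols are polynomials in all charts. -/
def polyOp : Subalgebra ℂ (Module.End ℂ (Dens n lam)) where
  carrier := {P | ∀ k, ∃ b, HasFullSymbol k P (toSmooth b)}
  mul_mem' := by
    intro P R hP hR k
    obtain ⟨a, ha⟩ := hP k
    obtain ⟨b, hb⟩ := hR k
    exact ⟨_, by rw [toSmooth_comp]; exact ha.mul hb⟩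
  add_mem' := by
    intro P R hP hR k
    obtain ⟨a, ha⟩ := hP k
    obtain ⟨b, hb⟩ := hR k
    exact ⟨a + b, by rw [map_add]; exact ha.add hb⟩
  algebraMap_mem' c k := ⟨_, hasFullSymbol_algebraMap c k⟩

theorem hasFullSymbol_eta (k i j : Fin (n + 1)) : HasFullSymbol k (eta lam i j)
    (toSmooth (lieSym MvPolynomial.X (-(lam * (n + 1))) k i j)) := by
  have h := map_lieSym (y := MvPolynomial.X) (polyToSmoothAlg n) (-(lam * (n + 1))) k i j
  have h1 := hasFullSymbol_lieDeriv (lam := lam) k i j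
  rw [show (smoothCoord : Fin n → Smooth n) =
    fun l => polyToSmoothAlg n (MvPolynomial.X l) from rfl, ← h] at h1
  exact h1

variable (n lam) in
/-- The algebra of operators generated by the Lie derivatives. -/
def lieOp : Subalgebra ℂ (Module.End ℂ (Dens n lam)) :=
  Algebra.adjoin ℂ (Set.range fun ij : Fin (n + 1) × Fin (n + 1) => eta lam ij.1 ij.2)

theorem eta_mem_lieOp (i j : Fin (n + 1)) : eta lam i j ∈ lieOp n lam :=
  Algebra.subset_adjoin ⟨(i, j), rfl⟩

theorem lieOp_le_polyOp : lieOp n lam ≤ polyOp n lam := by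
  refine Algebra.adjoin_le ?_
  rintro _ ⟨ij, rfl⟩ k
  exact ⟨_, hasFullSymbol_eta k ij.1 ij.2⟩

theorem ad_mem_subalgebra {R : Type*} [Ring R] [Algebra ℂ R] {U : Subalgebra ℂ R} {x y : R}
    (hx : x ∈ U) (hy : y ∈ U) : ad x y ∈ U := by
  rw [ad_apply]
  exact Subalgebra.sub_mem _ (Subalgebra.mul_mem _ hx hy) (Subalgebra.mul_mem _ hy hx)

theorem casimir_mem_subalgebra {R : Type*} [Ring R] [Algebra ℂ R] {U : Subalgebra ℂ R} {r : ℕ}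
    {A : Fin r → Fin r → R} (hA : ∀ i j, A i j ∈ U) {x : R} (hx : x ∈ U) : casimir A x ∈ U := by
  rw [casimir_apply]
  exact Subalgebra.sum_mem _ fun i _ => Subalgebra.sum_mem _ fun j _ =>
    ad_mem_subalgebra (hA i j) (ad_mem_subalgebra (hA j i) hx)

theorem lieDeriv_complex_mem (x : Matrix (Fin (n + 1)) (Fin (n + 1)) ℂ) :
    ∃ P ∈ lieOp n lam, IsPrincipalSymbol 1 P (momentumReal x) := by
  refine ⟨∑ i, ∑ j, x i j • eta lam i j, Subalgebra.sum_mem _ fun i _ => Subalgebra.sum_mem _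
    fun j _ => Subalgebra.smul_mem _ (eta_mem_lieOp i j) _, ?_⟩
  rw [momentumReal_eq_sum]
  exact IsPrincipalSymbol.sum _ fun i _ => IsPrincipalSymbol.sum _ fun j _ =>
    (isPrincipalSymbol_lieDeriv_single i j).smul _

variable (n lam) in
/-- The symbols of degree `d` of operators generated by Lie derivatives. -/
def lieSymDeg (d : ℕ) : Submodule ℂ (Sym n) where
  carrier := {φ | φ ∈ SymDeg n d ∧ ∃ P ∈ lieOp n lam, IsPrincipalSymbol d P φ.1}
  zero_mem' := ⟨Submodule.zero_mem _, 0, Subalgebra.zero_mem _,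
    isPrincipalSymbol_zero_of_mem (Submodule.zero_mem _)⟩
  add_mem' := by
    rintro φ ψ ⟨h1, P, h2, h3⟩ ⟨h4, R, h5, h6⟩
    exact ⟨Submodule.add_mem _ h1 h4, P + R, Subalgebra.add_mem _ h2 h5, h3.add h6⟩
  smul_mem' := by
    rintro c φ ⟨h1, P, h2, h3⟩
    exact ⟨Submodule.smul_mem _ c h1, c • P, Subalgebra.smul_mem _ h2 c, h3.smul c⟩

/-- Since momentum functions generate, a symbol in the momentum algebra is a polynomial in them, and
replacing them by Lie derivatives in a monomial gives an operator with that monomial as its symbol.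
Taking the component of degree `d` makes the degrees match. -/
theorem exists_mem_lieOp (hn : 1 ≤ n) {d : ℕ} {φ : Sym n} (hφ : φ ∈ SymDeg n d)
    (h : φ ∈ MomAlg n) : ∃ P ∈ lieOp n lam, IsPrincipalSymbol d P φ.1 := by
  have h1 : φ ∈ ⨆ d, lieSymDeg n lam d := by
    refine momAlg_le_iSup_of_mul_mem hn (T := lieSymDeg n lam) ⟨one_mem_symDeg, 1, Subalgebra.one_mem _,
      isPrincipalSymbol_one⟩ (fun x => ⟨momentumReal_mem_symDeg x, lieDeriv_complex_mem x⟩) ?_ h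
    rintro j k φ ⟨h1, P, h2, h3⟩ ψ ⟨h4, R, h5, h6⟩
    exact ⟨mul_mem_symDeg h1 h4, P * R, Subalgebra.mul_mem _ h2 h5, h3.mul h6⟩
  have h2 := symComp_mem_of_mem_iSup (T := lieSymDeg n lam) (fun d φ h => h.1) h1 d
  rw [symComp_of_mem hφ] at h2
  exact h2.2

/-- The algebra generated by the Lie derivatives is stable under the Casimir operator. Correcting a
lift in this algebra to an eigenlift stays in it, and the eigenlift is unique. -/
theorem quantLin_mem_lieOp (hn : 1 ≤ n) {φ : Sym n} (hφ : φ ∈ MomAlg n) :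
    quantLin n lam φ ∈ lieOp n lam := by
  have h : ∀ {d : ℕ} {φ : Sym n}, φ ∈ SymDeg n d → φ ∈ MomAlg n →
      quantLin n lam φ ∈ lieOp n lam := by
    intro d φ hφ h
    obtain ⟨P, hP, hP'⟩ := exists_mem_lieOp (lam := lam) hn hφ h
    obtain ⟨R, hR, hR'⟩ := exists_isEigenLift_mem (Subalgebra.toSubmodule (lieOp n lam))
      (fun P hP => casimir_mem_subalgebra (A := eta (n := n) lam) eta_mem_lieOp hP) hP hP'
    rw [(quantLin_of_mem hφ).unique hR']
    exact hR
  obtain ⟨N, _, hN⟩ := exists_sum_symComp φ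
  rw [hN, map_sum]
  exact Subalgebra.sum_mem _ fun d _ => h (symComp_mem d φ) (symComp_mem_momAlg hn hφ d)

theorem toSmooth_homogeneousComponent (d : ℕ) (b : PolAlg n) :
    MvPolynomial.homogeneousComponent d (toSmooth b) =
      toSmooth (MvPolynomial.homogeneousComponent d b) := by
  ext1 α
  rw [MvPolynomial.coeff_homogeneousComponent, toSmooth, MvPolynomial.coeff_map,
    MvPolynomial.coeff_map, MvPolynomial.coeff_homogeneousComponent]
  split_ifs
  · rfl
  · rw [map_zero]

/-- The leading parts of polynomial full symbols have polynomial coefficients in each chart, and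
such a symbol extends to a regular function. -/
theorem mem_momAlg_of_mem_polyOp {d : ℕ} {P : Module.End ℂ (Dens n lam)} (hP : P ∈ polyOp n lam)
    {φ : Sym n} (h : IsPrincipalSymbol d P φ.1) : φ ∈ MomAlg n := by
  choose b hb using hP
  refine mem_momAlg_of_hasSymbol (a := fun k => MvPolynomial.homogeneousComponent d (b k))
    fun k => ?_
  obtain ⟨a, h1, _, h3⟩ := h k
  rwa [h1.unique (hb k), toSmooth_homogeneousComponent] at h3

/-- The principal symbol lies in the momentum algebra, and its quantization has polynomial full
symbols too; subtracting it lowers the order inside `polyOp`. -/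
theorem exists_quantLin_eq_of_mem_polyOp (hn : 1 ≤ n) {d : ℕ} {P : Module.End ℂ (Dens n lam)}
    (hP : P ∈ polyOp n lam) (hd : P ∈ OrdLT n lam d) : ∃ φ ∈ MomAlg n, quantLin n lam φ = P := by
  induction d generalizing P with
  | zero => exact ⟨0, Subalgebra.zero_mem _, by rw [ordLT_zero hd, map_zero]⟩
  | succ d ih =>
    obtain ⟨φ, hφ, h⟩ := exists_isPrincipalSymbol hd
    have h1 := mem_momAlg_of_mem_polyOp hP h
    have h2 : P - quantLin n lam φ ∈ polyOp n lam := operator_sub_mem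
      (U := Subalgebra.toSubmodule (polyOp n lam)) hP (lieOp_le_polyOp (quantLin_mem_lieOp hn h1))
    obtain ⟨ψ, hψ, hψ'⟩ := ih h2 (h.sub_mem (quantLin_of_mem (lam := lam) hφ).1)
    refine ⟨ψ + φ, Subalgebra.add_mem _ hψ h1, ?_⟩
    rw [map_add, hψ']
    abel

/-- The quantization of the momentum algebra is the algebra generated by the Lie derivatives. -/
theorem mem_lieOp_iff (hn : 1 ≤ n) {P : Module.End ℂ (Dens n lam)} :
    P ∈ lieOp n lam ↔ ∃ φ ∈ MomAlg n, quantLin n lam φ = P := by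
  constructor
  · intro h
    have h1 := lieOp_le_polyOp h
    have h2 : P ∈ DiffOp n lam := fun k => by
      obtain ⟨b, hb⟩ := h1 k
      exact ⟨_, hb⟩
    obtain ⟨d, hd⟩ := exists_mem_ordLT h2
    exact exists_quantLin_eq_of_mem_polyOp hn h1 hd
  · rintro ⟨φ, hφ, rfl⟩
    exact quantLin_mem_lieOp hn hφ

/-- Polynomial coefficients in every chart already force an operator to be a polynomial in the Lie
derivatives, since its successive principal symbols lie in the momentum algebra. -/
theorem mem_lieOp_iff_mem_polyOp (hn : 1 ≤ n) {P : Module.End ℂ (Dens n lam)} :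
    P ∈ lieOp n lam ↔ P ∈ polyOp n lam := by
  refine ⟨fun h => lieOp_le_polyOp h, fun h1 => ?_⟩
  have h2 : P ∈ DiffOp n lam := fun k => by
    obtain ⟨b, hb⟩ := h1 k
    exact ⟨_, hb⟩
  obtain ⟨d, hd⟩ := exists_mem_ordLT h2
  exact (mem_lieOp_iff hn).2 (exists_quantLin_eq_of_mem_polyOp hn h1 hd)

end PolynomialOperators

/-! ### The star product -/

section Star

variable {n : ℕ} {lam : ℂ}

/-- The component of highest degree of a symbol is the principal symbol of its quantization, so it
vanishes if its degree is not below the bound on the order; the components are removed in turn. -/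
theorem symComp_eq_zero_of_quantLin_mem {d : ℕ} {φ : Sym n}
    (h : quantLin n lam φ ∈ OrdLT n lam d) {e : ℕ} (he : d ≤ e) : symComp e φ = 0 := by
  have key : ∀ N, (∀ e, N ≤ e → symComp e φ = 0) → ∀ e, d ≤ e → symComp e φ = 0 := by
    intro N
    induction N with
    | zero => exact fun h e _ => h e (Nat.zero_le e)
    | succ N ih =>
      intro hN
      by_cases hdN : d ≤ N
      · refine ih fun e he => ?_
        rcases he.eq_or_lt with rfl | he
        · have h1 := quantLin_principal (lam := lam) (d := N) (φ := φ) (fun e he => hN e he)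
          exact Subtype.ext (h1.unique (isPrincipalSymbol_zero_of_mem (ordLT_mono hdN h)))
        · exact hN e he
      · exact fun e he => hN e (by omega)
  obtain ⟨N, hN, _⟩ := exists_sum_symComp φ
  exact key N hN e he

/-- The symbol whose quantization is the composition of the quantizations of two symbols. -/
def compSym (lam : ℂ) (φ ψ : Sym n) : Sym n :=
  (quant n lam).symm ⟨quantLin n lam φ * quantLin n lam ψ,
    mul_mem_diffOp (quantLin_mem_diffOp φ) (quantLin_mem_diffOp ψ)⟩

theorem quantLin_compSym (φ ψ : Sym n) :
    quantLin n lam (compSym lam φ ψ) = quantLin n lam φ * quantLin n lam ψ :=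
  congrArg Subtype.val ((quant n lam).apply_symm_apply ⟨quantLin n lam φ * quantLin n lam ψ,
      mul_mem_diffOp (quantLin_mem_diffOp φ) (quantLin_mem_diffOp ψ)⟩)

theorem compSym_add_left (φ φ' ψ : Sym n) :
    compSym lam (φ + φ') ψ = compSym lam φ ψ + compSym lam φ' ψ := by
  apply quantLin_injective (lam := lam)
  rw [map_add, quantLin_compSym, quantLin_compSym, quantLin_compSym, map_add, add_mul]

theorem compSym_add_right (φ ψ ψ' : Sym n) :
    compSym lam φ (ψ + ψ') = compSym lam φ ψ + compSym lam φ ψ' := by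
  apply quantLin_injective (lam := lam)
  rw [map_add, quantLin_compSym, quantLin_compSym, quantLin_compSym, map_add, mul_add]

theorem compSym_smul_left (c : ℂ) (φ ψ : Sym n) :
    compSym lam (c • φ) ψ = c • compSym lam φ ψ := by
  apply quantLin_injective (lam := lam)
  rw [map_smul, quantLin_compSym, quantLin_compSym, map_smul]
  exact smul_mul_assoc c (quantLin n lam φ) (quantLin n lam ψ)

theorem compSym_smul_right (c : ℂ) (φ ψ : Sym n) :
    compSym lam φ (c • ψ) = c • compSym lam φ ψ := by
  apply quantLin_injective (lam := lam)
  rw [map_smul, quantLin_compSym, quantLin_compSym, map_smul]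
  exact mul_smul_comm c (quantLin n lam φ) (quantLin n lam ψ)

variable (n lam) in
/-- The product of symbols defined by the composition of their quantizations. -/
def starMul : Sym n →ₗ[ℂ] Sym n →ₗ[ℂ] Sym n :=
  LinearMap.mk₂ ℂ (compSym lam) compSym_add_left compSym_smul_left compSym_add_right
    compSym_smul_right

theorem quantLin_starMul (φ ψ : Sym n) :
    quantLin n lam (starMul n lam φ ψ) = quantLin n lam φ * quantLin n lam ψ :=
  quantLin_compSym φ ψ

theorem starMul_assoc (φ ψ χ : Sym n) : starMul n lam (starMul n lam φ ψ) χ =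
    starMul n lam φ (starMul n lam ψ χ) := by
  apply quantLin_injective (lam := lam)
  rw [quantLin_starMul, quantLin_starMul, quantLin_starMul, quantLin_starMul, mul_assoc]

theorem quantLin_one : quantLin n lam 1 = 1 := by
  refine (quantLin_of_mem one_mem_symDeg).unique ⟨isPrincipalSymbol_one, ?_⟩
  have h : ∀ P : Module.End ℂ (Dens n lam), ad P 1 = 0 := fun P => by
    rw [ad_eq, mul_one, one_mul]
    exact sub_self P
  rw [casimir_eta_apply, Finset.sum_eq_zero fun i _ => Finset.sum_eq_zero fun j _ => by
    rw [h, map_zero]]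
  simp [casVal]

theorem starMul_one_left (φ : Sym n) : starMul n lam 1 φ = φ :=
  quantLin_injective (lam := lam) (by rw [quantLin_starMul, quantLin_one, one_mul])

theorem starMul_one_right (φ : Sym n) : starMul n lam φ 1 = φ :=
  quantLin_injective (lam := lam) (by rw [quantLin_starMul, quantLin_one, mul_one])

theorem symComp_starMul_eq_zero {j k : ℕ} {φ ψ : Sym n} (hφ : φ ∈ SymDeg n j)
    (hψ : ψ ∈ SymDeg n k) {e : ℕ} (he : j + k < e) : symComp e (starMul n lam φ ψ) = 0 := by
  refine symComp_eq_zero_of_quantLin_mem (lam := lam) (d := j + k + 1) ?_ he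
  rw [quantLin_starMul]
  exact mul_mem_ordLT (quantLin_of_mem hφ).1.mem_ordLT (quantLin_of_mem hψ).1.mem_ordLT

theorem symComp_starMul {j k : ℕ} {φ ψ : Sym n} (hφ : φ ∈ SymDeg n j)
    (hψ : ψ ∈ SymDeg n k) : symComp (j + k) (starMul n lam φ ψ) = φ * ψ := by
  have h := quantLin_principal (lam := lam) (d := j + k) (φ := starMul n lam φ ψ)
    (fun e he => symComp_starMul_eq_zero hφ hψ he)
  rw [quantLin_starMul] at h
  exact Subtype.ext (h.unique ((quantLin_of_mem hφ).1.mul (quantLin_of_mem hψ).1))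

theorem starMul_mem_momAlg (hn : 1 ≤ n) {φ ψ : Sym n} (hφ : φ ∈ MomAlg n) (hψ : ψ ∈ MomAlg n) :
    starMul n lam φ ψ ∈ MomAlg n := by
  have h := Subalgebra.mul_mem _ (quantLin_mem_lieOp (lam := lam) hn hφ)
    (quantLin_mem_lieOp (lam := lam) hn hψ)
  obtain ⟨χ, hχ, h'⟩ := (mem_lieOp_iff hn).1 h
  rw [← quantLin_starMul] at h'
  rwa [← quantLin_injective h']

theorem eq_sum_symComp {φ : Sym n} {d : ℕ} (h : ∀ e, d < e → symComp e φ = 0) :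
    φ = ∑ p ∈ Finset.range (d + 1), symComp (d - p) φ := by
  have e := Finset.sum_range_reflect (fun i => symComp i φ) (d + 1)
  simp only [Nat.add_sub_cancel] at e
  rw [e]
  refine sym_ext_symComp fun j => ?_
  rw [symComp_sum_range (fun i => symComp_mem i φ)]
  split_ifs with hj
  · rfl
  · exact h j (by omega)

/-- The coefficients of a star product are the components of the product of symbols. -/
theorem IsStarOf.apply {C : ℕ → Sym n →ₗ[ℂ] Sym n →ₗ[ℂ] Sym n} (hC : IsStarOf (quant n lam) C)
    {j k : ℕ} {φ ψ : Sym n} (hφ : φ ∈ SymDeg n j) (hψ : ψ ∈ SymDeg n k) (p : ℕ) :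
    C p φ ψ = if p ≤ j + k then symComp (j + k - p) (starMul n lam φ ψ) else 0 := by
  obtain ⟨h1, h2, h3⟩ := hC j k φ ψ hφ hψ
  split_ifs with hp
  · have h4 : starMul n lam φ ψ = ∑ p ∈ Finset.range (j + k + 1), C p φ ψ := by
      apply quantLin_injective (lam := lam)
      rw [quantLin_starMul, map_sum]
      exact h3
    rw [h4, map_sum, Finset.sum_eq_single_of_mem p (Finset.mem_range.2 (by omega)),
      symComp_of_mem (h1 p hp)]
    intro q hq hqp
    have := Finset.mem_range.1 hq
    exact symComp_of_ne (by omega) (h1 q (by omega))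
  · exact h2 p (by omega)

theorem IsStarOf.unique {C C' : ℕ → Sym n →ₗ[ℂ] Sym n →ₗ[ℂ] Sym n}
    (hC : IsStarOf (quant n lam) C) (hC' : IsStarOf (quant n lam) C') : C = C' := by
  funext p
  ext1 φ
  ext1 ψ
  induction φ using sym_induction with
  | hom j φ hφ =>
    induction ψ using sym_induction with
    | hom k ψ hψ => rw [hC.apply hφ hψ, hC'.apply hφ hψ]
    | add ψ ψ' h1 h2 => rw [map_add, map_add, h1, h2]
  | add φ φ' h1 h2 => rw [map_add, map_add, LinearMap.add_apply, LinearMap.add_apply, h1, h2]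

/-- The contribution of the components of degrees `j` and `k` to the coefficient of order `p`. -/
def starTerm (lam : ℂ) (p j k : ℕ) (φ ψ : Sym n) : Sym n :=
  if p ≤ j + k then symComp (j + k - p) (starMul n lam (symComp j φ) (symComp k ψ)) else 0

theorem starTerm_finite (p : ℕ) (φ ψ : Sym n) :
    (Function.support fun jk : ℕ × ℕ => starTerm lam p jk.1 jk.2 φ ψ).Finite := by
  obtain ⟨N, hN, _⟩ := exists_sum_symComp φ
  obtain ⟨M, hM, _⟩ := exists_sum_symComp ψ
  refine (Finset.range N ×ˢ Finset.range M).finite_toSet.subset fun jk h => ?_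
  by_contra hjk
  refine h ?_
  rw [Finset.mem_coe, Finset.mem_product, Finset.mem_range, Finset.mem_range, not_and_or, not_lt,
    not_lt] at hjk
  simp only [starTerm]
  rcases hjk with hj | hk
  · rw [hN _ hj, map_zero, LinearMap.zero_apply, map_zero, ite_self]
  · rw [hM _ hk, map_zero, map_zero, ite_self]

variable (n lam) in
/-- The coefficients of the star product. -/
def starCoeff (p : ℕ) : Sym n →ₗ[ℂ] Sym n →ₗ[ℂ] Sym n :=
  LinearMap.mk₂ ℂ (fun φ ψ => ∑ᶠ jk : ℕ × ℕ, starTerm lam p jk.1 jk.2 φ ψ)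
    (fun φ φ' ψ => by
      rw [← finsum_add_distrib (starTerm_finite p φ ψ) (starTerm_finite p φ' ψ)]
      refine finsum_congr fun jk => ?_
      simp only [starTerm]
      split_ifs
      · rw [map_add, map_add, LinearMap.add_apply, map_add]
      · rw [add_zero])
    (fun c φ ψ => by
      rw [smul_finsum' c (starTerm_finite p φ ψ)]
      refine finsum_congr fun jk => ?_
      simp only [starTerm]
      split_ifs
      · rw [map_smul, map_smul, LinearMap.smul_apply, map_smul]
      · rw [smul_zero])
    (fun φ ψ ψ' => by
      rw [← finsum_add_distrib (starTerm_finite p φ ψ) (starTerm_finite p φ ψ')]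
      refine finsum_congr fun jk => ?_
      simp only [starTerm]
      split_ifs
      · rw [map_add, map_add, map_add]
      · rw [add_zero])
    (fun c φ ψ => by
      rw [smul_finsum' c (starTerm_finite p φ ψ)]
      refine finsum_congr fun jk => ?_
      simp only [starTerm]
      split_ifs
      · rw [map_smul, map_smul, map_smul]
      · rw [smul_zero])

theorem starCoeff_of_mem {j k : ℕ} {φ ψ : Sym n} (hφ : φ ∈ SymDeg n j) (hψ : ψ ∈ SymDeg n k)
    (p : ℕ) : starCoeff n lam p φ ψ =
      if p ≤ j + k then symComp (j + k - p) (starMul n lam φ ψ) else 0 := by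
  change ∑ᶠ jk : ℕ × ℕ, starTerm lam p jk.1 jk.2 φ ψ = _
  rw [finsum_eq_single _ (j, k), starTerm, symComp_of_mem hφ, symComp_of_mem hψ]
  rintro ⟨j', k'⟩ hne
  rw [Ne, Prod.mk.injEq, not_and_or] at hne
  rw [starTerm]
  rcases hne with hj | hk
  · rw [symComp_of_ne hj hφ, map_zero, LinearMap.zero_apply, map_zero, ite_self]
  · rw [symComp_of_ne hk hψ, map_zero, map_zero, ite_self]

theorem isStarOf_starCoeff : IsStarOf (quant n lam) (starCoeff n lam) := by
  intro j k φ ψ hφ hψ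
  refine ⟨fun p hp => ?_, fun p hp => ?_, ?_⟩
  · rw [starCoeff_of_mem hφ hψ, if_pos hp]
    exact symComp_mem _ _
  · rw [starCoeff_of_mem hφ hψ, if_neg (by omega)]
  · have h := eq_sum_symComp (fun e he => symComp_starMul_eq_zero (lam := lam) hφ hψ he)
    have h1 := congrArg (quantLin n lam) h
    rw [quantLin_starMul, map_sum] at h1
    refine h1.trans (Finset.sum_congr rfl fun p hp => ?_)
    rw [starCoeff_of_mem hφ hψ, if_pos (by have := Finset.mem_range.1 hp; omega)]
    rfl

/-! ### Properties of the star product -/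

variable {C : ℕ → Sym n →ₗ[ℂ] Sym n →ₗ[ℂ] Sym n} (hC : IsStarOf (quant n lam) C)

include hC

theorem IsStarOf.mem_momAlg (hn : 1 ≤ n) (p : ℕ) {φ ψ : Sym n} (hφ : φ ∈ MomAlg n)
    (hψ : ψ ∈ MomAlg n) : C p φ ψ ∈ MomAlg n := by
  obtain ⟨N, _, h1⟩ := exists_sum_symComp φ
  obtain ⟨M, _, h2⟩ := exists_sum_symComp ψ
  rw [h1, map_sum, LinearMap.sum_apply]
  refine Subalgebra.sum_mem _ fun j _ => ?_
  rw [h2, map_sum]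
  refine Subalgebra.sum_mem _ fun k _ => ?_
  rw [hC.apply (symComp_mem j φ) (symComp_mem k ψ)]
  split_ifs
  · exact symComp_mem_momAlg hn (starMul_mem_momAlg hn (symComp_mem_momAlg hn hφ j)
      (symComp_mem_momAlg hn hψ k)) _
  · exact Subalgebra.zero_mem _

theorem IsStarOf.exists_eq_zero (φ ψ : Sym n) : ∃ N, ∀ p, N ≤ p → C p φ ψ = 0 := by
  obtain ⟨N, _, h1⟩ := exists_sum_symComp φ
  obtain ⟨M, _, h2⟩ := exists_sum_symComp ψ
  refine ⟨N + M, fun p hp => ?_⟩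
  rw [h1, map_sum, LinearMap.sum_apply]
  refine Finset.sum_eq_zero fun j hj => ?_
  rw [h2, map_sum]
  refine Finset.sum_eq_zero fun k hk => ?_
  have := Finset.mem_range.1 hj
  have := Finset.mem_range.1 hk
  rw [hC.apply (symComp_mem j φ) (symComp_mem k ψ), if_neg (by omega)]

theorem IsStarOf.coeff_zero (φ ψ : Sym n) : C 0 φ ψ = φ * ψ := by
  induction φ using sym_induction with
  | hom j φ hφ =>
    induction ψ using sym_induction with
    | hom k ψ hψ => rw [hC.apply hφ hψ, if_pos (Nat.zero_le _), Nat.sub_zero, symComp_starMul hφ hψ]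
    | add ψ ψ' h1 h2 => rw [map_add, h1, h2, mul_add]
  | add φ φ' h1 h2 => rw [map_add, LinearMap.add_apply, h1, h2, add_mul]

/-- The commutator of the quantizations has order one less than their product, and its principal
symbol is the Poisson bracket. The component of the transported commutator in this degree is the
antisymmetrization of `C 1`. The degree of `φ` is `j + 1`, so that no difference is truncated. -/
theorem IsStarOf.coeff_one_of_mem {j k : ℕ} {φ ψ : Sym n} (hφ : φ ∈ SymDeg n (j + 1))
    (hψ : ψ ∈ SymDeg n k) : IsPoissonBracket φ.1 ψ.1 (C 1 φ ψ - C 1 ψ φ).1 := by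
  obtain ⟨χ, hχ, h1, h2⟩ := (quantLin_of_mem (lam := lam) hφ).1.commutator
    (quantLin_of_mem (lam := lam) hψ).1
  have e1 : quantLin n lam (starMul n lam φ ψ - starMul n lam ψ φ) =
      quantLin n lam φ * quantLin n lam ψ - quantLin n lam ψ * quantLin n lam φ := by
    refine (map_sub (quantLin n lam) (starMul n lam φ ψ) (starMul n lam ψ φ)).trans ?_
    rw [quantLin_starMul, quantLin_starMul]
  have e2 : C 1 φ ψ - C 1 ψ φ = symComp (j + k) (starMul n lam φ ψ - starMul n lam ψ φ) := by
    rw [hC.apply hφ hψ, hC.apply hψ hφ, if_pos (by omega), if_pos (by omega), map_sub]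
    congr 3 <;> omega
  have h3 : IsPrincipalSymbol (j + k)
      (quantLin n lam (starMul n lam φ ψ - starMul n lam ψ φ)) χ.1 := by
    rw [e1]
    exact h1
  have h4 := quantLin_principal (lam := lam) (d := j + k)
    (φ := starMul n lam φ ψ - starMul n lam ψ φ)
    fun e he => symComp_eq_zero_of_quantLin_mem h3.mem_ordLT he
  rw [e2, h4.unique h3]
  exact h2

theorem IsStarOf.coeff_one (φ ψ : Sym n) :
    IsPoissonBracket φ.1 ψ.1 (C 1 φ ψ - C 1 ψ φ).1 := by
  induction φ using sym_induction with
  | hom j φ hφ =>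
    induction ψ using sym_induction with
    | hom k ψ hψ =>
      rcases j with _ | j
      · rcases k with _ | k
        -- For two functions of degree zero the order `1` exceeds the total degree, so `C 1`
        -- vanishes, and so does the Poisson bracket.
        · rw [hC.apply hφ hψ, hC.apply hψ hφ, if_neg (by omega), if_neg (by omega), sub_self]
          intro l
          obtain ⟨a, ha, ha'⟩ := hφ l
          obtain ⟨b, hb, hb'⟩ := hψ l
          refine ⟨a, b, ha', hb', ?_⟩
          rw [poisson_eq, bracket_of_isHomogeneous_zero ha hb]
          exact HasSymbol.zero l
        · have h := (hC.coeff_one_of_mem hψ hφ).swap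
          have e : -(C 1 ψ φ - C 1 φ ψ).1 = (C 1 φ ψ - C 1 ψ φ).1 :=
            congrArg Subtype.val (neg_sub (C 1 ψ φ) (C 1 φ ψ))
          rwa [e] at h
      · exact hC.coeff_one_of_mem hφ hψ
    | add ψ ψ' h1 h2 =>
      have e : C 1 φ (ψ + ψ') - C 1 (ψ + ψ') φ =
          (C 1 φ ψ - C 1 ψ φ) + (C 1 φ ψ' - C 1 ψ' φ) := by
        rw [map_add, map_add, LinearMap.add_apply]
        abel
      rw [e]
      exact h1.add_right h2
  | add φ φ' h1 h2 =>
    have e : C 1 (φ + φ') ψ - C 1 ψ (φ + φ') =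
        (C 1 φ ψ - C 1 ψ φ) + (C 1 φ' ψ - C 1 ψ φ') := by
      rw [map_add, map_add, LinearMap.add_apply]
      abel
    rw [e]
    exact h1.add_left h2

theorem IsStarOf.unit {p : ℕ} (hp : 1 ≤ p) (φ : Sym n) : C p 1 φ = 0 ∧ C p φ 1 = 0 := by
  induction φ using sym_induction with
  | hom k φ hφ =>
    rw [hC.apply one_mem_symDeg hφ, hC.apply hφ one_mem_symDeg, starMul_one_left,
      starMul_one_right]
    constructor
    · split_ifs
      · exact symComp_of_ne (by omega) hφ
      · rfl
    · split_ifs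
      · exact symComp_of_ne (by omega) hφ
      · rfl
  | add φ ψ h1 h2 =>
    rw [map_add, map_add, LinearMap.add_apply, h1.1, h1.2, h2.1, h2.2, add_zero]
    exact ⟨rfl, rfl⟩

omit hC in
-- If `F` raises degrees by at most `l`, the component of degree `M + l - r` of `F X` receives
-- contributions only from the components of `X` of degree `M - b` with `b ≤ r`. With `F` a left or
-- right star multiplication, this sums the inner coefficients in the associativity law.
theorem sum_symComp_apply {F : Sym n →ₗ[ℂ] Sym n} {l : ℕ}
    (hF : ∀ i, ∀ φ ∈ SymDeg n i, ∀ e, i + l < e → symComp e (F φ) = 0) {X : Sym n} {M : ℕ}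
    (hX : ∀ e, M < e → symComp e X = 0) {r : ℕ} (hr : r ≤ M + l) :
    ∑ b ∈ Finset.range (r + 1), (if b ≤ M then symComp (M + l - r) (F (symComp (M - b) X)) else 0) =
      symComp (M + l - r) (F X) := by
  conv_rhs => rw [eq_sum_symComp hX, map_sum, map_sum]
  rw [Finset.sum_subset (Finset.range_mono (show r + 1 ≤ r + M + 1 by omega))]
  · symm
    refine Eq.trans (Finset.sum_congr rfl fun b hb => ?_)
      (Finset.sum_subset (Finset.range_mono (show M + 1 ≤ r + M + 1 by omega)) fun b _ hb => ?_)
    · rw [if_pos (by have := Finset.mem_range.1 hb; omega)]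
    · rw [Finset.mem_range] at hb
      rw [if_neg (by omega)]
  · intro b _ hb
    rw [Finset.mem_range] at hb
    split_ifs with h
    · exact hF (M - b) _ (symComp_mem _ X) _ (by omega)
    · rfl

/-- For homogeneous arguments of degrees `j`, `k`, `l` both sums are the component of degree `j + k
+ l - r` of the triple product under `starMul`, and that product is associative. -/
theorem IsStarOf.assoc (r : ℕ) (φ ψ χ : Sym n) :
    ∑ ij ∈ Finset.HasAntidiagonal.antidiagonal r, C ij.1 (C ij.2 φ ψ) χ =
      ∑ ij ∈ Finset.HasAntidiagonal.antidiagonal r, C ij.1 φ (C ij.2 ψ χ) := by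
  induction φ using sym_induction with
  | add φ φ' h1 h2 =>
    simp only [map_add, LinearMap.add_apply, Finset.sum_add_distrib, h1, h2]
  | hom j φ hφ =>
  induction ψ using sym_induction with
  | add ψ ψ' h1 h2 =>
    simp only [map_add, LinearMap.add_apply, Finset.sum_add_distrib, h1, h2]
  | hom k ψ hψ =>
  induction χ using sym_induction with
  | add χ χ' h1 h2 =>
    simp only [map_add, Finset.sum_add_distrib, h1, h2]
  | hom l χ hχ =>
  -- The sums are rewritten over the order `b` of the inner product, which leaves the order `r - b`
  -- to the outer one.
  rw [← Finset.Nat.sum_antidiagonal_swap, ← Finset.Nat.sum_antidiagonal_swap (n := r)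
    (f := fun ij => C ij.1 φ (C ij.2 ψ χ))]
  simp only [Prod.fst_swap, Prod.snd_swap]
  rw [Finset.Nat.sum_antidiagonal_eq_sum_range_succ (fun i i' => C i' (C i φ ψ) χ),
    Finset.Nat.sum_antidiagonal_eq_sum_range_succ (fun i i' => C i' φ (C i ψ χ))]
  have hL : ∀ b ∈ Finset.range (r + 1), C (r - b) (C b φ ψ) χ =
      if r ≤ j + k + l then (if b ≤ j + k then symComp (j + k + l - r)
        ((starMul n lam).flip χ (symComp (j + k - b) (starMul n lam φ ψ))) else 0) else 0 := by
    intro b hb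
    have hb' := Finset.mem_range.1 hb
    rw [hC.apply hφ hψ]
    by_cases h : b ≤ j + k
    · rw [if_pos h, if_pos h, hC.apply (symComp_mem _ _) hχ]
      by_cases hr : r ≤ j + k + l
      · rw [if_pos hr, if_pos (by omega), LinearMap.flip_apply]
        congr 2
        omega
      · rw [if_neg hr, if_neg (by omega)]
    · rw [if_neg h, if_neg h, map_zero, LinearMap.zero_apply, ite_self]
  have hR : ∀ b ∈ Finset.range (r + 1), C (r - b) φ (C b ψ χ) =
      if r ≤ k + l + j then (if b ≤ k + l then symComp (k + l + j - r)
        (starMul n lam φ (symComp (k + l - b) (starMul n lam ψ χ))) else 0) else 0 := by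
    intro b hb
    have hb' := Finset.mem_range.1 hb
    rw [hC.apply hψ hχ]
    by_cases h : b ≤ k + l
    · rw [if_pos h, if_pos h, hC.apply hφ (symComp_mem _ _)]
      by_cases hr : r ≤ k + l + j
      · rw [if_pos hr, if_pos (by omega)]
        congr 2
        omega
      · rw [if_neg hr, if_neg (by omega)]
    · rw [if_neg h, if_neg h, map_zero, ite_self]
  rw [Finset.sum_congr rfl hL, Finset.sum_congr rfl hR]
  by_cases hr : r ≤ j + k + l
  · have hr' : r ≤ k + l + j := by omega
    simp only [if_pos hr, if_pos hr']
    rw [sum_symComp_apply (F := (starMul n lam).flip χ)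
        (fun i φ hφ e he => symComp_starMul_eq_zero hφ hχ he)
        (fun e he => symComp_starMul_eq_zero hφ hψ he) hr,
      sum_symComp_apply (F := starMul n lam φ)
        (fun i χ hχ e he => symComp_starMul_eq_zero hφ hχ (by omega))
        (fun e he => symComp_starMul_eq_zero hψ hχ he) hr', LinearMap.flip_apply, starMul_assoc]
    congr 2
    omega
  · have hr' : ¬ r ≤ k + l + j := by omega
    simp only [if_neg hr, if_neg hr']

theorem IsStarOf.restrictsToGradedStarProduct (hn : 1 ≤ n) :
    RestrictsToGradedStarProduct (MomAlg n) C where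
  graded_algebra := momAlg_le_iSup hn
  closed p _ hφ _ hψ := hC.mem_momAlg hn p hφ hψ
  finite φ _ ψ _ := hC.exists_eq_zero φ ψ
  coeff_zero φ _ ψ _ := hC.coeff_zero φ ψ
  coeff_one φ _ ψ _ := hC.coeff_one φ ψ
  unit _ hp φ _ := hC.unit hp φ
  assoc r φ _ ψ _ χ _ := hC.assoc r φ ψ χ
  graded p j k φ _ ψ _ hφ hψ := ⟨(hC j k φ ψ hφ hψ).1 p, (hC j k φ ψ hφ hψ).2.1 p⟩

end Star

/-! ### Equivariance of the star product -/

section RealEquivariance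

variable {n : ℕ} {lam : ℂ}

/-- The equivariance of the quantization at weight `0` exhibits the transformed function as a
symbol, so no change of coordinates between charts is computed. -/
theorem actFun_mem_sym (g : Matrix.SpecialLinearGroup (Fin (n + 1)) ℝ) (φ : Sym n) :
    actFun g φ.1 ∈ Sym n := by
  obtain ⟨χ, h, _⟩ := (quant_isEquivariantQuantization (n := n) (lam := 0)).equivariant g φ
  rw [← h]
  exact χ.2

/-- The action of `SL(ℝ)` on symbols. -/
def actSym (g : Matrix.SpecialLinearGroup (Fin (n + 1)) ℝ) : Sym n →ₗ[ℂ] Sym n where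
  toFun φ := ⟨actFun g φ.1, actFun_mem_sym g φ⟩
  map_add' _ _ := rfl
  map_smul' _ _ := rfl

theorem quantLin_actSym (g : Matrix.SpecialLinearGroup (Fin (n + 1)) ℝ) (φ : Sym n) :
    quantLin n lam (actSym g φ) = conj lam g (quantLin n lam φ) := by
  obtain ⟨χ, h, h'⟩ := (quant_isEquivariantQuantization (n := n) (lam := lam)).equivariant g φ
  have e : actSym g φ = χ := Subtype.ext h.symm
  rw [e]
  exact h'

/-- The transformed function is the principal symbol, of the same degree, of a conjugated operator.
-/
theorem actSym_mem_symDeg (g : Matrix.SpecialLinearGroup (Fin (n + 1)) ℝ) {d : ℕ} {φ : Sym n}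
    (hφ : φ ∈ SymDeg n d) : actSym g φ ∈ SymDeg n d := by
  have h := (quantLin_of_mem (lam := 0) hφ).1.conj g
  obtain ⟨χ, h1, h2⟩ := exists_isPrincipalSymbol h.mem_ordLT
  have e : actSym g φ = χ := Subtype.ext (h.unique h2)
  rwa [e]

theorem starMul_actSym (g : Matrix.SpecialLinearGroup (Fin (n + 1)) ℝ) (φ ψ : Sym n) :
    starMul n lam (actSym g φ) (actSym g ψ) = actSym g (starMul n lam φ ψ) := by
  apply quantLin_injective (lam := lam)
  rw [quantLin_starMul, quantLin_actSym, quantLin_actSym, quantLin_actSym, quantLin_starMul,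
    map_mul]

theorem symComp_actSym (g : Matrix.SpecialLinearGroup (Fin (n + 1)) ℝ) (e : ℕ) (φ : Sym n) :
    symComp e (actSym g φ) = actSym g (symComp e φ) := by
  induction φ using sym_induction with
  | hom d φ hφ =>
    by_cases h : e = d
    · subst h
      rw [symComp_of_mem hφ, symComp_of_mem (actSym_mem_symDeg g hφ)]
    · rw [symComp_of_ne h hφ, symComp_of_ne h (actSym_mem_symDeg g hφ), map_zero]
  | add φ ψ h1 h2 => rw [map_add, map_add, map_add, map_add, h1, h2]

theorem IsStarOf.actSym {C : ℕ → Sym n →ₗ[ℂ] Sym n →ₗ[ℂ] Sym n} (hC : IsStarOf (quant n lam) C)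
    (g : Matrix.SpecialLinearGroup (Fin (n + 1)) ℝ) (p : ℕ) (φ ψ : Sym n) :
    C p (actSym g φ) (actSym g ψ) = ProjQuant.actSym g (C p φ ψ) := by
  induction φ using sym_induction with
  | hom j φ hφ =>
    induction ψ using sym_induction with
    | hom k ψ hψ =>
      rw [hC.apply hφ hψ, hC.apply (actSym_mem_symDeg g hφ) (actSym_mem_symDeg g hψ),
        starMul_actSym, symComp_actSym]
      split_ifs
      · rfl
      · rw [map_zero]
    | add ψ ψ' h1 h2 => rw [map_add, map_add, map_add, map_add, h1, h2]
  | add φ φ' h1 h2 =>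
    rw [map_add, map_add, map_add, LinearMap.add_apply, LinearMap.add_apply, map_add, h1, h2]

end RealEquivariance

/-! ### The action of the complex group on regular functions and families polynomial in a parameter
-/

section ComplexAction

variable {n : ℕ}

theorem act_mul {𝕜 : Type} [Field 𝕜] (g h : Matrix.SpecialLinearGroup (Fin (n + 1)) 𝕜)
    (x : CotP 𝕜 n) : CotP.act (g * h) x = CotP.act g (CotP.act h x) := by
  induction x using Quotient.inductionOn with
  | _ y =>
    refine congrArg (Quotient.mk (coneSetoid 𝕜 n)) (Subtype.ext (Prod.ext ?_ ?_))
    · change (g * h).1 *ᵥ y.1.1 = g.1 *ᵥ (h.1 *ᵥ y.1.1)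
      rw [Matrix.mulVec_mulVec, Matrix.SpecialLinearGroup.coe_mul]
    · change y.1.2 ᵥ* ((g * h)⁻¹).1 = (y.1.2 ᵥ* (h⁻¹).1) ᵥ* (g⁻¹).1
      rw [Matrix.vecMul_vecMul, mul_inv_rev, Matrix.SpecialLinearGroup.coe_mul]

theorem actFun_mul {𝕜 : Type} [Field 𝕜] (g h : Matrix.SpecialLinearGroup (Fin (n + 1)) 𝕜)
    (f : CotP 𝕜 n → ℂ) : actFun (g * h) f = actFun g (actFun h f) := by
  funext x
  change f (CotP.act (g * h)⁻¹ x) = f (CotP.act h⁻¹ (CotP.act g⁻¹ x))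
  rw [mul_inv_rev, act_mul]

/-- The action respects products and sums, so it suffices to consider the generating momentum
functions, whose matrices are conjugated. -/
theorem actFun_mem_reg (hn : 1 ≤ n) (g : Matrix.SpecialLinearGroup (Fin (n + 1)) ℂ) (f : Reg n) :
    actFun g f.1 ∈ Reg n := by
  have hf : f ∈ momGen n := momGen_eq_top hn ▸ Algebra.mem_top
  induction hf using Algebra.adjoin_induction with
  | mem f h =>
    obtain ⟨x, _, h⟩ := h
    rw [h, actFun_momentum]
    exact momentum_mem_reg _
  | algebraMap c => exact Subalgebra.algebraMap_mem (Reg n) c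
  | add f f' _ _ h h' => exact Subalgebra.add_mem _ h h'
  | mul f f' _ _ h h' => exact Subalgebra.mul_mem _ h h'

/-- The action of `SL(ℂ)` on regular functions. -/
def actReg (hn : 1 ≤ n) (g : Matrix.SpecialLinearGroup (Fin (n + 1)) ℂ) : Reg n →ₐ[ℂ] Reg n where
  toFun f := ⟨actFun g f.1, actFun_mem_reg hn g f⟩
  map_one' := rfl
  map_mul' _ _ := rfl
  map_zero' := rfl
  map_add' _ _ := rfl
  commutes' _ := rfl

theorem complexify_act (g : Matrix.SpecialLinearGroup (Fin (n + 1)) ℝ) (x : CotP ℝ n) :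
    complexify (CotP.act g x) =
      CotP.act (Matrix.SpecialLinearGroup.map Complex.ofRealHom g) (complexify x) := by
  induction x using Quotient.inductionOn with
  | _ y =>
    refine congrArg (Quotient.mk (coneSetoid ℂ n)) (Subtype.ext (Prod.ext ?_ ?_))
    · change (fun i => (((g.1 *ᵥ y.1.1) i : ℝ) : ℂ)) = (g.1.map Complex.ofRealHom) *ᵥ
        fun i => ((y.1.1 i : ℝ) : ℂ)
      funext i
      simp [Matrix.mulVec, dotProduct]
    · change (fun i => (((y.1.2 ᵥ* (g⁻¹).1) i : ℝ) : ℂ)) = (fun i => ((y.1.2 i : ℝ) : ℂ)) ᵥ*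
        ((Matrix.SpecialLinearGroup.map Complex.ofRealHom g)⁻¹).1
      rw [← map_inv]
      change _ = (fun i => ((y.1.2 i : ℝ) : ℂ)) ᵥ* ((g⁻¹).1.map Complex.ofRealHom)
      funext i
      simp only [Matrix.vecMul, dotProduct, Matrix.map_apply, Complex.ofReal_sum,
        Complex.ofReal_mul, Complex.ofRealHom_eq_coe]

theorem restrict_actReg (hn : 1 ≤ n) (g : Matrix.SpecialLinearGroup (Fin (n + 1)) ℝ) (f : Reg n) :
    restrict n (actReg hn (Matrix.SpecialLinearGroup.map Complex.ofRealHom g) f) =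
      actSym g (restrict n f) := by
  apply Subtype.ext
  funext x
  change f.1 (CotP.act (Matrix.SpecialLinearGroup.map Complex.ofRealHom g)⁻¹ (complexify x)) =
    f.1 (complexify (CotP.act g⁻¹ x))
  rw [complexify_act, map_inv]

/-- Families of regular functions depending polynomially on a parameter. -/
def polyFamily (n : ℕ) : Submodule ℂ (ℂ → Reg n) :=
  Submodule.span ℂ (Set.range fun mf : ℕ × Reg n => fun t : ℂ => t ^ mf.1 • mf.2)

theorem pow_smul_mem_polyFamily (m : ℕ) (f : Reg n) : (fun t : ℂ => t ^ m • f) ∈ polyFamily n :=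
  Submodule.subset_span ⟨(m, f), rfl⟩

theorem bilin_mem_polyFamily (B : Reg n →ₗ[ℂ] Reg n →ₗ[ℂ] Reg n) {F G : ℂ → Reg n}
    (hF : F ∈ polyFamily n) (hG : G ∈ polyFamily n) :
    (fun t => B (F t) (G t)) ∈ polyFamily n := by
  induction hF using Submodule.span_induction with
  | mem F h =>
    obtain ⟨⟨m, f⟩, rfl⟩ := h
    induction hG using Submodule.span_induction with
    | mem G h =>
      obtain ⟨⟨l, g⟩, rfl⟩ := h
      have e : (fun t : ℂ => B (t ^ m • f) (t ^ l • g)) = fun t => t ^ (m + l) • B f g := by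
        funext t
        rw [map_smul, map_smul, LinearMap.smul_apply, smul_smul, pow_add, mul_comm]
      simp only [e]
      exact pow_smul_mem_polyFamily _ _
    | zero =>
      convert Submodule.zero_mem (polyFamily n) using 1
      funext t
      exact map_zero _
    | add G G' _ _ h h' =>
      convert Submodule.add_mem _ h h' using 1
      funext t
      exact map_add _ _ _
    | smul c G _ h =>
      convert Submodule.smul_mem _ c h using 1
      funext t
      change B _ (c • G t) = c • B _ (G t)
      rw [map_smul]
  | zero =>
    convert Submodule.zero_mem (polyFamily n) using 1
    funext t
    change B 0 (G t) = 0
    rw [map_zero, LinearMap.zero_apply]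
  | add F F' _ _ h h' =>
    convert Submodule.add_mem _ h h' using 1
    funext t
    change B (F t + F' t) (G t) = B (F t) (G t) + B (F' t) (G t)
    rw [map_add, LinearMap.add_apply]
  | smul c F _ h =>
    convert Submodule.smul_mem _ c h using 1
    funext t
    change B (c • F t) (G t) = c • B (F t) (G t)
    rw [map_smul, LinearMap.smul_apply]

theorem exists_polynomial_of_mem_polyFamily {F : ℂ → Reg n} (hF : F ∈ polyFamily n)
    (y : CotP ℂ n) : ∃ q : Polynomial ℂ, ∀ t, (F t).1 y = q.eval t := by
  induction hF using Submodule.span_induction with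
  | mem F h =>
    obtain ⟨⟨m, f⟩, rfl⟩ := h
    refine ⟨Polynomial.monomial m (f.1 y), fun t => ?_⟩
    rw [Polynomial.eval_monomial, mul_comm]
    rfl
  | zero => exact ⟨0, fun t => by rw [Polynomial.eval_zero]; rfl⟩
  | add F F' _ _ h h' =>
    obtain ⟨q, hq⟩ := h
    obtain ⟨q', hq'⟩ := h'
    exact ⟨q + q', fun t => by rw [Polynomial.eval_add, ← hq, ← hq']; rfl⟩
  | smul c F _ h =>
    obtain ⟨q, hq⟩ := h
    exact ⟨c • q, fun t => by rw [Polynomial.eval_smul, ← hq]; rfl⟩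

/-- Polynomial families which agree at the real parameters agree. -/
theorem eq_of_mem_polyFamily {F G : ℂ → Reg n} (hF : F ∈ polyFamily n) (hG : G ∈ polyFamily n)
    (h : ∀ t : ℝ, F t = G t) (t : ℂ) : F t = G t := by
  apply Subtype.ext
  funext y
  obtain ⟨q, hq⟩ := exists_polynomial_of_mem_polyFamily hF y
  obtain ⟨q', hq'⟩ := exists_polynomial_of_mem_polyFamily hG y
  have e : q = q' := by
    refine Polynomial.eq_of_infinite_eval_eq _ _ ((Set.infinite_range_of_injective
      Complex.ofReal_injective).mono ?_)
    rintro _ ⟨t, rfl⟩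
    change q.eval _ = q'.eval _
    rw [← hq, ← hq', h t]
  rw [hq, hq', e]

theorem momReg_add (x y : Matrix (Fin (n + 1)) (Fin (n + 1)) ℂ) :
    momReg (x + y) = momReg x + momReg y := by
  apply Subtype.ext
  funext z
  induction z using cotP_induction with
  | h u p hu hp =>
    change momentum (x + y) (CotP.mk u p hu hp) =
      momentum x (CotP.mk u p hu hp) + momentum y (CotP.mk u p hu hp)
    rw [momentum_mk, momentum_mk, momentum_mk, Matrix.add_mulVec, dotProduct_add, neg_add]

theorem momReg_smul (c : ℂ) (x : Matrix (Fin (n + 1)) (Fin (n + 1)) ℂ) :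
    momReg (c • x) = c • momReg x := by
  apply Subtype.ext
  funext z
  induction z using cotP_induction with
  | h u p hu hp =>
    change momentum (c • x) (CotP.mk u p hu hp) = c • momentum x (CotP.mk u p hu hp)
    rw [momentum_mk, momentum_mk, Matrix.smul_mulVec, dotProduct_smul, smul_neg]

/-- With `E² = 0` the inverse of `1 + t E` is `1 - t E`, so a conjugated matrix is quadratic in `t`.
Momentum functions generate, and polynomial families are closed under sums and products. -/
theorem actReg_transvection_mem (hn : 1 ≤ n) {i j : Fin (n + 1)} (hij : i ≠ j) (f : Reg n) :
    (fun t : ℂ => actReg hn (Matrix.SpecialLinearGroup.transvection hij t) f) ∈ polyFamily n := by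
  have hf : f ∈ momGen n := momGen_eq_top hn ▸ Algebra.mem_top
  induction hf using Algebra.adjoin_induction with
  | mem f h =>
    obtain ⟨x, _, h⟩ := h
    let E : Matrix (Fin (n + 1)) (Fin (n + 1)) ℂ := Matrix.single i j 1
    have e : (fun t : ℂ => actReg hn (Matrix.SpecialLinearGroup.transvection hij t) f) =
        (fun t : ℂ => t ^ 0 • momReg x) + (fun t : ℂ => t ^ 1 • momReg (E * x - x * E)) +
          (fun t : ℂ => t ^ 2 • momReg (-(E * x * E))) := by
      funext t
      have e1 : (Matrix.SpecialLinearGroup.transvection hij t).1 = 1 + t • E := by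
        rw [Matrix.SpecialLinearGroup.transvection_coe, Matrix.smul_single, smul_eq_mul, mul_one]
      have e2 : ((Matrix.SpecialLinearGroup.transvection hij t)⁻¹).1 = 1 - t • E := by
        rw [Matrix.SpecialLinearGroup.transvection_inv, Matrix.SpecialLinearGroup.transvection_coe,
          Matrix.smul_single, smul_eq_mul, mul_one, sub_eq_add_neg, Matrix.single_neg]
      have e3 : (1 + t • E) * x * (1 - t • E) =
          x + t ^ 1 • (E * x - x * E) + t ^ 2 • (-(E * x * E)) := by
        simp only [add_mul, mul_sub, one_mul, mul_one, smul_mul_assoc, mul_smul_comm, smul_sub,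
          smul_add, smul_neg, smul_smul, pow_one, pow_two]
        abel
      have e4 : actReg hn (Matrix.SpecialLinearGroup.transvection hij t) f =
          momReg ((1 + t • E) * x * (1 - t • E)) := by
        apply Subtype.ext
        change actFun _ f.1 = momentum _
        rw [h, actFun_momentum, e1, e2]
      rw [e4, e3, momReg_add, momReg_add, momReg_smul, momReg_smul]
      simp only [Pi.add_apply, pow_zero, one_smul]
    rw [e]
    exact Submodule.add_mem _ (Submodule.add_mem _ (pow_smul_mem_polyFamily _ _)
      (pow_smul_mem_polyFamily _ _)) (pow_smul_mem_polyFamily _ _)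
  | algebraMap c =>
    have h := pow_smul_mem_polyFamily 0 (algebraMap ℂ (Reg n) c)
    convert h using 1
    funext t
    rw [AlgHom.commutes, pow_zero, one_smul]
  | add f f' _ _ h h' =>
    convert Submodule.add_mem _ h h' using 1
    funext t
    exact map_add _ _ _
  | mul f f' _ _ h h' =>
    convert bilin_mem_polyFamily (LinearMap.mul ℂ (Reg n)) h h' using 1
    funext t
    exact map_mul _ _ _

end ComplexAction

/-! ### Transvections generate the special linear group -/

section Transvections

open Matrix.SpecialLinearGroup in
-- This is the classical factorization in `SL₂`: the products `w(b) = e(b) f(-b⁻¹) e(b)` are the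
-- Weyl elements, and `w(a) w(-1)` is diagonal with entries `a` and `a⁻¹`.
theorem diag2n_eq_mul {ι F : Type*} [Fintype ι] [DecidableEq ι] [Field F] {i j : ι} (hij : i ≠ j)
    (a : F) (ha : a ≠ 0) :
    diag2n hij a ha = transvection hij a * transvection hij.symm (-a⁻¹) * transvection hij a *
      (transvection hij (-1) * transvection hij.symm 1 * transvection hij (-1)) := by
  apply Subtype.ext
  let E : Matrix ι ι F := Matrix.single i j 1
  let G : Matrix ι ι F := Matrix.single j i 1
  have hE : ∀ c, (transvection hij c : Matrix.SpecialLinearGroup ι F).1 = 1 + c • E := fun c => by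
    rw [transvection_coe, Matrix.smul_single, smul_eq_mul, mul_one]
  have hG : ∀ c, (transvection hij.symm c : Matrix.SpecialLinearGroup ι F).1 = 1 + c • G :=
    fun c => by rw [transvection_coe, Matrix.smul_single, smul_eq_mul, mul_one]
  have hEE : E * E = 0 := by simp [E, hij.symm]
  have hGG : G * G = 0 := by simp [G, hij]
  have hEG : E * G = Matrix.single i i 1 := by simp [E, G]
  have hGE : G * E = Matrix.single j j 1 := by simp [E, G]
  have hEGE : E * G * E = E := by rw [hEG]; simp [E]
  have hGEG : G * E * G = G := by rw [hGE]; simp [G]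
  -- The Weyl element `w(b)` is the identity outside the plane spanned by the indices `i`, `j`, and
  -- antidiagonal inside it.
  have hw : ∀ b : F, b ≠ 0 → (1 + b • E) * (1 + (-b⁻¹) • G) * (1 + b • E) =
      (1 - E * G - G * E) + b • E - b⁻¹ • G := by
    intro b hb
    have h1 : (1 + b • E) * (1 + (-b⁻¹) • G) = 1 + b • E - b⁻¹ • G - E * G := by
      simp only [add_mul, mul_add, one_mul, mul_one, smul_mul_smul_comm, neg_smul, mul_neg,
        mul_inv_cancel₀ hb, one_smul]
      abel
    rw [h1]
    simp only [sub_mul, add_mul, mul_add, mul_one, one_mul, smul_mul_assoc, hEE, smul_zero,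
      mul_smul_comm, hEGE, smul_smul, smul_sub, smul_add, mul_inv_cancel₀ hb,
      one_smul]
    abel
  have h1 := hw (-1) (by simp)
  rw [inv_neg, inv_one, neg_neg] at h1
  rw [coe_mul, coe_mul, coe_mul, coe_mul, coe_mul, hE, hG, hE, hG, hw a ha, h1, diag2n_coe]
  have h2 : (1 - E * G - G * E) * E = 0 := by
    rw [sub_mul, sub_mul, one_mul, hEGE, mul_assoc, hEE, mul_zero, sub_self, sub_self]
  have h3 : (1 - E * G - G * E) * G = 0 := by
    rw [sub_mul, sub_mul, one_mul, hGEG, mul_assoc, hGG, mul_zero, sub_zero, sub_self]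
  have h4 : E * (1 - E * G - G * E) = 0 := by
    rw [mul_sub, mul_sub, mul_one, ← mul_assoc, hEE, zero_mul, ← mul_assoc, hEGE, sub_zero,
      sub_self]
  have h5 : G * (1 - E * G - G * E) = 0 := by
    rw [mul_sub, mul_sub, mul_one, ← mul_assoc, hGEG, ← mul_assoc, hGG, zero_mul, sub_self,
      sub_zero]
  have h6 : (1 - E * G - G * E) * (1 - E * G - G * E) = 1 - E * G - G * E := by
    conv_lhs => rw [mul_sub, mul_sub, mul_one, ← mul_assoc, ← mul_assoc, h2, h3, zero_mul,
      zero_mul, sub_zero, sub_zero]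
  have h7 : (1 - E * G - G * E + a • E - a⁻¹ • G) *
      (1 - E * G - G * E + (-1 : F) • E - (-1 : F) • G) =
      1 - E * G - G * E + a • (E * G) + a⁻¹ • (G * E) := by
    generalize 1 - E * G - G * E = r at *
    simp only [neg_smul, one_smul, sub_neg_eq_add, add_mul, mul_add, sub_mul, mul_neg,
      smul_mul_assoc, h2, h3, h4, h5, h6, hEE, hGG, smul_zero]
    abel
  rw [h7, hEG, hGE]
  ext k l
  simp only [Matrix.diagonal_apply, Matrix.add_apply, Matrix.sub_apply, Matrix.smul_apply,
    Matrix.one_apply, Matrix.single_apply, smul_eq_mul]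
  by_cases hkl : k = l
  · subst hkl
    by_cases hki : k = i
    · subst hki
      simp [hij.symm]
    · by_cases hkj : k = j
      · subst hkj
        simp [hij, hki]
      · simp [hki, hkj, Ne.symm hki, Ne.symm hkj]
  · rw [if_neg hkl, if_neg hkl, if_neg fun h => hkl (h.1.symm.trans h.2),
      if_neg fun h => hkl (h.1.symm.trans h.2)]
    simp

open Matrix.SpecialLinearGroup in
-- The special linear group is generated by transvections and the diagonal matrices `diag2n`, and
-- the latter are products of transvections.
theorem transvection_induction {ι F : Type*} [Fintype ι] [DecidableEq ι] [Nontrivial ι] [Field F]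
    (P : Matrix.SpecialLinearGroup ι F → Prop)
    (h : ∀ (i j : ι) (hij : i ≠ j) (a : F), P (transvection hij a))
    (hmul : ∀ A B, P A → P B → P (A * B)) (g : Matrix.SpecialLinearGroup ι F) : P g :=
  diagonal_transvection_induction' P g (fun i j hij c hc => by
    rw [diag2n_eq_mul]
    exact hmul _ _ (hmul _ _ (hmul _ _ (h _ _ _ _) (h _ _ _ _)) (h _ _ _ _))
      (hmul _ _ (hmul _ _ (h _ _ _ _) (h _ _ _ _)) (h _ _ _ _))) h hmul

end Transvections

/-! ### Equivariance of the star product under the complex special linear group -/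

section ComplexEquivariance

variable {n : ℕ} {lam : ℂ} {C : ℕ → Sym n →ₗ[ℂ] Sym n →ₗ[ℂ] Sym n}

/-- The coefficients of the star product on regular functions. -/
theorem exists_regStar (hn : 1 ≤ n) (hC : IsStarOf (quant n lam) C) (p : ℕ) :
    ∃ B : Reg n →ₗ[ℂ] Reg n →ₗ[ℂ] Reg n,
      ∀ f g, restrict n (B f g) = C p (restrict n f) (restrict n g) := by
  choose b hb using fun f g : Reg n => (AlgHom.mem_range _).1
    (hC.mem_momAlg hn p (⟨f, rfl⟩ : restrict n f ∈ MomAlg n) (⟨g, rfl⟩ : restrict n g ∈ MomAlg n))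
  have h := restrict_injective n
  refine ⟨LinearMap.mk₂ ℂ b (fun f f' g => h ?_) (fun c f g => h ?_) (fun f g g' => h ?_)
    (fun c f g => h ?_), fun f g => hb f g⟩
  · rw [map_add, hb, hb, hb, map_add, map_add, LinearMap.add_apply]
  · rw [map_smul, hb, hb, map_smul, map_smul, LinearMap.smul_apply]
  · rw [map_add, hb, hb, hb, map_add, map_add]
  · rw [map_smul, hb, hb, map_smul, map_smul]

theorem transvection_map {i j : Fin (n + 1)} (hij : i ≠ j) (t : ℝ) :
    Matrix.SpecialLinearGroup.map Complex.ofRealHom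
      (Matrix.SpecialLinearGroup.transvection hij t) =
        Matrix.SpecialLinearGroup.transvection hij (t : ℂ) := by
  apply Subtype.ext
  change ((1 : Matrix (Fin (n + 1)) (Fin (n + 1)) ℝ) + Matrix.single i j t).map Complex.ofRealHom =
    1 + Matrix.single i j (t : ℂ)
  rw [Matrix.map_add _ (map_add _), Matrix.map_single, Matrix.map_one _ (map_zero _) (map_one _)]
  rfl

/-- For a transvection with parameter `t` both sides are polynomial families in `t`, which agree for
real `t` by the equivariance under the real group, hence for all complex `t`. The identity is stable
under products in the group, and transvections generate it. -/
theorem regStar_actReg (hn : 1 ≤ n) (hC : IsStarOf (quant n lam) C) {p : ℕ}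
    {B : Reg n →ₗ[ℂ] Reg n →ₗ[ℂ] Reg n}
    (hB : ∀ f g, restrict n (B f g) = C p (restrict n f) (restrict n g))
    (g : Matrix.SpecialLinearGroup (Fin (n + 1)) ℂ) (f f' : Reg n) :
    B (actReg hn g f) (actReg hn g f') = actReg hn g (B f f') := by
  have : Nontrivial (Fin (n + 1)) := Fin.nontrivial_iff_two_le.2 (by omega)
  induction g using transvection_induction generalizing f f' with
  | h i j hij t =>
    refine eq_of_mem_polyFamily
      (F := fun t : ℂ => B (actReg hn (Matrix.SpecialLinearGroup.transvection hij t) f)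
        (actReg hn (Matrix.SpecialLinearGroup.transvection hij t) f'))
      (bilin_mem_polyFamily B (actReg_transvection_mem hn hij f)
        (actReg_transvection_mem hn hij f')) (actReg_transvection_mem hn hij (B f f'))
      (fun t => ?_) t
    rw [← transvection_map]
    apply restrict_injective n
    rw [hB, restrict_actReg, restrict_actReg, restrict_actReg, hC.actSym, hB]
  | hmul g h hg hh =>
    have e : ∀ f, actReg hn (g * h) f = actReg hn g (actReg hn h f) :=
      fun f => Subtype.ext (actFun_mul g h f.1)
    rw [e, e, e, hg, hh]

theorem IsStarOf.isSLEquivariant (hn : 1 ≤ n) (hC : IsStarOf (quant n lam) C) :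
    IsSLEquivariant C := by
  intro g p f₁ f₂ f₃ h
  refine ⟨actReg hn g f₁, actReg hn g f₂, actReg hn g f₃, rfl, rfl, rfl, ?_⟩
  obtain ⟨B, hB⟩ := exists_regStar hn hC p
  have e : B f₁ f₂ = f₃ := restrict_injective n ((hB f₁ f₂).trans h)
  rw [← hB, regStar_actReg hn hC hB, e]

end ComplexEquivariance

/-! ### Holomorphic functions of several variables are smooth -/

section Holomorphic

open Metric MeasureTheory

variable {E : Type*} [NormedAddCommGroup E] [NormedSpace ℂ E]

theorem hasDerivAt_line {f : E → ℂ} {u v : E} {c : ℂ} (h : DifferentiableAt ℂ f (u + c • v)) :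
    HasDerivAt (fun ζ : ℂ => f (u + ζ • v)) (fderiv ℂ f (u + c • v) v) c := by
  have h1 : HasDerivAt (fun ζ : ℂ => u + ζ • v) v c := by
    simpa using ((hasDerivAt_id c).smul_const v).const_add u
  exact h.hasFDerivAt.comp_hasDerivAt c h1

theorem deriv_line {f : E → ℂ} {u v : E} (h : DifferentiableAt ℂ f u) :
    deriv (fun ζ : ℂ => f (u + ζ • v)) 0 = fderiv ℂ f u v := by
  have h1 : DifferentiableAt ℂ f (u + (0 : ℂ) • v) := by simpa using h
  simpa using (hasDerivAt_line h1).deriv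

theorem diffContOnCl_line {f : E → ℂ} {O : Set E} (hO : IsOpen O) (hf : DifferentiableOn ℂ f O)
    {u v : E} {r : ℝ} (h : ∀ ζ ∈ closedBall (0 : ℂ) r, u + ζ • v ∈ O) :
    DiffContOnCl ℂ (fun ζ : ℂ => f (u + ζ • v)) (ball 0 r) := by
  refine DifferentiableOn.diffContOnCl fun ζ hζ => ?_
  have h1 := h ζ (closure_ball_subset_closedBall hζ)
  exact (hasDerivAt_line (hf.differentiableAt (hO.mem_nhds h1))).differentiableAt.differentiableWithinAt

/-- Cauchy's estimate. -/
theorem norm_fderiv_le_of_bound {f : E → ℂ} {O : Set E} (hO : IsOpen O)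
    (hf : DifferentiableOn ℂ f O) {u : E} {R M : ℝ} (hR : 0 < R) (hM : 0 ≤ M)
    (hu : closedBall u R ⊆ O) (hb : ∀ w ∈ closedBall u R, ‖f w‖ ≤ M) : ‖fderiv ℂ f u‖ ≤ M / R := by
  refine ContinuousLinearMap.opNorm_le_bound _ (by positivity) fun v => ?_
  by_cases hv : v = 0
  · simp [hv]
  have hv' : 0 < ‖v‖ := norm_pos_iff.2 hv
  have h : ∀ ζ ∈ closedBall (0 : ℂ) (R / ‖v‖), u + ζ • v ∈ closedBall u R := fun ζ hζ => by
    rw [mem_closedBall_zero_iff] at hζ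
    rw [mem_closedBall, dist_eq_norm, add_sub_cancel_left, norm_smul]
    exact (le_div_iff₀ hv').1 hζ
  have h1 := Complex.norm_deriv_le_of_forall_mem_sphere_norm_le (div_pos hR hv')
    (diffContOnCl_line hO hf fun ζ hζ => hu (h ζ hζ))
    fun ζ hζ => hb _ (h ζ (sphere_subset_closedBall hζ))
  rw [deriv_line (hf.differentiableAt (hO.mem_nhds (hu (mem_closedBall_self hR.le))))] at h1
  rwa [div_div_eq_mul_div, mul_div_right_comm] at h1

variable [FiniteDimensional ℂ E]

/-- The directional derivative is a Cauchy integral of `f` over a circle in the complex line through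
`u` in the direction `v`. Differentiation under the integral sign is justified by Cauchy's estimate
for `fderiv ℂ f`, which needs no continuity of the derivative. -/
theorem differentiableAt_fderiv_apply {f : E → ℂ} {O : Set E} (hO : IsOpen O)
    (hf : DifferentiableOn ℂ f O) {u₀ : E} (hu₀ : u₀ ∈ O) (v : E) :
    DifferentiableAt ℂ (fun u => fderiv ℂ f u v) u₀ := by
  have : ProperSpace E := FiniteDimensional.proper ℂ E
  borelize E
  obtain ⟨δ, hδ, hδO⟩ := Metric.isOpen_iff.1 hO u₀ hu₀
  -- Points near `u₀` shifted along the circle stay within `2R`, and the balls of radius `R` around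
  -- them stay within `4R`, where `f` is bounded.
  obtain ⟨R, hR, hRδ⟩ : ∃ R : ℝ, 0 < R ∧ 4 * R < δ := ⟨δ / 5, by positivity, by linarith⟩
  have hsub : closedBall u₀ (4 * R) ⊆ O := (closedBall_subset_ball hRδ).trans hδO
  obtain ⟨M, hM⟩ := (isCompact_closedBall u₀ (4 * R)).exists_bound_of_continuousOn
    (hf.continuousOn.mono hsub)
  have hM0 : 0 ≤ M := (norm_nonneg _).trans (hM u₀ (mem_closedBall_self (by positivity)))
  obtain ⟨r, hr, hrv⟩ : ∃ r : ℝ, 0 < r ∧ r * ‖v‖ ≤ R :=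
    ⟨R / (‖v‖ + 1), by positivity, by
      rw [div_mul_eq_mul_div, div_le_iff₀ (by positivity)]
      nlinarith [norm_nonneg v]⟩
  have hshift : ∀ u ∈ ball u₀ R, ∀ ζ ∈ closedBall (0 : ℂ) r,
      u + ζ • v ∈ closedBall u₀ (2 * R) := fun u hu ζ hζ => by
    rw [mem_closedBall_zero_iff] at hζ
    rw [mem_ball, dist_eq_norm] at hu
    rw [mem_closedBall, dist_eq_norm, add_sub_right_comm]
    refine (norm_add_le _ _).trans ?_
    rw [norm_smul]
    nlinarith [mul_le_mul_of_nonneg_right hζ (norm_nonneg v)]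
  have h24 : closedBall u₀ (2 * R) ⊆ closedBall u₀ (4 * R) :=
    closedBall_subset_closedBall (by linarith)
  have hsmall : ∀ w ∈ closedBall u₀ (2 * R), closedBall w R ⊆ closedBall u₀ (4 * R) :=
    fun w hw => closedBall_subset_closedBall' (by rw [mem_closedBall] at hw; linarith)
  have hder : ∀ w ∈ closedBall u₀ (2 * R), ‖fderiv ℂ f w‖ ≤ M / R := fun w hw =>
    norm_fderiv_le_of_bound hO hf hR hM0 ((hsmall w hw).trans hsub)
      fun x hx => hM x (hsmall w hw hx)
  have hmem : ∀ θ, circleMap (0 : ℂ) r θ ∈ closedBall (0 : ℂ) r := fun θ =>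
    circleMap_mem_closedBall 0 hr.le θ
  -- This is the Cauchy kernel `dζ / ζ²` on the parametrized circle.
  let w : ℝ → ℂ := fun θ => circleMap 0 r θ * Complex.I * (1 / circleMap 0 r θ ^ 2)
  have hw : Continuous w := by
    have h := continuous_circleMap (0 : ℂ) r
    refine (h.mul continuous_const).mul (continuous_const.div (h.pow 2) fun θ => ?_)
    exact pow_ne_zero _ (circleMap_ne_center hr.ne')
  let F : E → ℝ → ℂ := fun u θ => w θ * f (u + circleMap 0 r θ • v)
  have hFcont : ∀ u ∈ ball u₀ R, Continuous (F u) := fun u hu => by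
    refine hw.mul ?_
    refine (hf.continuousOn.mono hsub).comp_continuous ?_ fun θ => h24 (hshift u hu _ (hmem θ))
    fun_prop
  have hdiff : ∀ θ, ∀ u ∈ ball u₀ R, HasFDerivAt (fun u => F u θ)
      (w θ • fderiv ℂ f (u + circleMap 0 r θ • v)) u := fun θ u hu => by
    have h1 : DifferentiableAt ℂ f (u + circleMap 0 r θ • v) :=
      hf.differentiableAt (hO.mem_nhds (hsub (h24 (hshift u hu _ (hmem θ)))))
    have h2 : HasFDerivAt (fun u => f (u + circleMap 0 r θ • v))
        (fderiv ℂ f (u + circleMap 0 r θ • v)) u := by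
      exact h1.hasFDerivAt.comp u ((hasFDerivAt_id u).add_const _)
    exact h2.const_mul _
  have hint := intervalIntegral.hasFDerivAt_integral_of_dominated_of_fderiv_le (𝕜 := ℂ)
    (μ := volume) (a := 0) (b := 2 * Real.pi) (F := F)
    (F' := fun u θ => w θ • fderiv ℂ f (u + circleMap 0 r θ • v)) (x₀ := u₀) (s := ball u₀ R)
    (bound := fun θ => ‖w θ‖ * (M / R)) (ball_mem_nhds u₀ hR)
    (Filter.eventually_of_mem (ball_mem_nhds u₀ hR) fun u hu =>
      (hFcont u hu).aestronglyMeasurable)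
    ((hFcont u₀ (mem_ball_self hR)).intervalIntegrable _ _)
    (by
      refine AEStronglyMeasurable.smul hw.aestronglyMeasurable ?_
      refine Measurable.aestronglyMeasurable ?_
      refine (measurable_fderiv ℂ f).comp (Continuous.measurable ?_)
      fun_prop)
    (Filter.Eventually.of_forall fun θ _ u hu => by
      rw [norm_smul]
      exact mul_le_mul_of_nonneg_left (hder _ (hshift u hu _ (hmem θ))) (norm_nonneg _))
    ((hw.norm.mul continuous_const).intervalIntegrable _ _)
    (Filter.Eventually.of_forall fun θ _ u hu => hdiff θ u hu)
  refine DifferentiableAt.congr_of_eventuallyEq (f := fun u =>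
    (2 * Real.pi * Complex.I : ℂ)⁻¹ • ∫ θ in (0 : ℝ)..2 * Real.pi, F u θ)
    (hint.differentiableAt.fun_const_smul _) ?_
  refine Filter.eventually_of_mem (ball_mem_nhds u₀ hR) fun u hu => ?_
  have hu' : u ∈ O := by
    have h := hshift u hu 0 (mem_closedBall_self hr.le)
    rw [zero_smul, add_zero] at h
    exact hsub (h24 h)
  have h := (diffContOnCl_line hO hf fun ζ hζ =>
    hsub (h24 (hshift u hu ζ hζ))).deriv_eq_smul_circleIntegral hr
  rw [deriv_line (hf.differentiableAt (hO.mem_nhds hu')), circleIntegral] at h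
  change fderiv ℂ f u v = _
  rw [eq_inv_smul_iff₀ Complex.two_pi_I_ne_zero, ← h]
  refine intervalIntegral.integral_congr fun θ _ => ?_
  simp only [F, w, sub_zero, smul_eq_mul, mul_assoc, deriv_circleMap]

/-- All directional derivatives of a holomorphic function are holomorphic again, so the order of
differentiability can be raised indefinitely. -/
theorem contDiffOn_of_differentiableOn {f : E → ℂ} {O : Set E} (hO : IsOpen O)
    (hf : DifferentiableOn ℂ f O) : ContDiffOn ℂ ∞ f O := by
  refine contDiffOn_infty.2 fun m => ?_
  induction m generalizing f with
  | zero => exact contDiffOn_zero.2 hf.continuousOn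
  | succ m ih =>
    rw [Nat.cast_succ, contDiffOn_succ_iff_fderiv_of_isOpen hO]
    refine ⟨hf, fun h => by simp at h, contDiffOn_clm_apply.2 fun v => ih fun u hu => ?_⟩
    exact (differentiableAt_fderiv_apply hO hf hu v).differentiableWithinAt

end Holomorphic

section

open TopologicalSpace (Opens)

/-! ### Twisted differential operators on complex projective space -/

section TwistedOperators

variable {n : ℕ} {lam : ℂ} {O O' : Opens (Fin (n + 1) → ℂ)}

/-- Polynomials in the affine coordinates as holomorphic functions of homogeneous coordinates. -/
def polyPullback (k : Fin (n + 1)) (hO : ∀ u ∈ O, u k ≠ 0) :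
    MvPolynomial (Fin n) ℂ →ₐ[ℂ] SmoothOn ℂ O :=
  MvPolynomial.aeval (affCoord k hO)

theorem polyPullback_apply (k : Fin (n + 1)) (hO : ∀ u ∈ O, u k ≠ 0) (q : MvPolynomial (Fin n) ℂ)
    (u : O) : (polyPullback k hO q).1 u = MvPolynomial.eval (chartCoord k u.1) q := by
  have h : (SmoothOn.ev u).comp (polyPullback k hO : MvPolynomial (Fin n) ℂ →+* SmoothOn ℂ O) =
      MvPolynomial.eval (chartCoord k u.1) := by
    apply MvPolynomial.ringHom_ext
    · intro c
      change SmoothOn.ev u (polyPullback k hO (algebraMap ℂ _ c)) = _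
      rw [AlgHom.commutes, MvPolynomial.eval_C]
      rfl
    · intro j
      change SmoothOn.ev u (polyPullback k hO (MvPolynomial.X j)) = _
      rw [polyPullback, MvPolynomial.aeval_X, MvPolynomial.eval_X]
      exact affCoord_apply k hO j u
  exact congrArg (fun F => F q) h

theorem chartD_polyPullback (k : Fin (n + 1)) (hO : ∀ u ∈ O, u k ≠ 0) (i : Fin n)
    (q : MvPolynomial (Fin n) ℂ) :
    chartD ℂ O k i (polyPullback k hO q) = polyPullback k hO (MvPolynomial.pderiv i q) := by
  induction q using MvPolynomial.induction_on with
  | C c =>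
    rw [MvPolynomial.pderiv_C, map_zero, ← MvPolynomial.algebraMap_eq, AlgHom.commutes]
    exact Derivation.map_algebraMap _ _
  | add p q hp hq => rw [map_add, map_add, map_add, map_add, hp, hq]
  | mul_X p j hp =>
    have h : chartD ℂ O k i (polyPullback k hO (MvPolynomial.X j)) =
        polyPullback k hO (MvPolynomial.pderiv i (MvPolynomial.X j)) := by
      rw [polyPullback, MvPolynomial.aeval_X, chartD_affCoord, MvPolynomial.pderiv_X,
        Pi.single_apply]
      by_cases h : i = j
      · subst h
        rw [if_pos rfl, if_pos rfl, map_one]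
      · rw [if_neg h, if_neg (Ne.symm h), map_zero]
    rw [map_mul, Derivation.leibniz, Derivation.leibniz, hp, h]
    simp only [smul_eq_mul, map_add, map_mul]

/-- The action of an algebraic differential operator on holomorphic functions. -/
def dopAlg (k : Fin (n + 1)) (hO : ∀ u ∈ O, u k ≠ 0) (b : PolAlg n) (t : SmoothOn ℂ O) :
    SmoothOn ℂ O :=
  dop (chartD ℂ O k) t
    (MvPolynomial.map (polyPullback k hO : MvPolynomial (Fin n) ℂ →+* SmoothOn ℂ O) b)

theorem dopAlg_apply (k : Fin (n + 1)) (hO : ∀ u ∈ O, u k ≠ 0) (b : PolAlg n) (t : SmoothOn ℂ O)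
    {s : (Fin (n + 1) → ℂ) → ℂ} (h : ∀ u : O, t.1 u = s u) (u : O) :
    (dopAlg k hO b t).1 u = applyAlg k b s u := by
  rw [dopAlg, dop_chartD_apply k _ b t h u, applyAlg]
  refine Finset.sum_congr rfl fun α _ => ?_
  have e : ((polyPullback k hO : MvPolynomial (Fin n) ℂ →+* SmoothOn ℂ O) (b.coeff α)).1 u =
      MvPolynomial.eval (chartCoord k u.1) (b.coeff α) := polyPullback_apply k hO _ u
  rw [e]
  rfl

theorem dopAlg_comp (k : Fin (n + 1)) (hO : ∀ u ∈ O, u k ≠ 0) (a b : PolAlg n)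
    (t : SmoothOn ℂ O) :
    dopAlg k hO (comp (fun i => MvPolynomial.pderiv (R := ℂ) i) a b) t =
      dopAlg k hO a (dopAlg k hO b t) := by
  rw [dopAlg, map_comp (D := fun i => MvPolynomial.pderiv (R := ℂ) i) (D' := chartD ℂ O k)
    pderiv_commuting (chartD_commuting k)
    (polyPullback k hO : MvPolynomial (Fin n) ℂ →+* SmoothOn ℂ O) (fun i q => (chartD_polyPullback k hO i q).symm) a b,
    dop_comp (chartD_commuting k)]
  rfl

theorem dopAlg_add (k : Fin (n + 1)) (hO : ∀ u ∈ O, u k ≠ 0) (a b : PolAlg n)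
    (t : SmoothOn ℂ O) : dopAlg k hO (a + b) t = dopAlg k hO a t + dopAlg k hO b t := by
  rw [dopAlg, map_add, map_add]
  rfl

theorem dopAlg_lieSym (k : Fin (n + 1)) (hO : ∀ u ∈ O, u k ≠ 0) {t : SmoothOn ℂ O} {μ : ℂ}
    (ht : eulerField ℂ O t = μ • t) (i j : Fin (n + 1)) :
    dopAlg k hO (lieSym MvPolynomial.X μ k i j) t = -(coord j * partials ℂ O i t) := by
  rw [dopAlg, map_lieSym, ← dop_lieSym k hO ht]
  simp only [polyPullback, MvPolynomial.aeval_X]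

theorem partials_res (h : O' ≤ O) (i : Fin (n + 1)) (t : SmoothOn ℂ O) :
    partials ℂ O' i (SmoothOn.res h t) = SmoothOn.res h (partials ℂ O i t) :=
  SmoothOn.dir_res h _ t

theorem res_coord (h : O' ≤ O) (i : Fin (n + 1)) :
    SmoothOn.res h (coord i : SmoothOn ℂ O) = coord i := by
  ext u
  rw [SmoothOn.res_apply, coord_apply, coord_apply]

theorem eulerField_res (h : O' ≤ O) (t : SmoothOn ℂ O) :
    eulerField ℂ O' (SmoothOn.res h t) = SmoothOn.res h (eulerField ℂ O t) := by
  rw [eulerField_apply, eulerField_apply, map_sum]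
  exact Finset.sum_congr rfl fun i _ => by rw [map_mul, res_coord, partials_res]

/-- The operators on the charts with full symbols `b k` preserve the homogeneous functions of
degree `μ` and agree on overlaps. -/
def ActsOnSections (μ : ℂ) (b : Fin (n + 1) → PolAlg n) : Prop :=
  ∀ (O : Opens (Fin (n + 1) → ℂ)) (t : SmoothOn ℂ O), eulerField ℂ O t = μ • t →
    ∃ t' : SmoothOn ℂ O, eulerField ℂ O t' = μ • t' ∧
      ∀ (k : Fin (n + 1)) (O' : Opens (Fin (n + 1) → ℂ)) (h : O' ≤ O) (hO : ∀ u ∈ O', u k ≠ 0),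
        SmoothOn.res h t' = dopAlg k hO (b k) (SmoothOn.res h t)

theorem eulerField_res_eq {μ : ℂ} (h : O' ≤ O) {t : SmoothOn ℂ O} (ht : eulerField ℂ O t = μ • t) :
    eulerField ℂ O' (SmoothOn.res h t) = μ • SmoothOn.res h t := by
  rw [eulerField_res, ht, map_smul]

/-- Agreement on overlaps alone does not compose. The condition also asks that sections are carried
to sections on the same open set, to which the second operator can be applied. -/
theorem ActsOnSections.comp {μ : ℂ} {a b : Fin (n + 1) → PolAlg n} (ha : ActsOnSections μ a)
    (hb : ActsOnSections μ b) : ActsOnSections μ fun k =>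
      comp (fun i => MvPolynomial.pderiv (R := ℂ) i) (a k) (b k) := by
  intro O t ht
  obtain ⟨t₁, ht₁, h₁⟩ := hb O t ht
  obtain ⟨t₂, ht₂, h₂⟩ := ha O t₁ ht₁
  exact ⟨t₂, ht₂, fun k O' h hO => by rw [dopAlg_comp, ← h₁, ← h₂]⟩

theorem ActsOnSections.add {μ : ℂ} {a b : Fin (n + 1) → PolAlg n} (ha : ActsOnSections μ a)
    (hb : ActsOnSections μ b) : ActsOnSections μ fun k => a k + b k := by
  intro O t ht
  obtain ⟨t₁, ht₁, h₁⟩ := ha O t ht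
  obtain ⟨t₂, ht₂, h₂⟩ := hb O t ht
  exact ⟨t₁ + t₂, by rw [map_add, ht₁, ht₂, smul_add],
    fun k O' h hO => by rw [dopAlg_add, map_add, ← h₁, ← h₂]⟩

theorem actsOnSections_const (μ c : ℂ) :
    ActsOnSections (n := n) μ fun _ => MvPolynomial.C (MvPolynomial.C c) := by
  intro O t ht
  refine ⟨c • t, by rw [Derivation.map_smul, ht, smul_comm], fun k O' h hO => ?_⟩
  rw [dopAlg, MvPolynomial.map_C, dop_C, map_smul, Algebra.smul_def]
  congr 1
  exact ((polyPullback k hO).commutes c).symm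

/-- All local expressions come from the single vector field `-u_j ∂/∂u_i`, which preserves
homogeneity because it commutes with the Euler field. -/
theorem actsOnSections_lieSym (μ : ℂ) (i j : Fin (n + 1)) :
    ActsOnSections μ fun k => lieSym MvPolynomial.X μ k i j := by
  intro O t ht
  refine ⟨-(coord j * partials ℂ O i t), ?_, fun k O' h hO => ?_⟩
  · have h : eulerField ℂ O (coord j * partials ℂ O i t) =
        coord j * partials ℂ O i (eulerField ℂ O t) := by
      rw [eulerField_apply, eulerField_apply]
      exact sum_euler_commute partials_commuting partials_coord j i t
    have h' : ∀ {R : Type} [CommRing R] [Algebra ℂ R] (c d : R), -(c * μ • d) = μ • -(c * d) :=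
      fun c d => by rw [mul_smul_comm, smul_neg]
    rw [Derivation.map_neg, h, ht, Derivation.map_smul]
    exact h' _ _
  · have h' : ∀ {R R' : Type} [CommRing R] [CommRing R'] [Algebra ℂ R] [Algebra ℂ R']
        (f : R →ₐ[ℂ] R') (c d : R), f (-(c * d)) = -(f c * f d) :=
      fun f c d => by rw [map_neg, map_mul]
    rw [dopAlg_lieSym k hO (eulerField_res_eq h ht), partials_res, ← res_coord h]
    exact h' _ _ _

/-- A local section is assumed to be complex differentiable only; being holomorphic it is smooth,
and its homogeneity is the eigenvalue equation for the Euler field. Both chart expressions are then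
values of the one section `t'`. -/
theorem ActsOnSections.isTDO {b : Fin (n + 1) → PolAlg n}
    (hb : ActsOnSections (-(lam * (n + 1))) b) : IsTDO lam b := by
  intro O s hs k l u hu hk hl
  obtain ⟨hO, -, hd, he⟩ := hs
  let U : Opens (Fin (n + 1) → ℂ) := ⟨O, hO⟩
  let t : SmoothOn ℂ U := SmoothOn.mk s (contDiffOn_of_differentiableOn hO hd)
  have ht : eulerField ℂ U t = (-(lam * (n + 1))) • t := by
    ext u
    rw [eulerField_apply]
    change SmoothOn.ev u (∑ i, coord i * partials ℂ U i t) = _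
    rw [map_sum]
    have h1 : ∀ i, SmoothOn.ev u (coord i * partials ℂ U i t) =
        u.1 i * fderiv ℂ s u.1 (Pi.single i 1) := fun i => by
      rw [map_mul, SmoothOn.ev_apply, SmoothOn.ev_apply, coord_apply, partials,
        SmoothOn.dir_apply_of_eq _ t (s := s) (fun _ => rfl)]
      rfl
    rw [Finset.sum_congr rfl fun i _ => h1 i]
    refine Eq.trans ?_ (he u.1 u.2)
    generalize fderiv ℂ s u.1 = L
    conv_rhs => rw [pi_eq_sum_univ' u.1, map_sum]
    exact Finset.sum_congr rfl fun i _ => by rw [map_smul, smul_eq_mul]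
  obtain ⟨t', -, h⟩ := hb U t ht
  have key : ∀ k, u k ≠ 0 → t'.1 ⟨u, hu⟩ = applyAlg k (b k) s u := fun k hk => by
    let U' : Opens (Fin (n + 1) → ℂ) :=
      ⟨O ∩ {u | u k ≠ 0}, hO.inter (isOpen_ne_fun (continuous_apply k) continuous_const)⟩
    have hU : U' ≤ U := fun _ h => h.1
    have h1 := congrArg (fun f => f.1 (⟨u, hu, hk⟩ : U')) (h k U' hU fun u hu => hu.2)
    rw [SmoothOn.res_apply] at h1
    rw [h1]
    exact dopAlg_apply k _ (b k) _ (fun u => SmoothOn.res_apply hU t u) _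
  rw [← key k hk, ← key l hl]

variable (n lam) in
/-- The algebra of twisted differential operators. -/
def twistedOp : Subalgebra ℂ (Module.End ℂ (Dens n lam)) where
  carrier := {P | ∃ b : Fin (n + 1) → PolAlg n, ActsOnSections (-(lam * (n + 1))) b ∧
    ∀ k, HasFullSymbol k P (toSmooth (b k))}
  mul_mem' := by
    rintro P R ⟨a, ha, hP⟩ ⟨b, hb, hR⟩
    exact ⟨_, ha.comp hb, fun k => by rw [toSmooth_comp]; exact (hP k).mul (hR k)⟩
  add_mem' := by
    rintro P R ⟨a, ha, hP⟩ ⟨b, hb, hR⟩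
    exact ⟨_, ha.add hb, fun k => by rw [map_add]; exact (hP k).add (hR k)⟩
  algebraMap_mem' c := ⟨_, actsOnSections_const _ c, hasFullSymbol_algebraMap c⟩

theorem lieOp_le_twistedOp : lieOp n lam ≤ twistedOp n lam := by
  refine Algebra.adjoin_le ?_
  rintro _ ⟨ij, rfl⟩
  exact ⟨_, actsOnSections_lieSym _ ij.1 ij.2, fun k => hasFullSymbol_eta k ij.1 ij.2⟩

/-- In one direction the polynomiality of the full symbols suffices. In the other, the operators
that come from an action on sections form an algebra containing the Lie derivatives. -/
theorem mem_algDiffOp_iff (hn : 1 ≤ n) {P : Module.End ℂ (Dens n lam)} :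
    P ∈ AlgDiffOp n lam ↔ P ∈ lieOp n lam := by
  refine ⟨?_, fun h => ?_⟩
  · rintro ⟨b, -, h⟩
    exact (mem_lieOp_iff_mem_polyOp hn).2 fun k => ⟨b k, h k⟩
  · obtain ⟨b, hb, h⟩ := lieOp_le_twistedOp h
    exact ⟨b, hb.isTDO, h⟩

end TwistedOperators

end

end ProjQuant

end

theorem proposition3 (n : ℕ) (hn : 1 ≤ n) (lam : ℂ) :
    -- the momentum algebra: regular functions on `T*ℂℙⁿ`, generated by the momentum functions
    (Function.Injective (ProjQuant.restrict n) ∧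
      ProjQuant.MomAlg n = Algebra.adjoin ℂ
        {φ : ProjQuant.Sym n | ∃ x : Matrix (Fin (n + 1)) (Fin (n + 1)) ℂ,
          x.trace = 0 ∧ φ.1 = ProjQuant.momentumReal x}) ∧
    -- the quantization map and its star product exist and are unique
    (∃! Q : ProjQuant.Sym n ≃ₗ[ℂ] ProjQuant.DiffOp n lam,
      ProjQuant.IsEquivariantQuantization lam Q) ∧
    ∀ Q : ProjQuant.Sym n ≃ₗ[ℂ] ProjQuant.DiffOp n lam,
      ProjQuant.IsEquivariantQuantization lam Q →
      (∃! C : ℕ → ProjQuant.Sym n →ₗ[ℂ] ProjQuant.Sym n →ₗ[ℂ] ProjQuant.Sym n,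
        ProjQuant.IsStarOf Q C) ∧
      (∀ C : ℕ → ProjQuant.Sym n →ₗ[ℂ] ProjQuant.Sym n →ₗ[ℂ] ProjQuant.Sym n,
        ProjQuant.IsStarOf Q C →
          ProjQuant.RestrictsToGradedStarProduct (ProjQuant.MomAlg n) C ∧
          ProjQuant.IsSLEquivariant C) ∧
      {P : Module.End ℂ (ProjQuant.Dens n lam) |
        ∃ φ : ProjQuant.Sym n, φ ∈ ProjQuant.MomAlg n ∧ (Q φ).1 = P} =
          ProjQuant.AlgDiffOp n lam := by
  refine ⟨⟨ProjQuant.restrict_injective n, ProjQuant.momAlg_eq_adjoin hn⟩,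
    ⟨ProjQuant.quant n lam, ProjQuant.quant_isEquivariantQuantization,
      fun Q hQ => ProjQuant.eq_quant hQ⟩, fun Q hQ => ?_⟩
  -- By uniqueness the given quantization is the eigenlift map, so the remaining claims concern
  -- `quant` only.
  obtain rfl := ProjQuant.eq_quant hQ
  refine ⟨⟨ProjQuant.starCoeff n lam, ProjQuant.isStarOf_starCoeff,
    fun C hC => hC.unique ProjQuant.isStarOf_starCoeff⟩,
    fun C hC => ⟨hC.restrictsToGradedStarProduct hn, hC.isSLEquivariant hn⟩, ?_⟩
  ext P
  exact (ProjQuant.mem_lieOp_iff hn).symm.trans (ProjQuant.mem_algDiffOp_iff hn).symm
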